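/- **Coarse-grained Caccioppoli inequality.** Let $d\ge 2$, $\square_m=(-\tfrac12 3^m,\tfrac12 3^m)^d$ for $m\in\mathbb Z$, and $\varrho\,\square_0=(-\tfrac{\varrho}{2},\tfrac{\varrho}{2})^d$. Let $\mathbf a$ be a field of symmetric matrices on $\square_0$, positive definite almost everywhere, with $\mathbf a,\mathbf a^{-1}\in L^1(\square_0)$. For an open cube $U\subseteq\square_0$: * $H^1_{\mathbf a}(U)$ is the completion of the smooth functions on $U$ of finite norm for $\bigl(\|u\|_{L^2(U)}^2+\int_U\nabla u\cdot\mathbf a\nabla u\bigr)^{1/2}$; * $\mathcal A(U)$ is the set of $u\in H^1_{\mathbf a}(U)$ with $\int_U\nabla\psi\cdot\mathbf a\nabla u=0$ for all $\psi\in C_c^\infty(U)$, and $\mathcal A_-(U)$ the set of $u\in H^1_{\mathbf a}(U)$ with $\int_U\nabla\psi\cdot\mathbf a\nabla u\le 0$ for all $0\le\psi\in C_c^\infty(U)$; * an admissible cone $\mathcal K$ assigns to every $U$ one of the following sets, or (with the same choice for all $U$) a union of several of them: $\mathcal A(U)$; $\mathcal A_-(U)$; the set of $F(v)\in H^1_{\mathbf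 a}(U)$ with $v\in\mathcal A(U)$ and $F:v(U)\to\mathbb R$ of class $C^1$, convex and monotone; the set of $(v-k)_+$ with $v\in\mathcal A(U)$, $k\in\mathbb R$; the set of $F(v)\in H^1_{\mathbf a}(U)$ with $0\le v\in\mathcal A(U)$ and $F:v(U)\to\mathbb R$ convex and monotone with $F'(r)=cr^p$ for some $c,p\in\mathbb R$; the whole space $H^1_{\mathbf a}(U)$. Set $$\|\mathbf a(U;\mathcal K)\|=\sup_{|p|=1}\ \sup_{v\in\mathcal K(U)}\frac1{|U|}\int_U\bigl(-\nabla v\cdot\mathbf a\nabla v+2p\cdot\mathbf a\nabla v\bigr),\qquad |\mathbf a_*^{-1}(U)|=\sup_{|q|=1}\ \sup_{v\in\mathcal A(U)}\frac1{|U|}\int_U\bigl(-\nabla v\cdot\mathbf a\nabla v+2q\cdot\nabla v\bigr),$$ $$\Lambda_s(\square_0;\mathcal K)=\Bigl((1-3^{-s})\sum_{k\le 0}3^{sk}\max_{z\in 3^k\mathbb Z^d\cap\square_0}\|\mathbf a(z+\square_k;\mathcal K)\|^{1/2}\Bigr)^2,\qquad \lambda_t(\square_0)=\Bigl((1-3^{-t})\sum_{k\le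 0}3^{tk}\max_{z\in 3^k\mathbb Z^d\cap\square_0}|\mathbf a_*^{-1}(z+\square_k)|^{1/2}\Bigr)^{-2},$$ with values in $[0,\infty]$, and $\Theta_{s,t}(\square_0;\mathcal K)=\Lambda_s(\square_0;\mathcal K)/\lambda_t(\square_0)$. Let $\|f\|_{\underline L^2(U)}=\bigl(\frac1{|U|}\int_U|f|^2\bigr)^{1/2}$. There exists a constant $C=C(d)<\infty$ with the following property. Let $s,t\in(0,1)$ with $\sigma:=1-s-t>0$, let $u\in\mathcal A(\square_0)$, and let $\Phi:\mathbb R\to\mathbb R$ be convex, and nondecreasing ($\varepsilon=1$) or nonincreasing ($\varepsilon=-1$) on the range of $u$. Let $C_\Phi>0$ and $\Psi:\mathbb R\to\mathbb R$ be such that one of the following holds (where $\Phi/\sqrt{|\Phi'|}$ is read as $0$ at the points where $\Phi'=0$, the identities with $C_\Phi$ are understood at all the points $r\in\mathbb R$ where $\Phi$ is differentiable, and the sign $\pm$ in them is arbitrary but does not depend on $r$): 1. $\displaystyle\lim_{r\to0^+}\Phi(r)/\sqrt{|\Phi'(r)|}=0$ and $\displaystyle\Psi(r)=\varepsilon\int_0^r\sqrt{|\Phi'|}=\pm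 C_\Phi\,\Phi(r)/\sqrt{|\Phi'(r)|}$; 2. $\displaystyle\lim_{r\to\infty}\Phi(r)/\sqrt{|\Phi'(r)|}=0$ and $\displaystyle\Psi(r)=-\varepsilon\int_r^\infty\sqrt{|\Phi'|}=\pm C_\Phi\,\Phi(r)/\sqrt{|\Phi'(r)|}$, the integral being convergent. Let $\mathcal K$ be an admissible cone with $\Phi(u),\Psi(u)\in\mathcal K(\square_0)$. Then, for all $\tfrac12\le\varrho_1<\varrho_2\le1$, $$\|\mathbf a^{1/2}\nabla\Psi(u)\|_{\underline L^2(\varrho_1\square_0)}\le\frac{C\,(2/\sigma)^{\frac{s+\sigma}{\sigma}}\,\Theta_{s,t}(\square_0;\mathcal K)^{\frac{s}{2\sigma}}\,\Lambda_s(\square_0;\mathcal K)^{\frac12}}{C_\Phi^{\frac{s+\sigma}{\sigma}}\,s^{\frac s\sigma}(1-s)^{\frac s\sigma}\,(\varrho_2-\varrho_1)^{\frac{s+\sigma}{\sigma}}}\ \|\Psi(u)\|_{\underline L^2(\varrho_2\square_0)}.$$ -/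

import Mathlib

open MeasureTheory Set Filter Topology
open scoped ENNReal

noncomputable section

namespace CoarseGrained

/-- Euclidean space of dimension `d`. -/
abbrev E (d : ℕ) : Type := EuclideanSpace ℝ (Fin d)

/-- A (not necessarily continuous) coefficient field: a matrix at every point. -/
abbrev CoeffField (d : ℕ) : Type := E d → Matrix (Fin d) (Fin d) ℝ

/-- The open cube with centre `z` and side length `ℓ`. -/
def cube {d : ℕ} (z : E d) (ℓ : ℝ) : Set (E d) := {x | ∀ i, |x i - z i| < ℓ / 2}

/-- The standing assumptions on the coefficient field in `U`: the matrix `a x` is symmetric,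
positive semidefinite and invertible (that is, positive definite) for almost every `x`, and the
entries of `a` and of `a⁻¹` belong to `L¹(U)`. -/
structure IsCoefficientField {d : ℕ} (a : CoeffField d) (U : Set (E d)) : Prop where
  posDef : ∀ᵐ x ∂(volume.restrict U), (a x).PosDef
  integrable : ∀ i j, IntegrableOn (fun x => a x i j) U volume
  integrable_inv : ∀ i j, IntegrableOn (fun x => (a x)⁻¹ i j) U volume

/-- The flux `a G` of a vector field `G`. -/
def flux {d : ℕ} (a : CoeffField d) (G : E d → E d) (x : E d) : E d :=
  Matrix.toEuclideanLin (a x) (G x)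

/-- The energy density `G ⬝ a G`, which is `|a^{1/2} G|²`. -/
def energyDensity {d : ℕ} (a : CoeffField d) (G : E d → E d) (x : E d) : ℝ :=
  inner ℝ (G x) (flux a G x)

/-- `∫_U G ⬝ a G`. -/
def energy {d : ℕ} (a : CoeffField d) (U : Set (E d)) (G : E d → E d) : ℝ≥0∞ :=
  ∫⁻ x in U, ENNReal.ofReal (energyDensity a G x)

/-- `u` belongs to `H¹_a(U)` and its gradient is `G`. The space `H¹_a(U)` is the completion of the
smooth functions on `U` for the norm `(‖u‖²_{L²(U)} + ∫_U ∇u ⬝ a ∇u)^{1/2}`; as `a⁻¹` is integrable,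
an element of the completion is a function in `L²(U)` whose gradient is determined by it a.e. -/
structure HasGrad {d : ℕ} (a : CoeffField d) (U : Set (E d)) (u : E d → ℝ) (G : E d → E d) :
    Prop where
  memLp : MemLp u 2 (volume.restrict U)
  aestronglyMeasurable : AEStronglyMeasurable G (volume.restrict U)
  energy_lt_top : energy a U G < ∞
  approx : ∃ φ : ℕ → E d → ℝ,
    (∀ n, ContDiffOn ℝ (⊤ : ℕ∞) (φ n) U) ∧
    Tendsto (fun n => eLpNorm (fun x => φ n x - u x) 2 (volume.restrict U)) atTop (𝓝 0) ∧
    Tendsto (fun n => energy a U (fun x => gradient (φ n) x - G x)) atTop (𝓝 0)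

/-- The test functions `C_c^∞(U)`. -/
structure IsTest {d : ℕ} (U : Set (E d)) (ψ : E d → ℝ) : Prop where
  contDiff : ContDiff ℝ (⊤ : ℕ∞) ψ
  hasCompactSupport : HasCompactSupport ψ
  tsupport_subset : tsupport ψ ⊆ U

/-- `u ∈ 𝒜(U)`, with gradient `G`: weak solutions of `∇ ⬝ a ∇u = 0` in `U`. -/
structure IsSol {d : ℕ} (a : CoeffField d) (U : Set (E d)) (u : E d → ℝ) (G : E d → E d) : Prop where
  hasGrad : HasGrad a U u G
  weak : ∀ ψ, IsTest U ψ → ∫ x in U, inner ℝ (gradient ψ x) (flux a G x) = 0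

/-- `u ∈ 𝒜₋(U)`, with gradient `G`: weak subsolutions, `-∇ ⬝ a ∇u ≤ 0` in `U`. -/
structure IsSub {d : ℕ} (a : CoeffField d) (U : Set (E d)) (u : E d → ℝ) (G : E d → E d) : Prop where
  hasGrad : HasGrad a U u G
  weak : ∀ ψ, IsTest U ψ → (∀ x, 0 ≤ ψ x) →
    ∫ x in U, inner ℝ (gradient ψ x) (flux a G x) ≤ 0

/-- The names of the six basic families of cones. -/
inductive ConeName
  | sol | sub | conv | trunc | pow | max

/-- `v`, with gradient `G`, belongs to the cone with the given name in `U`. In `conv` and `pow` the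
range of `u` is the interval `J` (up to a null set of points of `U`). -/
def ConeName.Mem {d : ℕ} (a : CoeffField d) (U : Set (E d)) (v : E d → ℝ) (G : E d → E d) :
    ConeName → Prop
  | .sol => IsSol a U v G
  | .sub => IsSub a U v G
  | .conv => HasGrad a U v G ∧
      ∃ (u : E d → ℝ) (Gu : E d → E d) (J : Set ℝ) (Φ : ℝ → ℝ),
        IsSol a U u Gu ∧ J.OrdConnected ∧ (∀ᵐ x ∂(volume.restrict U), u x ∈ J) ∧
        ContDiffOn ℝ 1 Φ J ∧ ConvexOn ℝ J Φ ∧ (MonotoneOn Φ J ∨ AntitoneOn Φ J) ∧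
        v =ᵐ[volume.restrict U] fun x => Φ (u x)
  | .trunc => HasGrad a U v G ∧
      ∃ (u : E d → ℝ) (Gu : E d → E d) (k : ℝ),
        IsSol a U u Gu ∧ v =ᵐ[volume.restrict U] fun x => Max.max (u x - k) 0
  | .pow => HasGrad a U v G ∧
      ∃ (u : E d → ℝ) (Gu : E d → E d) (J : Set ℝ) (Φ : ℝ → ℝ) (c p : ℝ),
        IsSol a U u Gu ∧ J.OrdConnected ∧ J ⊆ Ici 0 ∧ (∀ᵐ x ∂(volume.restrict U), u x ∈ J) ∧
        (∀ t ∈ J, HasDerivWithinAt Φ (c * t ^ p) J t) ∧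
        ConvexOn ℝ J Φ ∧ (MonotoneOn Φ J ∨ AntitoneOn Φ J) ∧
        v =ᵐ[volume.restrict U] fun x => Φ (u x)
  | .max => HasGrad a U v G

/-- Membership in an admissible cone, which is a union of some of the six basic cones. -/
def InCone {d : ℕ} (S : Set ConeName) (a : CoeffField d) (U : Set (E d)) (v : E d → ℝ)
    (G : E d → E d) : Prop :=
  ∃ k ∈ S, k.Mem a U v G

/-- `a(U, p ; cone) = sup_u ⨍_U (-∇u ⬝ a ∇u + 2 p ⬝ a ∇u)`. The supremum is nonnegative because the
cones contain `0`, so it can be taken in `[0, ∞]`. -/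
def cgA {d : ℕ} (S : Set ConeName) (a : CoeffField d) (U : Set (E d)) (p : E d) : ℝ≥0∞ :=
  ⨆ (v : E d → ℝ) (G : E d → E d) (_ : InCone S a U v G),
    ENNReal.ofReal (⨍ x in U, (-energyDensity a G x + 2 * inner ℝ p (flux a G x)))

/-- The norm `‖a(U ; cone)‖ = sup_{|p| = 1} a(U, p ; cone)`. -/
def cgANorm {d : ℕ} (S : Set ConeName) (a : CoeffField d) (U : Set (E d)) : ℝ≥0∞ :=
  ⨆ (p : E d) (_ : ‖p‖ = 1), cgA S a U p

/-- `q ⬝ a_*⁻¹(U) q = sup_u ⨍_U (-∇u ⬝ a ∇u + 2 q ⬝ ∇u)`, the supremum being over the solutions. -/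
def cgAStarInv {d : ℕ} (a : CoeffField d) (U : Set (E d)) (q : E d) : ℝ≥0∞ :=
  ⨆ (v : E d → ℝ) (G : E d → E d) (_ : IsSol a U v G),
    ENNReal.ofReal (⨍ x in U, (-energyDensity a G x + 2 * inner ℝ q (G x)))

/-- The spectral norm of the symmetric nonnegative matrix `a_*⁻¹(U)`. -/
def cgAStarInvNorm {d : ℕ} (a : CoeffField d) (U : Set (E d)) : ℝ≥0∞ :=
  ⨆ (q : E d) (_ : ‖q‖ = 1), cgAStarInv a U q

/-- The point `3^k n` of the lattice `3^k ℤ^d`. -/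
def latticePoint {d : ℕ} (k : ℤ) (n : Fin d → ℤ) : E d :=
  WithLp.toLp 2 fun i => (3 : ℝ) ^ k * (n i : ℝ)

/-- The sum
`(1 - 3^{-s}) ∑_{k ≤ m} 3^{-s (m - k)} max_{z ∈ 3^k ℤ^d ∩ □_m} F(z + □_k)^{1/2}`, with `k = m - j`,
where `□_m` is the cube with centre `0` and side length `3^m`. -/
def multiscaleSum {d : ℕ} (s : ℝ) (m : ℤ) (F : Set (E d) → ℝ≥0∞) : ℝ≥0∞ :=
  ENNReal.ofReal (1 - (3 : ℝ) ^ (-s)) *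
    ∑' j : ℕ, ENNReal.ofReal ((3 : ℝ) ^ (-s * (j : ℝ))) *
      ⨆ (n : Fin d → ℤ) (_ : latticePoint (m - j) n ∈ cube (0 : E d) ((3 : ℝ) ^ m)),
        F (cube (latticePoint (m - j) n) ((3 : ℝ) ^ (m - j))) ^ (1 / 2 : ℝ)

/-- `Λ_s(□_m ; cone)`. -/
def Lam {d : ℕ} (S : Set ConeName) (a : CoeffField d) (s : ℝ) (m : ℤ) : ℝ≥0∞ :=
  multiscaleSum s m (cgANorm S a) ^ 2

/-- `λ_s(□_m)`. -/
def lam {d : ℕ} (a : CoeffField d) (s : ℝ) (m : ℤ) : ℝ≥0∞ :=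
  (multiscaleSum s m (cgAStarInvNorm a) ^ 2)⁻¹

/-- The coarse-grained ellipticity ratio `Θ_{s,t}(□_m ; cone)`. -/
def Theta {d : ℕ} (S : Set ConeName) (a : CoeffField d) (s t : ℝ) (m : ℤ) : ℝ≥0∞ :=
  Lam S a s m / lam a t m

/-- The volume-normalized norm of `f` in `L²(U)`. -/
def avgL2 {d : ℕ} (U : Set (E d)) (f : E d → ℝ) : ℝ≥0∞ :=
  ((volume U)⁻¹ * ∫⁻ x in U, ENNReal.ofReal (f x ^ 2)) ^ (1 / 2 : ℝ)

/-- The volume-normalized norm of `a^{1/2} G` in `L²(U)`. -/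
def avgEnergyNorm {d : ℕ} (a : CoeffField d) (U : Set (E d)) (G : E d → E d) : ℝ≥0∞ :=
  ((volume U)⁻¹ * energy a U G) ^ (1 / 2 : ℝ)

/-- `ε = 1` and `Φ` is nondecreasing on `R`, or `ε = -1` and `Φ` is nonincreasing on `R`. -/
def IsMonotoneSign (Φ : ℝ → ℝ) (R : Set ℝ) (ε : ℝ) : Prop :=
  (ε = 1 ∧ MonotoneOn Φ R) ∨ (ε = -1 ∧ AntitoneOn Φ R)

/-- The identity `Ψ = ± c Φ / √|Φ'|`, with one sign for all the points where `Φ` is differentiable.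
The quotient is read as `0` where `Φ'` vanishes, as is needed for `Φ(t) = max(t - k, 0)`. -/
def IsQuotient (Φ Ψ : ℝ → ℝ) (c : ℝ) : Prop :=
  ∃ η : ℝ, (η = 1 ∨ η = -1) ∧
    ∀ t, DifferentiableAt ℝ Φ t → Ψ t = η * (c * (Φ t / √|deriv Φ t|))

/-- `Ψ` is the transform of `Φ`, with constant `c` and sign `ε`: either `Φ / √|Φ'|` tends to `0` at
`0⁺`, and `Ψ(t) = ε ∫_0^t √|Φ'| = ± c Φ(t) / √|Φ'(t)|`; or `Φ / √|Φ'|` tends to `0` at `∞`, and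
`Ψ(t) = -ε ∫_t^∞ √|Φ'| = ± c Φ(t) / √|Φ'(t)|`, the integral being convergent. -/
def IsTransform (Φ Ψ : ℝ → ℝ) (ε c : ℝ) : Prop :=
  (Tendsto (fun t => Φ t / √|deriv Φ t|) (𝓝[>] 0) (𝓝 0) ∧
    (∀ t, Ψ t = ε * ∫ τ in (0 : ℝ)..t, √|deriv Φ τ|) ∧ IsQuotient Φ Ψ c) ∨
  (Tendsto (fun t => Φ t / √|deriv Φ t|) atTop (𝓝 0) ∧
    (∀ t, IntegrableOn (fun τ => √|deriv Φ τ|) (Ioi t) volume) ∧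
    (∀ t, Ψ t = -ε * ∫ τ in Ioi t, √|deriv Φ τ|) ∧ IsQuotient Φ Ψ c)

end CoarseGrained

end

/-! ### Tails of multiscale sums and absorption along a sequence of levels -/

noncomputable section
namespace CoarseGrained

/-! The identity. After replacing `u` by `-u` when `ε = -1`, `Φ` is nondecreasing on the range.
Where `Φ` has begun to rise and `Ψ ≠ 0`, put `V = Ψ' = √Φ' = kΦ/Ψ` with `|k| = C_Φ`. Then `Φ' = V²`
and `V' = (k - 1)V²/Ψ`. Either `∇Ψ(u) = 0`, or convexity forces `1 ≤ k ≤ 2`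
(`IsTransformPair.one_le`, `IsTransformPair.le_two`). Testing the equation with `η k Φ(u) = η Ψ(u)
V(u)` gives, for `w = Ψ(u)`, the identity `k ∫ η ∇w·a∇w = -∫ w ∇η·a∇w`. It is proved with `Ψ`
replaced by `H(Ψ)`, `H` supported in an annulus, so that the test function is smooth in `u` and
bounded (`IsTransformPair.integral_identity`).

The right-hand side is estimated scale by scale. With `p = ∇η`, the integral `∫ w p·a∇w` is the
limit of sums over triadic cubes `Q` of the average of `w`, times `p` at the centre, times `∫_Q
a∇w`. Refining the cubes from `3^{-j}` to `3^{-j-1}` costs the oscillation of the averages of `w`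
between children, paired with fluxes. Fluxes obey `|∫_Q a∇w|² ≤ |Q| ‖a(Q;K)‖ ∫_Q ∇w·a∇w`, because
`w` lies in the cone. Slopes of an arbitrary smooth bounded `m` obey the analogous bound with
`a_*⁻¹(Q)`, because the solution with the same boundary values has the same mean gradient and less
energy (`exists_dirichlet_solution`). A recursion for first moments, a computation on three adjacent
cubes and the Efron-Stein inequality convert slope bounds into oscillation bounds with a constant
independent of the dimension (`sum_sq_child_sub_mean_le`). As `3^{-j} 3^{tj} 3^{sj} = 3^{-σj}`, all
scales finer than `N` together contribute a small tail `T` times the energy weighted by `|p|`; the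
scale `N` itself contributes the lower-order quantity `3^{sN} ‖w‖ ‖a^{1/2}∇w‖`
(`PairingData.abs_integral_le`).

One step. The cut-off decays exponentially in a smoothed distance `θ` to the inner cube, so that
`|∇η| ≤ λ (η + 2e^{-L})` with `λ` comparable to `L/h`. Hence the weighted energy is absorbed by the
left-hand side once `L T` is slightly less than `C_Φ h`, and the energy `F(τ)` in `{θ ≤ τ}`
satisfies `F(τ) ≤ C₀ e^{-L} F(τ + h) + C_L (ℓ 3^{sN} / (C_Φ h))² ‖w‖²` (`exists_oneStep`).

The iteration chooses widths `h_n` and scales `N_n`. The exponent `s/σ` in the result is unbounded,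
so a factor `C^{s/σ}` cannot be afforded when `s/σ` is large. There the scales advance in arithmetic
progression, each width is essentially the least one that the step permits, and the explicit
constants (`7/8` for the oscillation, `11/10` for the absorption) must be good enough for the total
width to fit between the cubes (`iteration_of_ge`). When `s/σ` is bounded, widths decreasing
geometrically suffice (`iteration_of_le`). -/

/-- The weighted tail `∑_{i > N} b_i 3^{-σ i}`. -/
def tailSum (b : ℕ → ℝ) (σ : ℝ) (N : ℕ) : ℝ :=
  ∑' i : ℕ, if N < i then b i * (3 : ℝ) ^ (-σ * (i : ℝ)) else 0

lemma summable_tail {b : ℕ → ℝ} (hb0 : ∀ i, 0 ≤ b i) (hb : Summable b) {σ : ℝ} (hσ : 0 < σ)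
    (N : ℕ) : Summable fun i : ℕ => if N < i then b i * (3 : ℝ) ^ (-σ * (i : ℝ)) else 0 := by
  refine Summable.of_nonneg_of_le (fun i => ?_) (fun i => ?_) hb
  · split_ifs
    · exact mul_nonneg (hb0 i) (by positivity)
    · exact le_rfl
  · split_ifs
    · refine mul_le_of_le_one_right (hb0 i) ?_
      apply Real.rpow_le_one_of_one_le_of_nonpos (by norm_num)
      have : (0 : ℝ) ≤ i := Nat.cast_nonneg i
      nlinarith
    · exact hb0 i

lemma tailSum_nonneg {b : ℕ → ℝ} (hb0 : ∀ i, 0 ≤ b i) (σ : ℝ) (N : ℕ) : 0 ≤ tailSum b σ N := by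
  refine tsum_nonneg fun i => ?_
  split_ifs
  · exact mul_nonneg (hb0 i) (by positivity)
  · exact le_rfl

lemma tailSum_le {b : ℕ → ℝ} (hb0 : ∀ i, 0 ≤ b i) (hb : Summable b) {σ : ℝ} (hσ : 0 < σ) (N : ℕ) :
    tailSum b σ N ≤ (3 : ℝ) ^ (-σ * (N : ℝ)) * ∑' i, b i := by
  rw [← tsum_mul_left]
  refine (summable_tail hb0 hb hσ N).tsum_le_tsum (fun i => ?_) (hb.mul_left _)
  split_ifs with h
  · rw [mul_comm]
    refine mul_le_mul_of_nonneg_right ?_ (hb0 i)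
    apply Real.rpow_le_rpow_of_exponent_le (by norm_num)
    have : (N : ℝ) ≤ i := by exact_mod_cast h.le
    nlinarith
  · exact mul_nonneg (by positivity) (hb0 i)

/-- This is `x ≤ e^{x - 1}` at `x = σ y log 3`; the maximum is attained at `y = 1 / (σ log 3)`. -/
lemma mul_rpow_neg_le {σ y : ℝ} (hσ : 0 < σ) :
    y * (3 : ℝ) ^ (-σ * y) ≤ 1 / (Real.exp 1 * σ * Real.log 3) := by
  have hl : 0 < Real.log 3 := Real.log_pos (by norm_num)
  have h1 := Real.add_one_le_exp (σ * Real.log 3 * y - 1)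
  rw [Real.rpow_def_of_pos (by norm_num), le_div_iff₀ (by positivity)]
  have h2 : Real.exp (σ * Real.log 3 * y - 1) * Real.exp 1 * Real.exp (Real.log 3 * (-σ * y)) = 1 := by
    rw [← Real.exp_add, ← Real.exp_add]; ring_nf; exact Real.exp_zero
  have h3 : σ * Real.log 3 * y ≤ Real.exp (σ * Real.log 3 * y - 1) := by linarith
  have := mul_le_mul_of_nonneg_right h3
    (by positivity : 0 ≤ Real.exp 1 * Real.exp (Real.log 3 * (-σ * y)))
  nlinarith

lemma card_filter_mul_lt (k M i : ℕ) (hM : 0 < M) :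
    (((Finset.range k).filter fun n => n * M < i).card : ℝ) ≤ (i : ℝ) / M + 1 := by
  have h : ((Finset.range k).filter fun n => n * M < i) ⊆ Finset.range (i / M + 1) := by
    intro n hn
    simp only [Finset.mem_filter, Finset.mem_range] at hn ⊢
    have := (Nat.le_div_iff_mul_le hM).2 hn.2.le
    omega
  have h2 := Finset.card_le_card h
  rw [Finset.card_range] at h2
  have h3 : ((i / M : ℕ) : ℝ) ≤ (i : ℝ) / M := Nat.cast_div_le
  have h4 : (((Finset.range k).filter fun n => n * M < i).card : ℝ) ≤ ((i / M + 1 : ℕ) : ℝ) := by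
    exact_mod_cast h2
  push_cast at h4
  linarith

/-- Exchange the sums: the term `b i * 3 ^ (-σ i)` occurs once for each `n` with `N + n M < i`,
hence at most `(i - N) / M + 1` times, and `y 3^{-σ y}` is at most `1 / (e σ log 3)`. Adding up the
bounds of `tailSum_le` would cost an extra factor close to `e` when `σ M` is small, which the
iteration for large `s / σ` cannot afford. -/
lemma sum_tailSum_le {b : ℕ → ℝ} (hb0 : ∀ i, 0 ≤ b i) (hb : Summable b) {σ : ℝ} (hσ : 0 < σ)
    (N M k : ℕ) (hM : 0 < M) :
    ∑ n ∈ Finset.range k, tailSum b σ (N + n * M) ≤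
      (3 : ℝ) ^ (-σ * (N : ℝ)) * (1 / (Real.exp 1 * σ * Real.log 3) / M + 1) * ∑' i, b i := by
  unfold tailSum
  rw [← Summable.tsum_finsetSum fun n _ => summable_tail hb0 hb hσ _, ← tsum_mul_left]
  have hM' : (0 : ℝ) < M := by exact_mod_cast hM
  refine Summable.tsum_le_tsum (fun i => ?_)
    (summable_sum fun n _ => summable_tail hb0 hb hσ _) (hb.mul_left _)
  rw [← Finset.sum_filter, Finset.sum_const, nsmul_eq_mul]
  by_cases hi : N ≤ i
  · obtain ⟨m, rfl⟩ := Nat.exists_eq_add_of_le hi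
    have hc := card_filter_mul_lt k M m hM
    have he : (Finset.filter (fun n => N + n * M < N + m) (Finset.range k)) =
        (Finset.filter (fun n => n * M < m) (Finset.range k)) := by
      ext n; simp
    rw [he]
    have h1 : (3 : ℝ) ^ (-σ * ((N + m : ℕ) : ℝ)) = (3 : ℝ) ^ (-σ * (N : ℝ)) * (3 : ℝ) ^ (-σ * (m : ℝ)) := by
      rw [← Real.rpow_add (by norm_num)]; push_cast; ring_nf
    rw [h1]
    have h2 : (((Finset.range k).filter fun n => n * M < m).card : ℝ) * (3 : ℝ) ^ (-σ * (m : ℝ)) ≤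
        1 / (Real.exp 1 * σ * Real.log 3) / M + 1 := by
      have h3 : (3 : ℝ) ^ (-σ * (m : ℝ)) ≤ 1 := by
        apply Real.rpow_le_one_of_one_le_of_nonpos (by norm_num)
        have : (0 : ℝ) ≤ m := Nat.cast_nonneg m
        nlinarith
      have h4 := mul_rpow_neg_le (y := (m : ℝ)) hσ
      calc _ ≤ ((m : ℝ) / M + 1) * (3 : ℝ) ^ (-σ * (m : ℝ)) := by gcongr
        _ = (m * (3 : ℝ) ^ (-σ * (m : ℝ))) / M + (3 : ℝ) ^ (-σ * (m : ℝ)) := by ring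
        _ ≤ _ := by gcongr
    have h5 : 0 ≤ b (N + m) * (3 : ℝ) ^ (-σ * (N : ℝ)) := mul_nonneg (hb0 _) (by positivity)
    have := mul_le_mul_of_nonneg_left h2 h5
    linarith
  · have he : (Finset.filter (fun n => N + n * M < i) (Finset.range k)) = ∅ := by
      ext n; simp; intro _; have := Nat.zero_le (n * M); omega
    rw [he]
    simp only [Finset.card_empty, Nat.cast_zero, zero_mul]
    have hl : 0 < Real.log 3 := Real.log_pos (by norm_num)
    exact mul_nonneg (by positivity) (hb0 i)

/-- Absorption along a sequence of levels. -/
lemma iterate_absorb {F : ℕ → ℝ} {q A r K : ℝ} (hq : 0 ≤ q) (hA : 0 ≤ A) (hr : 1 ≤ r)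
    (hqr : q * r ≤ 1 / 2) (hK : ∀ n, F n ≤ K) (h : ∀ n, F n ≤ q * F (n + 1) + A * r ^ n) :
    F 0 ≤ 2 * A := by
  have hq2 : q ≤ 1 / 2 := by nlinarith
  have h1 : ∀ n, F 0 ≤ q ^ n * F n + A * ∑ i ∈ Finset.range n, (1 / 2 : ℝ) ^ i := by
    intro n
    induction n with
    | zero => simp
    | succ n ih =>
      have h2 := mul_le_mul_of_nonneg_left (h n) (pow_nonneg hq n)
      have h3 : q ^ n * r ^ n ≤ (1 / 2 : ℝ) ^ n := by
        rw [← mul_pow]; exact pow_le_pow_left₀ (by positivity) hqr n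
      have h4 := mul_le_mul_of_nonneg_left h3 hA
      rw [Finset.sum_range_succ, pow_succ]
      nlinarith
  have h2 : ∀ n, F 0 ≤ (1 / 2 : ℝ) ^ n * |K| + 2 * A := by
    intro n
    have h3 : ∑ i ∈ Finset.range n, (1 / 2 : ℝ) ^ i ≤ 2 := sum_geometric_two_le n
    have h4 : q ^ n * F n ≤ (1 / 2 : ℝ) ^ n * |K| :=
      calc q ^ n * F n ≤ q ^ n * |K| :=
            mul_le_mul_of_nonneg_left ((hK n).trans (le_abs_self K)) (pow_nonneg hq n)
        _ ≤ _ := mul_le_mul_of_nonneg_right (pow_le_pow_left₀ hq hq2 n) (abs_nonneg K)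
    have := mul_le_mul_of_nonneg_left h3 hA
    linarith [h1 n]
  have h3 : Tendsto (fun n : ℕ => (1 / 2 : ℝ) ^ n * |K| + 2 * A) atTop (𝓝 (0 * |K| + 2 * A)) :=
    ((tendsto_pow_atTop_nhds_zero_of_lt_one (by norm_num) (by norm_num)).mul_const _).add_const _
  simpa using ge_of_tendsto' h3 h2

lemma exists_scale {s σ Y : ℝ} (hs : 0 < s) (hs1 : s < 1) (hσ : 0 < σ) (hY : 1 ≤ Y) :
    ∃ N : ℕ, Y ≤ (3 : ℝ) ^ (σ * (N : ℝ)) ∧ (3 : ℝ) ^ (s * (N : ℝ)) ≤ 3 * Y ^ (s / σ) := by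
  have hl : 0 < Real.log 3 := Real.log_pos (by norm_num)
  have hlY : 0 ≤ Real.log Y := Real.log_nonneg hY
  have hY0 : 0 < Y := by linarith
  refine ⟨⌈Real.log Y / (σ * Real.log 3)⌉₊, ?_, ?_⟩
  · rw [Real.rpow_def_of_pos (by norm_num), ← Real.log_le_iff_le_exp hY0]
    have := Nat.le_ceil (Real.log Y / (σ * Real.log 3))
    rw [div_le_iff₀ (by positivity)] at this
    linarith
  · have h1 := (Nat.ceil_lt_add_one (by positivity : 0 ≤ Real.log Y / (σ * Real.log 3))).le
    have h3 : (3 : ℝ) = Real.exp (Real.log 3) := (Real.exp_log (by norm_num)).symm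
    calc (3 : ℝ) ^ (s * ((⌈Real.log Y / (σ * Real.log 3)⌉₊ : ℕ) : ℝ))
        ≤ (3 : ℝ) ^ (s * (Real.log Y / (σ * Real.log 3)) + 1) := by
          apply Real.rpow_le_rpow_of_exponent_le (by norm_num)
          nlinarith
      _ = 3 * Y ^ (s / σ) := by
          rw [Real.rpow_add (by norm_num), Real.rpow_one, mul_comm,
            Real.rpow_def_of_pos (by norm_num : (0:ℝ) < 3), Real.rpow_def_of_pos hY0]
          congr 2
          field_simp

/-- Since `log 3 ≥ 1`, `3^{-s} ≤ e^{-s} ≤ 1 - s + s²/2`. The square of this bound dominates `s² (1 -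
s)`, which is how the powers of `s` and `1 - s` enter the final constant. -/
lemma one_sub_rpow_ge {s : ℝ} (hs : 0 < s) : s * (1 - s / 2) ≤ 1 - (3 : ℝ) ^ (-s) := by
  have h3 : (1 : ℝ) ≤ Real.log 3 := by
    rw [Real.le_log_iff_exp_le (by norm_num)]
    linarith [Real.exp_one_lt_d9]
  have h1 : (3 : ℝ) ^ (-s) ≤ Real.exp (-s) := by
    rw [Real.rpow_def_of_pos (by norm_num)]
    apply Real.exp_le_exp.2
    nlinarith
  have h2 : Real.exp (-s) ≤ 1 - s + s ^ 2 / 2 := by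
    have h4 := Real.quadratic_le_exp_of_nonneg hs.le
    have h5 : Real.exp (-s) * Real.exp s = 1 := by rw [← Real.exp_add]; simp
    have h6 : 0 < Real.exp (-s) := Real.exp_pos _
    have h7 : 1 ≤ (1 - s + s ^ 2 / 2) * Real.exp s := by
      have : 0 ≤ 1 - s + s ^ 2 / 2 := by nlinarith [sq_nonneg (s - 1)]
      calc (1 : ℝ) ≤ (1 - s + s ^ 2 / 2) * (1 + s + s ^ 2 / 2) := by nlinarith [sq_nonneg (s ^ 2)]
        _ ≤ _ := by gcongr
    have := mul_le_mul_of_nonneg_left h7 h6.le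
    nlinarith
  nlinarith

end CoarseGrained

end

/-! ### The iteration when `s / σ` is bounded -/

noncomputable section
namespace CoarseGrained

/-- Iteration of the one-step absorption estimate along given widths and scales. -/
lemma absorb_along {C₀ CL L c ℓ H K D κ s σ G ρ : ℝ} {b : ℕ → ℝ} {F : ℝ → ℝ} {h : ℕ → ℝ} {N : ℕ → ℕ}
    (hC₀ : 0 ≤ C₀) (hCL : 0 ≤ CL) (hc : 0 < c) (hℓ : 0 < ℓ) (hH : 0 ≤ H) (hK : ∀ τ, F τ ≤ K)
    (hstep : ∀ τ h : ℝ, ∀ N : ℕ, 0 ≤ τ → 0 < h → τ + h ≤ D →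
      11 / 10 * L * (κ * tailSum b σ N) ≤ c * h → CL * (3 : ℝ) ^ (-(N : ℝ)) ≤ h →
      F τ ≤ C₀ * Real.exp (-L) * F (τ + h) + CL * (ℓ * (3 : ℝ) ^ (s * (N : ℝ)) / (c * h)) ^ 2 * H)
    (hh : ∀ n, 0 < h n) (hsum : ∀ n, ∑ i ∈ Finset.range n, h i ≤ D)
    (h1 : ∀ n, 11 / 10 * L * (κ * tailSum b σ (N n)) ≤ c * h n)
    (h2 : ∀ n, CL * (3 : ℝ) ^ (-(N n : ℝ)) ≤ h n)
    (hρ : 1 ≤ ρ) (_hG : 0 ≤ G) (h3 : ∀ n, (3 : ℝ) ^ (s * (N n : ℝ)) / h n ≤ G * ρ ^ n)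
    (hq : C₀ * Real.exp (-L) * ρ ^ 2 ≤ 1 / 2) :
    F 0 ≤ 2 * (CL * (ℓ * G / c) ^ 2 * H) := by
  have := iterate_absorb (F := fun n => F (∑ i ∈ Finset.range n, h i)) (q := C₀ * Real.exp (-L))
    (A := CL * (ℓ * G / c) ^ 2 * H) (r := ρ ^ 2) (K := K) (by positivity) (by positivity)
    (one_le_pow₀ hρ) hq (fun n => hK _) (fun n => ?_)
  · simpa using this
  · have h4 := hstep (∑ i ∈ Finset.range n, h i) (h n) (N n)
      (Finset.sum_nonneg fun i _ => (hh i).le) (hh n)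
      (by rw [← Finset.sum_range_succ]; exact hsum _) (h1 n) (h2 n)
    rw [← Finset.sum_range_succ] at h4
    refine h4.trans ?_
    have h5 : ℓ * (3 : ℝ) ^ (s * (N n : ℝ)) / (c * h n) ≤ ℓ * G / c * ρ ^ n := by
      have h6 := mul_le_mul_of_nonneg_left (h3 n) (by positivity : 0 ≤ ℓ / c)
      calc _ = ℓ / c * ((3 : ℝ) ^ (s * (N n : ℝ)) / h n) := by
            have := (hh n).ne'
            field_simp
        _ ≤ ℓ / c * (G * ρ ^ n) := h6
        _ = _ := by ring
    have h7 : 0 ≤ ℓ * (3 : ℝ) ^ (s * (N n : ℝ)) / (c * h n) := by have := hh n; positivity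
    have h8 := pow_le_pow_left₀ h7 h5 2
    have h9 : CL * (ℓ * (3 : ℝ) ^ (s * (N n : ℝ)) / (c * h n)) ^ 2 * H ≤
        CL * (ℓ * G / c * ρ ^ n) ^ 2 * H := by gcongr
    have h10 : CL * (ℓ * G / c * ρ ^ n) ^ 2 * H = CL * (ℓ * G / c) ^ 2 * H * (ρ ^ 2) ^ n := by ring
    linarith

/-- From `log (1/x) ≤ 1/x - 1`. It pays for replacing `s²` by `σ s` inside a power with exponent `x
= s / σ`. -/
lemma one_div_rpow_self_le {x : ℝ} (hx : 0 < x) : (1 / x) ^ x ≤ Real.exp 1 := by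
  rw [Real.rpow_def_of_pos (by positivity)]
  apply Real.exp_le_exp.2
  have h := Real.log_le_sub_one_of_pos (by positivity : 0 < 1 / x)
  have h2 := mul_le_mul_of_nonneg_right h hx.le
  have : (1 / x - 1) * x = 1 - x := by field_simp
  linarith

section
variable {s σ c Δ ℓ a : ℝ}

/-- The constant in the inequality is `(2 / σ) ℓ / (c Δ)` times a power of a single quantity. -/
lemma bound_eq (hs : 0 < s) (hs1 : s < 1) (hσ : 0 < σ) (hc : 0 < c) (hΔ : 0 < Δ) (hℓ : 0 < ℓ)
    (ha : 0 < a) :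
    (2 / σ) ^ ((s + σ) / σ) * (ℓ * a) ^ (s / σ) * ℓ /
      (c ^ ((s + σ) / σ) * s ^ (s / σ) * (1 - s) ^ (s / σ) * Δ ^ ((s + σ) / σ)) =
    2 / σ * (ℓ / (c * Δ)) * (2 / σ * (ℓ * a) / (s * (1 - s) * c * Δ)) ^ (s / σ) := by
  have h1s : 0 < 1 - s := by linarith
  have hx : (s + σ) / σ = 1 + s / σ := by field_simp; ring
  have hy : 0 < 2 / σ := by positivity
  generalize 2 / σ = y at hy ⊢
  rw [hx, Real.rpow_add hy, Real.rpow_add hc, Real.rpow_add hΔ, Real.rpow_one,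
    Real.rpow_one, Real.rpow_one, Real.div_rpow (by positivity) (by positivity),
    Real.mul_rpow hy.le (by positivity), Real.mul_rpow (by positivity) hΔ.le,
    Real.mul_rpow (by positivity) hc.le, Real.mul_rpow hs.le h1s.le]
  have e1 : 0 < c ^ (s / σ) := by positivity
  have e2 : 0 < s ^ (s / σ) := by positivity
  have e3 : 0 < (1 - s) ^ (s / σ) := by positivity
  have e4 : 0 < Δ ^ (s / σ) := by positivity
  field_simp

/-- Comparison of the outcome of the iteration with the constant in the inequality, when `s / σ` is
bounded. -/
lemma bound_of_le {K₁ X : ℝ} (hs : 0 < s) (hs1 : s < 1) (hσ : 0 < σ) (hsσ : s + σ < 1) (hc : 0 < c)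
    (hΔ : 0 < Δ) (hℓ : 0 < ℓ) (ha : 0 < a) (hK₁1 : 1 ≤ K₁) (hx : s / σ ≤ X) :
    ℓ * (15 * (K₁ * (ℓ * a) / (s ^ 2 * c * Δ)) ^ (s / σ) / Δ) / c ≤
      30 * (K₁ ^ X * Real.exp 1) * ((2 / σ) ^ ((s + σ) / σ) * (ℓ * a) ^ (s / σ) * ℓ /
        (c ^ ((s + σ) / σ) * s ^ (s / σ) * (1 - s) ^ (s / σ) * Δ ^ ((s + σ) / σ))) := by
  have h1s : 0 < 1 - s := by linarith
  rw [bound_eq hs hs1 hσ hc hΔ hℓ ha]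
  set x := s / σ with hxdef
  have hx0 : 0 < x := by positivity
  set Γ := K₁ * (ℓ * a) / (s ^ 2 * c * Δ) with hΓ
  set Γ' := 2 / σ * (ℓ * a) / (s * (1 - s) * c * Δ) with hΓ'
  -- The quotient `Γ / Γ'` is `K₁ (1 - s) / (2x)`. Its power `x` is bounded by `K₁ ^ X * e`, so the
  -- different base is harmless as long as `x ≤ X`.
  have e1 : Γ ≤ K₁ * (1 / x) * Γ' := by
    have : K₁ * (1 / x) * Γ' = K₁ * (ℓ * a) / (s ^ 2 * c * Δ) * (2 / (1 - s)) := by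
      rw [hΓ', hxdef]; field_simp
    rw [this]
    refine le_mul_of_one_le_right (by positivity) ?_
    rw [le_div_iff₀ h1s]; linarith
  have hΓ0 : 0 < Γ := by positivity
  have hΓ'0 : 0 < Γ' := by positivity
  have e2 : Γ ^ x ≤ (K₁ ^ X * Real.exp 1) * Γ' ^ x := by
    calc Γ ^ x ≤ (K₁ * (1 / x) * Γ') ^ x := Real.rpow_le_rpow hΓ0.le e1 hx0.le
      _ = K₁ ^ x * (1 / x) ^ x * Γ' ^ x := by
        rw [Real.mul_rpow (by positivity) hΓ'0.le, Real.mul_rpow (by positivity) (by positivity)]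
      _ ≤ _ := by
        have i1 := one_div_rpow_self_le hx0
        have i2 : K₁ ^ x ≤ K₁ ^ X := Real.rpow_le_rpow_of_exponent_le hK₁1 hx
        have i3 : 0 < Γ' ^ x := by positivity
        have i4 : 0 < (1 / x) ^ x := by positivity
        gcongr
  have hσ1 : 1 ≤ 2 / σ := by rw [le_div_iff₀ hσ]; linarith
  have e4 : 0 < Γ' ^ x := by positivity
  have e5 : 0 < K₁ ^ X * Real.exp 1 := by positivity
  have e6 : 0 < ℓ / (c * Δ) := by positivity
  generalize Γ' ^ x = G at *
  generalize K₁ ^ X * Real.exp 1 = k at *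
  generalize 2 / σ = y at *
  have e7 : ℓ * (15 * Γ ^ x / Δ) / c = 15 * (ℓ / (c * Δ)) * Γ ^ x := by field_simp
  rw [e7]
  calc 15 * (ℓ / (c * Δ)) * Γ ^ x ≤ 15 * (ℓ / (c * Δ)) * (k * G) := by gcongr
    _ = 15 * k * (1 * (ℓ / (c * Δ)) * G) := by ring
    _ ≤ 30 * k * (y * (ℓ / (c * Δ)) * G) := by gcongr; norm_num

end

lemma sum_half_le (A : ℝ) (hA : 0 ≤ A) (n : ℕ) : ∑ i ∈ Finset.range n, A * (1 / 2 : ℝ) ^ i ≤ 2 * A := by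
  rw [← Finset.mul_sum, mul_comm]
  exact mul_le_mul_of_nonneg_right (sum_geometric_two_le n) hA

set_option maxHeartbeats 1600000 in
/-- The regime in which `s / σ` is bounded. -/
lemma iteration_of_le (C₀ : ℝ) (hC₀ : 1 ≤ C₀) (CL : ℝ → ℝ) (hCL : ∀ L, 1 ≤ CL L) (X : ℝ)
    (hX : 0 < X) :
    ∃ C : ℝ, 0 < C ∧ ∀ (s σ c Δ ℓ a H K : ℝ) (b : ℕ → ℝ) (F : ℝ → ℝ), 0 < s → s < 1 → 0 < σ →
      s + σ < 1 → 1 ≤ c → c ≤ 2 → 0 < Δ → Δ ≤ 1 → 0 < ℓ → 0 < a → 1 ≤ ℓ * a → 0 ≤ H →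
      (∀ i, 0 ≤ b i) → Summable b → ∑' i, b i ≤ ℓ / (1 - (3 : ℝ) ^ (-s)) → (∀ τ, F τ ≤ K) →
      (∀ L τ h : ℝ, ∀ N : ℕ, 1 ≤ L → 0 ≤ τ → 0 < h → τ + h ≤ 47 / 100 * Δ →
        11 / 10 * L * (7 / 8 * a / (1 - (3 : ℝ) ^ (-(s + σ))) * tailSum b σ N) ≤ c * h →
        CL L * (3 : ℝ) ^ (-(N : ℝ)) ≤ h →
        F τ ≤ C₀ * Real.exp (-L) * F (τ + h) +
          CL L * (ℓ * (3 : ℝ) ^ (s * (N : ℝ)) / (c * h)) ^ 2 * H) →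
      s / σ ≤ X →
      F 0 ≤ C * ((2 / σ) ^ ((s + σ) / σ) * (ℓ * a) ^ (s / σ) * ℓ /
        (c ^ ((s + σ) / σ) * s ^ (s / σ) * (1 - s) ^ (s / σ) * Δ ^ ((s + σ) / σ))) ^ 2 * H := by
  -- Along the iteration `3^{s N_n} / h_n` grows at most like `ρ^n` with `ρ ≤ 2^{X+1}`. This `L`
  -- makes `C₀ e^{-L} ρ² ≤ 1/2`, so the remainders form a geometric series.
  set L := Real.log (2 * C₀ * ((2 : ℝ) ^ (X + 1)) ^ 2) + 1 with hL
  have h2X : 1 ≤ (2 : ℝ) ^ (X + 1) := Real.one_le_rpow (by norm_num) (by linarith)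
  have hLarg : 1 ≤ 2 * C₀ * ((2 : ℝ) ^ (X + 1)) ^ 2 := by nlinarith [one_le_pow₀ h2X (n := 2)]
  have hL1 : 1 ≤ L := by have := Real.log_nonneg hLarg; linarith
  have hq0 : C₀ * Real.exp (-L) * ((2 : ℝ) ^ (X + 1)) ^ 2 ≤ 1 / 2 := by
    have h1 : Real.exp (-L) ≤ (2 * C₀ * ((2 : ℝ) ^ (X + 1)) ^ 2)⁻¹ := by
      rw [← Real.exp_log (by positivity : 0 < 2 * C₀ * ((2 : ℝ) ^ (X + 1)) ^ 2), ← Real.exp_neg]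
      exact Real.exp_le_exp.2 (by linarith)
    calc _ ≤ C₀ * (2 * C₀ * ((2 : ℝ) ^ (X + 1)) ^ 2)⁻¹ * ((2 : ℝ) ^ (X + 1)) ^ 2 := by gcongr
      _ = 1 / 2 := by field_simp
  set Λ := CL L
  have hΛ : 1 ≤ Λ := hCL L
  -- The factor `L` serves the condition on the tails and the factor `Λ` the condition `Λ 3^{-N} ≤
  -- h`; the number `100` leaves room in both.
  set K₁ := 100 * L * Λ with hK₁
  have hK₁1 : 1 ≤ K₁ := by nlinarith [mul_le_mul hL1 hΛ zero_le_one (by linarith)]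
  refine ⟨2 * Λ * (30 * (K₁ ^ X * Real.exp 1)) ^ 2, by positivity, ?_⟩
  intro s σ c Δ ℓ a H K b F hs hs1 hσ hsσ hc1 hc2 hΔ hΔ1 hℓ ha hℓa hH hb0 hb hbs hK hstep hx
  have hc : 0 < c := by linarith
  have hg := one_sub_rpow_ge hs
  have hg2 : s / 2 ≤ 1 - (3 : ℝ) ^ (-s) := by nlinarith
  have hg3 : s / 2 ≤ 1 - (3 : ℝ) ^ (-(s + σ)) := by
    have : (3 : ℝ) ^ (-(s + σ)) ≤ (3 : ℝ) ^ (-s) :=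
      Real.rpow_le_rpow_of_exponent_le (by norm_num) (by linarith)
    linarith
  set x := s / σ with hxdef
  have hx0 : 0 < x := by positivity
  set Γ := K₁ * (ℓ * a) / (s ^ 2 * c * Δ) with hΓ
  have hs2 : s ^ 2 ≤ 1 := by nlinarith
  have hden : s ^ 2 * c * Δ ≤ 2 * Δ := by
    have : s ^ 2 * c ≤ 2 := by nlinarith
    nlinarith
  have hΓ1 : K₁ / (2 * Δ) ≤ Γ := by
    rw [hΓ]
    apply div_le_div₀ (by positivity) (by nlinarith) (by positivity) hden
  have hΓ2 : 1 ≤ Γ := by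
    refine le_trans ?_ hΓ1
    rw [le_div_iff₀ (by positivity)]
    nlinarith [mul_le_mul hL1 hΛ zero_le_one (by linarith)]
  -- The factor `2 ^ n` makes the tails decrease as fast as the widths `h_n = (Δ/5) 2^{-n}`, whose
  -- sum is at most `2Δ/5 < 47Δ/100`.
  have hpick : ∀ n : ℕ, ∃ N : ℕ, Γ * 2 ^ n ≤ (3 : ℝ) ^ (σ * (N : ℝ)) ∧
      (3 : ℝ) ^ (s * (N : ℝ)) ≤ 3 * (Γ * 2 ^ n) ^ x := fun n =>
    exists_scale hs hs1 hσ (by nlinarith [one_le_pow₀ (one_le_two (α := ℝ)) (n := n)])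
  choose N hN1 hN2 using hpick
  have hpow : ∀ n : ℕ, (1 / 2 : ℝ) ^ n = (2 ^ n)⁻¹ := fun n => by rw [one_div, inv_pow]
  have hT : ∀ n, tailSum b σ n ≤ (3 : ℝ) ^ (-σ * (n : ℝ)) * (ℓ / (s / 2)) := fun n => by
    refine (tailSum_le hb0 hb hσ n).trans ?_
    gcongr
    refine hbs.trans ?_
    gcongr
  have hinv : ∀ n, (3 : ℝ) ^ (-σ * (N n : ℝ)) ≤ (Γ * 2 ^ n)⁻¹ := fun n => by
    rw [neg_mul, Real.rpow_neg (by norm_num)]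
    gcongr
    exact hN1 n
  -- In `ρ = 2^{x+1}`, the factor `2^x` comes from `3^{s N_n} ≤ 3 (Γ 2^n)^x` and the factor `2` from
  -- `1 / h_n`; `15 = 3 · 5` collects the constants of these two bounds.
  have hmain := absorb_along (h := fun n => 1 / 5 * Δ * (1 / 2 : ℝ) ^ n) (N := N) (ρ := 2 ^ (x + 1))
    (G := 15 * Γ ^ x / Δ) (L := L) (D := 47 / 100 * Δ) (by linarith) (by linarith : 0 ≤ Λ) hc hℓ hH hK
    (fun τ h N h1 h2 h3 h4 h5 => hstep L τ h N hL1 h1 h2 h3 h4 h5)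
    (fun n => by positivity)
    (fun n => (sum_half_le _ (by positivity) n).trans (by linarith)) (fun n => ?_) (fun n => ?_)
    (Real.one_le_rpow (by norm_num) (by linarith)) (by positivity) (fun n => ?_) (le_trans ?_ hq0)
  · refine hmain.trans ?_
    have e3 := bound_of_le hs hs1 hσ hsσ hc hΔ hℓ ha hK₁1 hx
    generalize (2 / σ) ^ ((s + σ) / σ) * (ℓ * a) ^ (s / σ) * ℓ /
      (c ^ ((s + σ) / σ) * s ^ (s / σ) * (1 - s) ^ (s / σ) * Δ ^ ((s + σ) / σ)) = W at *
    have e4 : 0 ≤ ℓ * (15 * Γ ^ x / Δ) / c := by positivity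
    have e5 := pow_le_pow_left₀ e4 e3 2
    calc 2 * (Λ * (ℓ * (15 * Γ ^ x / Δ) / c) ^ 2 * H)
        ≤ 2 * (Λ * (30 * (K₁ ^ X * Real.exp 1) * W) ^ 2 * H) := by gcongr
      _ = _ := by ring
  · have e1 : 11 / 10 * L * (7 / 8 * a / (1 - (3 : ℝ) ^ (-(s + σ))) * tailSum b σ (N n)) ≤
        11 / 10 * L * (7 / 8 * a / (s / 2) * ((Γ * 2 ^ n)⁻¹ * (ℓ / (s / 2)))) := by
      have := tailSum_nonneg hb0 σ (N n)
      gcongr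
      exact (hT _).trans (by gcongr; exact hinv n)
    refine e1.trans ?_
    rw [hpow, hΓ, hK₁]
    have h2n : (0 : ℝ) < 2 ^ n := by positivity
    have : 11 / 10 * L * (7 / 8 * a / (s / 2) * ((100 * L * Λ * (ℓ * a) / (s ^ 2 * c * Δ) * 2 ^ n)⁻¹ *
        (ℓ / (s / 2)))) = (77 / 2000 / Λ) * (c * Δ * (2 ^ n)⁻¹) := by
      field_simp; ring
    rw [this]
    have : 77 / 2000 / Λ ≤ 1 / 5 := by rw [div_le_iff₀ (by positivity)]; linarith
    calc 77 / 2000 / Λ * (c * Δ * (2 ^ n)⁻¹) ≤ 1 / 5 * (c * Δ * (2 ^ n)⁻¹) := by gcongr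
      _ = _ := by ring
  · have e1 : (3 : ℝ) ^ (-(N n : ℝ)) ≤ (Γ * 2 ^ n)⁻¹ := by
      refine le_trans ?_ (hinv n)
      apply Real.rpow_le_rpow_of_exponent_le (by norm_num)
      have : (0 : ℝ) ≤ N n := Nat.cast_nonneg _
      nlinarith
    have e2 : (Γ * 2 ^ n)⁻¹ ≤ (K₁ / (2 * Δ) * 2 ^ n)⁻¹ := by gcongr
    calc Λ * (3 : ℝ) ^ (-(N n : ℝ)) ≤ Λ * (K₁ / (2 * Δ) * 2 ^ n)⁻¹ := by
          gcongr; exact e1.trans e2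
      _ = 1 / (50 * L) * (Δ * (2 ^ n)⁻¹) := by rw [hK₁]; field_simp; ring
      _ ≤ 1 / 5 * (Δ * (2 ^ n)⁻¹) := by
          gcongr; linarith
      _ = _ := by rw [hpow]; ring
  · rw [div_le_iff₀ (by positivity)]
    refine (hN2 n).trans (le_of_eq ?_)
    rw [Real.mul_rpow (by positivity) (by positivity), Real.rpow_add (by norm_num), Real.rpow_one,
      mul_pow, hpow, ← Real.rpow_natCast 2 n, ← Real.rpow_mul (by norm_num), ← Real.rpow_natCast
      ((2 : ℝ) ^ x) n, ← Real.rpow_mul (by norm_num), mul_comm (n : ℝ) x]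
    have : (0 : ℝ) < 2 ^ (n : ℝ) := by positivity
    field_simp
    norm_num
  · have : (2 : ℝ) ^ (x + 1) ≤ 2 ^ (X + 1) :=
      Real.rpow_le_rpow_of_exponent_le (by norm_num) (by linarith)
    gcongr

end CoarseGrained

end

/-! ### The iteration when `s / σ` is large -/

noncomputable section
namespace CoarseGrained

/-- The total width used by the iteration when `s / σ` is large. -/
lemma total_width_le {L T M x s σ c Δ ℓ a : ℝ} (hs : 0 < s) (hs1 : s < 1) (hσ : 0 < σ) (hc : 0 < c)
    (hΔ : 0 < Δ) (hℓ : 0 < ℓ) (ha : 0 < a) (hx : x = s / σ) (hM : 0 < M) (hL : 0 < L)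
    (hLM : L ≤ 2 * s * Real.log 3 * (51 / 50) * M) (hLx : L ≤ x / 50)
    (hT : T ≤ (2 / σ * (ℓ * a) / (s * (1 - s) * c * Δ))⁻¹ *
      (1 / (Real.exp 1 * σ * Real.log 3) / M + 1) * (ℓ / (1 - (3 : ℝ) ^ (-s)))) :
    11 / 10 * L * (7 / 8 * a / (1 - (3 : ℝ) ^ (-(s + σ))) * T) / c ≤ 9 / 20 * Δ := by
  have hl : 0 < Real.log 3 := Real.log_pos (by norm_num)
  have hg := one_sub_rpow_ge hs
  have h1s : 0 < 1 - s := by linarith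
  have hg0 : 0 < s * (1 - s / 2) := by nlinarith
  set g := 1 - (3 : ℝ) ^ (-s) with hgdef
  have hg1 : 0 < g := by linarith
  have hgg : g ≤ 1 - (3 : ℝ) ^ (-(s + σ)) := by
    have : (3 : ℝ) ^ (-(s + σ)) ≤ (3 : ℝ) ^ (-s) :=
      Real.rpow_le_rpow_of_exponent_le (by norm_num) (by linarith)
    rw [hgdef]; linarith
  have hsq : s ^ 2 * (1 - s) ≤ g ^ 2 := by
    have h1 := pow_le_pow_left₀ hg0.le hg 2
    have : s ^ 2 * (1 - s) ≤ (s * (1 - s / 2)) ^ 2 := by nlinarith [sq_nonneg (s ^ 2)]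
    linarith
  have hx0 : 0 < x := by rw [hx]; positivity
  -- The bound on `L` by a multiple of `M` cancels the `M` in the denominator and leaves `(51/25)/e
  -- ≤ 76/100`; the summand `1` costs `L ≤ x/50`, that is `2/100` more.
  have hkey : L * (1 / (Real.exp 1 * σ * Real.log 3) / M + 1) ≤ 78 / 100 * x := by
    have h1 : L * (1 / (Real.exp 1 * σ * Real.log 3) / M) ≤ 51 / 25 / Real.exp 1 * x := by
      calc L * (1 / (Real.exp 1 * σ * Real.log 3) / M)
          ≤ (2 * s * Real.log 3 * (51 / 50) * M) * (1 / (Real.exp 1 * σ * Real.log 3) / M) := by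
            gcongr
        _ = _ := by rw [hx]; field_simp; ring
    have h2 : 51 / 25 / Real.exp 1 ≤ 76 / 100 := by
      rw [div_le_iff₀ (Real.exp_pos 1)]
      linarith [Real.exp_one_gt_d9]
    nlinarith
  have hk0 : 0 ≤ 1 / (Real.exp 1 * σ * Real.log 3) / M + 1 := by positivity
  set k := 1 / (Real.exp 1 * σ * Real.log 3) / M + 1
  set T' := (2 / σ * (ℓ * a) / (s * (1 - s) * c * Δ))⁻¹ * k * (ℓ / g) with hT'
  have hT'0 : 0 ≤ T' := by positivity
  have hg2 : 0 < 1 - (3 : ℝ) ^ (-(s + σ)) := by linarith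
  -- The two denominators `1 - 3^{-s}` and `1 - 3^{-(s+σ)}` are both bounded below by `g`, and `s²
  -- (1 - s) ≤ g²` cancels the factors `s` and `1 - s` contributed by `Γ⁻¹`. The numerical outcome
  -- `(77/80)(78/100)/2` is about `0.376`, below `9/20`.
  calc 11 / 10 * L * (7 / 8 * a / (1 - (3 : ℝ) ^ (-(s + σ))) * T) / c
      ≤ 11 / 10 * L * (7 / 8 * a / (1 - (3 : ℝ) ^ (-(s + σ))) * T') / c := by
        gcongr
    _ ≤ 11 / 10 * L * (7 / 8 * a / g * T') / c := by gcongr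
    _ = 77 / 80 * (L * k) * (σ * s * (1 - s) / (2 * g ^ 2)) * Δ := by
        rw [hT']; field_simp; ring
    _ ≤ 77 / 80 * (78 / 100 * x) * (σ * s * (1 - s) / (2 * g ^ 2)) * Δ := by gcongr
    _ = 77 / 80 * (78 / 100) / 2 * (s ^ 2 * (1 - s) / g ^ 2) * Δ := by
        rw [hx]; field_simp
    _ ≤ 77 / 80 * (78 / 100) / 2 * 1 * Δ := by
        gcongr
        rw [div_le_one (by positivity)]; exact hsq
    _ ≤ 9 / 20 * Δ := by nlinarith

set_option maxHeartbeats 1600000 in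
/-- The regime in which `s / σ` is large. -/
lemma iteration_of_ge (C₀ : ℝ) (hC₀ : 1 ≤ C₀) (CL : ℝ → ℝ) (hCL : ∀ L, 1 ≤ CL L) :
    ∃ X C : ℝ, 0 < X ∧ 0 < C ∧ ∀ (s σ c Δ ℓ a H K : ℝ) (b : ℕ → ℝ) (F : ℝ → ℝ), 0 < s → s < 1 →
      0 < σ →
      s + σ < 1 → 1 ≤ c → c ≤ 2 → 0 < Δ → Δ ≤ 1 → 0 < ℓ → 0 < a → 1 ≤ ℓ * a → 0 ≤ H →
      (∀ i, 0 ≤ b i) → Summable b → ∑' i, b i ≤ ℓ / (1 - (3 : ℝ) ^ (-s)) → (∀ τ, F τ ≤ K) →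
      (∀ L τ h : ℝ, ∀ N : ℕ, 1 ≤ L → 0 ≤ τ → 0 < h → τ + h ≤ 47 / 100 * Δ →
        11 / 10 * L * (7 / 8 * a / (1 - (3 : ℝ) ^ (-(s + σ))) * tailSum b σ N) ≤ c * h →
        CL L * (3 : ℝ) ^ (-(N : ℝ)) ≤ h →
        F τ ≤ C₀ * Real.exp (-L) * F (τ + h) +
          CL L * (ℓ * (3 : ℝ) ^ (s * (N : ℝ)) / (c * h)) ^ 2 * H) →
      X ≤ s / σ →
      F 0 ≤ C * ((2 / σ) ^ ((s + σ) / σ) * (ℓ * a) ^ (s / σ) * ℓ /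
        (c ^ ((s + σ) / σ) * s ^ (s / σ) * (1 - s) ^ (s / σ) * Δ ^ ((s + σ) / σ))) ^ 2 * H := by
  have hl : 0 < Real.log 3 := Real.log_pos (by norm_num)
  have hl1 : (1 : ℝ) ≤ Real.log 3 := by
    rw [Real.le_log_iff_exp_le (by norm_num)]
    linarith [Real.exp_one_lt_d9]
  -- These choices give `e^{-L} = 3^{-2(Y+1)} / (8 C₀)`, while the scales advance by `M` with `Y ≤
  -- sM ≤ Y + 1`. With growth rate `ρ = 2 · 3^{sM}` this yields `C₀ e^{-L} ρ² ≤ 1/2`. Taking `Y = 25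
  -- (k + 2)` ensures `2(Y + 1) + k ≤ 2 (51/50) Y`: the number `L` exceeds its unavoidable part `2 s
  -- M log 3` by at most two percent.
  set k := Real.log (8 * C₀) / Real.log 3 with hk
  have hk0 : 0 ≤ k := div_nonneg (Real.log_nonneg (by linarith)) hl.le
  set Y := 25 * (k + 2) with hY
  have hY1 : 1 ≤ Y := by linarith
  set L := (2 * (Y + 1) + k) * Real.log 3 with hL
  have hL1 : 1 ≤ L := by nlinarith
  have hexp : Real.exp (-L) = (8 * C₀)⁻¹ * ((3 : ℝ) ^ (Y + 1))⁻¹ ^ 2 := by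
    have e1 : k * Real.log 3 = Real.log (8 * C₀) := by rw [hk]; field_simp
    have e2 : -L = -Real.log (8 * C₀) + -(Real.log 3 * (Y + 1)) * 2 := by rw [hL, ← e1]; ring
    rw [e2, Real.exp_add, Real.exp_neg, Real.exp_log (by positivity), Real.rpow_def_of_pos (by norm_num),
      ← Real.exp_neg, ← Real.exp_nat_mul]
    push_cast; ring_nf
  set Λ := CL L
  have hΛ : 1 ≤ Λ := hCL L
  -- The threshold gives `L ≤ x/50`, needed for the total width, and `100 Λ / Δ ≤ Γ`, needed for `Λ
  -- 3^{-N} ≤ h`. In `300 = 3 · 100`, the `3` is the loss in choosing an integer scale and the `100`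
  -- comes from the lower bound `h_n ≥ (Δ/100) 2^{-n}`.
  refine ⟨50 * L + 100 * Λ, 2 * Λ * 300 ^ 2, by positivity, by positivity, ?_⟩
  intro s σ c Δ ℓ a H K b F hs hs1 hσ hsσ hc1 hc2 hΔ hΔ1 hℓ ha hℓa hH hb0 hb hbs hK hstep hX
  have hc : 0 < c := by linarith
  have h1s : 0 < 1 - s := by linarith
  rw [bound_eq hs hs1 hσ hc hΔ hℓ ha]
  set x := s / σ with hx
  have hx0 : 0 < x := by positivity
  set Γ := 2 / σ * (ℓ * a) / (s * (1 - s) * c * Δ) with hΓ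
  have hΓx : x / Δ ≤ Γ := by
    have : Γ = 2 * x * (ℓ * a) / (s ^ 2 * (1 - s) * c * Δ) := by rw [hΓ, hx]; field_simp
    rw [this]
    have e0 : s ^ 2 ≤ 1 := by nlinarith
    have e1 : s ^ 2 * (1 - s) ≤ 1 := by nlinarith
    have e2 : s ^ 2 * (1 - s) * c ≤ 2 := by nlinarith
    rw [div_le_div_iff₀ hΔ (by positivity)]
    have e3 : x * (s ^ 2 * (1 - s) * c * Δ) ≤ x * (2 * Δ) := by gcongr
    have e4 : 2 * x * Δ * 1 ≤ 2 * x * Δ * (ℓ * a) := by gcongr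
    nlinarith
  have hΓ1 : 1 ≤ Γ := by
    refine le_trans ?_ hΓx
    rw [le_div_iff₀ hΔ]; linarith
  obtain ⟨N₀, hN1, hN2⟩ := exists_scale hs hs1 hσ hΓ1
  set M := ⌈Y / s⌉₊ with hM
  have hMpos : 0 < M := Nat.ceil_pos.2 (by positivity)
  have hM1 : Y ≤ s * M := by
    have := Nat.le_ceil (Y / s)
    rw [div_le_iff₀ hs] at this
    linarith
  have hM2 : s * M ≤ Y + 1 := by
    have := (Nat.ceil_lt_add_one (by positivity : 0 ≤ Y / s)).le
    have h2 := mul_le_mul_of_nonneg_left this hs.le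
    have : s * (Y / s + 1) = Y + s := by field_simp
    linarith
  have hM' : (0 : ℝ) < M := by exact_mod_cast hMpos
  have hM1' : (1 : ℝ) ≤ M := by exact_mod_cast hMpos
  have hpow : ∀ n : ℕ, (1 / 2 : ℝ) ^ n = (2 ^ n)⁻¹ := fun n => by rw [one_div, inv_pow]
  have hinv : (3 : ℝ) ^ (-σ * (N₀ : ℝ)) ≤ Γ⁻¹ := by
    rw [neg_mul, Real.rpow_neg (by norm_num)]
    gcongr
  have hg0 : 0 < 1 - (3 : ℝ) ^ (-s) := lt_of_lt_of_le (by nlinarith) (one_sub_rpow_ge hs)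
  have hg3 : 0 < 1 - (3 : ℝ) ^ (-(s + σ)) :=
    lt_of_lt_of_le (by nlinarith) (one_sub_rpow_ge (by linarith : 0 < s + σ))
  have hlog : L ≤ 2 * s * Real.log 3 * (51 / 50) * M := by
    have : 2 * (Y + 1) + k ≤ 2 * (51 / 50) * Y := by rw [hY]; linarith
    calc L ≤ (2 * (51 / 50) * Y) * Real.log 3 := by rw [hL]; gcongr
      _ ≤ (2 * (51 / 50) * (s * M)) * Real.log 3 := by gcongr
      _ = _ := by ring
  -- The first summand is the least width that the absorption permits at the scale `N₀ + n M`. The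
  -- small geometric part bounds `h n` from below, also where the tail is tiny, and its total is at
  -- most `Δ/50`.
  set h : ℕ → ℝ := fun n => 11 / 10 * L * (7 / 8 * a / (1 - (3 : ℝ) ^ (-(s + σ))) *
    tailSum b σ (N₀ + n * M)) / c + 1 / 100 * Δ * (1 / 2 : ℝ) ^ n with hh
  have hT0 : ∀ n, 0 ≤ 11 / 10 * L * (7 / 8 * a / (1 - (3 : ℝ) ^ (-(s + σ))) *
    tailSum b σ (N₀ + n * M)) / c := fun n => by
    have := tailSum_nonneg hb0 σ (N₀ + n * M)
    positivity
  have hh1 : ∀ n, 1 / 100 * Δ * (1 / 2 : ℝ) ^ n ≤ h n := fun n => by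
    have := hT0 n
    simp only [hh]; linarith
  have hh0 : ∀ n, 0 < h n := fun n => lt_of_lt_of_le (by positivity) (hh1 n)
  have hmain := absorb_along (h := h) (N := fun n => N₀ + n * M) (ρ := 2 * (3 : ℝ) ^ (s * M))
    (G := 300 * Γ ^ x / Δ) (L := L) (D := 47 / 100 * Δ) (by linarith) (by linarith : 0 ≤ Λ) hc hℓ hH hK
    (fun τ h N h1 h2 h3 h4 h5 => hstep L τ h N hL1 h1 h2 h3 h4 h5)
    hh0 (fun n => ?_) (fun n => ?_) (fun n => ?_)
    (by nlinarith [Real.one_le_rpow (by norm_num : (1 : ℝ) ≤ 3) (by positivity : 0 ≤ s * M)])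
    (by positivity) (fun n => ?_) ?_
  · refine hmain.trans ?_
    have hσ1 : 1 ≤ 2 / σ := by rw [le_div_iff₀ hσ]; linarith
    have e4 : 0 < Γ ^ x := by positivity
    generalize Γ ^ x = G at *
    generalize 2 / σ = y at *
    have e6 : 0 < ℓ / (c * Δ) := by positivity
    have e7 : ℓ * (300 * G / Δ) / c = 300 * (1 * (ℓ / (c * Δ)) * G) := by field_simp
    rw [e7]
    calc 2 * (Λ * (300 * (1 * (ℓ / (c * Δ)) * G)) ^ 2 * H)
        ≤ 2 * (Λ * (300 * (y * (ℓ / (c * Δ)) * G)) ^ 2 * H) := by gcongr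
      _ = _ := by ring
  · simp only [hh]
    rw [Finset.sum_add_distrib]
    have h1 := sum_half_le (1 / 100 * Δ) (by positivity) n
    have h2 := sum_tailSum_le hb0 hb hσ N₀ M n hMpos
    have hbt : 0 ≤ ∑' i, b i := tsum_nonneg hb0
    have h3 := total_width_le (T := ∑ i ∈ Finset.range n, tailSum b σ (N₀ + i * M)) hs hs1 hσ hc hΔ
      hℓ ha hx hM' (by linarith) hlog (by linarith) (h2.trans (mul_le_mul (mul_le_mul_of_nonneg_right hinv (by positivity)) hbs hbt (by positivity)))
    have h4 : ∑ i ∈ Finset.range n, 11 / 10 * L * (7 / 8 * a / (1 - (3 : ℝ) ^ (-(s + σ))) *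
        tailSum b σ (N₀ + i * M)) / c = 11 / 10 * L * (7 / 8 * a / (1 - (3 : ℝ) ^ (-(s + σ))) *
        ∑ i ∈ Finset.range n, tailSum b σ (N₀ + i * M)) / c := by
      rw [Finset.mul_sum, Finset.mul_sum, Finset.sum_div]
    rw [h4]
    linarith
  · simp only [hh]
    rw [mul_add, mul_div_cancel₀ _ hc.ne']
    have : 0 ≤ c * (1 / 100 * Δ * (1 / 2) ^ n) := by positivity
    linarith
  · refine le_trans ?_ (hh1 n)
    have e1 : (3 : ℝ) ^ (-((N₀ + n * M : ℕ) : ℝ)) ≤ Γ⁻¹ * (1 / 2 : ℝ) ^ n := by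
      have : (3 : ℝ) ^ (-((N₀ + n * M : ℕ) : ℝ)) =
          (3 : ℝ) ^ (-(N₀ : ℝ)) * (3 : ℝ) ^ (-(n * M : ℝ)) := by
        rw [← Real.rpow_add (by norm_num)]; push_cast; ring_nf
      rw [this]
      have i1 : (3 : ℝ) ^ (-(N₀ : ℝ)) ≤ Γ⁻¹ := by
        refine le_trans ?_ hinv
        apply Real.rpow_le_rpow_of_exponent_le (by norm_num)
        have : (0 : ℝ) ≤ N₀ := Nat.cast_nonneg _
        nlinarith
      have i2 : (3 : ℝ) ^ (-(n * M : ℝ)) ≤ (1 / 2 : ℝ) ^ n := by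
        rw [hpow, Real.rpow_neg (by norm_num)]
        gcongr
        calc (2 : ℝ) ^ n ≤ 3 ^ n := by gcongr; norm_num
          _ = 3 ^ (n : ℝ) := (Real.rpow_natCast _ _).symm
          _ ≤ _ := by
            apply Real.rpow_le_rpow_of_exponent_le (by norm_num)
            have : (0 : ℝ) ≤ n := Nat.cast_nonneg _
            nlinarith
      gcongr
    have e2 : Γ⁻¹ ≤ (100 * Λ / Δ)⁻¹ := by
      have : 100 * Λ / Δ ≤ Γ := by
        refine le_trans ?_ hΓx
        gcongr
        linarith
      gcongr
    calc Λ * (3 : ℝ) ^ (-((N₀ + n * M : ℕ) : ℝ)) ≤ Λ * ((100 * Λ / Δ)⁻¹ * (1 / 2 : ℝ) ^ n) := by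
          gcongr
          exact e1.trans (by gcongr)
      _ = _ := by field_simp
  · have e1 : (3 : ℝ) ^ (s * ((N₀ + n * M : ℕ) : ℝ)) =
        (3 : ℝ) ^ (s * (N₀ : ℝ)) * ((3 : ℝ) ^ (s * (M : ℝ))) ^ n := by
      rw [← Real.rpow_natCast, ← Real.rpow_mul (by norm_num), ← Real.rpow_add (by norm_num)]
      push_cast; ring_nf
    rw [e1]
    calc (3 : ℝ) ^ (s * (N₀ : ℝ)) * ((3 : ℝ) ^ (s * (M : ℝ))) ^ n / h n
        ≤ (3 * Γ ^ x) * ((3 : ℝ) ^ (s * (M : ℝ))) ^ n / (1 / 100 * Δ * (1 / 2 : ℝ) ^ n) := by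
          gcongr
          exact hh1 n
      _ = _ := by
          rw [hpow, mul_pow]; field_simp; ring
  · rw [hexp]
    have e1 : (3 : ℝ) ^ (s * (M : ℝ)) ≤ (3 : ℝ) ^ (Y + 1) :=
      Real.rpow_le_rpow_of_exponent_le (by norm_num) hM2
    calc C₀ * ((8 * C₀)⁻¹ * ((3 : ℝ) ^ (Y + 1))⁻¹ ^ 2) * (2 * (3 : ℝ) ^ (s * (M : ℝ))) ^ 2
        ≤ C₀ * ((8 * C₀)⁻¹ * ((3 : ℝ) ^ (Y + 1))⁻¹ ^ 2) * (2 * (3 : ℝ) ^ (Y + 1)) ^ 2 := by gcongr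
      _ = 1 / 2 := by field_simp; norm_num

/-- The iteration, for all values of `s / σ`. -/
lemma iteration (C₀ : ℝ) (hC₀ : 1 ≤ C₀) (CL : ℝ → ℝ) (hCL : ∀ L, 1 ≤ CL L) :
    ∃ C : ℝ, 0 < C ∧ ∀ (s σ c Δ ℓ a H K : ℝ) (b : ℕ → ℝ) (F : ℝ → ℝ), 0 < s → s < 1 → 0 < σ →
      s + σ < 1 → 1 ≤ c → c ≤ 2 → 0 < Δ → Δ ≤ 1 → 0 < ℓ → 0 < a → 1 ≤ ℓ * a → 0 ≤ H →
      (∀ i, 0 ≤ b i) → Summable b → ∑' i, b i ≤ ℓ / (1 - (3 : ℝ) ^ (-s)) → (∀ τ, F τ ≤ K) →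
      (∀ L τ h : ℝ, ∀ N : ℕ, 1 ≤ L → 0 ≤ τ → 0 < h → τ + h ≤ 47 / 100 * Δ →
        11 / 10 * L * (7 / 8 * a / (1 - (3 : ℝ) ^ (-(s + σ))) * tailSum b σ N) ≤ c * h →
        CL L * (3 : ℝ) ^ (-(N : ℝ)) ≤ h →
        F τ ≤ C₀ * Real.exp (-L) * F (τ + h) +
          CL L * (ℓ * (3 : ℝ) ^ (s * (N : ℝ)) / (c * h)) ^ 2 * H) →
      F 0 ≤ C * ((2 / σ) ^ ((s + σ) / σ) * (ℓ * a) ^ (s / σ) * ℓ /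
        (c ^ ((s + σ) / σ) * s ^ (s / σ) * (1 - s) ^ (s / σ) * Δ ^ ((s + σ) / σ))) ^ 2 * H := by
  obtain ⟨X, C₁, hX, hC₁, h₁⟩ := iteration_of_ge C₀ hC₀ CL hCL
  obtain ⟨C₂, hC₂, h₂⟩ := iteration_of_le C₀ hC₀ CL hCL X hX
  refine ⟨C₁ + C₂, by positivity, ?_⟩
  intro s σ c Δ ℓ a H K b F hs hs1 hσ hsσ hc1 hc2 hΔ hΔ1 hℓ ha hℓa hH hb0 hb hbs hK hstep
  have h₁' := h₁ s σ c Δ ℓ a H K b F hs hs1 hσ hsσ hc1 hc2 hΔ hΔ1 hℓ ha hℓa hH hb0 hb hbs hK hstep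
  have h₂' := h₂ s σ c Δ ℓ a H K b F hs hs1 hσ hsσ hc1 hc2 hΔ hΔ1 hℓ ha hℓa hH hb0 hb hbs hK hstep
  generalize (2 / σ) ^ ((s + σ) / σ) * (ℓ * a) ^ (s / σ) * ℓ /
    (c ^ ((s + σ) / σ) * s ^ (s / σ) * (1 - s) ^ (s / σ) * Δ ^ ((s + σ) / σ)) = W at h₁' h₂' ⊢
  have hW : 0 ≤ W ^ 2 * H := by positivity
  rcases le_total X (s / σ) with h | h
  · exact (h₁' h).trans (by nlinarith)
  · exact (h₂' h).trans (by nlinarith)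

end CoarseGrained

end

/-! ### Positive definite coefficients and the energy form -/

noncomputable section
namespace CoarseGrained

variable {d : ℕ}

section Pointwise

variable {A : Matrix (Fin d) (Fin d) ℝ}

theorem inner_mulVec_comm (hA : A.PosDef) (x y : E d) :
    inner ℝ x (Matrix.toEuclideanLin A y) = inner ℝ y (Matrix.toEuclideanLin A x) := by
  have := (Matrix.isSymmetric_toEuclideanLin_iff (A := A)).2 hA.1
  rw [← this x y, real_inner_comm]

theorem inner_mulVec_self_nonneg (hA : A.PosDef) (x : E d) :
    0 ≤ inner ℝ x (Matrix.toEuclideanLin A x) :=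
  (Matrix.isPositive_toEuclideanLin_iff.2 hA.posSemidef).inner_nonneg_right x

theorem sq_inner_mulVec_le (hA : A.PosDef) (x y : E d) :
    (inner ℝ x (Matrix.toEuclideanLin A y)) ^ 2 ≤
      inner ℝ x (Matrix.toEuclideanLin A x) * inner ℝ y (Matrix.toEuclideanLin A y) := by
  have h := fun t : ℝ => inner_mulVec_self_nonneg hA (x + t • y)
  have h2 : ∀ t : ℝ, 0 ≤ inner ℝ y (Matrix.toEuclideanLin A y) * (t * t) +
      2 * inner ℝ x (Matrix.toEuclideanLin A y) * t + inner ℝ x (Matrix.toEuclideanLin A x) := by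
    intro t
    have := h t
    simp only [map_add, map_smul, inner_add_left, inner_add_right, real_inner_smul_left,
      real_inner_smul_right, inner_mulVec_comm hA y x] at this
    linarith
  have := discrim_le_zero h2
  rw [discrim] at this
  nlinarith

theorem inner_single_mulVec_single (B : Matrix (Fin d) (Fin d) ℝ) (i j : Fin d) :
    inner ℝ (EuclideanSpace.single i (1 : ℝ))
      (Matrix.toEuclideanLin B (EuclideanSpace.single j 1)) = B i j := by
  rw [EuclideanSpace.inner_single_left]
  simp [Matrix.toLpLin_apply, EuclideanSpace.single]

/-- Cauchy-Schwarz for the form of `A`, applied to each `e_i` and `x`, since `(A x)_i = e_i · A x`.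
With `a ∈ L¹` it makes fluxes of finite energy integrable. -/
theorem sq_norm_mulVec_le (hA : A.PosDef) (x : E d) :
    ‖Matrix.toEuclideanLin A x‖ ^ 2 ≤ (∑ i, A i i) * inner ℝ x (Matrix.toEuclideanLin A x) := by
  rw [EuclideanSpace.norm_sq_eq, Finset.sum_mul]
  refine Finset.sum_le_sum fun i _ => ?_
  have := sq_inner_mulVec_le hA (EuclideanSpace.single i 1) x
  rw [inner_single_mulVec_single, EuclideanSpace.inner_single_left] at this
  simpa using this

/-- The same with `A⁻¹ e_i` in place of `e_i`, since `x_i = A⁻¹ e_i · A x` and `A⁻¹ e_i · A A⁻¹ e_i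
= (A⁻¹)_{ii}`. With `a⁻¹ ∈ L¹` it makes vector fields of finite energy integrable. -/
theorem sq_norm_le_mulVec (hA : A.PosDef) (x : E d) :
    ‖x‖ ^ 2 ≤ (∑ i, A⁻¹ i i) * inner ℝ x (Matrix.toEuclideanLin A x) := by
  rw [EuclideanSpace.norm_sq_eq, Finset.sum_mul]
  refine Finset.sum_le_sum fun i _ => ?_
  have hinv : Matrix.toEuclideanLin A (Matrix.toEuclideanLin A⁻¹ (EuclideanSpace.single i (1 : ℝ))) =
      EuclideanSpace.single i 1 := by
    have : IsUnit A.det := (Matrix.isUnit_iff_isUnit_det A).1 hA.isUnit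
    simp only [Matrix.toLpLin_apply, Matrix.mulVec_mulVec, Matrix.mul_nonsing_inv _ this,
      Matrix.one_mulVec]
    
  have := sq_inner_mulVec_le hA (Matrix.toEuclideanLin A⁻¹ (EuclideanSpace.single i (1 : ℝ))) x
  rw [inner_mulVec_comm hA, hinv, real_inner_comm _ (Matrix.toEuclideanLin A⁻¹ _),
    inner_single_mulVec_single, EuclideanSpace.inner_single_right] at this
  simpa using this

theorem abs_inner_mulVec_le (B : Matrix (Fin d) (Fin d) ℝ) (x y : E d) :
    |inner ℝ x (Matrix.toEuclideanLin B y)| ≤ (∑ i, ∑ j, |B i j|) * (‖x‖ * ‖y‖) := by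
  have h : inner ℝ x (Matrix.toEuclideanLin B y) = ∑ i, ∑ j, x i * (B i j * y j) := by
    simp [PiLp.inner_apply, Matrix.toLpLin_apply, Matrix.mulVec, dotProduct, Finset.mul_sum,
      mul_comm]
  rw [h, Finset.sum_mul]
  refine (Finset.abs_sum_le_sum_abs _ _).trans (Finset.sum_le_sum fun i _ => ?_)
  rw [Finset.sum_mul]
  refine (Finset.abs_sum_le_sum_abs _ _).trans (Finset.sum_le_sum fun j _ => ?_)
  have h1 : |x i| ≤ ‖x‖ := by simpa using PiLp.norm_apply_le x i
  have h2 : |y j| ≤ ‖y‖ := by simpa using PiLp.norm_apply_le y j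
  rw [abs_mul, abs_mul]
  calc |x i| * (|B i j| * |y j|) = |B i j| * (|x i| * |y j|) := by ring
    _ ≤ _ := by gcongr

end Pointwise

section Fields

variable {a : CoeffField d} {U W : Set (E d)} {G K M : E d → E d}

theorem IsCoefficientField.mono (ha : IsCoefficientField a U) (h : W ⊆ U) :
    IsCoefficientField a W where
  posDef := ae_restrict_of_ae_restrict_of_subset h ha.posDef
  integrable i j := (ha.integrable i j).mono_set h
  integrable_inv i j := (ha.integrable_inv i j).mono_set h

/-- Measurable vector fields of finite energy. -/
structure FiniteEnergy (a : CoeffField d) (W : Set (E d)) (G : E d → E d) : Prop where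
  aesm : AEStronglyMeasurable G (volume.restrict W)
  lt_top : energy a W G < ∞

theorem HasGrad.finiteEnergy {u : E d → ℝ} (h : HasGrad a W u G) : FiniteEnergy a W G :=
  ⟨h.aestronglyMeasurable, h.energy_lt_top⟩

theorem FiniteEnergy.mono (h : FiniteEnergy a U G) (hW : W ⊆ U) : FiniteEnergy a W G :=
  ⟨h.aesm.mono_set hW, lt_of_le_of_lt (lintegral_mono_set hW) h.lt_top⟩

theorem flux_add (a : CoeffField d) (G K : E d → E d) :
    flux a (fun x => G x + K x) = fun x => flux a G x + flux a K x := by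
  ext1 x; simp [flux]

theorem flux_smul (a : CoeffField d) (f : E d → ℝ) (G : E d → E d) :
    flux a (fun x => f x • G x) = fun x => f x • flux a G x := by
  ext1 x; simp [flux]

theorem energyDensity_smul (a : CoeffField d) (f : E d → ℝ) (G : E d → E d) (x : E d) :
    energyDensity a (fun x => f x • G x) x = f x ^ 2 * energyDensity a G x := by
  simp only [energyDensity, flux_smul, real_inner_smul_left, real_inner_smul_right]; ring

theorem energyDensity_nonneg (h : (a x).PosDef) : 0 ≤ energyDensity a G x :=
  inner_mulVec_self_nonneg h _

theorem ae_energyDensity_nonneg (ha : IsCoefficientField a W) (G : E d → E d) :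
    ∀ᵐ x ∂(volume.restrict W), 0 ≤ energyDensity a G x :=
  ha.posDef.mono fun _ h => energyDensity_nonneg h

theorem inner_flux_comm (h : (a x).PosDef) (G K : E d → E d) :
    inner ℝ (G x) (flux a K x) = inner ℝ (K x) (flux a G x) :=
  inner_mulVec_comm h _ _

theorem energyDensity_add (h : (a x).PosDef) (G K : E d → E d) :
    energyDensity a (fun x => G x + K x) x =
      energyDensity a G x + 2 * inner ℝ (G x) (flux a K x) + energyDensity a K x := by
  simp only [energyDensity, flux_add, inner_add_left, inner_add_right, inner_flux_comm h K G]; ring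

theorem aestronglyMeasurable_flux (ha : IsCoefficientField a W)
    (h : AEStronglyMeasurable G (volume.restrict W)) :
    AEStronglyMeasurable (flux a G) (volume.restrict W) := by
  have h1 : ∀ i, AEStronglyMeasurable (fun x => ∑ j, a x i j * G x j) (volume.restrict W) := by
    intro i
    refine Finset.aestronglyMeasurable_fun_sum _ fun j _ => ?_
    refine (ha.integrable i j).aestronglyMeasurable.mul ?_
    exact (by fun_prop : Continuous fun y : E d => y j).comp_aestronglyMeasurable h
  have h2 : flux a G = fun x => WithLp.toLp 2 fun i => ∑ j, a x i j * G x j := by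
    ext x i
    simp [flux, Matrix.toLpLin_apply, Matrix.mulVec, dotProduct]
  rw [h2]
  exact (PiLp.continuous_toLp 2 _).comp_aestronglyMeasurable
    ((aemeasurable_pi_lambda _ fun i => (h1 i).aemeasurable).aestronglyMeasurable)

theorem aestronglyMeasurable_inner_flux (ha : IsCoefficientField a W)
    (hG : AEStronglyMeasurable G (volume.restrict W))
    (hK : AEStronglyMeasurable K (volume.restrict W)) :
    AEStronglyMeasurable (fun x => inner ℝ (G x) (flux a K x)) (volume.restrict W) :=
  hG.inner (aestronglyMeasurable_flux ha hK)

theorem FiniteEnergy.integrable (ha : IsCoefficientField a W) (h : FiniteEnergy a W G) :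
    IntegrableOn (energyDensity a G) W := by
  refine ⟨aestronglyMeasurable_inner_flux ha h.aesm h.aesm, ?_⟩
  rw [hasFiniteIntegral_iff_ofReal (ae_energyDensity_nonneg ha G)]
  exact h.lt_top

theorem finiteEnergy_iff_integrable (ha : IsCoefficientField a W)
    (h : AEStronglyMeasurable G (volume.restrict W)) :
    FiniteEnergy a W G ↔ IntegrableOn (energyDensity a G) W :=
  ⟨fun h => h.integrable ha, fun hi => ⟨h, by
    have := hi.2
    rwa [hasFiniteIntegral_iff_ofReal (ae_energyDensity_nonneg ha G)] at this⟩⟩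

theorem FiniteEnergy.integrable_inner (ha : IsCoefficientField a W) (h : FiniteEnergy a W G)
    (hK : FiniteEnergy a W K) : IntegrableOn (fun x => inner ℝ (G x) (flux a K x)) W := by
  refine ((h.integrable ha).add (hK.integrable ha)).mono'
    (aestronglyMeasurable_inner_flux ha h.aesm hK.aesm) ?_
  filter_upwards [ha.posDef] with x hx
  have h1 : 0 ≤ energyDensity a G x := energyDensity_nonneg hx
  have h2 : 0 ≤ energyDensity a K x := energyDensity_nonneg hx
  have h3 : inner ℝ (G x) (flux a K x) ^ 2 ≤ energyDensity a G x * energyDensity a K x :=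
    sq_inner_mulVec_le hx _ _
  rw [Real.norm_eq_abs, Pi.add_apply]
  exact abs_le_of_sq_le_sq (by nlinarith) (by positivity)

theorem FiniteEnergy.add (ha : IsCoefficientField a W) (h : FiniteEnergy a W G)
    (hK : FiniteEnergy a W K) : FiniteEnergy a W fun x => G x + K x := by
  refine (finiteEnergy_iff_integrable ha (h.aesm.add hK.aesm)).2 ?_
  refine (((h.integrable ha).add ((h.integrable_inner ha hK).const_mul 2)).add
    (hK.integrable ha)).congr ?_
  filter_upwards [ha.posDef] with x hx
  exact (energyDensity_add hx G K).symm

theorem FiniteEnergy.bdd_smul (ha : IsCoefficientField a W) {f : E d → ℝ} {C : ℝ}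
    (hf : AEStronglyMeasurable f (volume.restrict W)) (hC : ∀ᵐ x ∂(volume.restrict W), |f x| ≤ C)
    (h : FiniteEnergy a W G) : FiniteEnergy a W fun x => f x • G x := by
  refine (finiteEnergy_iff_integrable ha (hf.smul h.aesm)).2 ?_
  refine ((h.integrable ha).const_mul (C ^ 2)).mono'
    (aestronglyMeasurable_inner_flux ha (hf.smul h.aesm) (hf.smul h.aesm)) ?_
  filter_upwards [ha.posDef, hC] with x hx hc
  rw [show energyDensity a (f • G) x = _ from energyDensity_smul a f G x, norm_mul, Real.norm_eq_abs, Real.norm_eq_abs,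
    abs_of_nonneg (energyDensity_nonneg hx), abs_pow]
  have := energyDensity_nonneg (G := G) hx
  gcongr

theorem FiniteEnergy.const_smul (ha : IsCoefficientField a W) (c : ℝ)
    (h : FiniteEnergy a W G) : FiniteEnergy a W fun x => c • G x :=
  h.bdd_smul ha aestronglyMeasurable_const (C := |c|) (Eventually.of_forall fun _ => le_rfl)

theorem FiniteEnergy.sub (ha : IsCoefficientField a W) (h : FiniteEnergy a W G)
    (hK : FiniteEnergy a W K) : FiniteEnergy a W fun x => G x - K x := by
  have := h.add ha (hK.const_smul ha (-1))
  simpa [sub_eq_add_neg] using this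

theorem FiniteEnergy.of_bounded (ha : IsCoefficientField a W) {C : ℝ}
    (hG : AEStronglyMeasurable G (volume.restrict W))
    (hC : ∀ᵐ x ∂(volume.restrict W), ‖G x‖ ≤ C) : FiniteEnergy a W G := by
  rw [finiteEnergy_iff_integrable ha hG]
  have h1 : IntegrableOn (fun x => (∑ i, ∑ j, |a x i j|) * (C * C)) W :=
    (integrable_finsetSum _ fun i _ => integrable_finsetSum _ fun j _ =>
      (ha.integrable i j).abs).mul_const _
  refine h1.mono' (aestronglyMeasurable_inner_flux ha hG hG) ?_
  filter_upwards [hC] with x hx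
  refine (abs_inner_mulVec_le _ _ _).trans ?_
  have := (norm_nonneg _).trans hx
  gcongr

theorem FiniteEnergy.congr (h : FiniteEnergy a W G) (hK : G =ᵐ[volume.restrict W] K) :
    FiniteEnergy a W K := by
  refine ⟨h.aesm.congr hK, ?_⟩
  have : energy a W K = energy a W G := by
    refine lintegral_congr_ae ?_
    filter_upwards [hK] with x hx
    simp [energyDensity, flux, hx]
  rw [this]; exact h.lt_top

/-- The bilinear form `∫_W G ⬝ a K`. -/
def bil (a : CoeffField d) (W : Set (E d)) (G K : E d → E d) : ℝ :=
  ∫ x in W, inner ℝ (G x) (flux a K x)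

theorem bil_comm (ha : IsCoefficientField a W) (G K : E d → E d) : bil a W G K = bil a W K G :=
  integral_congr_ae (ha.posDef.mono fun _ hx => inner_flux_comm hx G K)

theorem bil_self (a : CoeffField d) (W : Set (E d)) (G : E d → E d) :
    bil a W G G = ∫ x in W, energyDensity a G x := rfl

theorem bil_self_nonneg (ha : IsCoefficientField a W) (G : E d → E d) : 0 ≤ bil a W G G :=
  integral_nonneg_of_ae (ae_energyDensity_nonneg ha G)

theorem energy_eq_ofReal (ha : IsCoefficientField a W) (h : FiniteEnergy a W G) :
    energy a W G = ENNReal.ofReal (bil a W G G) :=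
  (ofReal_integral_eq_lintegral_ofReal (h.integrable ha) (ae_energyDensity_nonneg ha G)).symm

theorem bil_self_mono (ha : IsCoefficientField a U) (h : FiniteEnergy a U G) (hW : W ⊆ U) :
    bil a W G G ≤ bil a U G G :=
  setIntegral_mono_set (h.integrable ha) (ae_energyDensity_nonneg ha G) hW.eventuallyLE

theorem bil_congr (hG : G =ᵐ[volume.restrict W] G') (hK : K =ᵐ[volume.restrict W] K') :
    bil a W G K = bil a W G' K' := by
  refine integral_congr_ae ?_
  filter_upwards [hG, hK] with x h1 h2
  simp [flux, h1, h2]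

theorem bil_add_left (ha : IsCoefficientField a W) (hG : FiniteEnergy a W G)
    (hK : FiniteEnergy a W K) (hM : FiniteEnergy a W M) :
    bil a W (fun x => G x + K x) M = bil a W G M + bil a W K M := by
  rw [bil, bil, bil, ← integral_add (hG.integrable_inner ha hM) (hK.integrable_inner ha hM)]
  simp only [inner_add_left]

theorem bil_sub_left (ha : IsCoefficientField a W) (hG : FiniteEnergy a W G)
    (hK : FiniteEnergy a W K) (hM : FiniteEnergy a W M) :
    bil a W (fun x => G x - K x) M = bil a W G M - bil a W K M := by
  rw [bil, bil, bil, ← integral_sub (hG.integrable_inner ha hM) (hK.integrable_inner ha hM)]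
  simp only [inner_sub_left]

theorem bil_smul_left (a : CoeffField d) (W : Set (E d)) (c : ℝ) (G K : E d → E d) :
    bil a W (fun x => c • G x) K = c * bil a W G K := by
  rw [bil, bil, ← integral_const_mul]
  simp only [real_inner_smul_left]

theorem bil_add_right (ha : IsCoefficientField a W) (hG : FiniteEnergy a W G)
    (hK : FiniteEnergy a W K) (hM : FiniteEnergy a W M) :
    bil a W M (fun x => G x + K x) = bil a W M G + bil a W M K := by
  rw [bil_comm ha, bil_add_left ha hG hK hM, bil_comm ha G, bil_comm ha K]

theorem bil_sub_right (ha : IsCoefficientField a W) (hG : FiniteEnergy a W G)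
    (hK : FiniteEnergy a W K) (hM : FiniteEnergy a W M) :
    bil a W M (fun x => G x - K x) = bil a W M G - bil a W M K := by
  rw [bil_comm ha, bil_sub_left ha hG hK hM, bil_comm ha G, bil_comm ha K]

theorem bil_smul_right (ha : IsCoefficientField a W) (c : ℝ) (G K : E d → E d) :
    bil a W K (fun x => c • G x) = c * bil a W K G := by
  rw [bil_comm ha, bil_smul_left, bil_comm ha]

theorem sq_bil_le (ha : IsCoefficientField a W) (hG : FiniteEnergy a W G)
    (hK : FiniteEnergy a W K) : bil a W G K ^ 2 ≤ bil a W G G * bil a W K K := by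
  have h2 : ∀ t : ℝ, 0 ≤ bil a W K K * (t * t) + 2 * bil a W G K * t + bil a W G G := by
    intro t
    have h0 := bil_self_nonneg ha (fun x => G x + t • K x)
    have h3 := hK.const_smul ha t
    rw [bil_add_left ha hG h3 (hG.add ha h3), bil_add_right ha hG h3 hG,
      bil_add_right ha hG h3 h3, bil_smul_left, bil_smul_left, bil_smul_right ha,
      bil_smul_right ha, bil_comm ha K G] at h0
    linarith
  have := discrim_le_zero h2
  rw [discrim] at this
  nlinarith

theorem abs_bil_le (ha : IsCoefficientField a W) (hG : FiniteEnergy a W G)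
    (hK : FiniteEnergy a W K) : |bil a W G K| ≤ √(bil a W G G) * √(bil a W K K) := by
  rw [← Real.sqrt_mul (bil_self_nonneg ha G)]
  exact Real.abs_le_sqrt (sq_bil_le ha hG hK)

theorem sqrt_bil_add_le (ha : IsCoefficientField a W) (hG : FiniteEnergy a W G)
    (hK : FiniteEnergy a W K) :
    √(bil a W (fun x => G x + K x) (fun x => G x + K x)) ≤ √(bil a W G G) + √(bil a W K K) := by
  refine Real.sqrt_le_iff.2 ⟨by positivity, ?_⟩
  rw [bil_add_left ha hG hK (hG.add ha hK), bil_add_right ha hG hK hG, bil_add_right ha hG hK hK,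
    bil_comm ha K G, add_sq, Real.sq_sqrt (bil_self_nonneg ha G), Real.sq_sqrt (bil_self_nonneg ha K)]
  have := (le_abs_self _).trans (abs_bil_le ha hG hK)
  linarith

/-- The hypothesis gives `2t‖f‖ ≤ t² p + q` for every `t > 0`. Integrating, the discriminant of the
resulting quadratic polynomial is nonpositive. -/
theorem integrable_of_sq_le_mul {α F : Type*} [MeasurableSpace α] {μ : Measure α}
    [NormedAddCommGroup F] {f : α → F} {p q : α → ℝ} (hf : AEStronglyMeasurable f μ)
    (hp : Integrable p μ) (hq : Integrable q μ) (hp0 : 0 ≤ᵐ[μ] p) (hq0 : 0 ≤ᵐ[μ] q)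
    (h : ∀ᵐ x ∂μ, ‖f x‖ ^ 2 ≤ p x * q x) :
    Integrable f μ ∧ (∫ x, ‖f x‖ ∂μ) ^ 2 ≤ (∫ x, p x ∂μ) * ∫ x, q x ∂μ := by
  have hi : Integrable f μ := by
    refine (hp.add hq).mono' hf ?_
    filter_upwards [hp0, hq0, h] with x h1 h2 h3
    simp only [Pi.zero_apply, Pi.add_apply] at *
    refine abs_le_of_sq_le_sq' ?_ (by positivity) |>.2
    nlinarith
  refine ⟨hi, ?_⟩
  have h2 : ∀ t : ℝ, 0 < t → 2 * t * (∫ x, ‖f x‖ ∂μ) ≤ t ^ 2 * (∫ x, p x ∂μ) + ∫ x, q x ∂μ := by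
    intro t ht
    rw [← integral_const_mul, ← integral_const_mul, ← integral_add (hp.const_mul _) hq]
    refine integral_mono_ae (hi.norm.const_mul _) ((hp.const_mul _).add hq) ?_
    filter_upwards [hp0, hq0, h] with x h1 h2 h3
    simp only [Pi.zero_apply] at *
    refine abs_le_of_sq_le_sq' ?_ (by positivity) |>.2
    nlinarith [sq_nonneg (t ^ 2 * p x - q x), mul_le_mul_of_nonneg_left h3 (sq_nonneg t)]
  have h0 : 0 ≤ ∫ x, ‖f x‖ ∂μ := integral_nonneg fun _ => norm_nonneg _
  have h3 : ∀ t : ℝ, 0 ≤ (∫ x, p x ∂μ) * (t * t) + (-2 * ∫ x, ‖f x‖ ∂μ) * t + ∫ x, q x ∂μ := by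
    intro t
    rcases lt_or_ge 0 t with ht | ht
    · have := h2 t ht; nlinarith
    · have h4 := integral_nonneg_of_ae hp0
      have h5 := integral_nonneg_of_ae hq0
      nlinarith [mul_nonneg h4 (mul_self_nonneg t), mul_nonneg h0 (neg_nonneg.2 ht)]
  have := discrim_le_zero h3
  rw [discrim] at this
  nlinarith

/-- `∫_W tr a⁻¹`. -/
def traceInv (a : CoeffField d) (W : Set (E d)) : ℝ := ∫ x in W, ∑ i, (a x)⁻¹ i i

/-- `∫_W tr a`. -/
def traceInt (a : CoeffField d) (W : Set (E d)) : ℝ := ∫ x in W, ∑ i, (a x) i i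

theorem FiniteEnergy.integrable_self_and (ha : IsCoefficientField a W) (h : FiniteEnergy a W G) :
    IntegrableOn G W ∧ (∫ x in W, ‖G x‖) ^ 2 ≤ traceInv a W * bil a W G G := by
  refine integrable_of_sq_le_mul h.aesm (integrable_finsetSum _ fun i _ => ha.integrable_inv i i)
    (h.integrable ha) ?_ (ae_energyDensity_nonneg ha G) ?_
  · filter_upwards [ha.posDef] with x hx
    exact Finset.sum_nonneg fun i _ => hx.inv.posSemidef.diag_nonneg
  · filter_upwards [ha.posDef] with x hx
    exact sq_norm_le_mulVec hx _

theorem FiniteEnergy.integrable_flux_and (ha : IsCoefficientField a W) (h : FiniteEnergy a W G) :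
    IntegrableOn (flux a G) W ∧ (∫ x in W, ‖flux a G x‖) ^ 2 ≤ traceInt a W * bil a W G G := by
  refine integrable_of_sq_le_mul (aestronglyMeasurable_flux ha h.aesm)
    (integrable_finsetSum _ fun i _ => ha.integrable i i)
    (h.integrable ha) ?_ (ae_energyDensity_nonneg ha G) ?_
  · filter_upwards [ha.posDef] with x hx
    exact Finset.sum_nonneg fun i _ => hx.posSemidef.diag_nonneg
  · filter_upwards [ha.posDef] with x hx
    exact sq_norm_mulVec_le hx _

theorem FiniteEnergy.integrable_self (ha : IsCoefficientField a W) (h : FiniteEnergy a W G) :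
    IntegrableOn G W := (h.integrable_self_and ha).1

theorem FiniteEnergy.integrable_flux (ha : IsCoefficientField a W) (h : FiniteEnergy a W G) :
    IntegrableOn (flux a G) W := (h.integrable_flux_and ha).1

theorem FiniteEnergy.integral_norm_le (ha : IsCoefficientField a W) (h : FiniteEnergy a W G) :
    ∫ x in W, ‖G x‖ ≤ √(traceInv a W * bil a W G G) :=
  Real.le_sqrt_of_sq_le (h.integrable_self_and ha).2

theorem ae_eq_zero_of_bil_self_eq_zero (ha : IsCoefficientField a W) (h : FiniteEnergy a W G)
    (h0 : bil a W G G = 0) : G =ᵐ[volume.restrict W] 0 := by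
  have h1 := (integral_eq_zero_iff_of_nonneg_ae (ae_energyDensity_nonneg ha G)
    (h.integrable ha)).1 h0
  filter_upwards [h1, ha.posDef] with x hx hp
  have h2 := sq_norm_le_mulVec hp (G x)
  have h3 : inner ℝ (G x) (Matrix.toEuclideanLin (a x) (G x)) = 0 := hx
  rw [h3, mul_zero] at h2
  have : ‖G x‖ = 0 := by nlinarith [norm_nonneg (G x)]
  simpa using this

end Fields

end CoarseGrained

end

/-! ### Gradients, test functions and convergence in energy -/

noncomputable section
namespace CoarseGrained

variable {d : ℕ}

section Gradient

theorem gradient_mul {f g : E d → ℝ} {x : E d} (hf : DifferentiableAt ℝ f x)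
    (hg : DifferentiableAt ℝ g x) :
    gradient (fun y => f y * g y) x = f x • gradient g x + g x • gradient f x := by
  refine ext_inner_right ℝ fun v => ?_
  rw [inner_add_left, real_inner_smul_left, real_inner_smul_left, inner_gradient_left,
    inner_gradient_left, inner_gradient_left, fderiv_fun_mul hf hg]
  simp

theorem gradient_add {f g : E d → ℝ} {x : E d} (hf : DifferentiableAt ℝ f x)
    (hg : DifferentiableAt ℝ g x) :
    gradient (fun y => f y + g y) x = gradient f x + gradient g x := by
  refine ext_inner_right ℝ fun v => ?_
  rw [inner_add_left, inner_gradient_left, inner_gradient_left, inner_gradient_left,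
    fderiv_fun_add hf hg]
  simp

theorem gradient_sub {f g : E d → ℝ} {x : E d} (hf : DifferentiableAt ℝ f x)
    (hg : DifferentiableAt ℝ g x) :
    gradient (fun y => f y - g y) x = gradient f x - gradient g x := by
  refine ext_inner_right ℝ fun v => ?_
  rw [inner_sub_left, inner_gradient_left, inner_gradient_left, inner_gradient_left,
    fderiv_fun_sub hf hg]
  simp

theorem gradient_const_mul {f : E d → ℝ} {x : E d} (c : ℝ) (hf : DifferentiableAt ℝ f x) :
    gradient (fun y => c * f y) x = c • gradient f x := by
  refine ext_inner_right ℝ fun v => ?_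
  rw [real_inner_smul_left, inner_gradient_left, inner_gradient_left, fderiv_const_mul hf]
  simp

theorem gradient_comp {S : ℝ → ℝ} {f : E d → ℝ} {x : E d} (hS : DifferentiableAt ℝ S (f x))
    (hf : DifferentiableAt ℝ f x) :
    gradient (fun y => S (f y)) x = deriv S (f x) • gradient f x := by
  refine ext_inner_right ℝ fun v => ?_
  rw [real_inner_smul_left, inner_gradient_left, inner_gradient_left]
  have := (hS.hasDerivAt.comp_hasFDerivAt x hf.hasFDerivAt).fderiv
  rw [show (fun y => S (f y)) = S ∘ f from rfl, this]
  simp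

theorem gradient_const (c : ℝ) (x : E d) : gradient (fun _ : E d => c) x = 0 := by
  refine ext_inner_right ℝ fun v => ?_
  rw [inner_gradient_left]
  simp

theorem norm_gradient (f : E d → ℝ) (x : E d) : ‖gradient f x‖ = ‖fderiv ℝ f x‖ := by
  rw [gradient, LinearIsometryEquiv.norm_map]

theorem continuous_gradient {f : E d → ℝ} (hf : ContDiff ℝ 1 f) : Continuous (gradient f) :=
  (LinearIsometryEquiv.continuous _).comp (hf.continuous_fderiv one_ne_zero)

theorem continuousOn_gradient {f : E d → ℝ} {W : Set (E d)} (hW : IsOpen W)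
    (hf : ContDiffOn ℝ 1 f W) : ContinuousOn (gradient f) W :=
  (LinearIsometryEquiv.continuous _).comp_continuousOn (hf.continuousOn_fderiv_of_isOpen hW le_rfl)

theorem gradient_of_notMem_tsupport {f : E d → ℝ} {x : E d} (h : x ∉ tsupport f) :
    gradient f x = 0 := by
  rw [gradient, fderiv_of_notMem_tsupport ℝ h, map_zero]

end Gradient

section Test

variable {W U : Set (E d)} {η ψ φ : E d → ℝ}

theorem IsTest.mono (h : IsTest W η) (hW : W ⊆ U) : IsTest U η :=
  ⟨h.contDiff, h.hasCompactSupport, h.tsupport_subset.trans hW⟩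

theorem IsTest.contDiff_one (h : IsTest W η) : ContDiff ℝ 1 η := h.contDiff.of_le (by simp)

theorem IsTest.differentiable (h : IsTest W η) : Differentiable ℝ η :=
  h.contDiff_one.differentiable (by simp)

theorem IsTest.eq_zero (h : IsTest W η) {x : E d} (hx : x ∉ W) : η x = 0 :=
  image_eq_zero_of_notMem_tsupport fun h' => hx (h.tsupport_subset h')

theorem IsTest.gradient_eq_zero (h : IsTest W η) {x : E d} (hx : x ∉ W) : gradient η x = 0 :=
  gradient_of_notMem_tsupport fun h' => hx (h.tsupport_subset h')

theorem IsTest.exists_bound (h : IsTest W η) :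
    ∃ C, 0 ≤ C ∧ (∀ x, |η x| ≤ C) ∧ ∀ x, ‖gradient η x‖ ≤ C := by
  obtain ⟨C₁, h₁⟩ := h.hasCompactSupport.exists_bound_of_continuous h.contDiff_one.continuous
  obtain ⟨C₂, h₂⟩ := (h.hasCompactSupport.fderiv ℝ).exists_bound_of_continuous
    (h.contDiff_one.continuous_fderiv one_ne_zero)
  refine ⟨max C₁ C₂, ?_, fun x => (h₁ x).trans (le_max_left _ _), fun x => ?_⟩
  · exact (norm_nonneg _).trans ((h₁ 0).trans (le_max_left _ _))
  · rw [norm_gradient]; exact (h₂ x).trans (le_max_right _ _)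

theorem IsTest.mul_contDiffOn (hW : IsOpen W) (h : IsTest W η) (hφ : ContDiffOn ℝ (⊤ : ℕ∞) φ W) :
    IsTest W fun x => η x * φ x where
  contDiff := by
    rw [contDiff_iff_contDiffAt]
    intro x
    by_cases hx : x ∈ W
    · exact h.contDiff.contDiffAt.mul (hφ.contDiffAt (hW.mem_nhds hx))
    · have hx' : x ∉ tsupport η := fun h' => hx (h.tsupport_subset h')
      have h0 : (fun x => η x * φ x) =ᶠ[𝓝 x] fun _ => 0 := by
        filter_upwards [(isClosed_tsupport η).isOpen_compl.mem_nhds hx'] with y hy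
        rw [image_eq_zero_of_notMem_tsupport hy, zero_mul]
      exact contDiffAt_const.congr_of_eventuallyEq h0
  hasCompactSupport := h.hasCompactSupport.mul_right
  tsupport_subset := (tsupport_mul_subset_left).trans h.tsupport_subset

theorem IsTest.add (h : IsTest W η) (h' : IsTest W ψ) : IsTest W fun x => η x + ψ x where
  contDiff := h.contDiff.add h'.contDiff
  hasCompactSupport := h.hasCompactSupport.add h'.hasCompactSupport
  tsupport_subset := (tsupport_add η ψ).trans (union_subset h.tsupport_subset h'.tsupport_subset)

theorem IsTest.const_mul (h : IsTest W η) (c : ℝ) : IsTest W fun x => c * η x where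
  contDiff := contDiff_const.mul h.contDiff
  hasCompactSupport := h.hasCompactSupport.mul_left
  tsupport_subset := (tsupport_mul_subset_right).trans h.tsupport_subset

theorem IsTest.integral_fderiv_eq_zero (h : IsTest W η) (v : E d) :
    ∫ x, fderiv ℝ η x v = 0 := by
  have h1 : Integrable fun x => fderiv ℝ η x v :=
    Continuous.integrable_of_hasCompactSupport
      ((h.contDiff_one.continuous_fderiv one_ne_zero).clm_apply continuous_const)
      (h.hasCompactSupport.fderiv_apply ℝ v)
  have := integral_mul_fderiv_eq_neg_fderiv_mul_of_integrable (f := fun _ => (1 : ℝ)) (g := η)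
    (v := v) (μ := volume) (by simp) (by simpa using h1)
    (by simpa using h.contDiff_one.continuous.integrable_of_hasCompactSupport h.hasCompactSupport)
    (fun x _ => by fun_prop) (fun x _ => h.differentiable x)
  simpa using this

theorem setIntegral_eq_of_test (h : IsTest W η) (f : E d → E d) :
    ∫ x in W, inner ℝ (gradient η x) (f x) = ∫ x, inner ℝ (gradient η x) (f x) :=
  setIntegral_eq_integral_of_forall_compl_eq_zero fun x hx => by
    rw [h.gradient_eq_zero hx, inner_zero_left]

end Test

section Convergence

variable {a : CoeffField d} {U W : Set (E d)} {G K M : E d → E d}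

/-- Convergence of `∫_W ⟪K n, a M⟫` under convergence in energy. -/
theorem tendsto_bil_left (ha : IsCoefficientField a W) {K : ℕ → E d → E d}
    (hK : ∀ n, FiniteEnergy a W (K n)) (hG : FiniteEnergy a W G) (hM : FiniteEnergy a W M)
    (h : Tendsto (fun n => bil a W (fun x => K n x - G x) (fun x => K n x - G x)) atTop (𝓝 0)) :
    Tendsto (fun n => bil a W (K n) M) atTop (𝓝 (bil a W G M)) := by
  rw [tendsto_iff_norm_sub_tendsto_zero]
  have h1 : Tendsto (fun n => √(bil a W (fun x => K n x - G x) (fun x => K n x - G x)) *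
      √(bil a W M M)) atTop (𝓝 0) := by
    simpa using (h.sqrt).mul_const (√(bil a W M M))
  refine squeeze_zero (fun _ => norm_nonneg _) (fun n => ?_) h1
  rw [← bil_sub_left ha (hK n) hG hM, Real.norm_eq_abs]
  exact abs_bil_le ha ((hK n).sub ha hG) hM

theorem tendsto_integral_norm_sub (ha : IsCoefficientField a W) {K : ℕ → E d → E d}
    (hK : ∀ n, FiniteEnergy a W (K n)) (hG : FiniteEnergy a W G)
    (h : Tendsto (fun n => bil a W (fun x => K n x - G x) (fun x => K n x - G x)) atTop (𝓝 0)) :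
    Tendsto (fun n => ∫ x in W, ‖K n x - G x‖) atTop (𝓝 0) := by
  have h1 : Tendsto (fun n => √(traceInv a W *
      bil a W (fun x => K n x - G x) (fun x => K n x - G x))) atTop (𝓝 0) := by
    simpa using (h.const_mul (traceInv a W)).sqrt
  exact squeeze_zero (fun _ => integral_nonneg fun _ => norm_nonneg _)
    (fun n => ((hK n).sub ha hG).integral_norm_le ha) h1

theorem tendsto_eLpNorm_of_tendsto_integral {α F : Type*} [MeasurableSpace α] {μ : Measure α}
    [NormedAddCommGroup F] {K : ℕ → α → F} {G : α → F} (hK : ∀ n, Integrable (K n) μ)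
    (hG : Integrable G μ) (h : Tendsto (fun n => ∫ x, ‖K n x - G x‖ ∂μ) atTop (𝓝 0)) :
    Tendsto (fun n => eLpNorm (K n - G) 1 μ) atTop (𝓝 0) := by
  have : ∀ n, eLpNorm (K n - G) 1 μ = ENNReal.ofReal (∫ x, ‖K n x - G x‖ ∂μ) := fun n => by
    rw [eLpNorm_one_eq_lintegral_enorm]
    exact (ofReal_integral_norm_eq_lintegral_enorm ((hK n).sub hG)).symm
  simp_rw [this]
  have := (ENNReal.continuous_ofReal.tendsto 0).comp h
  rwa [ENNReal.ofReal_zero] at this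

theorem exists_subseq_tendsto_ae {α F : Type*} [MeasurableSpace α] {μ : Measure α}
    [NormedAddCommGroup F] {p : ℝ≥0∞} (hp : p ≠ 0) {K : ℕ → α → F} {G : α → F}
    (hK : ∀ n, AEStronglyMeasurable (K n) μ) (hG : AEStronglyMeasurable G μ)
    (h : Tendsto (fun n => eLpNorm (K n - G) p μ) atTop (𝓝 0)) :
    ∃ ns : ℕ → ℕ, StrictMono ns ∧ ∀ᵐ x ∂μ, Tendsto (fun i => K (ns i) x) atTop (𝓝 (G x)) :=
  (tendstoInMeasure_of_tendsto_eLpNorm hp hK hG h).exists_seq_tendsto_ae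

/-- Smooth approximations in `H¹_a(W)`, converging almost everywhere. -/
structure Approximates (a : CoeffField d) (W : Set (E d)) (φ : ℕ → E d → ℝ) (u : E d → ℝ)
    (G : E d → E d) : Prop where
  contDiffOn : ∀ n, ContDiffOn ℝ (⊤ : ℕ∞) (φ n) W
  memLp : ∀ n, MemLp (φ n) 2 (volume.restrict W)
  finiteEnergy : ∀ n, FiniteEnergy a W (gradient (φ n))
  tendsto_eLpNorm : Tendsto (fun n => eLpNorm (fun x => φ n x - u x) 2 (volume.restrict W))
    atTop (𝓝 0)
  tendsto_bil : Tendsto (fun n => bil a W (fun x => gradient (φ n) x - G x)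
    (fun x => gradient (φ n) x - G x)) atTop (𝓝 0)
  ae_tendsto : ∀ᵐ x ∂(volume.restrict W), Tendsto (fun n => φ n x) atTop (𝓝 (u x))
  ae_tendsto_gradient : ∀ᵐ x ∂(volume.restrict W),
    Tendsto (fun n => gradient (φ n) x) atTop (𝓝 (G x))

/-- Convergence in energy implies convergence of the gradients in `L¹`, because `a⁻¹` is integrable;
two successive subsequences then converge almost everywhere. The first terms, which may have
infinite norm, are dropped by the shift by `N`. -/
theorem HasGrad.exists_approximates (hW : IsOpen W) (ha : IsCoefficientField a W) {u : E d → ℝ}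
    (hu : HasGrad a W u G) : ∃ φ, Approximates a W φ u G := by
  obtain ⟨φ, h1, h2, h3⟩ := hu.approx
  have hm : ∀ n, AEStronglyMeasurable (gradient (φ n)) (volume.restrict W) := fun n =>
    (continuousOn_gradient hW ((h1 n).of_le (by simp))).aestronglyMeasurable hW.measurableSet
  have hm' : ∀ n, AEStronglyMeasurable (φ n) (volume.restrict W) := fun n =>
    (h1 n).continuousOn.aestronglyMeasurable hW.measurableSet
  have ev : ∀ᶠ n in atTop, eLpNorm (fun x => φ n x - u x) 2 (volume.restrict W) < ∞ ∧
      energy a W (fun x => gradient (φ n) x - G x) < ∞ :=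
    (h2.eventually (gt_mem_nhds ENNReal.zero_lt_top)).and
      (h3.eventually (gt_mem_nhds ENNReal.zero_lt_top))
  obtain ⟨N, hN⟩ := eventually_atTop.1 ev
  have hfe : ∀ n, FiniteEnergy a W (gradient (φ (n + N))) := fun n => by
    have : FiniteEnergy a W (fun x => gradient (φ (n + N)) x - G x) :=
      ⟨(hm _).sub hu.aestronglyMeasurable, (hN _ (by omega)).2⟩
    simpa using this.add ha hu.finiteEnergy
  have hlp : ∀ n, MemLp (φ (n + N)) 2 (volume.restrict W) := fun n => by
    have : MemLp (fun x => φ (n + N) x - u x) 2 (volume.restrict W) :=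
      ⟨(hm' _).sub hu.memLp.1, (hN _ (by omega)).1⟩
    have h' := this.add hu.memLp
    refine h'.congr_norm (hm' _) (Eventually.of_forall fun x => by simp)
  have hb : Tendsto (fun n => bil a W (fun x => gradient (φ (n + N)) x - G x)
      (fun x => gradient (φ (n + N)) x - G x)) atTop (𝓝 0) := by
    have h4 := (ENNReal.tendsto_toReal ENNReal.zero_ne_top).comp
      (h3.comp (tendsto_add_atTop_nat N))
    refine h4.congr fun n => ?_
    simp only [Function.comp]
    rw [energy_eq_ofReal ha ((hfe n).sub ha hu.finiteEnergy),
      ENNReal.toReal_ofReal (bil_self_nonneg ha _)]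
  have h2' := h2.comp (tendsto_add_atTop_nat N)
  obtain ⟨ns, hns, hae⟩ := exists_subseq_tendsto_ae (p := 2) (by simp)
    (fun n => (hlp n).1) hu.memLp.1 h2'
  have hL1 := tendsto_eLpNorm_of_tendsto_integral (fun n => (hfe n).integrable_self ha)
    (hu.finiteEnergy.integrable_self ha) (tendsto_integral_norm_sub ha hfe hu.finiteEnergy hb)
  obtain ⟨ms, hms, hae'⟩ := exists_subseq_tendsto_ae (p := 1) (by simp)
    (fun n => (hfe (ns n)).aesm) hu.aestronglyMeasurable (hL1.comp hns.tendsto_atTop)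
  refine ⟨fun n => φ (ns (ms n) + N), fun n => h1 _, fun n => hlp _, fun n => hfe _,
    h2'.comp (hns.comp hms).tendsto_atTop, hb.comp (hns.comp hms).tendsto_atTop, ?_, hae'⟩
  filter_upwards [hae] with x hx using hx.comp hms.tendsto_atTop

theorem Approximates.hasGrad (ha : IsCoefficientField a W) {u : E d → ℝ} {φ : ℕ → E d → ℝ}
    (h : Approximates a W φ u G) (hu : MemLp u 2 (volume.restrict W)) (hG : FiniteEnergy a W G) :
    HasGrad a W u G where
  memLp := hu
  aestronglyMeasurable := hG.aesm
  energy_lt_top := hG.lt_top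
  approx := by
    refine ⟨φ, h.contDiffOn, h.tendsto_eLpNorm, ?_⟩
    have := (ENNReal.continuous_ofReal.tendsto 0).comp h.tendsto_bil
    rw [ENNReal.ofReal_zero] at this
    refine this.congr fun n => ?_
    exact (energy_eq_ofReal ha ((h.finiteEnergy n).sub ha hG)).symm

/-- A version of `HasGrad` with data in `ℝ`. -/
theorem HasGrad.of_tendsto (ha : IsCoefficientField a W) {u : E d → ℝ} {φ : ℕ → E d → ℝ}
    (hu : MemLp u 2 (volume.restrict W)) (hG : FiniteEnergy a W G)
    (h1 : ∀ n, ContDiffOn ℝ (⊤ : ℕ∞) (φ n) W)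
    (hfe : ∀ n, FiniteEnergy a W (gradient (φ n)))
    (h2 : Tendsto (fun n => eLpNorm (fun x => φ n x - u x) 2 (volume.restrict W)) atTop (𝓝 0))
    (h3 : Tendsto (fun n => bil a W (fun x => gradient (φ n) x - G x)
      (fun x => gradient (φ n) x - G x)) atTop (𝓝 0)) : HasGrad a W u G where
  memLp := hu
  aestronglyMeasurable := hG.aesm
  energy_lt_top := hG.lt_top
  approx := by
    refine ⟨φ, h1, h2, ?_⟩
    have := (ENNReal.continuous_ofReal.tendsto 0).comp h3
    rw [ENNReal.ofReal_zero] at this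
    refine this.congr fun n => ?_
    exact (energy_eq_ofReal ha ((hfe n).sub ha hG)).symm

end Convergence

end CoarseGrained

end

/-! ### Weak gradients, the chain rule and testing with functions of a solution -/

noncomputable section
namespace CoarseGrained

variable {d : ℕ} {a : CoeffField d} {U W : Set (E d)} {G K M : E d → E d} {u v : E d → ℝ}

section WeakGradient

theorem setIntegral_mul_fderiv_of_smooth {φ ψ : E d → ℝ} (hW : IsOpen W)
    (hφ : ContDiffOn ℝ (⊤ : ℕ∞) φ W) (hψ : IsTest W ψ) (e : E d) :
    ∫ x in W, φ x * fderiv ℝ ψ x e = -∫ x in W, inner ℝ (gradient φ x) e * ψ x := by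
  have hp := hψ.mul_contDiffOn hW hφ
  have h0 := hp.integral_fderiv_eq_zero e
  have hdiff : ∀ x ∈ W, DifferentiableAt ℝ φ x := fun x hx =>
    ((hφ.contDiffAt (hW.mem_nhds hx)).differentiableAt (by simp))
  have h1 : ∀ x, fderiv ℝ (fun x => ψ x * φ x) x e =
      W.indicator (fun x => φ x * fderiv ℝ ψ x e + inner ℝ (gradient φ x) e * ψ x) x := by
    intro x
    by_cases hx : x ∈ W
    · rw [indicator_of_mem hx, fderiv_fun_mul (hψ.differentiable x) (hdiff x hx),
        inner_gradient_left]
      simp; ring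
    · rw [indicator_of_notMem hx, ← inner_gradient_left, hp.gradient_eq_zero hx, inner_zero_left]
  simp_rw [h1] at h0
  rw [integral_indicator hW.measurableSet] at h0
  have hc1 : Continuous fun x => W.indicator (fun x => φ x * fderiv ℝ ψ x e) x := by
    have : IsTest W fun x => fderiv ℝ ψ x e :=
      ⟨(hψ.contDiff.fderiv_right (m := (⊤ : ℕ∞)) (by simp)).clm_apply contDiff_const,
        hψ.hasCompactSupport.fderiv_apply ℝ e,
        (tsupport_fderiv_apply_subset ℝ e).trans hψ.tsupport_subset⟩
    have h2 := (this.mul_contDiffOn hW hφ)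
    refine h2.contDiff.continuous.congr fun x => ?_
    by_cases hx : x ∈ W
    · rw [indicator_of_mem hx, mul_comm]
    · rw [indicator_of_notMem hx, h2.eq_zero hx]
  have hi1 : IntegrableOn (fun x => φ x * fderiv ℝ ψ x e) W := by
    rw [← integrable_indicator_iff hW.measurableSet]
    refine hc1.integrable_of_hasCompactSupport ?_
    refine HasCompactSupport.intro hψ.hasCompactSupport fun x hx => ?_
    by_cases hxW : x ∈ W
    · rw [indicator_of_mem hxW, fderiv_of_notMem_tsupport ℝ hx]; simp
    · rw [indicator_of_notMem hxW]
  have hi2 : IntegrableOn (fun x => φ x * fderiv ℝ ψ x e + inner ℝ (gradient φ x) e * ψ x) W := by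
    rw [← integrable_indicator_iff hW.measurableSet]
    have h3 : (W.indicator fun x => φ x * fderiv ℝ ψ x e + inner ℝ (gradient φ x) e * ψ x) =
        fun x => fderiv ℝ (fun x => ψ x * φ x) x e := by ext x; rw [h1]
    rw [h3]
    exact Continuous.integrable_of_hasCompactSupport
      ((hp.contDiff_one.continuous_fderiv one_ne_zero).clm_apply continuous_const)
      (hp.hasCompactSupport.fderiv_apply ℝ e)
  have hi3 : IntegrableOn (fun x => inner ℝ (gradient φ x) e * ψ x) W := by
    refine (hi2.sub hi1).congr (Eventually.of_forall fun x => ?_)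
    simp
  rw [integral_add hi1 hi3] at h0
  linarith

theorem tendsto_setIntegral_mul_of_bounded {α : Type*} [MeasurableSpace α] {μ : Measure α}
    {f : ℕ → α → ℝ} {g ψ : α → ℝ} {C : ℝ} (hf : ∀ n, Integrable (f n) μ) (hg : Integrable g μ)
    (hψ : AEStronglyMeasurable ψ μ) (hC : ∀ x, |ψ x| ≤ C)
    (h : Tendsto (fun n => eLpNorm (fun x => f n x - g x) 1 μ) atTop (𝓝 0)) :
    Tendsto (fun n => ∫ x, f n x * ψ x ∂μ) atTop (𝓝 (∫ x, g x * ψ x ∂μ)) := by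
  have hfi : ∀ n, Integrable (fun x => f n x * ψ x) μ := fun n =>
    (hf n).mul_bdd (c := C) hψ (Eventually.of_forall fun x => hC x)
  have hgi : Integrable (fun x => g x * ψ x) μ :=
    hg.mul_bdd (c := C) hψ (Eventually.of_forall fun x => hC x)
  refine tendsto_integral_of_L1' _ hgi.1 (Eventually.of_forall hfi) ?_
  have h2 : Tendsto (fun n => ENNReal.ofReal C * eLpNorm (fun x => f n x - g x) 1 μ) atTop
      (𝓝 0) := by
    simpa using ENNReal.Tendsto.const_mul h (Or.inr ENNReal.ofReal_ne_top)
  refine tendsto_of_tendsto_of_tendsto_of_le_of_le tendsto_const_nhds h2 (fun _ => bot_le)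
    fun n => ?_
  refine eLpNorm_le_mul_eLpNorm_of_ae_le_mul (Eventually.of_forall fun x => ?_) 1
  simp only [Pi.sub_apply, ← sub_mul, norm_mul]
  rw [mul_comm]
  gcongr
  exact hC x

theorem tendsto_eLpNorm_one_of_two {α : Type*} [MeasurableSpace α] {μ : Measure α}
    [IsFiniteMeasure μ] {f : ℕ → α → ℝ} (hf : ∀ n, AEStronglyMeasurable (f n) μ)
    (h : Tendsto (fun n => eLpNorm (f n) 2 μ) atTop (𝓝 0)) :
    Tendsto (fun n => eLpNorm (f n) 1 μ) atTop (𝓝 0) := by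
  have h1 : ∀ n, eLpNorm (f n) 1 μ ≤ eLpNorm (f n) 2 μ *
      μ univ ^ (1 / (1 : ℝ≥0∞).toReal - 1 / (2 : ℝ≥0∞).toReal) := fun n =>
    eLpNorm_le_eLpNorm_mul_rpow_measure_univ (by simp) (hf n)
  have h2 := ENNReal.Tendsto.mul_const (b := μ univ ^ (1 / (1 : ℝ≥0∞).toReal -
    1 / (2 : ℝ≥0∞).toReal)) h (Or.inr (ENNReal.rpow_ne_top_of_nonneg (by norm_num)
      (measure_ne_top _ _)))
  rw [zero_mul] at h2
  exact tendsto_of_tendsto_of_tendsto_of_le_of_le tendsto_const_nhds h2 (fun _ => bot_le) h1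

/-- Integration by parts for the smooth approximations passes to the limit: the functions converge
in `L²`, hence in `L¹` on a set of finite measure, and the gradients converge in `L¹` by the
integrability of `a⁻¹`. -/
theorem HasGrad.integral_mul_fderiv (hW : IsOpen W) (hWf : volume W ≠ ∞)
    (ha : IsCoefficientField a W) (hu : HasGrad a W u G) {ψ : E d → ℝ} (hψ : IsTest W ψ)
    (e : E d) :
    ∫ x in W, u x * fderiv ℝ ψ x e = -∫ x in W, inner ℝ (G x) e * ψ x := by
  have : IsFiniteMeasure (volume.restrict W) := ⟨by simpa using hWf.lt_top⟩
  obtain ⟨φ, hφ⟩ := hu.exists_approximates hW ha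
  obtain ⟨C, hC0, hC1, hC2⟩ := hψ.exists_bound
  have hcf : Continuous fun x => fderiv ℝ ψ x e :=
    (hψ.contDiff_one.continuous_fderiv one_ne_zero).clm_apply continuous_const
  have h1 : Tendsto (fun n => ∫ x in W, φ n x * fderiv ℝ ψ x e) atTop
      (𝓝 (∫ x in W, u x * fderiv ℝ ψ x e)) := by
    refine tendsto_setIntegral_mul_of_bounded (C := C * ‖e‖)
      (fun n => (hφ.memLp n).integrable (by simp)) (hu.memLp.integrable (by simp))
      hcf.aestronglyMeasurable (fun x => ?_)
      (tendsto_eLpNorm_one_of_two (fun n => (hφ.memLp n).1.sub hu.memLp.1) hφ.tendsto_eLpNorm)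
    refine ((fderiv ℝ ψ x).le_opNorm e).trans ?_
    rw [← norm_gradient]
    gcongr
    exact hC2 x
  have h2 : Tendsto (fun n => ∫ x in W, inner ℝ (gradient (φ n) x) e * ψ x) atTop
      (𝓝 (∫ x in W, inner ℝ (G x) e * ψ x)) := by
    have hi : ∀ n, IntegrableOn (gradient (φ n)) W := fun n => (hφ.finiteEnergy n).integrable_self ha
    have hG := hu.finiteEnergy.integrable_self ha
    refine tendsto_setIntegral_mul_of_bounded (C := C)
      (fun n => (hi n).inner_const e) (hG.inner_const e)
      hψ.contDiff_one.continuous.aestronglyMeasurable hC1 ?_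
    have h3 := tendsto_eLpNorm_of_tendsto_integral hi hG
      (tendsto_integral_norm_sub ha hφ.finiteEnergy hu.finiteEnergy hφ.tendsto_bil)
    have h4 : Tendsto (fun n => ENNReal.ofReal ‖e‖ *
        eLpNorm (gradient (φ n) - G) 1 (volume.restrict W)) atTop (𝓝 0) := by
      have := ENNReal.Tendsto.const_mul h3 (Or.inr (ENNReal.ofReal_ne_top (r := ‖e‖)))
      rwa [mul_zero] at this
    refine tendsto_of_tendsto_of_tendsto_of_le_of_le tendsto_const_nhds h4 (fun _ => bot_le)
      fun n => ?_
    refine eLpNorm_le_mul_eLpNorm_of_ae_le_mul (Eventually.of_forall fun x => ?_) 1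
    rw [← inner_sub_left, mul_comm]
    exact norm_inner_le_norm _ _
  refine tendsto_nhds_unique h1 ?_
  refine h2.neg.congr fun n => ?_
  rw [setIntegral_mul_fderiv_of_smooth hW (hφ.contDiffOn n) hψ]

theorem ae_eq_zero_of_integral_inner_mul_test (hW : IsOpen W) (hG : IntegrableOn G W)
    (h : ∀ ψ, IsTest W ψ → ∀ e, ∫ x in W, inner ℝ (G x) e * ψ x = 0) :
    G =ᵐ[volume.restrict W] 0 := by
  have h1 : ∀ᵐ x, x ∈ W → G x = 0 := by
    refine hW.ae_eq_zero_of_integral_contDiff_smul_eq_zero hG.locallyIntegrableOn fun ψ h1 h2 h3 => ?_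
    have hψ : IsTest W ψ := ⟨h1, h2, h3⟩
    have h4 : ∫ x, ψ x • G x = ∫ x in W, ψ x • G x :=
      (setIntegral_eq_integral_of_forall_compl_eq_zero fun x hx => by
        rw [hψ.eq_zero hx, zero_smul]).symm
    obtain ⟨C, hC0, hC1, -⟩ := hψ.exists_bound
    have hint : IntegrableOn (fun x => ψ x • G x) W :=
      hG.bdd_smul C hψ.contDiff_one.continuous.aestronglyMeasurable
        (Eventually.of_forall hC1)
    rw [h4]
    refine ext_inner_right ℝ fun e => ?_
    rw [inner_zero_left, real_inner_comm, ← integral_inner hint, ← h ψ hψ e]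
    refine integral_congr_ae (Eventually.of_forall fun x => ?_)
    simp only [real_inner_smul_right, real_inner_comm e (G x)]
    ring
  exact (ae_restrict_iff' hW.measurableSet).2 h1

end WeakGradient

section Algebra

theorem HasGrad.mono (ha : IsCoefficientField a U) (hU : IsOpen U) (hu : HasGrad a U u G)
    (hWU : W ⊆ U) : HasGrad a W u G := by
  obtain ⟨φ, hφ⟩ := hu.exists_approximates hU ha
  refine .of_tendsto (ha.mono hWU) (hu.memLp.mono_measure (Measure.restrict_mono_set _ hWU))
    (hu.finiteEnergy.mono hWU) (fun n => (hφ.contDiffOn n).mono hWU)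
    (fun n => (hφ.finiteEnergy n).mono hWU) ?_ ?_
  · exact tendsto_of_tendsto_of_tendsto_of_le_of_le tendsto_const_nhds hφ.tendsto_eLpNorm
      (fun _ => bot_le) fun n => eLpNorm_mono_measure _ (Measure.restrict_mono_set _ hWU)
  · refine squeeze_zero (fun n => bil_self_nonneg (ha.mono hWU) _) (fun n => ?_) hφ.tendsto_bil
    exact bil_self_mono ha ((hφ.finiteEnergy n).sub ha hu.finiteEnergy) hWU

theorem sqrt_bil_const_smul (ha : IsCoefficientField a W) (c : ℝ) :
    bil a W (fun x => c • G x) (fun x => c • G x) = c ^ 2 * bil a W G G := by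
  rw [bil_smul_left, bil_smul_right ha]; ring

theorem tendsto_bil_add_zero (ha : IsCoefficientField a W) {K L : ℕ → E d → E d}
    (hK : ∀ n, FiniteEnergy a W (K n)) (hL : ∀ n, FiniteEnergy a W (L n))
    (h1 : Tendsto (fun n => bil a W (K n) (K n)) atTop (𝓝 0))
    (h2 : Tendsto (fun n => bil a W (L n) (L n)) atTop (𝓝 0)) :
    Tendsto (fun n => bil a W (fun x => K n x + L n x) (fun x => K n x + L n x)) atTop (𝓝 0) := by
  have h3 := (h1.sqrt.add h2.sqrt).pow 2
  simp only [Real.sqrt_zero, add_zero, ne_eq, OfNat.ofNat_ne_zero, not_false_eq_true,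
    zero_pow] at h3
  refine squeeze_zero (fun n => bil_self_nonneg ha _) (fun n => ?_) h3
  exact (Real.sqrt_le_left (by positivity)).1 (sqrt_bil_add_le ha (hK n) (hL n))

theorem HasGrad.add (hW : IsOpen W) (ha : IsCoefficientField a W) (hu : HasGrad a W u G)
    (hv : HasGrad a W v K) : HasGrad a W (fun x => u x + v x) (fun x => G x + K x) := by
  obtain ⟨φ, hφ⟩ := hu.exists_approximates hW ha
  obtain ⟨χ, hχ⟩ := hv.exists_approximates hW ha
  have hd : ∀ {f : E d → ℝ}, ContDiffOn ℝ (⊤ : ℕ∞) f W → ∀ x ∈ W, DifferentiableAt ℝ f x :=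
    fun h x hx => (h.contDiffAt (hW.mem_nhds hx)).differentiableAt (by simp)
  have hg : ∀ n, gradient (fun x => φ n x + χ n x) =ᵐ[volume.restrict W]
      fun x => gradient (φ n) x + gradient (χ n) x := fun n => by
    filter_upwards [ae_restrict_mem hW.measurableSet] with x hx
    exact gradient_add (hd (hφ.contDiffOn n) x hx) (hd (hχ.contDiffOn n) x hx)
  refine .of_tendsto ha (φ := fun n x => φ n x + χ n x) (hu.memLp.add hv.memLp)
    (hu.finiteEnergy.add ha hv.finiteEnergy)
    (fun n => (hφ.contDiffOn n).add (hχ.contDiffOn n))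
    (fun n => ((hφ.finiteEnergy n).add ha (hχ.finiteEnergy n)).congr (hg n).symm) ?_ ?_
  · have h := hφ.tendsto_eLpNorm.add hχ.tendsto_eLpNorm
    rw [add_zero] at h
    refine tendsto_of_tendsto_of_tendsto_of_le_of_le tendsto_const_nhds h (fun _ => bot_le)
      fun n => ?_
    refine le_trans (le_of_eq ?_) (eLpNorm_add_le ((hφ.memLp n).1.sub hu.memLp.1)
      ((hχ.memLp n).1.sub hv.memLp.1) (by simp))
    refine eLpNorm_congr_ae (Eventually.of_forall fun x => ?_)
    simp only [Pi.add_apply]; ring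
  · refine (tendsto_bil_add_zero ha (fun n => (hφ.finiteEnergy n).sub ha hu.finiteEnergy)
      (fun n => (hχ.finiteEnergy n).sub ha hv.finiteEnergy) hφ.tendsto_bil hχ.tendsto_bil).congr
      fun n => ?_
    have : (fun x => gradient (φ n) x - G x + (gradient (χ n) x - K x)) =ᵐ[volume.restrict W]
        fun x => gradient (fun x => φ n x + χ n x) x - (G x + K x) := by
      filter_upwards [hg n] with x hx
      rw [hx]; abel
    exact bil_congr this this

end Algebra

section Chain

/-- Multiplication by uniformly bounded, almost everywhere convergent factors. -/
theorem tendsto_bil_smul_sub (ha : IsCoefficientField a W) {f : ℕ → E d → ℝ} {g : E d → ℝ}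
    {C : ℝ} (hG : FiniteEnergy a W G)
    (hf : ∀ n, AEStronglyMeasurable (f n) (volume.restrict W))
    (hC : ∀ n, ∀ᵐ x ∂(volume.restrict W), |f n x| ≤ C)
    (h : ∀ᵐ x ∂(volume.restrict W), Tendsto (fun n => f n x) atTop (𝓝 (g x))) :
    Tendsto (fun n => bil a W (fun x => (f n x - g x) • G x) (fun x => (f n x - g x) • G x))
      atTop (𝓝 0) := by
  have hgm : AEStronglyMeasurable g (volume.restrict W) := aestronglyMeasurable_of_tendsto_ae _ hf h
  have hgC : ∀ᵐ x ∂(volume.restrict W), |g x| ≤ C := by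
    filter_upwards [h, ae_all_iff.2 hC] with x hx hc
    exact le_of_tendsto hx.abs (Eventually.of_forall hc)
  have : (0 : ℝ) = ∫ x in W, 0 := by simp
  rw [this]
  refine tendsto_integral_of_dominated_convergence
    (fun x => (C + C) ^ 2 * energyDensity a G x) (fun n => ?_) ((hG.integrable ha).const_mul _)
    (fun n => ?_) ?_
  · exact aestronglyMeasurable_inner_flux ha (((hf n).sub hgm).smul hG.aesm)
      (((hf n).sub hgm).smul hG.aesm)
  · filter_upwards [ha.posDef, hC n, hgC] with x hp h1 h2
    have := energyDensity_smul a (fun x => f n x - g x) G x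
    simp only [energyDensity] at this
    have h0 : 0 ≤ energyDensity a G x := energyDensity_nonneg hp
    rw [this, norm_mul, Real.norm_eq_abs, Real.norm_eq_abs, abs_pow]
    change _ * |energyDensity a G x| ≤ _
    rw [abs_of_nonneg h0]
    gcongr
    exact (abs_sub _ _).trans (add_le_add h1 h2)
  · filter_upwards [h] with x hx
    have := fun n => energyDensity_smul a (fun x => f n x - g x) G x
    simp only [energyDensity] at this
    simp only [this]
    have h2 := ((hx.sub_const (g x)).pow 2).mul_const (inner ℝ (G x) (flux a G x))
    simpa using h2

/-- The approximation in the chain rule. -/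
theorem Approximates.comp (hW : IsOpen W) (hWf : volume W ≠ ∞) (ha : IsCoefficientField a W)
    (hu : HasGrad a W u G) {φ : ℕ → E d → ℝ} (hφ : Approximates a W φ u G) {S : ℝ → ℝ} {C : ℝ}
    (hS : ContDiff ℝ (⊤ : ℕ∞) S) (hC : ∀ t, |deriv S t| ≤ C) :
    Approximates a W (fun n x => S (φ n x)) (fun x => S (u x))
      (fun x => deriv S (u x) • G x) := by
  have : IsFiniteMeasure (volume.restrict W) := ⟨by simpa using hWf.lt_top⟩
  have hd : ∀ n, ∀ x ∈ W, DifferentiableAt ℝ (φ n) x := fun n x hx =>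
    ((hφ.contDiffOn n).contDiffAt (hW.mem_nhds hx)).differentiableAt (by simp)
  have hS1 : Differentiable ℝ S := hS.differentiable (by simp)
  have hcS' : Continuous (deriv S) := hS.continuous_deriv (by simp)
  have hg : ∀ n, ∀ x ∈ W, gradient (fun x => S (φ n x)) x = deriv S (φ n x) • gradient (φ n) x :=
    fun n x hx => gradient_comp (hS1 _) (hd n x hx)
  have hgae : ∀ n, gradient (fun x => S (φ n x)) =ᵐ[volume.restrict W]
      fun x => deriv S (φ n x) • gradient (φ n) x := fun n => by
    filter_upwards [ae_restrict_mem hW.measurableSet] with x hx using hg n x hx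
  have hlip : ∀ s t, |S s - S t| ≤ C * |s - t| := fun s t => by
    have := Convex.norm_image_sub_le_of_norm_deriv_le (f := S) (C := C) (s := univ) (x := t) (y := s)
      (fun x _ => hS1 x) (fun x _ => hC x) convex_univ (mem_univ _) (mem_univ _)
    simpa using this
  have hm : ∀ n, AEStronglyMeasurable (fun x => deriv S (φ n x)) (volume.restrict W) := fun n =>
    hcS'.comp_aestronglyMeasurable (hφ.memLp n).1
  refine ⟨fun n => hS.comp_contDiffOn (hφ.contDiffOn n), fun n => ?_, fun n => ?_, ?_, ?_, ?_, ?_⟩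
  · have h1 : MemLp (fun x => |S 0| + C * |φ n x|) 2 (volume.restrict W) := by
      have h1 : MemLp (fun _ : E d => |S 0|) 2 (volume.restrict W) := memLp_const _
      have h2 : MemLp (fun x => C * |φ n x|) 2 (volume.restrict W) := (hφ.memLp n).norm.const_mul C
      exact h1.add h2
    refine h1.mono' (hS.continuous.comp_aestronglyMeasurable (hφ.memLp n).1)
      (Eventually.of_forall fun x => ?_)
    have h2 := hlip (φ n x) 0
    rw [sub_zero] at h2
    rw [Real.norm_eq_abs]
    have h3 := abs_add_le (S 0) (S (φ n x) - S 0)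
    rw [add_sub_cancel] at h3
    linarith
  · exact ((hφ.finiteEnergy n).bdd_smul ha (hm n) (Eventually.of_forall fun x => hC _)).congr
      (hgae n).symm
  · have h1 : Tendsto (fun n => ENNReal.ofReal C *
        eLpNorm (fun x => φ n x - u x) 2 (volume.restrict W)) atTop (𝓝 0) := by
      simpa using ENNReal.Tendsto.const_mul hφ.tendsto_eLpNorm (Or.inr ENNReal.ofReal_ne_top)
    refine tendsto_of_tendsto_of_tendsto_of_le_of_le tendsto_const_nhds h1 (fun _ => bot_le)
      fun n => ?_
    exact eLpNorm_le_mul_eLpNorm_of_ae_le_mul (Eventually.of_forall fun x => hlip _ _) 2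
  · have hu' := hu.finiteEnergy
    -- The error is split as `S'(φ_n)(∇φ_n - G) + (S'(φ_n) - S'(u)) G`. The first part is controlled
    -- by the bound on `S'`, the second by dominated convergence.
    have h1 : ∀ n, FiniteEnergy a W (fun x => deriv S (φ n x) • (gradient (φ n) x - G x)) :=
      fun n => ((hφ.finiteEnergy n).sub ha hu').bdd_smul ha (hm n) (Eventually.of_forall fun x => hC _)
    have hmu : AEStronglyMeasurable (fun x => deriv S (u x)) (volume.restrict W) :=
      hcS'.comp_aestronglyMeasurable hu.memLp.1
    have h2 : ∀ n, FiniteEnergy a W (fun x => (deriv S (φ n x) - deriv S (u x)) • G x) :=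
      fun n => hu'.bdd_smul ha ((hm n).sub hmu) (C := C + C) (Eventually.of_forall fun x =>
        (abs_sub _ _).trans (add_le_add (hC _) (hC _)))
    have h3 : Tendsto (fun n => bil a W (fun x => deriv S (φ n x) • (gradient (φ n) x - G x))
        (fun x => deriv S (φ n x) • (gradient (φ n) x - G x))) atTop (𝓝 0) := by
      have h0 := hφ.tendsto_bil.const_mul (C ^ 2)
      rw [mul_zero] at h0
      refine squeeze_zero (fun n => bil_self_nonneg ha _) (fun n => ?_) h0
      rw [bil_self, bil_self, ← integral_const_mul]
      refine integral_mono_ae ((h1 n).integrable ha)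
        ((((hφ.finiteEnergy n).sub ha hu').integrable ha).const_mul _) ?_
      filter_upwards [ha.posDef] with x hx
      rw [energyDensity_smul a (fun x => deriv S (φ n x)) (fun x => gradient (φ n) x - G x)]
      have h0 : 0 ≤ energyDensity a (fun x => gradient (φ n) x - G x) x := energyDensity_nonneg hx
      refine mul_le_mul_of_nonneg_right ?_ h0
      rw [← sq_abs]
      have := hC (φ n x)
      gcongr
    refine (tendsto_bil_add_zero ha h1 h2 h3 (tendsto_bil_smul_sub ha hu' hm
      (fun n => Eventually.of_forall fun x => hC _) ?_)).congr fun n => ?_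
    · filter_upwards [hφ.ae_tendsto] with x hx using (hcS'.tendsto _).comp hx
    · have : (fun x => deriv S (φ n x) • (gradient (φ n) x - G x) +
          (deriv S (φ n x) - deriv S (u x)) • G x) =ᵐ[volume.restrict W]
          fun x => gradient (fun x => S (φ n x)) x - deriv S (u x) • G x := by
        filter_upwards [hgae n] with x hx
        rw [hx, smul_sub, sub_smul]; abel
      exact bil_congr this this
  · filter_upwards [hφ.ae_tendsto] with x hx using (hS.continuous.tendsto _).comp hx
  · filter_upwards [hφ.ae_tendsto, hφ.ae_tendsto_gradient, ae_all_iff.2 hgae] with x h1 h2 h3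
    simp only [h3]
    exact ((hcS'.tendsto _).comp h1).smul h2

theorem HasGrad.comp (hW : IsOpen W) (hWf : volume W ≠ ∞) (ha : IsCoefficientField a W)
    (hu : HasGrad a W u G) {S : ℝ → ℝ} {C : ℝ}
    (hS : ContDiff ℝ (⊤ : ℕ∞) S) (hC : ∀ t, |deriv S t| ≤ C) :
    HasGrad a W (fun x => S (u x)) (fun x => deriv S (u x) • G x) := by
  obtain ⟨φ, hφ⟩ := hu.exists_approximates hW ha
  have h := hφ.comp hW hWf ha hu hS hC
  have hcS' : Continuous (deriv S) := hS.continuous_deriv (by simp)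
  refine h.hasGrad ha ?_ (hu.finiteEnergy.bdd_smul ha
    (hcS'.comp_aestronglyMeasurable hu.memLp.1) (Eventually.of_forall fun x => hC _))
  have h0 := (h.tendsto_eLpNorm.eventually (gt_mem_nhds ENNReal.zero_lt_top)).exists
  obtain ⟨n, hn⟩ := h0
  have hm := hS.continuous.comp_aestronglyMeasurable hu.memLp.1
  have h1 : MemLp (fun x => S (φ n x) - S (u x)) 2 (volume.restrict W) :=
    ⟨(h.memLp n).1.sub hm, hn⟩
  refine ((h.memLp n).sub h1).congr_norm hm (Eventually.of_forall fun x => by simp)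

/-- The gradient vanishes on level sets. -/
theorem HasGrad.ae_eq_zero_of_eq (hW : IsOpen W) (hWf : volume W ≠ ∞) (ha : IsCoefficientField a W)
    (hu : HasGrad a W u G) (r : ℝ) : ∀ᵐ x ∂(volume.restrict W), u x = r → G x = 0 := by
  have : IsFiniteMeasure (volume.restrict W) := ⟨by simpa using hWf.lt_top⟩
  -- The functions `arctan((n+1)(t-r))/(n+1)` tend to zero uniformly while their derivatives tend
  -- boundedly to the indicator function of `{r}`. Hence `1_{u = r} G` is the weak gradient of the
  -- zero function.
  set S : ℕ → ℝ → ℝ := fun n t => ((n : ℝ) + 1)⁻¹ * Real.arctan ((n + 1) * (t - r)) with hS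
  have hSd : ∀ n, ContDiff ℝ (⊤ : ℕ∞) (S n) := fun n =>
    contDiff_const.mul (Real.contDiff_arctan.comp (contDiff_const.mul (contDiff_id.sub contDiff_const)))
  have hS' : ∀ n t, deriv (S n) t = (1 + (((n : ℝ) + 1) * (t - r)) ^ 2)⁻¹ := by
    intro n t
    have h1 : HasDerivAt (fun t => ((n : ℝ) + 1) * (t - r)) ((n : ℝ) + 1) t := by
      simpa using ((hasDerivAt_id t).sub_const r).const_mul ((n : ℝ) + 1)
    have h2 := (h1.arctan).const_mul (((n : ℝ) + 1)⁻¹)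
    rw [h2.deriv]
    have : (n : ℝ) + 1 ≠ 0 := by positivity
    field_simp
  have hS'1 : ∀ n t, |deriv (S n) t| ≤ 1 := fun n t => by
    rw [hS', abs_of_nonneg (by positivity)]
    exact inv_le_one_of_one_le₀ (by nlinarith [sq_nonneg (((n : ℝ) + 1) * (t - r))])
  have hGi := hu.finiteEnergy.integrable_self ha
  set K : E d → E d := fun x => (if u x = r then (1 : ℝ) else 0) • G x with hK
  have hlim : ∀ x, Tendsto (fun n => deriv (S n) (u x)) atTop (𝓝 (if u x = r then (1 : ℝ) else 0)) := by
    intro x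
    simp only [hS']
    split_ifs with h
    · simp [h]
    · have hne : (u x - r) ^ 2 ≠ 0 := pow_ne_zero 2 (sub_ne_zero.2 h)
      have hpos : 0 < (u x - r) ^ 2 := lt_of_le_of_ne (sq_nonneg _) hne.symm
      have h1 : Tendsto (fun n : ℕ => 1 + (((n : ℝ) + 1) * (u x - r)) ^ 2) atTop atTop := by
        refine tendsto_atTop_mono (f := fun n : ℕ => (n : ℝ) * (u x - r) ^ 2) (fun n => ?_)
          (tendsto_natCast_atTop_atTop.atTop_mul_const hpos)
        have : (0 : ℝ) ≤ n := n.cast_nonneg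
        nlinarith [mul_nonneg this hpos.le, mul_nonneg (mul_nonneg this this) hpos.le]
      exact h1.inv_tendsto_atTop
  have hmn : ∀ n, AEStronglyMeasurable (fun x => deriv (S n) (u x)) (volume.restrict W) := fun n =>
    ((hSd n).continuous_deriv (by simp)).comp_aestronglyMeasurable hu.memLp.1
  have hm : AEStronglyMeasurable (fun x => if u x = r then (1 : ℝ) else 0) (volume.restrict W) :=
    aestronglyMeasurable_of_tendsto_ae atTop hmn (Eventually.of_forall hlim)
  have hKi : IntegrableOn K W := hGi.bdd_smul 1 hm (Eventually.of_forall fun x => by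
    split_ifs <;> simp)
  have hK0 : K =ᵐ[volume.restrict W] 0 := by
    refine ae_eq_zero_of_integral_inner_mul_test hW hKi fun ψ hψ e => ?_
    obtain ⟨C, hC0, hC1, hC2⟩ := hψ.exists_bound
    have h1 : ∀ n, ∫ x in W, S n (u x) * fderiv ℝ ψ x e =
        -∫ x in W, inner ℝ (deriv (S n) (u x) • G x) e * ψ x := fun n =>
      (hu.comp hW hWf ha (hSd n) (hS'1 n)).integral_mul_fderiv hW hWf ha hψ e
    have h2 : Tendsto (fun n => ∫ x in W, S n (u x) * fderiv ℝ ψ x e) atTop (𝓝 0) := by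
      have h3 : Tendsto (fun n : ℕ => ((n : ℝ) + 1)⁻¹ * (Real.pi / 2) * (C * ‖e‖) *
          volume.real W) atTop (𝓝 0) := by
        have h4 : Tendsto (fun n : ℕ => ((n : ℝ) + 1)⁻¹) atTop (𝓝 0) := by
          simpa using tendsto_one_div_add_atTop_nhds_zero_nat (𝕜 := ℝ)
        simpa using ((h4.mul_const (Real.pi / 2)).mul_const (C * ‖e‖)).mul_const (volume.real W)
      refine squeeze_zero_norm (fun n => ?_) h3
      refine norm_setIntegral_le_of_norm_le_const hWf.lt_top fun x _ => ?_
      rw [norm_mul]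
      have h5 : ‖fderiv ℝ ψ x e‖ ≤ C * ‖e‖ := by
        refine ((fderiv ℝ ψ x).le_opNorm e).trans ?_
        rw [← norm_gradient]
        gcongr
        exact hC2 x
      have h6 : ‖S n (u x)‖ ≤ ((n : ℝ) + 1)⁻¹ * (Real.pi / 2) := by
        rw [hS, norm_mul, Real.norm_eq_abs, abs_of_nonneg (by positivity)]
        gcongr
        exact abs_le.2 ⟨(Real.neg_pi_div_two_lt_arctan _).le, (Real.arctan_lt_pi_div_two _).le⟩
      gcongr
    have h3 : Tendsto (fun n => ∫ x in W, inner ℝ (deriv (S n) (u x) • G x) e * ψ x) atTop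
        (𝓝 (∫ x in W, inner ℝ (K x) e * ψ x)) := by
      refine tendsto_integral_of_dominated_convergence (fun x => ‖G x‖ * ‖e‖ * C) (fun n => ?_)
        ((hGi.norm.mul_const _).mul_const _) (fun n => Eventually.of_forall fun x => ?_)
        (Eventually.of_forall fun x => ?_)
      · exact (((hmn n).smul hGi.1).inner aestronglyMeasurable_const).mul
          hψ.contDiff_one.continuous.aestronglyMeasurable
      · rw [norm_mul]
        have h6 : ‖inner ℝ (deriv (S n) (u x) • G x) e‖ ≤ ‖G x‖ * ‖e‖ := by
          refine (norm_inner_le_norm _ _).trans ?_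
          gcongr
          rw [norm_smul]
          exact mul_le_of_le_one_left (norm_nonneg _) (hS'1 n _)
        gcongr
        exact hC1 x
      · exact (((hlim x).smul_const (G x)).inner tendsto_const_nhds).mul_const _
    have h4 := tendsto_nhds_unique (h2.congr h1) h3.neg
    linarith
  filter_upwards [hK0] with x hx hxr
  simpa [hK, hxr] using hx

end Chain

section Caccioppoli

/-- Testing the equation for `u` with `η S(u)`. -/
theorem IsSol.integral_comp (hW : IsOpen W) (hWf : volume W ≠ ∞) (ha : IsCoefficientField a W)
    (hu : IsSol a W u G) {S : ℝ → ℝ} {C : ℝ} (hS : ContDiff ℝ (⊤ : ℕ∞) S)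
    (hC : ∀ t, |deriv S t| ≤ C) (hC' : ∀ t, |S t| ≤ C) {η : E d → ℝ} (hη : IsTest W η) :
    ∫ x in W, η x * deriv S (u x) * energyDensity a G x =
      -∫ x in W, S (u x) * inner ℝ (gradient η x) (flux a G x) := by
  obtain ⟨φ, hφ⟩ := hu.hasGrad.exists_approximates hW ha
  have hG := hu.hasGrad.finiteEnergy
  have h := hφ.comp hW hWf ha hu.hasGrad hS hC
  have hv := hu.hasGrad.comp hW hWf ha hS hC
  have hd : ∀ n, ∀ x ∈ W, DifferentiableAt ℝ (fun x => S (φ n x)) x := fun n x hx =>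
    ((h.contDiffOn n).contDiffAt (hW.mem_nhds hx)).differentiableAt (by simp)
  obtain ⟨Cη, hC0, hC1, hC2⟩ := hη.exists_bound
  have hmη := hη.contDiff_one.continuous.aestronglyMeasurable (μ := volume.restrict W)
  have hgη : FiniteEnergy a W (gradient η) := .of_bounded ha
    (continuous_gradient hη.contDiff_one).aestronglyMeasurable (Eventually.of_forall hC2)
  have e1 : ∀ n, FiniteEnergy a W fun x => η x • gradient (fun x => S (φ n x)) x := fun n =>
    (h.finiteEnergy n).bdd_smul ha hmη (Eventually.of_forall hC1)
  have hSm : ∀ n, AEStronglyMeasurable (fun x => S (φ n x)) (volume.restrict W) := fun n =>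
    (h.memLp n).1
  have hSu : AEStronglyMeasurable (fun x => S (u x)) (volume.restrict W) :=
    hS.continuous.comp_aestronglyMeasurable hu.hasGrad.memLp.1
  have e2 : ∀ n, FiniteEnergy a W fun x => S (φ n x) • gradient η x := fun n =>
    hgη.bdd_smul ha (hSm n) (Eventually.of_forall fun x => hC' _)
  have e3 : FiniteEnergy a W fun x => η x • (deriv S (u x) • G x) :=
    hv.finiteEnergy.bdd_smul ha hmη (Eventually.of_forall hC1)
  have e4 : FiniteEnergy a W fun x => S (u x) • gradient η x :=
    hgη.bdd_smul ha hSu (Eventually.of_forall fun x => hC' _)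
  -- The product `η S(φ_n)` is a genuine test function because `φ_n` is smooth in `W`; the two terms
  -- come from the product rule. Both converge as `n → ∞`.
  have key : ∀ n, bil a W (fun x => η x • gradient (fun x => S (φ n x)) x) G +
      bil a W (fun x => S (φ n x) • gradient η x) G = 0 := by
    intro n
    have h0 := hu.weak _ (hη.mul_contDiffOn hW (h.contDiffOn n))
    rw [← bil_add_left ha (e1 n) (e2 n) hG, ← h0]
    refine setIntegral_congr_fun hW.measurableSet fun x hx => ?_
    simp only [gradient_mul (hη.differentiable x) (hd n x hx)]
  have l1 : Tendsto (fun n => bil a W (fun x => η x • gradient (fun x => S (φ n x)) x) G) atTop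
      (𝓝 (bil a W (fun x => η x • (deriv S (u x) • G x)) G)) := by
    refine tendsto_bil_left ha e1 e3 hG ?_
    have h0 := h.tendsto_bil.const_mul (Cη ^ 2)
    rw [mul_zero] at h0
    refine squeeze_zero (fun n => bil_self_nonneg ha _) (fun n => ?_) h0
    have hfe := (h.finiteEnergy n).sub ha hv.finiteEnergy
    have h5 := hfe.bdd_smul ha hmη (Eventually.of_forall hC1)
    simp only [← smul_sub]
    rw [bil_self, bil_self, ← integral_const_mul]
    refine integral_mono_ae (h5.integrable ha) ((hfe.integrable ha).const_mul _) ?_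
    filter_upwards [ha.posDef] with x hx
    rw [energyDensity_smul a η]
    refine mul_le_mul_of_nonneg_right ?_ (energyDensity_nonneg hx)
    rw [← sq_abs]
    have := hC1 x
    gcongr
  have l2 : Tendsto (fun n => bil a W (fun x => S (φ n x) • gradient η x) G) atTop
      (𝓝 (bil a W (fun x => S (u x) • gradient η x) G)) := by
    refine tendsto_bil_left ha e2 e4 hG ?_
    simp only [← sub_smul]
    exact tendsto_bil_smul_sub ha hgη hSm (fun n => Eventually.of_forall fun x => hC' _) h.ae_tendsto
  have h6 := tendsto_nhds_unique (tendsto_const_nhds.congr fun n => (key n).symm) (l1.add l2)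
  have r1 : bil a W (fun x => η x • (deriv S (u x) • G x)) G =
      ∫ x in W, η x * deriv S (u x) * energyDensity a G x := by
    refine integral_congr_ae (Eventually.of_forall fun x => ?_)
    simp only [real_inner_smul_left, energyDensity]; ring
  have r2 : bil a W (fun x => S (u x) • gradient η x) G =
      ∫ x in W, S (u x) * inner ℝ (gradient η x) (flux a G x) := by
    refine integral_congr_ae (Eventually.of_forall fun x => ?_)
    simp only [real_inner_smul_left]
  rw [← r1, ← r2]
  linarith

end Caccioppoli

end CoarseGrained

end

/-! ### Convex functions and the transform -/

noncomputable section
namespace CoarseGrained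

section ConvexReal

variable {Φ : ℝ → ℝ}

theorem exists_abs_deriv_le (hΦ : ConvexOn ℝ univ Φ) (p q : ℝ) :
    ∃ K : ℝ, 0 ≤ K ∧ ∀ t ∈ Ioo p q, |deriv Φ t| ≤ K := by
  obtain ⟨K, hK⟩ := LocallyLipschitzOn.exists_lipschitzOnWith_of_compact
    (isCompact_Icc (a := p) (b := q)) (hΦ.locallyLipschitz.locallyLipschitzOn)
  exact ⟨K, K.2, fun t ht => norm_deriv_le_of_lipschitzOn
    (Icc_mem_nhds ht.1 ht.2) hK⟩

theorem ConvexOn.ae_differentiableAt (hΦ : ConvexOn ℝ univ Φ) :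
    ∀ᵐ t, DifferentiableAt ℝ Φ t := by
  have : ∀ n : ℕ, ∀ᵐ t, t ∈ Ioo (-(n : ℝ)) n → DifferentiableAt ℝ Φ t := fun n => by
    obtain ⟨K, hK⟩ := LocallyLipschitzOn.exists_lipschitzOnWith_of_compact
      (isCompact_Icc (a := -(n : ℝ)) (b := n)) (hΦ.locallyLipschitz.locallyLipschitzOn)
    filter_upwards [hK.ae_differentiableWithinAt_of_mem_real] with t ht htn
    exact (ht ⟨htn.1.le, htn.2.le⟩).differentiableAt (Icc_mem_nhds htn.1 htn.2)
  filter_upwards [ae_all_iff.2 this] with t ht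
  obtain ⟨n, hn⟩ := exists_nat_gt |t|
  exact ht n (abs_lt.1 hn)

theorem ConvexOn.exists_differentiableAt (hΦ : ConvexOn ℝ univ Φ) {p q : ℝ} (h : p < q) :
    ∃ t ∈ Ioo p q, DifferentiableAt ℝ Φ t := by
  obtain ⟨t, h1, h2⟩ := (Measure.dense_of_ae (ConvexOn.ae_differentiableAt hΦ)).exists_between h
  exact ⟨t, h2, h1⟩

theorem ConvexOn.intervalIntegrable_deriv (hΦ : ConvexOn ℝ univ Φ) (p q : ℝ) :
    IntervalIntegrable (deriv Φ) volume p q := by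
  obtain ⟨K, -, hK⟩ := exists_abs_deriv_le hΦ (min p q - 1) (max p q + 1)
  rw [intervalIntegrable_iff]
  refine Measure.integrableOn_of_bounded (M := K) (by simp) (measurable_deriv Φ).aestronglyMeasurable ?_
  filter_upwards [ae_restrict_mem measurableSet_uIoc] with t ht
  rw [uIoc, mem_Ioc] at ht
  exact hK t ⟨by linarith [ht.1], by linarith [ht.2]⟩

theorem ConvexOn.intervalIntegrable_sqrt (hΦ : ConvexOn ℝ univ Φ) (p q : ℝ) :
    IntervalIntegrable (fun t => √|deriv Φ t|) volume p q := by
  obtain ⟨K, -, hK⟩ := exists_abs_deriv_le hΦ (min p q - 1) (max p q + 1)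
  rw [intervalIntegrable_iff]
  refine Measure.integrableOn_of_bounded (M := √K) (by simp)
    ((measurable_deriv Φ).abs.sqrt).aestronglyMeasurable ?_
  filter_upwards [ae_restrict_mem measurableSet_uIoc] with t ht
  rw [uIoc, mem_Ioc] at ht
  rw [Real.norm_eq_abs, abs_of_nonneg (Real.sqrt_nonneg _)]
  exact Real.sqrt_le_sqrt (hK t ⟨by linarith [ht.1], by linarith [ht.2]⟩)

theorem ConvexOn.integral_deriv (hΦ : ConvexOn ℝ univ Φ) (p q : ℝ) :
    ∫ t in p..q, deriv Φ t = Φ q - Φ p := by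
  obtain ⟨K, hK⟩ := LocallyLipschitzOn.exists_lipschitzOnWith_of_compact
    (isCompact_uIcc (a := p) (b := q)) (hΦ.locallyLipschitz.locallyLipschitzOn)
  exact hK.absolutelyContinuousOnInterval.integral_deriv_eq_sub

/-- The points to the left of which a function takes a smaller value. -/
def risingSet (Φ : ℝ → ℝ) : Set ℝ := {t | ∃ x < t, Φ x < Φ t}

theorem ConvexOn.lt_of_mem_risingSet (hΦ : ConvexOn ℝ univ Φ) {t s : ℝ} (ht : t ∈ risingSet Φ)
    (hts : t < s) : Φ t < Φ s := by
  obtain ⟨x, hx, hx'⟩ := ht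
  have := hΦ.slope_mono_adjacent (mem_univ x) (mem_univ s) hx hts
  have h1 : 0 < (Φ t - Φ x) / (t - x) := div_pos (by linarith) (by linarith)
  have h2 := h1.trans_le this
  have h3 : 0 < Φ s - Φ t := by
    rcases div_pos_iff.1 h2 with h | h
    · exact h.1
    · linarith [h.2]
  linarith

theorem ConvexOn.mem_risingSet_of_lt (hΦ : ConvexOn ℝ univ Φ) {t s : ℝ} (ht : t ∈ risingSet Φ)
    (hts : t < s) : s ∈ risingSet Φ := ⟨t, hts, ConvexOn.lt_of_mem_risingSet hΦ ht hts⟩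

theorem ConvexOn.isOpen_risingSet (hΦ : ConvexOn ℝ univ Φ) : IsOpen (risingSet Φ) := by
  have : risingSet Φ = ⋃ x, Ioi x ∩ {t | Φ x < Φ t} := by
    ext t; simp [risingSet]
  rw [this]
  exact isOpen_iUnion fun x => isOpen_Ioi.inter
    (isOpen_lt continuous_const hΦ.locallyLipschitz.continuous)

theorem ConvexOn.exists_le_deriv (hΦ : ConvexOn ℝ univ Φ) {t : ℝ} (ht : t ∈ risingSet Φ) :
    ∃ δ > 0, ∀ s ≥ t, DifferentiableAt ℝ Φ s → δ ≤ deriv Φ s := by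
  obtain ⟨x, hx, hx'⟩ := ht
  refine ⟨(Φ t - Φ x) / (t - x), div_pos (by linarith) (by linarith), fun s hs hd => ?_⟩
  rcases hs.eq_or_lt with rfl | hs
  · have := hΦ.slope_le_deriv (mem_univ x) (mem_univ _) hx hd
    rwa [slope_def_field] at this
  · have h1 := hΦ.slope_mono_adjacent (mem_univ x) (mem_univ s) hx hs
    have h2 := hΦ.slope_le_deriv (mem_univ t) (mem_univ s) hs hd
    rw [slope_def_field] at h2
    exact h1.trans h2

end ConvexReal

/-- A convex function `Φ` and an antiderivative `Ψ = k Φ / √|Φ'|` of `√|Φ'|`. -/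
structure IsTransformPair (Φ Ψ : ℝ → ℝ) (k : ℝ) : Prop where
  convex : ConvexOn ℝ univ Φ
  sub_eq : ∀ p q, Ψ q - Ψ p = ∫ t in p..q, √|deriv Φ t|
  quot : ∀ t, DifferentiableAt ℝ Φ t → Ψ t = k * (Φ t / √|deriv Φ t|)
  -- The integral defining `Ψ` starts at `0` or at `∞`; the limit at `-∞` occurs after the
  -- reflection `t ↦ -t`.
  anchor : Ψ 0 = 0 ∨ Tendsto Ψ atBot (𝓝 0) ∨ Tendsto Ψ atTop (𝓝 0)

namespace IsTransformPair

variable {Φ Ψ : ℝ → ℝ} {k : ℝ} (h : IsTransformPair Φ Ψ k)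

include h

theorem monotone : Monotone Ψ := fun p q hpq => by
  have := h.sub_eq p q
  have h2 : 0 ≤ ∫ t in p..q, √|deriv Φ t| :=
    intervalIntegral.integral_nonneg hpq fun _ _ => Real.sqrt_nonneg _
  linarith

theorem continuous : Continuous Ψ := by
  have h1 : Ψ = fun q => Ψ 0 + ∫ t in (0 : ℝ)..q, √|deriv Φ t| := by
    ext q; rw [← h.sub_eq]; ring
  rw [h1]
  exact continuous_const.add
    (intervalIntegral.continuous_primitive (ConvexOn.intervalIntegrable_sqrt h.convex) 0)

theorem sqrt_mul_le_sub {p q δ : ℝ} (hpq : p ≤ q)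
    (hδ : ∀ t ∈ Icc p q, DifferentiableAt ℝ Φ t → δ ≤ |deriv Φ t|) :
    √δ * (q - p) ≤ Ψ q - Ψ p := by
  rw [h.sub_eq]
  have h1 : ∫ _ in p..q, √δ = √δ * (q - p) := by
    rw [intervalIntegral.integral_const, smul_eq_mul, mul_comm]
  rw [← h1]
  refine intervalIntegral.integral_mono_ae_restrict hpq (by simp)
    (ConvexOn.intervalIntegrable_sqrt h.convex p q) ?_
  filter_upwards [ae_restrict_mem measurableSet_Icc,
    ae_restrict_of_ae (ConvexOn.ae_differentiableAt h.convex)] with t ht hd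
  exact Real.sqrt_le_sqrt (hδ t ht hd)

theorem tendsto_atTop {t : ℝ} (ht : t ∈ risingSet Φ) : Tendsto Ψ atTop atTop := by
  obtain ⟨δ, hδ, hd⟩ := ConvexOn.exists_le_deriv h.convex ht
  have h1 : Tendsto (fun s => Ψ t + √δ * (s - t)) atTop atTop :=
    tendsto_atTop_add_const_left _ _
      ((tendsto_atTop_add_const_right _ _ tendsto_id).const_mul_atTop (Real.sqrt_pos.2 hδ))
  refine tendsto_atTop_mono' _ ?_ h1
  filter_upwards [eventually_ge_atTop t] with s hs
  have := h.sqrt_mul_le_sub hs (δ := δ) fun r hr hd' => (hd r hr.1 hd').trans (le_abs_self _)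
  linarith

/-- There `Φ' = 0`, and the quotient is `0` because division by zero gives zero; continuity of `Ψ`
covers the end points. -/
theorem eq_zero_of_const {p q c : ℝ} (hpq : p < q) (hc : ∀ y ∈ Ioo p q, Φ y = c) :
    ∀ y ∈ Icc p q, Ψ y = 0 := by
  have h1 : ∀ y ∈ Ioo p q, Ψ y = 0 := fun y hy => by
    have he : Φ =ᶠ[𝓝 y] fun _ => c := by
      filter_upwards [Ioo_mem_nhds hy.1 hy.2] with z hz using hc z hz
    have h2 := h.quot y ((differentiableAt_const c).congr_of_eventuallyEq he)
    rw [he.deriv_eq] at h2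
    simpa using h2
  have h2 : closure (Ioo p q) ⊆ {y | Ψ y = 0} :=
    (isClosed_eq h.continuous continuous_const).closure_subset_iff.2 h1
  rw [closure_Ioo hpq.ne] at h2
  exact h2

/-- `√|Φ'|`, where `Ψ` does not vanish. -/
theorem sqrt_eq {t : ℝ} (hd : DifferentiableAt ℝ Φ t) (h0 : Ψ t ≠ 0) :
    0 < √|deriv Φ t| ∧ √|deriv Φ t| = k * Φ t / Ψ t := by
  have h1 := h.quot t hd
  have h2 : √|deriv Φ t| ≠ 0 := fun h' => h0 (by rw [h1, h']; simp)
  refine ⟨lt_of_le_of_ne (Real.sqrt_nonneg _) h2.symm, ?_⟩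
  rw [eq_div_iff h0, h1]
  field_simp

theorem ae_eq_nhds {t : ℝ} (h0 : Ψ t ≠ 0) :
    ∀ᶠ s in 𝓝 t ⊓ ae volume, √|deriv Φ s| = k * Φ s / Ψ s := by
  have h1 : ∀ᶠ s in 𝓝 t, Ψ s ≠ 0 := h.continuous.continuousAt.eventually_ne h0
  filter_upwards [h1.filter_mono inf_le_left,
    (ConvexOn.ae_differentiableAt h.convex).filter_mono inf_le_right] with s h2 h3
  exact (h.sqrt_eq h3 h2).2

theorem continuousAt_quot {t : ℝ} (h0 : Ψ t ≠ 0) : ContinuousAt (fun s => k * Φ s / Ψ s) t :=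
  (continuousAt_const.mul h.convex.locallyLipschitz.continuous.continuousAt).div
    h.continuous.continuousAt h0

/-- The integrand `√|Φ'|` agrees almost everywhere near `t` with `kΦ/Ψ`, which is continuous at `t`.
So `Ψ` is differentiable at every such point, although `Φ'` is known only almost everywhere. -/
theorem hasDerivAt {t : ℝ} (h0 : Ψ t ≠ 0) : HasDerivAt Ψ (k * Φ t / Ψ t) t := by
  have h1 : HasDerivAt (fun q => ∫ s in (0 : ℝ)..q, √|deriv Φ s|) (k * Φ t / Ψ t) t := by
    refine intervalIntegral.integral_hasDerivAt_of_tendsto_ae_right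
      (ConvexOn.intervalIntegrable_sqrt h.convex 0 t)
      ((measurable_deriv Φ).abs.sqrt.stronglyMeasurable.stronglyMeasurableAtFilter) ?_
    refine (((h.continuousAt_quot h0).tendsto).mono_left inf_le_left).congr' ?_
    filter_upwards [h.ae_eq_nhds h0] with s hs using hs.symm
  have h2 : Ψ = fun q => Ψ 0 + ∫ s in (0 : ℝ)..q, √|deriv Φ s| := by
    ext q; rw [← h.sub_eq]; ring
  rw [h2]
  exact h1.const_add _ |>.congr_deriv (by rw [← h2])

theorem hasDerivAt_base {t : ℝ} (ht : t ∈ risingSet Φ) (h0 : Ψ t ≠ 0) :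
    HasDerivAt Φ ((k * Φ t / Ψ t) ^ 2) t := by
  have h1 : HasDerivAt (fun q => ∫ s in (0 : ℝ)..q, deriv Φ s) ((k * Φ t / Ψ t) ^ 2) t := by
    refine intervalIntegral.integral_hasDerivAt_of_tendsto_ae_right
      (ConvexOn.intervalIntegrable_deriv h.convex 0 t)
      ((measurable_deriv Φ).stronglyMeasurable.stronglyMeasurableAtFilter) ?_
    refine ((((h.continuousAt_quot h0).pow 2).tendsto).mono_left inf_le_left).congr' ?_
    filter_upwards [h.ae_eq_nhds h0,
      mem_inf_of_left ((ConvexOn.isOpen_risingSet h.convex).mem_nhds ht),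
      (ConvexOn.ae_differentiableAt h.convex).filter_mono inf_le_right] with s hs hm hd
    obtain ⟨δ, hδ, hδ'⟩ := ConvexOn.exists_le_deriv h.convex hm
    have := hδ' s le_rfl hd
    rw [Pi.pow_apply, ← hs, Real.sq_sqrt (abs_nonneg _), abs_of_pos (by linarith)]
  have h2 : Φ = fun q => Φ 0 + ∫ s in (0 : ℝ)..q, deriv Φ s := by
    ext q; rw [ConvexOn.integral_deriv h.convex]; ring
  rw [h2]
  exact h1.const_add _ |>.congr_deriv (by rw [← h2])

theorem quot_pos {t : ℝ} (ht : t ∈ risingSet Φ) (h0 : Ψ t ≠ 0) : 0 < k * Φ t / Ψ t := by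
  have h1 := h.sqrt_eq (h.hasDerivAt_base ht h0).differentiableAt h0
  exact h1.2 ▸ h1.1

/-- With `V = kΦ/Ψ`, the relations `Φ' = V²` and `Ψ' = V` give `V' = kV²/Ψ - kΦV/Ψ² = (k - 1)V²/Ψ`.
This equation determines the range of `k` and produces the coefficient `kap`. -/
theorem hasDerivAt_quot {t : ℝ} (ht : t ∈ risingSet Φ) (h0 : Ψ t ≠ 0) :
    HasDerivAt (fun s => k * Φ s / Ψ s) ((k - 1) * (k * Φ t / Ψ t) ^ 2 / Ψ t) t := by
  refine (((h.hasDerivAt_base ht h0).const_mul k).div (h.hasDerivAt h0) h0).congr_deriv ?_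
  field_simp

/-- The square of the quotient is `Φ'`, which is nondecreasing by convexity, and the quotient is
positive on the rising set. -/
theorem sq_quot_le {s t : ℝ} (hst : s < t) (hs : s ∈ risingSet Φ) (hs0 : Ψ s ≠ 0) (ht0 : Ψ t ≠ 0) :
    k * Φ s / Ψ s ≤ k * Φ t / Ψ t := by
  have ht := ConvexOn.mem_risingSet_of_lt h.convex hs hst
  have h1 := h.convex.le_slope_of_hasDerivAt (mem_univ s) (mem_univ t) hst (h.hasDerivAt_base hs hs0)
  have h2 := h.convex.slope_le_of_hasDerivAt (mem_univ s) (mem_univ t) hst (h.hasDerivAt_base ht ht0)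
  exact le_of_sq_le_sq (h1.trans h2) (h.quot_pos ht ht0).le

theorem exists_forall_pos (hne : (risingSet Φ).Nonempty) (B : ℝ) :
    ∃ T ∈ risingSet Φ, ∀ t ≥ T, B < Ψ t := by
  obtain ⟨t, ht⟩ := hne
  obtain ⟨T, hT1, hT2⟩ := ((h.tendsto_atTop ht).eventually_gt_atTop B).and
    (eventually_gt_atTop t) |>.exists
  exact ⟨T, ConvexOn.mem_risingSet_of_lt h.convex ht hT2, fun s hs => hT1.trans_le (h.monotone hs)⟩

/-- Beyond some point `Ψ > 0`, and there `V' = (k - 1)V²/Ψ` would be negative for `k < 1`, whereas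
`V` is nondecreasing. -/
theorem one_le (hne : (risingSet Φ).Nonempty) : 1 ≤ k := by
  obtain ⟨T, hT, hpos⟩ := h.exists_forall_pos hne 0
  have hm : ∀ t ≥ T, t ∈ risingSet Φ := fun t ht => by
    rcases ht.eq_or_lt with rfl | h'
    · exact hT
    · exact ConvexOn.mem_risingSet_of_lt h.convex hT h'
  have hd : ∀ t ≥ T, HasDerivAt (fun s => k * Φ s / Ψ s) ((k - 1) * (k * Φ t / Ψ t) ^ 2 / Ψ t) t :=
    fun t ht => h.hasDerivAt_quot (hm t ht) (hpos t ht).ne'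
  obtain ⟨c, hc, hc'⟩ := exists_hasDerivAt_eq_slope (fun s => k * Φ s / Ψ s)
    (fun t => (k - 1) * (k * Φ t / Ψ t) ^ 2 / Ψ t) (by linarith : T < T + 1)
    (fun t ht => (hd t ht.1).continuousAt.continuousWithinAt) (fun t ht => hd t ht.1.le)
  have h1 := h.sq_quot_le (by linarith : T < T + 1) hT (hpos _ le_rfl).ne' (hpos _ (by linarith)).ne'
  have h2 : 0 ≤ (k - 1) * (k * Φ c / Ψ c) ^ 2 / Ψ c := by
    rw [hc']; simp; linarith
  by_contra hk
  have h3 := h.quot_pos (hm c hc.1.le) (hpos c hc.1.le).ne'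
  have h4 : (k - 1) * (k * Φ c / Ψ c) ^ 2 / Ψ c < 0 :=
    div_neg_of_neg_of_pos (mul_neg_of_neg_of_pos (by linarith) (by positivity)) (hpos c hc.1.le)
  linarith

/-- Where `Ψ > 0` on the rising set, `(Ψ/V)' = 1 - ΨV'/V² = 2 - k`. For `k > 2` the positive
function `Ψ/V` would decrease linearly on a half-line and become negative. -/
theorem le_two (hne : (risingSet Φ).Nonempty) : k ≤ 2 := by
  obtain ⟨T, hT, hpos⟩ := h.exists_forall_pos hne 0
  have hm : ∀ t ≥ T, t ∈ risingSet Φ := fun t ht => by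
    rcases ht.eq_or_lt with rfl | h'
    · exact hT
    · exact ConvexOn.mem_risingSet_of_lt h.convex hT h'
  have hV : ∀ t ≥ T, 0 < k * Φ t / Ψ t := fun t ht => h.quot_pos (hm t ht) (hpos t ht).ne'
  have hd : ∀ t ≥ T, HasDerivAt (fun s => Ψ s / (k * Φ s / Ψ s)) (2 - k) t := fun t ht => by
    have h0 := (hpos t ht).ne'
    have hv := (hV t ht).ne'
    refine ((h.hasDerivAt h0).div (h.hasDerivAt_quot (hm t ht) h0) hv).congr_deriv ?_
    generalize k * Φ t / Ψ t = V at *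
    field_simp
    ring
  by_contra hk
  push Not at hk
  set Z := Ψ T / (k * Φ T / Ψ T) with hZ
  have hZ0 : 0 < Z := div_pos (hpos T le_rfl) (hV T le_rfl)
  have hlt : T < T + (Z / (k - 2) + 1) := by
    have : 0 < Z / (k - 2) := div_pos hZ0 (by linarith)
    linarith
  obtain ⟨c, hc, hc'⟩ := exists_hasDerivAt_eq_slope (fun s => Ψ s / (k * Φ s / Ψ s))
    (fun t => 2 - k) hlt
    (fun t ht => (hd t ht.1).continuousAt.continuousWithinAt) (fun t ht => hd t ht.1.le)
  rw [eq_div_iff (by linarith)] at hc'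
  have h5 : 0 < Ψ (T + (Z / (k - 2) + 1)) / (k * Φ (T + (Z / (k - 2) + 1)) /
    Ψ (T + (Z / (k - 2) + 1))) := div_pos (hpos _ hlt.le) (hV _ hlt.le)
  have h6 : (2 - k) * (T + (Z / (k - 2) + 1) - T) = -Z - (k - 2) := by
    have : k - 2 ≠ 0 := by linarith
    field_simp
    ring
  rw [h6] at hc'
  linarith

/-- This makes functions of `Ψ` supported away from `0` extend smoothly by zero across the boundary
of the rising set. To the left of `t₀` the function `Φ` does not increase. If `Ψ t₀ ≠ 0` it is even
strictly larger than `Φ t₀` there, for otherwise it would be constant on an interval and `Ψ` would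
vanish on it. So `Φ` grows at least linearly at `-∞`, and the equation `Ψ √|Φ'| = kΦ` contradicts
each possible normalization of `Ψ`. -/
theorem eq_zero_of_mem_closure {t₀ : ℝ} (h1 : t₀ ∈ closure (risingSet Φ)) (h2 : t₀ ∉ risingSet Φ) :
    Ψ t₀ = 0 := by
  by_contra hne
  have hnon : (risingSet Φ).Nonempty := closure_nonempty_iff.1 ⟨_, h1⟩
  have hk := h.one_le hnon
  have hmin : ∀ x < t₀, Φ t₀ ≤ Φ x := fun x hx => by
    by_contra h'; exact h2 ⟨x, hx, not_le.1 h'⟩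
  have hanti : ∀ x y, x < y → y ≤ t₀ → Φ y ≤ Φ x := fun x y hxy hy => by
    by_contra h'
    have : y ∈ risingSet Φ := ⟨x, hxy, not_le.1 h'⟩
    rcases hy.eq_or_lt with rfl | hy
    · exact h2 this
    · exact h2 (ConvexOn.mem_risingSet_of_lt h.convex this hy)
  have hstrict : ∀ x < t₀, Φ t₀ < Φ x := fun x hx => by
    refine lt_of_le_of_ne (hmin x hx) fun he => hne ?_
    refine h.eq_zero_of_const hx (c := Φ t₀) (fun y hy => ?_) t₀ ⟨hx.le, le_rfl⟩
    exact le_antisymm ((hanti x y hy.1 hy.2.le).trans he.symm.le) (hmin y hy.2)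
  have hdneg : ∀ t < t₀, DifferentiableAt ℝ Φ t → deriv Φ t < 0 := fun t ht hd => by
    have h3 := h.convex.deriv_le_slope (mem_univ t) (mem_univ t₀) ht hd
    rw [slope_def_field] at h3
    have : (Φ t₀ - Φ t) / (t₀ - t) < 0 :=
      div_neg_of_neg_of_pos (by linarith [hstrict t ht]) (by linarith)
    linarith
  set δ := Φ (t₀ - 1) - Φ t₀ with hδ
  have hδ0 : 0 < δ := by have := hstrict (t₀ - 1) (by linarith); linarith
  have hsl : ∀ t < t₀ - 1, (Φ t₀ - Φ t) / (t₀ - t) ≤ -δ := fun t ht => by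
    have := h.convex.secant_mono (mem_univ t₀) (mem_univ t) (mem_univ (t₀ - 1)) (by linarith)
      (by linarith) ht.le
    have e1 : (Φ (t₀ - 1) - Φ t₀) / (t₀ - 1 - t₀) = -δ := by rw [hδ]; ring
    rw [e1] at this
    have e2 : (Φ t₀ - Φ t) / (t₀ - t) = (Φ t - Φ t₀) / (t - t₀) := by
      rw [← neg_sub, ← neg_sub t, neg_div_neg_eq]
    rw [e2]; exact this
  have hgrow : ∀ t < t₀ - 1, Φ t₀ + δ * (t₀ - t) ≤ Φ t := fun t ht => by
    have := hsl t ht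
    rw [div_le_iff₀ (by linarith)] at this
    linarith
  have hsq : ∀ t < t₀, DifferentiableAt ℝ Φ t → 0 < √|deriv Φ t| ∧
      Ψ t * √|deriv Φ t| = k * Φ t := fun t ht hd => by
    have h3 := hdneg t ht hd
    have h4 : 0 < √|deriv Φ t| := Real.sqrt_pos.2 (abs_pos.2 h3.ne)
    refine ⟨h4, ?_⟩
    rw [h.quot t hd]; field_simp
  -- If `Ψ 0 = 0` and `Ψ t₀ < 0`, then `Ψ < 0` far to the left, where `kΦ > 0`. If `Ψ 0 = 0` and `Ψ
  -- t₀ > 0`, then `t₀ > 0`, and `Ψ √|Φ'|` tends to `0` at `0⁺` while `kΦ` stays above a positive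
  -- number. A limit at `-∞` is excluded by `√|Φ'| ≥ √δ` there, and a limit at `∞` by the growth of
  -- `Ψ` on the rising set.
  rcases h.anchor with ha | ha | ha
  · rcases lt_or_gt_of_ne hne with hlt | hgt
    · obtain ⟨t, ht, hd⟩ := ConvexOn.exists_differentiableAt h.convex
        (by linarith : min (t₀ - 1) (t₀ - |Φ t₀| / δ) - 2 < min (t₀ - 1) (t₀ - |Φ t₀| / δ) - 1)
      have e1 : t < t₀ - 1 := by linarith [ht.2, min_le_left (t₀ - 1) (t₀ - |Φ t₀| / δ)]
      have e2 : t < t₀ - |Φ t₀| / δ := by linarith [ht.2, min_le_right (t₀ - 1) (t₀ - |Φ t₀| / δ)]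
      have h3 := hgrow t e1
      obtain ⟨h4, h5⟩ := hsq t (by linarith) hd
      have h6 : Ψ t ≤ Ψ t₀ := h.monotone (by linarith)
      have h7 : |Φ t₀| < δ * (t₀ - t) := by
        have : |Φ t₀| / δ < t₀ - t := by linarith
        rwa [div_lt_iff₀' hδ0] at this
      have h8 : 0 < Φ t := by linarith [neg_abs_le (Φ t₀)]
      have h9 : Ψ t * √|deriv Φ t| < 0 := mul_neg_of_neg_of_pos (by linarith) h4
      have : 0 < k * Φ t := by positivity
      linarith
    · have ht0 : 0 < t₀ := by
        by_contra h'
        have := h.monotone (not_lt.1 h'); linarith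
      have hev : ∀ᶠ s in 𝓝[<] t₀, 0 < Ψ s :=
        (h.continuous.continuousAt.eventually (lt_mem_nhds hgt)).filter_mono nhdsWithin_le_nhds
      obtain ⟨m₀, hm1, hm2⟩ := (hev.and (Ioo_mem_nhdsLT ht0)).exists
      obtain ⟨m, hm3, hmd⟩ := ConvexOn.exists_differentiableAt h.convex hm2.2
      have hm0 : 0 < m := hm2.1.trans hm3.1
      have hΨm : 0 < Ψ m := hm1.trans_le (h.monotone hm3.1.le)
      obtain ⟨h4, h5⟩ := hsq m hm3.2 hmd
      have hΦm : 0 < Φ m := by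
        have : 0 < k * Φ m := by rw [← h5]; positivity
        exact pos_of_mul_pos_right this (by linarith)
      obtain ⟨K, hK0, hK⟩ := exists_abs_deriv_le h.convex 0 m
      have hlow : ∀ t ∈ Ioo 0 m, DifferentiableAt ℝ Φ t → Φ m ≤ Ψ t * √K := fun t ht hd => by
        obtain ⟨h6, h7⟩ := hsq t (ht.2.trans hm3.2) hd
        have h8 := hanti t m ht.2 hm3.2.le
        have h9 : 0 ≤ Ψ t := by rw [← ha]; exact h.monotone ht.1.le
        calc Φ m ≤ 1 * Φ t := by linarith
          _ ≤ k * Φ t := by gcongr; linarith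
          _ = _ := h7.symm
          _ ≤ _ := by gcongr; exact hK t ht
      have hK' : 0 ≤ √K := Real.sqrt_nonneg _
      have hev2 : ∀ᶠ s in 𝓝[>] (0 : ℝ), Ψ s * √K < Φ m := by
        have : Tendsto (fun s => Ψ s * √K) (𝓝[>] 0) (𝓝 (Ψ 0 * √K)) :=
          (h.continuous.continuousAt.mul_const _).mono_left nhdsWithin_le_nhds
        rw [ha, zero_mul] at this
        exact this.eventually (gt_mem_nhds hΦm)
      obtain ⟨p, hp1, hp2⟩ := (hev2.and (Ioo_mem_nhdsGT hm0)).exists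
      obtain ⟨t, ht, hd⟩ := ConvexOn.exists_differentiableAt h.convex hp2.1
      have h6 := hlow t ⟨ht.1, ht.2.trans hp2.2⟩ hd
      have h7 : Ψ t ≤ Ψ p := h.monotone ht.2.le
      have : Ψ t * √K ≤ Ψ p * √K := by gcongr
      linarith
  · have h3 : ∀ t < t₀ - 1, √δ * (t₀ - 1 - t) ≤ Ψ (t₀ - 1) - Ψ t := fun t ht => by
      refine h.sqrt_mul_le_sub ht.le fun s hs hd => ?_
      have hs' : s < t₀ := by linarith [hs.2]
      have h4 := h.convex.deriv_le_slope (mem_univ s) (mem_univ t₀) hs' hd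
      rw [slope_def_field] at h4
      have h5 : (Φ t₀ - Φ s) / (t₀ - s) ≤ -δ := by
        rcases hs.2.eq_or_lt with rfl | h'
        · apply le_of_eq; rw [hδ]; ring
        · exact hsl s h'
      have := neg_abs_le (deriv Φ s)
      linarith
    have h4 : ∀ᶠ t in atBot, -1 < Ψ t := ha.eventually (lt_mem_nhds (by norm_num))
    have h5 : Tendsto (fun t => √δ * (t₀ - 1 - t)) atBot atTop :=
      (tendsto_atTop_add_const_left _ _ tendsto_neg_atBot_atTop).const_mul_atTop
        (Real.sqrt_pos.2 hδ0)
    obtain ⟨t, ⟨h6, h7⟩, h8⟩ := ((h4.and (h5.eventually_gt_atTop (Ψ (t₀ - 1) + 1))).and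
      (eventually_lt_atBot (t₀ - 1))).exists
    have := h3 t h8
    linarith
  · obtain ⟨t, ht⟩ := hnon
    exact not_tendsto_nhds_of_tendsto_atTop (h.tendsto_atTop ht) _ ha

/-- Off the rising set, a convex function that is monotone on `R` has `Ψ = 0`, up to one point. -/
theorem exists_eq_zero_or_eq {R : Set ℝ} (hR : MonotoneOn Φ R) :
    ∃ r, ∀ t ∈ R, t ∉ risingSet Φ → Ψ t = 0 ∨ t = r := by
  by_cases hex : ∃ r ∈ R, r ∉ risingSet Φ
  · obtain ⟨r, hr, hr'⟩ := hex
    -- Monotonicity on `R` gives `Φ t₁ ≤ Φ t₂`, while `t₂` outside the rising set gives `Φ t₂ ≤ Φ`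
    -- to its left. With convexity `Φ` is constant on the interval, so two points of `R` outside the
    -- rising set force `Ψ = 0` between them.
    have key : ∀ t₁ t₂, t₁ ∈ R → t₂ ∈ R → t₂ ∉ risingSet Φ → t₁ < t₂ → ∀ y ∈ Icc t₁ t₂, Ψ y = 0 := by
      intro t₁ t₂ m1 m2 m3 hlt
      have e1 : Φ t₁ ≤ Φ t₂ := hR m1 m2 hlt.le
      have e2 : ∀ x < t₂, Φ t₂ ≤ Φ x := fun x hx => by
        by_contra h'; exact m3 ⟨x, hx, not_le.1 h'⟩
      refine h.eq_zero_of_const hlt (c := Φ t₂) fun y hy => le_antisymm ?_ (e2 y hy.2)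
      have := h.convex.le_max_of_mem_Icc (mem_univ t₁) (mem_univ t₂) ⟨hy.1.le, hy.2.le⟩
      exact this.trans (max_le e1 le_rfl)
    refine ⟨r, fun t ht ht' => ?_⟩
    rcases lt_trichotomy t r with h1 | h1 | h1
    · exact Or.inl (key t r ht hr hr' h1 t ⟨le_rfl, h1.le⟩)
    · exact Or.inr h1
    · exact Or.inl (key r t hr ht ht' h1 t ⟨h1.le, le_rfl⟩)
  · push Not at hex
    exact ⟨0, fun t ht ht' => absurd (hex t ht) ht'⟩

/-- Bootstrapping: if `Φ` and `Ψ` are of class `C^n` then so is `V = kΦ/Ψ`, and `Φ' = V²`, `Ψ' = V`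
gain one derivative. -/
theorem contDiffOn_quot : ContDiffOn ℝ (⊤ : ℕ∞) (fun s => k * Φ s / Ψ s)
    (risingSet Φ ∩ {t | Ψ t ≠ 0}) ∧ ContDiffOn ℝ (⊤ : ℕ∞) Ψ (risingSet Φ ∩ {t | Ψ t ≠ 0}) := by
  set O := risingSet Φ ∩ {t | Ψ t ≠ 0} with hO
  have hOo : IsOpen O := (ConvexOn.isOpen_risingSet h.convex).inter
    (isOpen_ne_fun h.continuous continuous_const)
  have key : ∀ n : ℕ, ContDiffOn ℝ n Φ O ∧ ContDiffOn ℝ n Ψ O := by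
    intro n
    induction n with
    | zero => exact ⟨contDiffOn_zero.2 h.convex.locallyLipschitz.continuous.continuousOn,
        contDiffOn_zero.2 h.continuous.continuousOn⟩
    | succ n ih =>
      have hV : ContDiffOn ℝ n (fun s => k * Φ s / Ψ s) O :=
        (contDiffOn_const.mul ih.1).div ih.2 fun t ht => ht.2
      push_cast
      refine ⟨(contDiffOn_succ_iff_deriv_of_isOpen hOo).2 ⟨fun t ht =>
          (h.hasDerivAt_base ht.1 ht.2).differentiableAt.differentiableWithinAt, by simp, ?_⟩,
        (contDiffOn_succ_iff_deriv_of_isOpen hOo).2 ⟨fun t ht =>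
          (h.hasDerivAt ht.2).differentiableAt.differentiableWithinAt, by simp, ?_⟩⟩
      · exact (hV.pow 2).congr fun t ht => (h.hasDerivAt_base ht.1 ht.2).deriv
      · exact hV.congr fun t ht => (h.hasDerivAt ht.2).deriv
  have h1 : ContDiffOn ℝ (⊤ : ℕ∞) Φ O := contDiffOn_infty.2 fun n => (key n).1
  have h2 : ContDiffOn ℝ (⊤ : ℕ∞) Ψ O := contDiffOn_infty.2 fun n => (key n).2
  exact ⟨(contDiffOn_const.mul h1).div h2 fun t ht => ht.2, h2⟩

theorem eventually_lt_of_notMem {r₀ t₀ : ℝ} (hr : 0 < r₀) (ht : t₀ ∉ risingSet Φ ∩ {t | Ψ t ≠ 0}) :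
    ∀ᶠ t in 𝓝 t₀, t ∈ risingSet Φ → |Ψ t| < r₀ := by
  have hz : Ψ t₀ = 0 → ∀ᶠ t in 𝓝 t₀, t ∈ risingSet Φ → |Ψ t| < r₀ := fun h0 => by
    have h1 : Tendsto (fun t => |Ψ t|) (𝓝 t₀) (𝓝 |Ψ t₀|) := h.continuous.abs.continuousAt
    rw [h0, abs_zero] at h1
    exact (h1.eventually (gt_mem_nhds hr)).mono fun t ht _ => ht
  by_cases hm : t₀ ∈ risingSet Φ
  · exact hz (by_contra fun h' => ht ⟨hm, h'⟩)
  · by_cases hc : t₀ ∈ closure (risingSet Φ)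
    · exact hz (h.eq_zero_of_mem_closure hc hm)
    · filter_upwards [isClosed_closure.isOpen_compl.mem_nhds hc] with t ht ht'
      exact absurd (subset_closure ht') ht

end IsTransformPair

/-- Smooth functions supported in the annulus `r₀ ≤ |r| ≤ r₁`. -/
structure IsAnnular (H : ℝ → ℝ) (r₀ r₁ : ℝ) : Prop where
  contDiff : ContDiff ℝ (⊤ : ℕ∞) H
  pos : 0 < r₀
  eq_zero_of_lt : ∀ r, |r| < r₀ → H r = 0
  eq_zero_of_gt : ∀ r, r₁ < |r| → H r = 0

/-- `H' + (k - 1) H / r`. -/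
def kap (k : ℝ) (H : ℝ → ℝ) (r : ℝ) : ℝ := deriv H r + (k - 1) * (H r / r)

namespace IsAnnular

variable {H : ℝ → ℝ} {r₀ r₁ : ℝ} (hH : IsAnnular H r₀ r₁)

include hH

theorem deriv_eq_zero_of_lt {r : ℝ} (hr : |r| < r₀) : deriv H r = 0 := by
  have : H =ᶠ[𝓝 r] fun _ => 0 := by
    filter_upwards [(isOpen_lt continuous_abs continuous_const).mem_nhds hr] with s hs
    exact hH.eq_zero_of_lt s hs
  rw [this.deriv_eq]; simp

theorem deriv_eq_zero_of_gt {r : ℝ} (hr : r₁ < |r|) : deriv H r = 0 := by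
  have : H =ᶠ[𝓝 r] fun _ => 0 := by
    filter_upwards [(isOpen_lt continuous_const continuous_abs).mem_nhds hr] with s hs
    exact hH.eq_zero_of_gt s hs
  rw [this.deriv_eq]; simp

theorem hasCompactSupport : HasCompactSupport H :=
  HasCompactSupport.intro (isCompact_Icc (a := -r₁) (b := r₁)) fun r hr => by
    refine hH.eq_zero_of_gt r ?_
    by_contra h
    exact hr (abs_le.1 (not_lt.1 h))

theorem exists_bound (k : ℝ) : ∃ C, 0 ≤ C ∧ (∀ r, |H r| ≤ C) ∧ (∀ r, |deriv H r| ≤ C) ∧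
    ∀ r, |kap k H r| ≤ C := by
  obtain ⟨C₁, h₁⟩ := hH.hasCompactSupport.exists_bound_of_continuous hH.contDiff.continuous
  obtain ⟨C₂, h₂⟩ := hH.hasCompactSupport.deriv.exists_bound_of_continuous
    (hH.contDiff.continuous_deriv (by simp))
  have hC1 : 0 ≤ C₁ := (norm_nonneg _).trans (h₁ 0)
  have hC2 : 0 ≤ C₂ := (norm_nonneg _).trans (h₂ 0)
  have h0 := hH.pos
  have hp : 0 ≤ |k - 1| * (C₁ / r₀) := by positivity
  refine ⟨C₁ + C₂ + |k - 1| * (C₁ / r₀), by positivity, fun r => ?_, fun r => ?_, fun r => ?_⟩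
  · have := h₁ r; rw [Real.norm_eq_abs] at this; linarith
  · have := h₂ r; rw [Real.norm_eq_abs] at this; linarith
  · have e2 := h₂ r
    rw [Real.norm_eq_abs] at e2
    have e1 := h₁ r
    rw [Real.norm_eq_abs] at e1
    refine (abs_add_le _ _).trans ?_
    rw [abs_mul, abs_div]
    have : |H r| / |r| ≤ C₁ / r₀ := by
      by_cases hr : |r| < r₀
      · rw [hH.eq_zero_of_lt r hr]; simp; positivity
      · exact div_le_div₀ hC1 e1 h0 (not_lt.1 hr)
    have : |k - 1| * (|H r| / |r|) ≤ |k - 1| * (C₁ / r₀) := by gcongr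
    linarith

end IsAnnular

namespace IsTransformPair

variable {Φ Ψ : ℝ → ℝ} {k : ℝ} (h : IsTransformPair Φ Ψ k) {H : ℝ → ℝ} {r₀ r₁ : ℝ}
  (hH : IsAnnular H r₀ r₁)

open Classical in
/-- `f(Ψ) g` on the rising set, extended by zero. -/
def cutoff (Φ : ℝ → ℝ) (f : ℝ → ℝ) (t : ℝ) : ℝ := if t ∈ risingSet Φ then f t else 0

include h hH

/-- Near a point outside `{t ∈ risingSet Φ | Ψ t ≠ 0}`, every nearby point of the rising set has
small `|Ψ|`, where `H` vanishes; so the extension by zero is locally zero. -/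
theorem cutoff_aux {g : ℝ → ℝ} (hg : ContDiffOn ℝ (⊤ : ℕ∞) g (risingSet Φ ∩ {t | Ψ t ≠ 0})) (t₀ : ℝ) :
    (t₀ ∈ risingSet Φ ∩ {t | Ψ t ≠ 0} ∧ ContDiffAt ℝ (⊤ : ℕ∞) (fun t => H (Ψ t) * g t) t₀ ∧
      cutoff Φ (fun t => H (Ψ t) * g t) =ᶠ[𝓝 t₀] fun t => H (Ψ t) * g t) ∨
    (t₀ ∉ risingSet Φ ∩ {t | Ψ t ≠ 0} ∧
      cutoff Φ (fun t => H (Ψ t) * g t) =ᶠ[𝓝 t₀] fun _ => 0) := by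
  by_cases ht : t₀ ∈ risingSet Φ ∩ {t | Ψ t ≠ 0}
  · have hOo : IsOpen (risingSet Φ ∩ {t | Ψ t ≠ 0}) := (ConvexOn.isOpen_risingSet h.convex).inter
      (isOpen_ne_fun h.continuous continuous_const)
    refine Or.inl ⟨ht, ?_, ?_⟩
    · exact (hH.contDiff.contDiffAt.comp t₀ (h.contDiffOn_quot.2.contDiffAt (hOo.mem_nhds ht))).mul
        (hg.contDiffAt (hOo.mem_nhds ht))
    · filter_upwards [hOo.mem_nhds ht] with t ht
      simp [cutoff, ht.1]
  · refine Or.inr ⟨ht, ?_⟩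
    filter_upwards [h.eventually_lt_of_notMem hH.pos ht] with t ht
    by_cases hm : t ∈ risingSet Φ
    · simp [cutoff, hm, hH.eq_zero_of_lt _ (ht hm)]
    · simp [cutoff, hm]

theorem contDiff_cutoff {g : ℝ → ℝ} (hg : ContDiffOn ℝ (⊤ : ℕ∞) g (risingSet Φ ∩ {t | Ψ t ≠ 0})) :
    ContDiff ℝ (⊤ : ℕ∞) (cutoff Φ (fun t => H (Ψ t) * g t)) := by
  rw [contDiff_iff_contDiffAt]
  intro t
  rcases h.cutoff_aux hH hg t with ⟨-, h1, h2⟩ | ⟨-, h2⟩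
  · exact h1.congr_of_eventuallyEq h2
  · exact contDiffAt_const.congr_of_eventuallyEq h2

/-- With `V = kΦ/Ψ`: `(H(Ψ) V)' = H'(Ψ) V² + H(Ψ)(k - 1)V²/Ψ`. The factor `V²` converts the energy
of `u` into that of `Ψ(u)`. -/
theorem deriv_cutoff_quot (t : ℝ) :
    deriv (cutoff Φ (fun t => H (Ψ t) * (k * Φ t / Ψ t))) t =
      cutoff Φ (fun t => kap k H (Ψ t) * (k * Φ t / Ψ t) ^ 2) t := by
  rcases h.cutoff_aux hH h.contDiffOn_quot.1 t with ⟨ht, h1, h2⟩ | ⟨ht, h2⟩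
  · rw [h2.deriv_eq, cutoff, if_pos ht.1]
    have e1 := ((hH.contDiff.differentiable (by simp) (Ψ t)).hasDerivAt.comp t
      (h.hasDerivAt ht.2)).mul (h.hasDerivAt_quot ht.1 ht.2)
    have e2 : deriv (fun t => H (Ψ t) * (k * Φ t / Ψ t)) t = _ := e1.deriv
    rw [e2, kap]
    have := ht.2
    simp only [Function.comp]
    ring
  · rw [h2.deriv_eq, cutoff]
    split_ifs with hm
    · have h0 : Ψ t = 0 := by_contra fun h' => ht ⟨hm, h'⟩
      rw [h0, kap, hH.deriv_eq_zero_of_lt (by simpa using hH.pos)]; simp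
    · simp

theorem deriv_cutoff_one (t : ℝ) :
    deriv (cutoff Φ (fun t => H (Ψ t) * 1)) t =
      cutoff Φ (fun t => deriv H (Ψ t) * (k * Φ t / Ψ t)) t := by
  rcases h.cutoff_aux hH (g := fun _ => 1) contDiffOn_const t with ⟨ht, h1, h2⟩ | ⟨ht, h2⟩
  · rw [h2.deriv_eq, cutoff, if_pos ht.1]
    have e1 := ((hH.contDiff.differentiable (by simp) (Ψ t)).hasDerivAt.comp t
      (h.hasDerivAt ht.2))
    have e2 : deriv (fun t => H (Ψ t)) t = _ := e1.deriv
    simp only [mul_one]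
    rw [e2]
  · rw [h2.deriv_eq, cutoff]
    split_ifs with hm
    · have h0 : Ψ t = 0 := by_contra fun h' => ht ⟨hm, h'⟩
      rw [h0]; simp
    · simp

omit hH in
/-- A uniform bound for products with powers of `√|Φ'|`, restricted to the support of `H(Ψ)`. -/
theorem exists_bound_cutoff (hne : (risingSet Φ).Nonempty) {f : ℝ → ℝ} {C : ℝ}
    (hf : ∀ r, |f r| ≤ C) (hf0 : f 0 = 0) (hf1 : ∀ r, r₁ < |r| → f r = 0) (n : ℕ) :
    ∃ C', ∀ t, |cutoff Φ (fun t => f (Ψ t) * (k * Φ t / Ψ t) ^ n) t| ≤ C' := by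
  -- Beyond `T` the value `Ψ` exceeds `r₁` and `f(Ψ)` vanishes; before `T` the quotient is at most
  -- its value at `T`, by monotonicity.
  obtain ⟨T, hT, hT'⟩ := h.exists_forall_pos hne (max r₁ 0)
  have hC : 0 ≤ C := (abs_nonneg _).trans (hf 0)
  have hT0 : Ψ T ≠ 0 := ((le_max_right _ _).trans_lt (hT' T le_rfl)).ne'
  have hVT := h.quot_pos hT hT0
  refine ⟨C * (k * Φ T / Ψ T) ^ n, fun t => ?_⟩
  have hnn : 0 ≤ C * (k * Φ T / Ψ T) ^ n := by positivity
  rw [cutoff]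
  split_ifs with hm
  · by_cases ht : T ≤ t
    · have h1 := hT' t ht
      rw [hf1 (Ψ t) (((le_max_left _ _).trans_lt h1).trans_le (le_abs_self _))]
      simpa using hnn
    · by_cases h0 : Ψ t = 0
      · rw [h0, hf0]; simpa using hnn
      · have h1 := h.sq_quot_le (not_le.1 ht) hm h0 hT0
        have h2 := h.quot_pos hm h0
        rw [abs_mul, abs_of_pos (by positivity : 0 < (k * Φ t / Ψ t) ^ n)]
        exact mul_le_mul (hf _) (pow_le_pow_left₀ h2.le h1 n) (by positivity) hC
  · simpa using hnn

end IsTransformPair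

end CoarseGrained

end

/-! ### Annular truncations of the identity and the integral identity -/

noncomputable section
namespace CoarseGrained

variable {d : ℕ} {a : CoeffField d} {U W : Set (E d)} {G K M : E d → E d} {u v : E d → ℝ}

section AnnularId

/-- A smooth bump function on `ℝ`, equal to `1` on `[-1, 1]` and supported in `[-2, 2]`. -/
def logBump : ContDiffBump (0 : ℝ) := ⟨1, 2, one_pos, one_lt_two⟩

theorem logBump_one {x : ℝ} (h : |x| ≤ 1) : logBump x = 1 :=
  logBump.one_of_mem_closedBall (by simpa [logBump] using h)

theorem logBump_zero {x : ℝ} (h : 2 ≤ |x|) : logBump x = 0 :=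
  logBump.zero_of_le_dist (by simpa [logBump] using h)

/-- The function `r f(log |r| / n)`, where `f` is a bump function. -/
def annularId (n : ℝ) (r : ℝ) : ℝ := r * logBump (Real.log r / n)

variable {n : ℝ} (hn : 0 < n)

include hn

theorem annularId_eq_zero_of_lt {r : ℝ} (h : |r| < Real.exp (-2 * n)) : annularId n r = 0 := by
  by_cases hr : r = 0
  · simp [annularId, hr]
  · have h1 := Real.log_lt_log (abs_pos.2 hr) h
    rw [Real.log_abs, Real.log_exp] at h1
    rw [annularId, logBump_zero, mul_zero]
    rw [abs_div, abs_of_pos hn, le_div_iff₀ hn, abs_of_neg (by nlinarith)]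
    linarith

theorem annularId_eq_zero_of_gt {r : ℝ} (h : Real.exp (2 * n) < |r|) : annularId n r = 0 := by
  have h1 := Real.log_lt_log (Real.exp_pos _) h
  rw [Real.log_abs, Real.log_exp] at h1
  rw [annularId, logBump_zero, mul_zero]
  rw [abs_div, abs_of_pos hn, le_div_iff₀ hn]
  exact h1.le.trans (le_abs_self _)

theorem annularId_eq_self {r : ℝ} (h : |Real.log r| ≤ n) : annularId n r = r := by
  rw [annularId, logBump_one, mul_one]
  rw [abs_div, abs_of_pos hn]
  exact (div_le_one hn).2 h

theorem isAnnular_annularId : IsAnnular (annularId n) (Real.exp (-2 * n)) (Real.exp (2 * n)) where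
  contDiff := by
    rw [contDiff_iff_contDiffAt]
    intro r
    by_cases hr : r = 0
    · have : annularId n =ᶠ[𝓝 r] fun _ => 0 := by
        filter_upwards [(isOpen_lt continuous_abs continuous_const).mem_nhds
          (show |r| < Real.exp (-2 * n) by rw [hr, abs_zero]; exact Real.exp_pos _)] with s hs
        exact annularId_eq_zero_of_lt hn hs
      exact contDiffAt_const.congr_of_eventuallyEq this
    · exact contDiffAt_id.mul (logBump.contDiff.contDiffAt.comp r
        ((Real.contDiffAt_log.2 hr).div_const n))
  pos := Real.exp_pos _
  eq_zero_of_lt r hr := annularId_eq_zero_of_lt hn hr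
  eq_zero_of_gt r hr := annularId_eq_zero_of_gt hn hr

omit hn in
theorem abs_annularId_le (n r : ℝ) : |annularId n r| ≤ |r| := by
  rw [annularId, abs_mul, abs_of_nonneg logBump.nonneg]
  exact mul_le_of_le_one_right (abs_nonneg _) logBump.le_one

omit hn in
theorem exists_deriv_logBump_le : ∃ C, 0 ≤ C ∧ ∀ x, |deriv (logBump : ℝ → ℝ) x| ≤ C := by
  obtain ⟨C, hC⟩ := logBump.hasCompactSupport.deriv.exists_bound_of_continuous
    (logBump.contDiff (n := 1).continuous_deriv le_rfl)
  exact ⟨C, (norm_nonneg _).trans (hC 0), hC⟩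

/-- A cut-off in the logarithmic variable has `r d/dr` of order `1/n`, so the derivative exceeds `1`
by at most `C / n`. This derivative multiplies the leading energy term, so the excess has to
disappear in the limit. -/
theorem abs_deriv_annularId_le {C : ℝ} (hC : ∀ x, |deriv (logBump : ℝ → ℝ) x| ≤ C) (r : ℝ) :
    |deriv (annularId n) r| ≤ 1 + C / n := by
  have hC0 : 0 ≤ C := (abs_nonneg _).trans (hC 0)
  by_cases hr : r = 0
  · rw [(isAnnular_annularId hn).deriv_eq_zero_of_lt (by rw [hr, abs_zero]; exact Real.exp_pos _),
      abs_zero]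
    positivity
  · have h1 : HasDerivAt (fun r => Real.log r / n) (r⁻¹ / n) r := (Real.hasDerivAt_log hr).div_const n
    have h2 := (hasDerivAt_id r).mul ((((logBump.contDiff (n := 1)).differentiable one_ne_zero
      (Real.log r / n)).hasDerivAt).comp r h1)
    have h3 : deriv (annularId n) r = _ := h2.deriv
    rw [h3]
    simp only [Function.comp, one_mul, id]
    have h4 : r * (deriv (logBump : ℝ → ℝ) (Real.log r / n) * (r⁻¹ / n)) =
        deriv (logBump : ℝ → ℝ) (Real.log r / n) / n := by field_simp
    rw [h4]
    refine (abs_add_le _ _).trans (add_le_add ?_ ?_)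
    · rw [abs_of_nonneg logBump.nonneg]; exact logBump.le_one
    · rw [abs_div, abs_of_pos hn]
      gcongr
      exact hC _

theorem kap_annularId_of_lt {k r : ℝ} (hr : r ≠ 0) (h : |Real.log r| < n) :
    kap k (annularId n) r = k := by
  have h1 : annularId n =ᶠ[𝓝 r] fun s => s := by
    have : ∀ᶠ s in 𝓝 r, |Real.log s| < n :=
      ((Real.continuousAt_log hr).abs).eventually (gt_mem_nhds h)
    filter_upwards [this] with s hs
    exact annularId_eq_self hn hs.le
  rw [kap, h1.deriv_eq, h1.eq_of_nhds, div_self hr]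
  simp

theorem abs_kap_annularId_le {C k : ℝ} (hC : ∀ x, |deriv (logBump : ℝ → ℝ) x| ≤ C) (r : ℝ) :
    |kap k (annularId n) r| ≤ 1 + C / n + |k - 1| := by
  refine (abs_add_le _ _).trans (add_le_add (abs_deriv_annularId_le hn hC r) ?_)
  rw [abs_mul, abs_div]
  refine mul_le_of_le_one_right (abs_nonneg _) ?_
  exact div_le_one_of_le₀ (abs_annularId_le n r) (abs_nonneg _)

end AnnularId

section Transform

variable {Φ Ψ : ℝ → ℝ} {ε c k : ℝ}

theorem IsTransform.sub_eq (hΦ : ConvexOn ℝ univ Φ) (h : IsTransform Φ Ψ ε c) :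
    (∀ p q, Ψ q - Ψ p = ε * ∫ t in p..q, √|deriv Φ t|) ∧ IsQuotient Φ Ψ c ∧
      (Ψ 0 = 0 ∨ Tendsto Ψ atTop (𝓝 0)) := by
  rcases h with ⟨-, h1, h2⟩ | ⟨-, h0, h1, h2⟩
  · refine ⟨fun p q => ?_, h2, Or.inl (by rw [h1]; simp)⟩
    rw [h1, h1, ← intervalIntegral.integral_interval_sub_left
      (ConvexOn.intervalIntegrable_sqrt hΦ 0 q) (ConvexOn.intervalIntegrable_sqrt hΦ 0 p)]
    ring
  · have key : ∀ p q, ∫ t in Ioi p, √|deriv Φ t| =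
        (∫ t in p..q, √|deriv Φ t|) + ∫ t in Ioi q, √|deriv Φ t| := fun p q => by
      rw [intervalIntegral.integral_interval_add_Ioi (h0 p) (h0 q)]
    refine ⟨fun p q => ?_, h2, Or.inr ?_⟩
    · rw [h1, h1, key p q]; ring
    · have h3 := intervalIntegral_tendsto_integral_Ioi 0 (h0 0) tendsto_id
      have h4 : Ψ = fun q => -ε * ((∫ t in Ioi 0, √|deriv Φ t|) - ∫ t in (0 : ℝ)..q, √|deriv Φ t|) := by
        ext q; rw [h1, key 0 q]; ring
      rw [h4]
      simpa using (h3.const_sub (∫ t in Ioi 0, √|deriv Φ t|)).const_mul (-ε)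

/-- Composition with `t ↦ εt` removes the sign in front of the integral; `k` carries the sign in the
quotient identity. For `ε = -1` a limit at `∞` becomes a limit at `-∞`. -/
theorem IsTransform.exists_isTransformPair (hΦ : ConvexOn ℝ univ Φ) (hc : 0 < c)
    (h : IsTransform Φ Ψ ε c) (hε : ε = 1 ∨ ε = -1) :
    ∃ k, |k| = c ∧ IsTransformPair (fun t => Φ (ε * t)) (fun t => Ψ (ε * t)) k := by
  obtain ⟨h1, ⟨η, hη, h2⟩, h3⟩ := h.sub_eq hΦ
  refine ⟨η * c, ?_, ?_⟩
  · rw [abs_mul, abs_of_pos hc]; rcases hη with rfl | rfl <;> simp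
  rcases hε with rfl | rfl
  · simp only [one_mul]
    refine ⟨hΦ, fun p q => by rw [h1, one_mul], fun t ht => by rw [h2 t ht]; ring, ?_⟩
    exact h3.imp_right Or.inr
  · simp only [neg_mul, one_mul]
    have hd : ∀ t, deriv (fun t => Φ (-t)) t = -deriv Φ (-t) := fun t => deriv_comp_neg Φ t
    refine ⟨?_, fun p q => ?_, fun t ht => ?_, ?_⟩
    · have := hΦ.comp_linearMap (-LinearMap.id : ℝ →ₗ[ℝ] ℝ)
      simpa [Function.comp_def] using this
    · rw [h1]
      simp only [hd, abs_neg]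
      rw [intervalIntegral.integral_comp_neg (fun t => √|deriv Φ t|),
        intervalIntegral.integral_symm (-p)]
      ring
    · have h4 : DifferentiableAt ℝ Φ (-t) := by
        have : DifferentiableAt ℝ (fun s => Φ (-s)) (- -t) := by rwa [neg_neg]
        have h5 := this.comp (-t) (f := fun s => -s) (by fun_prop)
        simpa [Function.comp_def] using h5
      rw [h2 _ h4, hd, abs_neg]; ring
    · rcases h3 with h3 | h3
      · exact Or.inl (by simpa using h3)
      · exact Or.inr (Or.inl (h3.comp tendsto_neg_atBot_atTop))

end Transform

theorem HasGrad.const_mul (hW : IsOpen W) (hWf : volume W ≠ ∞) (ha : IsCoefficientField a W)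
    (hu : HasGrad a W u G) (c : ℝ) : HasGrad a W (fun x => c * u x) (fun x => c • G x) := by
  have h1 : ∀ t, deriv (fun s : ℝ => c * s) t = c := fun t => by simp
  have := hu.comp hW hWf ha (S := fun s => c * s) (C := |c|) (contDiff_const.mul contDiff_id)
    (fun t => by rw [h1])
  simpa only [h1] using this

theorem HasGrad.sub (hW : IsOpen W) (hWf : volume W ≠ ∞) (ha : IsCoefficientField a W)
    (hu : HasGrad a W u G) (hv : HasGrad a W v K) :
    HasGrad a W (fun x => u x - v x) (fun x => G x - K x) := by
  have := hu.add hW ha (hv.const_mul hW hWf ha (-1))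
  simpa [sub_eq_add_neg] using this

theorem IsSol.const_mul (hW : IsOpen W) (hWf : volume W ≠ ∞) (ha : IsCoefficientField a W)
    (hu : IsSol a W u G) (c : ℝ) : IsSol a W (fun x => c * u x) (fun x => c • G x) where
  hasGrad := hu.hasGrad.const_mul hW hWf ha c
  weak ψ hψ := by
    rw [flux_smul a (fun _ => c)]
    simp only [real_inner_smul_right]
    rw [integral_const_mul, hu.weak ψ hψ, mul_zero]

/-- The identity satisfied by the transform of a solution. -/
theorem IsTransformPair.integral_identity {Φ Ψ : ℝ → ℝ} {k : ℝ} (h : IsTransformPair Φ Ψ k)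
    (hW : IsOpen W) (hWf : volume W ≠ ∞) (ha : IsCoefficientField a W) (hu : IsSol a W u G)
    (hmono : MonotoneOn Φ (u '' W)) (hw : HasGrad a W (fun x => Ψ (u x)) K) :
    K =ᵐ[volume.restrict W] 0 ∨ (1 ≤ k ∧ k ≤ 2 ∧ ∀ H r₀ r₁, IsAnnular H r₀ r₁ →
      ∀ η, IsTest W η → ∫ x in W, η x * kap k H (Ψ (u x)) * energyDensity a K x =
        -∫ x in W, H (Ψ (u x)) * inner ℝ (gradient η x) (flux a K x)) := by
  obtain ⟨r, hr⟩ := h.exists_eq_zero_or_eq hmono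
  -- Outside the rising set, `Ψ(u)` takes only the values `0` and `Ψ r`, and a gradient vanishes
  -- almost everywhere on level sets.
  have hoff : ∀ᵐ x ∂(volume.restrict W), u x ∉ risingSet Φ → K x = 0 := by
    filter_upwards [hw.ae_eq_zero_of_eq hW hWf ha 0, hw.ae_eq_zero_of_eq hW hWf ha (Ψ r),
      ae_restrict_mem hW.measurableSet] with x h1 h2 hx hnot
    rcases hr (u x) (mem_image_of_mem u hx) hnot with h3 | h3
    · exact h1 h3
    · exact h2 (by rw [h3])
  by_cases hne : (risingSet Φ).Nonempty
  swap
  · left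
    rw [not_nonempty_iff_eq_empty] at hne
    filter_upwards [hoff] with x hx
    exact hx (by rw [hne]; simp)
  refine Or.inr ⟨h.one_le hne, h.le_two hne, fun H r₀ r₁ hH η hη => ?_⟩
  -- Both sides are gradients: of `H'(Ψ(u))` by the chain rule in `Ψ(u)`, and of its extension by
  -- zero, a smooth function of `u`. The two functions agree where `u` lies in the rising set, so
  -- their gradients agree there. In this way the relation `∇Ψ(u) = V ∇u` is obtained without a
  -- chain rule for `Ψ` itself.
  have hchain : ∀ H' s₀ s₁, IsAnnular H' s₀ s₁ → ∀ᵐ x ∂(volume.restrict W), u x ∈ risingSet Φ →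
      deriv H' (Ψ (u x)) • K x = (deriv H' (Ψ (u x)) * (k * Φ (u x) / Ψ (u x))) • G x := by
    intro H' s₀ s₁ hH'
    obtain ⟨C, hC0, hC1, hC2, hC3⟩ := hH'.exists_bound k
    obtain ⟨C', hC'⟩ := h.exists_bound_cutoff hne hC2
      (hH'.deriv_eq_zero_of_lt (by simpa using hH'.pos)) (fun _ => hH'.deriv_eq_zero_of_gt) 1
    have hF := hu.hasGrad.comp hW hWf ha (h.contDiff_cutoff hH' (g := fun _ => 1) contDiffOn_const)
      (C := C') (fun t => by rw [h.deriv_cutoff_one hH']; simpa using hC' t)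
    have hz := (hw.comp hW hWf ha hH'.contDiff hC2).sub hW hWf ha hF
    filter_upwards [hz.ae_eq_zero_of_eq hW hWf ha 0] with x hx hm
    have h1 := hx (by simp [cutoff, hm])
    rw [h.deriv_cutoff_one hH', cutoff, if_pos hm] at h1
    exact sub_eq_zero.1 h1
  -- For this `n`, `annularId n` has derivative `1` on the whole annulus `r₀ ≤ |r| ≤ r₁` that
  -- carries `H`.
  obtain ⟨n, hn, hn0, hn1⟩ : ∃ n : ℝ, 0 < n ∧ -n < Real.log r₀ ∧ Real.log r₁ < n := by
    refine ⟨|Real.log r₀| + |Real.log r₁| + 1, by positivity, ?_, ?_⟩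
    · linarith [neg_abs_le (Real.log r₀), abs_nonneg (Real.log r₁)]
    · linarith [le_abs_self (Real.log r₁), abs_nonneg (Real.log r₀)]
  have hK : ∀ᵐ x ∂(volume.restrict W), u x ∈ risingSet Φ →
      r₀ ≤ |Ψ (u x)| → |Ψ (u x)| ≤ r₁ → K x = (k * Φ (u x) / Ψ (u x)) • G x := by
    filter_upwards [hchain _ _ _ (isAnnular_annularId hn)] with x hx hm h0 h1
    have hne0 : Ψ (u x) ≠ 0 := fun h' => by
      rw [h', abs_zero] at h0; exact absurd hH.pos (not_lt.2 h0)
    have hpos := abs_pos.2 hne0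
    have hlog : |Real.log (Ψ (u x))| < n := by
      rw [← Real.log_abs, abs_lt]
      exact ⟨hn0.trans_le (Real.log_le_log hH.pos h0), (Real.log_le_log hpos h1).trans_lt hn1⟩
    have hd : deriv (annularId n) (Ψ (u x)) = 1 := by
      have := kap_annularId_of_lt (k := 1) hn hne0 hlog
      simpa [kap] using this
    have := hx hm
    rwa [hd, one_smul, one_mul] at this
  obtain ⟨C, hC0, hC1, hC2, hC3⟩ := hH.exists_bound k
  have hH0 : H 0 = 0 := hH.eq_zero_of_lt 0 (by simpa using hH.pos)
  have hkap0 : kap k H 0 = 0 := by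
    simp [kap, hH.deriv_eq_zero_of_lt (r := 0) (by simpa using hH.pos)]
  have hkap1 : ∀ r, r₁ < |r| → kap k H r = 0 := fun r hr => by
    rw [kap, hH.deriv_eq_zero_of_gt hr, hH.eq_zero_of_gt r hr]; simp
  have hkap2 : ∀ r, |r| < r₀ → kap k H r = 0 := fun r hr => by
    rw [kap, hH.deriv_eq_zero_of_lt hr, hH.eq_zero_of_lt r hr]; simp
  obtain ⟨C₁, hC₁⟩ := h.exists_bound_cutoff hne hC1 hH0 hH.eq_zero_of_gt 1
  obtain ⟨C₂, hC₂⟩ := h.exists_bound_cutoff hne hC3 hkap0 hkap1 2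
  -- The test function is `η H(Ψ(u)) V(u)`. In the resulting identity the factors `V²` and `V` turn
  -- `∇u` into `K`; off the annulus, and off the rising set, both integrands vanish.
  have hS := hu.integral_comp hW hWf ha (h.contDiff_cutoff hH h.contDiffOn_quot.1)
    (C := max C₁ C₂) (fun t => by
      rw [h.deriv_cutoff_quot hH]; exact (hC₂ t).trans (le_max_right _ _))
    (fun t => by have := hC₁ t; simp only [pow_one] at this; exact this.trans (le_max_left _ _)) hη
  refine (integral_congr_ae ?_).trans (hS.trans (congrArg Neg.neg (integral_congr_ae ?_)))
  · filter_upwards [hK, hoff] with x h1 h2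
    rw [h.deriv_cutoff_quot hH, cutoff]
    split_ifs with hm
    · by_cases h3 : r₀ ≤ |Ψ (u x)| ∧ |Ψ (u x)| ≤ r₁
      · have h4 := h1 hm h3.1 h3.2
        have h5 : energyDensity a K x = (k * Φ (u x) / Ψ (u x)) ^ 2 * energyDensity a G x := by
          simp only [energyDensity, flux, h4, map_smul, real_inner_smul_left, real_inner_smul_right]
          ring
        rw [h5]; ring
      · have : kap k H (Ψ (u x)) = 0 := by
          by_cases h4 : |Ψ (u x)| < r₀
          · exact hkap2 _ h4
          · exact hkap1 _ (not_le.1 fun h5 => h3 ⟨not_lt.1 h4, h5⟩)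
        rw [this]; simp
    · have h3 := h2 hm
      simp [energyDensity, h3]
  · filter_upwards [hK, hoff] with x h1 h2
    rw [cutoff]
    split_ifs with hm
    · by_cases h3 : r₀ ≤ |Ψ (u x)| ∧ |Ψ (u x)| ≤ r₁
      · have h4 := h1 hm h3.1 h3.2
        simp only [flux, h4, map_smul, real_inner_smul_right]
        ring
      · have : H (Ψ (u x)) = 0 := by
          by_cases h4 : |Ψ (u x)| < r₀
          · exact hH.eq_zero_of_lt _ h4
          · exact hH.eq_zero_of_gt _ (not_le.1 fun h5 => h3 ⟨not_lt.1 h4, h5⟩)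
        rw [this]; simp
    · have h3 := h2 hm
      simp [flux, h3]

end CoarseGrained

end

/-! ### Completeness in energy and the Dirichlet problem -/

noncomputable section
namespace CoarseGrained

variable {d : ℕ} {a : CoeffField d} {U W : Set (E d)} {G K M : E d → E d} {u v : E d → ℝ}

section Completeness

theorem exists_ae_tendsto_of_integral_le {α F : Type*} [MeasurableSpace α] {μ : Measure α}
    [NormedAddCommGroup F] [CompleteSpace F] {f : ℕ → α → F} (hf : ∀ n, Integrable (f n) μ) {C : ℝ}
    (hC : ∀ N n m, N ≤ n → N ≤ m → ∫ x, ‖f n x - f m x‖ ∂μ ≤ C * (1 / 2) ^ N) :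
    ∃ g : α → F, AEStronglyMeasurable g μ ∧
      ∀ᵐ x ∂μ, Tendsto (fun n => f n x) atTop (𝓝 (g x)) := by
  have hC0 : 0 ≤ C := by
    have := hC 0 0 0 le_rfl le_rfl
    simpa using this
  have h1 := Lp.ae_tendsto_of_cauchy_eLpNorm (p := 1) (fun n => (hf n).1) le_rfl
    (B := fun N => ENNReal.ofReal (C + 1) * (ENNReal.ofReal (1 / 2)) ^ N) ?_ ?_
  · obtain ⟨g, hg, hg'⟩ := exists_stronglyMeasurable_limit_of_tendsto_ae (fun n => (hf n).1) h1
    exact ⟨g, hg.aestronglyMeasurable, hg'⟩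
  · rw [ENNReal.tsum_mul_left, ENNReal.tsum_geometric]
    exact ENNReal.mul_ne_top ENNReal.ofReal_ne_top (ENNReal.inv_ne_top.2
      (tsub_pos_of_lt (ENNReal.ofReal_lt_one.2 (by norm_num))).ne')
  · intro N n m hn hm
    rw [← ENNReal.ofReal_pow (by norm_num), ← ENNReal.ofReal_mul (by positivity),
      eLpNorm_one_eq_lintegral_enorm]
    rw [← ofReal_integral_norm_eq_lintegral_enorm ((hf n).sub (hf m))]
    refine (ENNReal.ofReal_lt_ofReal_iff (by positivity)).2 ?_
    refine (hC N n m hn hm).trans_lt ?_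
    gcongr
    linarith

theorem tendsto_eLpNorm_of_bounded {α : Type*} [MeasurableSpace α] {μ : Measure α}
    [IsFiniteMeasure μ] {f : ℕ → α → ℝ} {g : α → ℝ} {C : ℝ}
    (hf : ∀ n, AEStronglyMeasurable (f n) μ) (hg : AEStronglyMeasurable g μ)
    (hC : ∀ n, ∀ᵐ x ∂μ, |f n x| ≤ C)
    (h : ∀ᵐ x ∂μ, Tendsto (fun n => f n x) atTop (𝓝 (g x))) :
    Tendsto (fun n => eLpNorm (fun x => f n x - g x) 2 μ) atTop (𝓝 0) := by
  have hgC : ∀ᵐ x ∂μ, |g x| ≤ C := by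
    filter_upwards [h, ae_all_iff.2 hC] with x hx hc
    exact le_of_tendsto hx.abs (Eventually.of_forall hc)
  have h1 : Tendsto (fun n => ∫⁻ x, ‖f n x - g x‖ₑ ^ (2 : ℝ) ∂μ) atTop (𝓝 (∫⁻ x, 0 ∂μ)) := by
    refine tendsto_lintegral_of_dominated_convergence'
      (fun _ => (ENNReal.ofReal (C + C)) ^ (2 : ℝ)) (fun n => ?_) (fun n => ?_) ?_ ?_
    · exact ((hf n).sub hg).enorm.pow_const _
    · filter_upwards [hC n, hgC] with x h1 h2
      gcongr
      rw [← ofReal_norm, Real.norm_eq_abs]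
      exact ENNReal.ofReal_le_ofReal ((abs_sub _ _).trans (add_le_add h1 h2))
    · rw [lintegral_const]
      exact ENNReal.mul_ne_top (ENNReal.rpow_ne_top_of_nonneg (by norm_num) ENNReal.ofReal_ne_top)
        (measure_ne_top _ _)
    · filter_upwards [h] with x hx
      have h2 : Tendsto (fun n => f n x - g x) atTop (𝓝 0) := by simpa using hx.sub_const (g x)
      have h3 := ((continuous_enorm.tendsto _).comp h2)
      have h4 := (ENNReal.continuous_rpow_const (y := 2)).tendsto _ |>.comp h3
      simpa [Function.comp_def] using h4
  rw [lintegral_zero] at h1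
  have h5 := (ENNReal.continuous_rpow_const (y := 1 / 2)).tendsto _ |>.comp h1
  rw [ENNReal.zero_rpow_of_pos (by norm_num)] at h5
  refine h5.congr fun n => ?_
  rw [eLpNorm_eq_lintegral_rpow_enorm_toReal (by simp) (by simp)]
  simp

/-- Cauchy in energy implies Cauchy in `L¹`, because `a⁻¹` is integrable. This provides an almost
everywhere limit, and Fatou's lemma bounds the energy of the difference from it. -/
theorem exists_energy_limit (ha : IsCoefficientField a W) {G : ℕ → E d → E d}
    (hG : ∀ n, FiniteEnergy a W (G n))
    (hC : ∀ N n m, N ≤ n → N ≤ m →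
      bil a W (fun x => G n x - G m x) (fun x => G n x - G m x) ≤ (1 / 4) ^ N) :
    ∃ K, FiniteEnergy a W K ∧
      Tendsto (fun n => bil a W (fun x => G n x - K x) (fun x => G n x - K x)) atTop (𝓝 0) := by
  have hsq : ∀ N : ℕ, √((1 / 4 : ℝ) ^ N) = (1 / 2) ^ N := fun N => by
    rw [show (1 / 4 : ℝ) = (1 / 2) ^ 2 by norm_num, ← pow_mul, mul_comm, pow_mul,
      Real.sqrt_sq (by positivity)]
  obtain ⟨K, hKm, hK⟩ := exists_ae_tendsto_of_integral_le (μ := volume.restrict W)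
    (f := G) (C := √(traceInv a W)) (fun n => (hG n).integrable_self ha) (fun N n m hn hm => by
      refine (((hG n).sub ha (hG m)).integral_norm_le ha).trans ?_
      rw [← hsq, ← Real.sqrt_mul' _ (by positivity)]
      refine Real.sqrt_le_sqrt (mul_le_mul_of_nonneg_left (hC N n m hn hm) ?_)
      refine integral_nonneg_of_ae ?_
      filter_upwards [ha.posDef] with x hx
      exact Finset.sum_nonneg fun i _ => hx.inv.posSemidef.diag_nonneg)
  have hle : ∀ n, energy a W (fun x => G n x - K x) ≤ ENNReal.ofReal ((1 / 4) ^ n) := fun n => by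
    have hmeas : ∀ m, AEMeasurable (fun x => ENNReal.ofReal
        (energyDensity a (fun x => G n x - G m x) x)) (volume.restrict W) := fun m =>
      (((hG n).sub ha (hG m)).integrable ha).1.aemeasurable.ennreal_ofReal
    have h1 : energy a W (fun x => G n x - K x) ≤
        ∫⁻ x in W, liminf (fun m => ENNReal.ofReal
          (energyDensity a (fun x => G n x - G m x) x)) atTop := by
      refine lintegral_mono_ae ?_
      filter_upwards [hK] with x hx
      refine le_of_eq (Tendsto.liminf_eq ?_).symm
      refine (ENNReal.continuous_ofReal.tendsto _).comp ?_
      have h2 : Tendsto (fun m => G n x - G m x) atTop (𝓝 (G n x - K x)) := hx.const_sub _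
      have h3 : Continuous fun y : E d => inner ℝ y (Matrix.toEuclideanLin (a x) y) :=
        continuous_id.inner (LinearMap.continuous_of_finiteDimensional _)
      exact (h3.tendsto _).comp h2
    refine h1.trans ((lintegral_liminf_le' hmeas).trans ?_)
    refine liminf_le_of_frequently_le' (Eventually.frequently ?_)
    filter_upwards [eventually_ge_atTop n] with m hm
    have := energy_eq_ofReal ha ((hG n).sub ha (hG m))
    rw [energy] at this
    rw [this]
    exact ENNReal.ofReal_le_ofReal (hC n n m le_rfl hm)
  have hfe : ∀ n, FiniteEnergy a W (fun x => G n x - K x) := fun n =>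
    ⟨(hG n).aesm.sub hKm, (hle n).trans_lt ENNReal.ofReal_lt_top⟩
  refine ⟨K, ?_, ?_⟩
  · have := (hG 0).sub ha (hfe 0)
    simpa using this
  · refine squeeze_zero (fun n => bil_self_nonneg ha _) (fun n => ?_)
      (tendsto_pow_atTop_nhds_zero_of_lt_one (by norm_num) (by norm_num : (1 / 4 : ℝ) < 1))
    have := hle n
    rw [energy_eq_ofReal ha (hfe n)] at this
    exact (ENNReal.ofReal_le_ofReal_iff (by positivity)).1 this

end Completeness

section Poincare

/-- The Poincaré inequality is needed in `L¹`, since the energy controls gradients only in that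
space. -/
theorem exists_integral_abs_le_of_test (hd : 2 ≤ d) (hW : Bornology.IsBounded W) :
    ∃ C : ℝ, 0 ≤ C ∧ ∀ ψ, IsTest W ψ → ∫ x in W, |ψ x| ≤ C * ∫ x in W, ‖gradient ψ x‖ := by
  refine ⟨eLpNormLESNormFDerivOfLeConst ℝ (volume : Measure (E d)) W 1 1, NNReal.coe_nonneg _,
    fun ψ hψ => ?_⟩
  have h := eLpNorm_le_eLpNorm_fderiv_of_le (volume : Measure (E d)) hψ.contDiff_one (s := W)
    (fun x hx => by_contra fun h => hx (hψ.eq_zero h)) (p := 1) (q := 1) le_rfl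
    (by rw [finrank_euclideanSpace_fin]; exact_mod_cast hd) (by simp) hW
  have i1 : Integrable ψ :=
    hψ.contDiff_one.continuous.integrable_of_hasCompactSupport hψ.hasCompactSupport
  have i2 : Integrable (fderiv ℝ ψ) :=
    (hψ.contDiff_one.continuous_fderiv one_ne_zero).integrable_of_hasCompactSupport
      (hψ.hasCompactSupport.fderiv ℝ)
  rw [ENNReal.coe_one, eLpNorm_one_eq_lintegral_enorm, eLpNorm_one_eq_lintegral_enorm,
    ← ofReal_integral_norm_eq_lintegral_enorm i1, ← ofReal_integral_norm_eq_lintegral_enorm i2,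
    ← ENNReal.ofReal_coe_nnreal, ← ENNReal.ofReal_mul (NNReal.coe_nonneg _)] at h
  have h3 := (ENNReal.ofReal_le_ofReal_iff (mul_nonneg (NNReal.coe_nonneg _)
    (integral_nonneg fun _ => norm_nonneg _))).1 h
  have e1 : ∫ x in W, |ψ x| = ∫ x, ‖ψ x‖ := by
    rw [setIntegral_eq_integral_of_forall_compl_eq_zero fun x hx => by rw [hψ.eq_zero hx, abs_zero]]
    rfl
  have e2 : ∫ x in W, ‖gradient ψ x‖ = ∫ x, ‖fderiv ℝ ψ x‖ := by
    rw [setIntegral_eq_integral_of_forall_compl_eq_zero fun x hx => by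
      rw [hψ.gradient_eq_zero hx, norm_zero]]
    simp only [norm_gradient]
  rw [e1, e2]
  exact h3

end Poincare

section Truncation

/-- Smooth truncations. -/
theorem exists_truncation (B : ℝ) (hB : 0 ≤ B) : ∃ T : ℝ → ℝ, ContDiff ℝ (⊤ : ℕ∞) T ∧
    (∀ r, |r| ≤ B → T r = r) ∧ (∀ r, |deriv T r| ≤ 1) ∧ ∀ r, |T r| ≤ B + 2 := by
  let χ : ContDiffBump (0 : ℝ) := ⟨B + 1, B + 2, by linarith, by linarith⟩
  have hc : Continuous (χ : ℝ → ℝ) := χ.continuous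
  have hd : ∀ r, HasDerivAt (fun r => ∫ s in (0 : ℝ)..r, χ s) (χ r) r := fun r =>
    intervalIntegral.integral_hasDerivAt_right (hc.intervalIntegrable _ _)
      hc.stronglyMeasurable.stronglyMeasurableAtFilter hc.continuousAt
  have hχ1 : ∀ r, |r| ≤ B + 1 → χ r = 1 := fun r hr =>
    χ.one_of_mem_closedBall (by simpa [χ] using hr)
  have hχ0 : ∀ r, B + 2 ≤ |r| → χ r = 0 := fun r hr => χ.zero_of_le_dist (by simpa [χ] using hr)
  refine ⟨fun r => ∫ s in (0 : ℝ)..r, χ s, ?_, fun r hr => ?_, fun r => ?_, fun r => ?_⟩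
  · rw [contDiff_infty_iff_deriv]
    refine ⟨fun r => (hd r).differentiableAt, ?_⟩
    have : deriv (fun r => ∫ s in (0 : ℝ)..r, χ s) = χ := by ext r; exact (hd r).deriv
    rw [this]
    exact χ.contDiff
  · have : ∫ s in (0 : ℝ)..r, χ s = ∫ s in (0 : ℝ)..r, 1 := by
      refine intervalIntegral.integral_congr fun s hs => hχ1 s ?_
      have h1 := abs_sub_left_of_mem_uIcc hs
      simp only [sub_zero] at h1
      linarith
    simp only [this]; simp
  · rw [(hd r).deriv, abs_of_nonneg χ.nonneg]; exact χ.le_one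
  · have key : ∀ r, 0 ≤ r → |∫ s in (0 : ℝ)..r, χ s| ≤ B + 2 ∧
        |∫ s in (-r)..0, χ s| ≤ B + 2 := by
      intro r hr
      have gen : ∀ p q, p ≤ q → min |p| |q| = 0 → |∫ s in p..q, χ s| ≤ B + 2 := by
        intro p q hpq h0
        have hint : IntegrableOn χ (Ioc p q) := (hc.integrableOn_Icc).mono_set Ioc_subset_Icc_self
        rw [intervalIntegral.integral_of_le hpq, abs_of_nonneg (integral_nonneg fun _ => χ.nonneg)]
        have h1 : ∫ s in Ioc p q, χ s ≤
            ∫ s in Ioc p q, (Icc (-(B + 2)) (B + 2)).indicator (fun _ => (1 : ℝ)) s := by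
          refine integral_mono hint ?_ fun s => ?_
          · exact (integrable_const 1).indicator measurableSet_Icc
          · by_cases hs : s ∈ Icc (-(B + 2)) (B + 2)
            · rw [indicator_of_mem hs]; exact χ.le_one
            · rw [indicator_of_notMem hs, hχ0]
              by_contra h'
              exact hs (abs_le.1 (not_le.1 h').le)
        refine h1.trans ?_
        rw [setIntegral_indicator measurableSet_Icc, setIntegral_const, smul_eq_mul, mul_one]
        rcases min_choice |p| |q| with h2 | h2 <;> rw [h2] at h0 <;> rw [abs_eq_zero] at h0 <;> subst h0
        · calc volume.real (Ioc 0 q ∩ Icc (-(B + 2)) (B + 2)) ≤ volume.real (Icc 0 (B + 2)) :=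
              measureReal_mono (fun s hs => ⟨hs.1.1.le, hs.2.2⟩) (by simp)
            _ ≤ _ := by rw [Real.volume_real_Icc_of_le (by linarith)]; linarith
        · calc volume.real (Ioc p 0 ∩ Icc (-(B + 2)) (B + 2)) ≤ volume.real (Icc (-(B + 2)) 0) :=
              measureReal_mono (fun s hs => ⟨hs.2.1, hs.1.2⟩) (by simp)
            _ ≤ _ := by rw [Real.volume_real_Icc_of_le (by linarith)]; linarith
      exact ⟨gen 0 r hr (by simp), gen (-r) 0 (by linarith) (by simp)⟩
    rcases le_total 0 r with hr | hr
    · exact (key r hr).1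
    · have := (key (-r) (by linarith)).2
      rw [neg_neg] at this
      simp only
      rw [intervalIntegral.integral_symm, abs_neg]
      exact this

end Truncation

section Dirichlet

/-- Solvability of the Dirichlet problem with smooth, bounded boundary data of finite energy. -/
theorem exists_dirichlet_solution (hd : 2 ≤ d) (hW : IsOpen W) (hWb : Bornology.IsBounded W)
    (ha : IsCoefficientField a W) {m : E d → ℝ} (hm : ContDiffOn ℝ (⊤ : ℕ∞) m W) {B : ℝ}
    (hB : ∀ x ∈ W, |m x| ≤ B) (hfe : FiniteEnergy a W (gradient m)) :
    ∃ w Gw, IsSol a W w Gw ∧ ∫ x in W, Gw x = ∫ x in W, gradient m x ∧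
      bil a W Gw Gw ≤ bil a W (gradient m) (gradient m) ∧
      bil a W Gw (gradient m) = bil a W Gw Gw ∧ ∃ C, ∀ᵐ x ∂(volume.restrict W), |w x| ≤ C := by
  have hWf : volume W ≠ ∞ := hWb.measure_lt_top.ne
  have hfin : IsFiniteMeasure (volume.restrict W) := ⟨by simpa using hWf.lt_top⟩
  have hdm : ∀ x ∈ W, DifferentiableAt ℝ m x := fun x hx =>
    (hm.contDiffAt (hW.mem_nhds hx)).differentiableAt (by simp)
  -- the gradients of the competitors
  set Gr : (E d → ℝ) → E d → E d := fun ψ x => gradient m x + gradient ψ x with hGr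
  have hfψ : ∀ ψ, IsTest W ψ → FiniteEnergy a W (gradient ψ) := fun ψ hψ => by
    obtain ⟨C, -, -, hC⟩ := hψ.exists_bound
    exact .of_bounded ha (continuous_gradient hψ.contDiff_one).aestronglyMeasurable
      (Eventually.of_forall hC)
  have hfG : ∀ ψ, IsTest W ψ → FiniteEnergy a W (Gr ψ) := fun ψ hψ => hfe.add ha (hfψ ψ hψ)
  set A : Set ℝ := {e | ∃ ψ, IsTest W ψ ∧ bil a W (Gr ψ) (Gr ψ) = e} with hA
  have htest0 : IsTest W fun _ : E d => (0 : ℝ) :=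
    ⟨contDiff_const, HasCompactSupport.zero, by simp [tsupport]⟩
  have hAne : A.Nonempty := ⟨_, _, htest0, rfl⟩
  have hAbd : BddBelow A := ⟨0, by rintro e ⟨ψ, -, rfl⟩; exact bil_self_nonneg ha _⟩
  set I := sInf A with hI
  have hIle : ∀ ψ, IsTest W ψ → I ≤ bil a W (Gr ψ) (Gr ψ) := fun ψ hψ =>
    csInf_le hAbd ⟨ψ, hψ, rfl⟩
  -- The Poincaré inequality gives convergence of a minimizing sequence only in `L¹`. Uniform
  -- bounds, obtained by truncating the competitors, upgrade it to the `L²` convergence that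
  -- membership in `H¹_a` requires. The truncation fixes the values of `m` and does not increase the
  -- energy, because `|T'| ≤ 1`.
  obtain ⟨T, hT1, hT2, hT3, hT4⟩ := exists_truncation |B| (abs_nonneg B)
  -- truncation of competitors
  have htrunc : ∀ ψ, IsTest W ψ → ∃ ψ', IsTest W ψ' ∧ bil a W (Gr ψ') (Gr ψ') ≤ bil a W (Gr ψ) (Gr ψ) ∧
      ∀ x ∈ W, |m x + ψ' x| ≤ |B| + 2 := by
    intro ψ hψ
    have hmB : ∀ x ∈ W, T (m x) = m x := fun x hx => hT2 _ ((hB x hx).trans (le_abs_self B))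
    have hsm : ContDiffOn ℝ (⊤ : ℕ∞) (fun x => T (m x + ψ x) - m x) W :=
      (hT1.comp_contDiffOn (hm.add hψ.contDiff.contDiffOn)).sub hm
    classical
    obtain ⟨χ, hχs, hχc, hχ1⟩ : ∃ χ : E d → ℝ, ContDiff ℝ (⊤ : ℕ∞) χ ∧ IsTest W χ ∧
        ∀ x ∈ tsupport ψ, χ x = 1 := by
      obtain ⟨K', hK'1, hK'2, hK'3⟩ := exists_compact_between hψ.hasCompactSupport hW
        hψ.tsupport_subset
      obtain ⟨f, hf1, -, hf2, hf3⟩ := exists_contMDiff_support_eq_eq_one_iff (modelWithCornersSelf ℝ (E d))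
        (n := (⊤ : ℕ∞)) isOpen_interior (isClosed_tsupport ψ) hK'2
      have hsub : tsupport f ⊆ K' := by
        rw [tsupport, hf2]
        exact closure_minimal interior_subset hK'1.isClosed
      exact ⟨f, hf1.contDiff, ⟨hf1.contDiff, hK'1.of_isClosed_subset (isClosed_tsupport f) hsub,
        hsub.trans hK'3⟩, fun x hx => (hf3 x).1 hx⟩
    -- The function `T(m + ψ) - m` is smooth in `W` and vanishes outside the support of `ψ`; the
    -- factor `χ`, which is `1` on that support, turns it into a test function without changing it
    -- in `W`.
    have hψ' := hχc.mul_contDiffOn hW hsm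
    have hval : ∀ x ∈ W, χ x * (T (m x + ψ x) - m x) = T (m x + ψ x) - m x := fun x hx => by
      by_cases hxs : x ∈ tsupport ψ
      · rw [hχ1 x hxs, one_mul]
      · rw [image_eq_zero_of_notMem_tsupport hxs, add_zero, hmB x hx, sub_self, mul_zero]
    refine ⟨_, hψ', ?_, fun x hx => ?_⟩
    · have hgr : ∀ x ∈ W, Gr (fun x => χ x * (T (m x + ψ x) - m x)) x =
          deriv T (m x + ψ x) • Gr ψ x := fun x hx => by
        have e1 : (fun x => χ x * (T (m x + ψ x) - m x)) =ᶠ[𝓝 x] fun x => T (m x + ψ x) - m x := by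
          filter_upwards [hW.mem_nhds hx] with y hy using hval y hy
        have e2 : gradient (fun x => χ x * (T (m x + ψ x) - m x)) x =
            gradient (fun x => T (m x + ψ x) - m x) x := by
          rw [gradient, gradient, e1.fderiv_eq]
        have e3 : DifferentiableAt ℝ (fun x => m x + ψ x) x := (hdm x hx).add (hψ.differentiable x)
        have e4 : DifferentiableAt ℝ T (m x + ψ x) := hT1.differentiable (by simp) _
        have e5 : DifferentiableAt ℝ (fun x => T (m x + ψ x)) x :=
          DifferentiableAt.comp (f := fun x => m x + ψ x) (g := T) x e4 e3
        simp only [hGr]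
        rw [e2, gradient_sub e5 (hdm x hx), gradient_comp (f := fun x => m x + ψ x) e4 e3,
          gradient_add (hdm x hx) (hψ.differentiable x)]
        abel
      have i1 := (hfG _ hψ').integrable ha
      rw [bil_self, bil_self]
      refine integral_mono_ae i1 ((hfG ψ hψ).integrable ha) ?_
      filter_upwards [ha.posDef, ae_restrict_mem hW.measurableSet] with x hp hx
      have e6 : energyDensity a (Gr (fun x => χ x * (T (m x + ψ x) - m x))) x =
          deriv T (m x + ψ x) ^ 2 * energyDensity a (Gr ψ) x := by
        rw [← energyDensity_smul a (fun x => deriv T (m x + ψ x))]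
        simp only [energyDensity, flux, hgr x hx]
      rw [e6]
      refine mul_le_of_le_one_left (energyDensity_nonneg hp) ?_
      rw [sq_le_one_iff_abs_le_one]
      exact hT3 _
    · rw [hval x hx, add_sub_cancel]
      exact hT4 _
  -- With an excess of less than `4^{-n}/4` over the infimum, the parallelogram identity gives
  -- energies at most `4^{-N}` for the differences of competitors with indices at least `N`.
  have hseq : ∀ n : ℕ, ∃ ψ, IsTest W ψ ∧ bil a W (Gr ψ) (Gr ψ) < I + (1 / 4) ^ n / 4 ∧
      ∀ x ∈ W, |m x + ψ x| ≤ |B| + 2 := fun n => by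
    obtain ⟨e, ⟨ψ, hψ, rfl⟩, he⟩ := exists_lt_of_csInf_lt hAne
      (show sInf A < I + (1 / 4) ^ n / 4 by rw [← hI]; linarith [pow_pos (by norm_num : (0 : ℝ) < 1 / 4) n])
    obtain ⟨ψ', h1, h2, h3⟩ := htrunc ψ hψ
    exact ⟨ψ', h1, h2.trans_lt he, h3⟩
  choose ψ hψ hψI hψB using hseq
  have hanti : ∀ N n : ℕ, N ≤ n → (1 / 4 : ℝ) ^ n ≤ (1 / 4) ^ N := fun N n h =>
    pow_le_pow_of_le_one (by norm_num) (by norm_num) h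
  have hbil : ∀ f g, IsTest W f → IsTest W g → bil a W (Gr f) (Gr f) + bil a W (Gr g) (Gr g) -
      bil a W (fun x => Gr f x - Gr g x) (fun x => Gr f x - Gr g x) / 2 =
      2 * bil a W (Gr (fun x => (1 / 2) * (f x + g x))) (Gr (fun x => (1 / 2) * (f x + g x))) := by
    intro f g hf hg
    have e1 : Gr (fun x => (1 / 2) * (f x + g x)) = fun x => (1 / 2 : ℝ) • (Gr f x + Gr g x) := by
      ext1 x
      simp only [hGr]
      rw [gradient_const_mul (f := fun x => f x + g x) _
        ((hf.differentiable x).add (hg.differentiable x)),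
        gradient_add (hf.differentiable x) (hg.differentiable x)]
      module
    have F := hfG f hf
    have F' := hfG g hg
    rw [e1, sqrt_bil_const_smul ha, bil_sub_left ha F F' (F.sub ha F'), bil_sub_right ha F F' F,
      bil_sub_right ha F F' F', bil_add_left ha F F' (F.add ha F'), bil_add_right ha F F' F,
      bil_add_right ha F F' F', bil_comm ha (Gr g) (Gr f)]
    ring
  have hCau : ∀ N n k, N ≤ n → N ≤ k → bil a W (fun x => Gr (ψ n) x - Gr (ψ k) x)
      (fun x => Gr (ψ n) x - Gr (ψ k) x) ≤ (1 / 4) ^ N := fun N n k hn hk => by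
    have h1 := hbil _ _ (hψ n) (hψ k)
    have h2 := hIle _ (((hψ n).add (hψ k)).const_mul (1 / 2))
    have h3 := hψI n
    have h4 := hψI k
    have h5 := hanti N n hn
    have h6 := hanti N k hk
    linarith
  obtain ⟨Gw, hGw, hlim⟩ := exists_energy_limit ha (fun n => hfG _ (hψ n)) hCau
  obtain ⟨Cp, hCp0, hCp⟩ := exists_integral_abs_le_of_test hd hWb
  have hmi : ∀ n, Integrable (fun x => m x + ψ n x) (volume.restrict W) := fun n => by
    refine Integrable.of_bound (C := |B| + 2) ?_ ?_
    · exact (hm.continuousOn.add (hψ n).contDiff_one.continuous.continuousOn).aestronglyMeasurable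
        hW.measurableSet
    · filter_upwards [ae_restrict_mem hW.measurableSet] with x hx using hψB n x hx
  have hsq : ∀ N : ℕ, √((1 / 4 : ℝ) ^ N) = (1 / 2) ^ N := fun N => by
    rw [show (1 / 4 : ℝ) = (1 / 2) ^ 2 by norm_num, ← pow_mul, mul_comm, pow_mul,
      Real.sqrt_sq (by positivity)]
  have htr : 0 ≤ traceInv a W := by
    refine integral_nonneg_of_ae ?_
    filter_upwards [ha.posDef] with x hx
    exact Finset.sum_nonneg fun i _ => hx.inv.posSemidef.diag_nonneg
  obtain ⟨w, hwm, hw⟩ := exists_ae_tendsto_of_integral_le (C := Cp * √(traceInv a W)) hmi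
    (fun N n k hn hk => by
      have ht := (hψ n).add ((hψ k).const_mul (-1))
      have e1 : ∀ x, gradient (fun x => ψ n x + -1 * ψ k x) x = Gr (ψ n) x - Gr (ψ k) x := fun x => by
        rw [gradient_add ((hψ n).differentiable x) (((hψ k).const_mul (-1)).differentiable x),
          gradient_const_mul _ ((hψ k).differentiable x)]
        simp only [hGr]; module
      have h1 := hCp _ ht
      simp only [e1] at h1
      have h2 := ((hfG _ (hψ n)).sub ha (hfG _ (hψ k))).integral_norm_le ha
      have h3 : √(traceInv a W * bil a W (fun x => Gr (ψ n) x - Gr (ψ k) x)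
          (fun x => Gr (ψ n) x - Gr (ψ k) x)) ≤ √(traceInv a W) * (1 / 2) ^ N := by
        rw [← hsq, ← Real.sqrt_mul htr]
        exact Real.sqrt_le_sqrt (mul_le_mul_of_nonneg_left (hCau N n k hn hk) htr)
      calc ∫ x in W, ‖m x + ψ n x - (m x + ψ k x)‖ = ∫ x in W, |ψ n x + -1 * ψ k x| := by
            refine integral_congr_ae (Eventually.of_forall fun x => ?_)
            simp only [Real.norm_eq_abs]; congr 1; ring
        _ ≤ Cp * (√(traceInv a W) * (1 / 2) ^ N) :=
            h1.trans (mul_le_mul_of_nonneg_left (h2.trans h3) hCp0)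
        _ = _ := by ring)
  have hwB : ∀ᵐ x ∂(volume.restrict W), |w x| ≤ |B| + 2 := by
    filter_upwards [hw, ae_restrict_mem hW.measurableSet] with x hx hxW
    exact le_of_tendsto hx.abs (Eventually.of_forall fun n => hψB n x hxW)
  have hgrad : ∀ n, gradient (fun x => m x + ψ n x) =ᵐ[volume.restrict W] Gr (ψ n) := fun n => by
    filter_upwards [ae_restrict_mem hW.measurableSet] with x hx
    exact gradient_add (hdm x hx) ((hψ n).differentiable x)
  have hgw : HasGrad a W w Gw := by
    refine .of_tendsto ha (φ := fun n x => m x + ψ n x)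
      (MemLp.of_bound hwm (|B| + 2) hwB) hGw
      (fun n => hm.add (hψ n).contDiff.contDiffOn)
      (fun n => (hfG _ (hψ n)).congr (hgrad n).symm) ?_ ?_
    · exact tendsto_eLpNorm_of_bounded (C := |B| + 2) (fun n => (hmi n).1) hwm (fun n => by
        filter_upwards [ae_restrict_mem hW.measurableSet] with x hx using hψB n x hx) hw
    · refine hlim.congr fun n => ?_
      have : (fun x => Gr (ψ n) x - Gw x) =ᵐ[volume.restrict W]
          fun x => gradient (fun x => m x + ψ n x) x - Gw x := by
        filter_upwards [hgrad n] with x hx; rw [hx]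
      exact bil_congr this this
  -- minimality
  have hconv : Tendsto (fun n => bil a W (Gr (ψ n)) (Gr (ψ n))) atTop (𝓝 (bil a W Gw Gw)) := by
    have h1 := tendsto_bil_left ha (fun n => hfG _ (hψ n)) hGw hGw hlim
    have h2 : ∀ n, bil a W (Gr (ψ n)) (Gr (ψ n)) = bil a W (fun x => Gr (ψ n) x - Gw x)
        (fun x => Gr (ψ n) x - Gw x) + 2 * bil a W (Gr (ψ n)) Gw - bil a W Gw Gw := fun n => by
      have F := hfG _ (hψ n)
      rw [bil_sub_left ha F hGw (F.sub ha hGw), bil_sub_right ha F hGw F, bil_sub_right ha F hGw hGw,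
        bil_comm ha Gw (Gr (ψ n))]
      ring
    have h3 := (hlim.add (h1.const_mul 2)).sub_const (bil a W Gw Gw)
    refine (h3.congr fun n => (h2 n).symm).trans (by rw [show (0 : ℝ) + 2 * bil a W Gw Gw -
      bil a W Gw Gw = bil a W Gw Gw by ring])
  have hEI : bil a W Gw Gw ≤ I := by
    refine le_of_tendsto_of_tendsto hconv (b := atTop)
      (g := fun n : ℕ => I + (1 / 4 : ℝ) ^ n / 4) ?_ (Eventually.of_forall fun n => (hψI n).le)
    have := (tendsto_pow_atTop_nhds_zero_of_lt_one (by norm_num)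
      (by norm_num : (1 / 4 : ℝ) < 1)).div_const 4
    simpa using this.const_add I
  have horth : ∀ χ, IsTest W χ → bil a W (gradient χ) Gw = 0 := by
    intro χ hχ
    have hF := hfψ χ hχ
    have hq : ∀ t : ℝ, 0 ≤ bil a W (gradient χ) (gradient χ) * (t * t) +
        2 * bil a W (gradient χ) Gw * t + 0 := by
      intro t
      have h1 : ∀ n, I ≤ bil a W (Gr (ψ n)) (Gr (ψ n)) + 2 * t * bil a W (Gr (ψ n)) (gradient χ) +
          t ^ 2 * bil a W (gradient χ) (gradient χ) := fun n => by
        have h2 := hIle _ ((hψ n).add (hχ.const_mul t))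
        have e1 : Gr (fun x => ψ n x + t * χ x) = fun x => Gr (ψ n) x + t • gradient χ x := by
          ext1 x
          simp only [hGr]
          rw [gradient_add ((hψ n).differentiable x) ((hχ.const_mul t).differentiable x),
            gradient_const_mul _ (hχ.differentiable x)]
          abel
        have F := hfG _ (hψ n)
        have F' := hF.const_smul ha t
        rw [e1, bil_add_left ha F F' (F.add ha F'), bil_add_right ha F F' F,
          bil_add_right ha F F' F', bil_smul_left, bil_smul_left, bil_smul_right ha,
          bil_smul_right ha, bil_comm ha (gradient χ) (Gr (ψ n))] at h2
        linarith
      have h3 := (hconv.add ((tendsto_bil_left ha (fun n => hfG _ (hψ n)) hGw hF hlim).const_mul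
        (2 * t))).add_const (t ^ 2 * bil a W (gradient χ) (gradient χ))
      have h4 := ge_of_tendsto h3 (Eventually.of_forall h1)
      rw [bil_comm ha Gw (gradient χ)] at h4
      linarith
    have := discrim_le_zero hq
    rw [discrim] at this
    nlinarith
  have hsol : IsSol a W w Gw := ⟨hgw, horth⟩
  refine ⟨w, Gw, hsol, ?_, ?_, ?_, _, hwB⟩
  · have hint : ∀ n, ∫ x in W, Gr (ψ n) x = ∫ x in W, gradient m x := fun n => by
      rw [hGr, integral_add (hfe.integrable_self ha) ((hfψ _ (hψ n)).integrable_self ha)]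
      have : ∫ x in W, gradient (ψ n) x = 0 := by
        refine ext_inner_right ℝ fun e => ?_
        rw [inner_zero_left, real_inner_comm, ← integral_inner ((hfψ _ (hψ n)).integrable_self ha)]
        rw [← (hψ n).integral_fderiv_eq_zero e]
        rw [setIntegral_eq_integral_of_forall_compl_eq_zero fun x hx => by
          rw [(hψ n).gradient_eq_zero hx, inner_zero_right]]
        refine integral_congr_ae (Eventually.of_forall fun x => ?_)
        simp only
        rw [real_inner_comm, inner_gradient_left]
      rw [this, add_zero]
    have hL1 := tendsto_eLpNorm_of_tendsto_integral (fun n => (hfG _ (hψ n)).integrable_self ha)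
      (hGw.integrable_self ha) (tendsto_integral_norm_sub ha (fun n => hfG _ (hψ n)) hGw hlim)
    have h1 := tendsto_integral_of_L1' _ (hGw.integrable_self ha).1
      (Eventually.of_forall fun n => (hfG _ (hψ n)).integrable_self ha) hL1
    exact tendsto_nhds_unique h1 (tendsto_const_nhds.congr fun n => (hint n).symm)
  · refine hEI.trans ((hIle _ htest0).trans (le_of_eq ?_))
    have : Gr (fun _ => 0) = gradient m := by
      ext1 x; simp only [hGr]; rw [gradient_const, add_zero]
    rw [this]
  · have h1 := tendsto_bil_left ha (fun n => hfG _ (hψ n)) hGw hGw hlim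
    have h2 : ∀ n, bil a W (Gr (ψ n)) Gw = bil a W (gradient m) Gw := fun n => by
      rw [hGr, bil_add_left ha hfe (hfψ _ (hψ n)) hGw, horth _ (hψ n), add_zero]
    have h3 := tendsto_nhds_unique h1 (tendsto_const_nhds.congr fun n => (h2 n).symm)
    rw [bil_comm ha, ← h3]

end Dirichlet

end CoarseGrained

end

/-! ### Cubes, cones and the coarse-grained inequalities -/

noncomputable section
namespace CoarseGrained

variable {d : ℕ} {a : CoeffField d} {U W Q : Set (E d)} {G K M : E d → E d} {u v : E d → ℝ}

section Cube

theorem cube_eq (z : E d) (ℓ : ℝ) : cube z ℓ =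
    (WithLp.ofLp : E d → Fin d → ℝ) ⁻¹' (Set.pi univ fun i => Ioo (z i - ℓ / 2) (z i + ℓ / 2)) := by
  ext x
  simp only [cube, mem_ofPred_eq, mem_preimage, Set.mem_pi, mem_univ, true_imp_iff, mem_Ioo, abs_lt]
  refine forall_congr' fun i => ⟨fun h => ⟨by linarith [h.1], by linarith [h.2]⟩,
    fun h => ⟨by linarith [h.1], by linarith [h.2]⟩⟩

theorem isOpen_cube (z : E d) (ℓ : ℝ) : IsOpen (cube z ℓ) := by
  rw [cube_eq]
  exact (isOpen_set_pi finite_univ fun _ _ => isOpen_Ioo).preimage (PiLp.continuous_ofLp 2 _)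

theorem measurableSet_cube (z : E d) (ℓ : ℝ) : MeasurableSet (cube z ℓ) :=
  (isOpen_cube z ℓ).measurableSet

theorem volume_cube (z : E d) {ℓ : ℝ} (hℓ : 0 ≤ ℓ) : volume (cube z ℓ) = ENNReal.ofReal (ℓ ^ d) := by
  rw [cube_eq, (PiLp.volume_preserving_ofLp (Fin d)).measure_preimage
    (MeasurableSet.univ_pi fun _ => measurableSet_Ioo).nullMeasurableSet, Real.volume_pi_Ioo]
  simp only [add_sub_sub_cancel, add_halves, Finset.prod_const, Finset.card_univ, Fintype.card_fin]
  rw [ENNReal.ofReal_pow hℓ]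

theorem volume_real_cube (z : E d) {ℓ : ℝ} (hℓ : 0 ≤ ℓ) : volume.real (cube z ℓ) = ℓ ^ d := by
  rw [Measure.real, volume_cube z hℓ, ENNReal.toReal_ofReal (by positivity)]

theorem isBounded_cube (z : E d) (ℓ : ℝ) : Bornology.IsBounded (cube z ℓ) := by
  rw [isBounded_iff_forall_norm_le]
  refine ⟨‖z‖ + ∑ _i : Fin d, ℓ / 2, fun x hx => ?_⟩
  have h1 : ‖x - z‖ ≤ ∑ i, |x i - z i| := by
    have := EuclideanSpace.norm_eq (x - z)
    rw [this]
    refine Real.sqrt_le_iff.2 ⟨Finset.sum_nonneg fun _ _ => abs_nonneg _, ?_⟩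
    have := Finset.sum_sq_le_sq_sum_of_nonneg (s := Finset.univ) (f := fun i => |x i - z i|)
      fun _ _ => abs_nonneg _
    simpa using this
  have h2 : ∑ i, |x i - z i| ≤ ∑ _i : Fin d, ℓ / 2 := Finset.sum_le_sum fun i _ => (hx i).le
  calc ‖x‖ = ‖z + (x - z)‖ := by rw [add_sub_cancel]
    _ ≤ ‖z‖ + ‖x - z‖ := norm_add_le _ _
    _ ≤ _ := by linarith

theorem volume_cube_ne_top (z : E d) (ℓ : ℝ) : volume (cube z ℓ) ≠ ∞ :=
  (isBounded_cube z ℓ).measure_lt_top.ne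

end Cube

section Cone

variable {S : Set ConeName}

theorem IsSol.mono (ha : IsCoefficientField a U) (hU : IsOpen U) (hu : IsSol a U u G)
    (hWU : W ⊆ U) : IsSol a W u G where
  hasGrad := hu.hasGrad.mono ha hU hWU
  weak ψ hψ := by
    rw [setIntegral_eq_of_test hψ, ← setIntegral_eq_of_test (hψ.mono hWU)]
    exact hu.weak ψ (hψ.mono hWU)

theorem IsSub.mono (ha : IsCoefficientField a U) (hU : IsOpen U) (hu : IsSub a U u G)
    (hWU : W ⊆ U) : IsSub a W u G where
  hasGrad := hu.hasGrad.mono ha hU hWU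
  weak ψ hψ h0 := by
    rw [setIntegral_eq_of_test hψ, ← setIntegral_eq_of_test (hψ.mono hWU)]
    exact hu.weak ψ (hψ.mono hWU) h0

theorem InCone.mono (ha : IsCoefficientField a U) (hU : IsOpen U) (hu : InCone S a U u G)
    (hWU : W ⊆ U) : InCone S a W u G := by
  obtain ⟨k, hk, h⟩ := hu
  refine ⟨k, hk, ?_⟩
  have hle : volume.restrict W ≤ volume.restrict U := Measure.restrict_mono_set _ hWU
  cases k with
  | sol => exact IsSol.mono ha hU h hWU
  | sub => exact IsSub.mono ha hU h hWU
  | conv =>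
    obtain ⟨h0, u', Gu, J, Φ, h1, h2, h3, h4, h5, h6, h7⟩ := h
    exact ⟨h0.mono ha hU hWU, u', Gu, J, Φ, h1.mono ha hU hWU, h2, ae_mono hle h3, h4, h5, h6,
      ae_mono hle h7⟩
  | trunc =>
    obtain ⟨h0, u', Gu, k, h1, h2⟩ := h
    exact ⟨h0.mono ha hU hWU, u', Gu, k, h1.mono ha hU hWU, ae_mono hle h2⟩
  | pow =>
    obtain ⟨h0, u', Gu, J, Φ, c, p, h1, h2, h3, h4, h5, h6, h7, h8⟩ := h
    exact ⟨h0.mono ha hU hWU, u', Gu, J, Φ, c, p, h1.mono ha hU hWU, h2, h3, ae_mono hle h4, h5, h6,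
      h7, ae_mono hle h8⟩
  | max => exact HasGrad.mono ha hU h hWU

theorem InCone.const_mul (hW : IsOpen W) (hWf : volume W ≠ ∞) (ha : IsCoefficientField a W)
    (hu : InCone S a W u G) {t : ℝ} (ht : 0 < t) :
    InCone S a W (fun x => t * u x) (fun x => t • G x) := by
  obtain ⟨k, hk, h⟩ := hu
  refine ⟨k, hk, ?_⟩
  have hmono : ∀ {Φ : ℝ → ℝ} {J : Set ℝ}, MonotoneOn Φ J ∨ AntitoneOn Φ J →
      MonotoneOn (fun r => t * Φ r) J ∨ AntitoneOn (fun r => t * Φ r) J := fun h =>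
    h.imp (fun h x hx y hy hxy => mul_le_mul_of_nonneg_left (h hx hy hxy) ht.le)
      fun h x hx y hy hxy => mul_le_mul_of_nonneg_left (h hx hy hxy) ht.le
  cases k with
  | sol => exact IsSol.const_mul hW hWf ha h t
  | sub =>
    refine ⟨h.hasGrad.const_mul hW hWf ha t, fun ψ hψ h0 => ?_⟩
    rw [flux_smul a (fun _ => t)]
    simp only [real_inner_smul_right]
    rw [integral_const_mul]
    exact mul_nonpos_of_nonneg_of_nonpos ht.le (h.weak ψ hψ h0)
  | conv =>
    obtain ⟨h0, u', Gu, J, Φ, h1, h2, h3, h4, h5, h6, h7⟩ := h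
    exact ⟨h0.const_mul hW hWf ha t, u', Gu, J, fun r => t * Φ r, h1, h2, h3, contDiffOn_const.mul h4,
      h5.smul ht.le, hmono h6, h7.mono fun x hx => by simp only [hx]⟩
  | trunc =>
    obtain ⟨h0, u', Gu, k, h1, h2⟩ := h
    refine ⟨h0.const_mul hW hWf ha t, _, _, t * k, h1.const_mul hW hWf ha t, h2.mono fun x hx => ?_⟩
    simp only [hx]
    rw [mul_max_of_nonneg _ _ ht.le, mul_zero, mul_sub]
  | pow =>
    obtain ⟨h0, u', Gu, J, Φ, c, p, h1, h2, h3, h4, h5, h6, h7, h8⟩ := h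
    refine ⟨h0.const_mul hW hWf ha t, u', Gu, J, fun r => t * Φ r, t * c, p, h1, h2, h3, h4,
      fun r hr => ?_, h6.smul ht.le, hmono h7, h8.mono fun x hx => by simp only [hx]⟩
    rw [mul_assoc]
    exact (h5 r hr).const_mul t
  | max => exact HasGrad.const_mul hW hWf ha h t

theorem InCone.hasGrad (h : InCone S a W u G) : HasGrad a W u G := by
  obtain ⟨k, hk, h⟩ := h
  cases k with
  | sol => exact h.hasGrad
  | sub => exact h.hasGrad
  | conv => exact h.1
  | trunc => exact h.1
  | pow => exact h.1
  | max => exact h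

theorem HasGrad.add_const (hW : IsOpen W) (hWf : volume W ≠ ∞) (ha : IsCoefficientField a W)
    (hu : HasGrad a W u G) (c : ℝ) : HasGrad a W (fun x => u x + c) G := by
  have h1 : ∀ t, deriv (fun s : ℝ => s + c) t = 1 := fun t => by simp
  have := hu.comp hW hWf ha (S := fun s => s + c) (C := 1) (contDiff_id.add contDiff_const)
    (fun t => by rw [h1]; simp)
  simpa only [h1, one_smul] using this

/-- Every nonempty cone contains the bounded solutions, up to the addition of constants. -/
theorem exists_inCone_of_isSol (hS : S.Nonempty) (hW : IsOpen W) (hWf : volume W ≠ ∞)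
    (ha : IsCoefficientField a W) (hu : IsSol a W u G) {C : ℝ}
    (hC : ∀ᵐ x ∂(volume.restrict W), |u x| ≤ C) : ∃ v, InCone S a W v G := by
  obtain ⟨k, hk⟩ := hS
  have hs : IsSol a W (fun x => u x + C) G := ⟨hu.hasGrad.add_const hW hWf ha C, hu.weak⟩
  have h0 : ∀ᵐ x ∂(volume.restrict W), 0 ≤ u x + C := hC.mono fun x hx => by
    linarith [neg_abs_le (u x)]
  refine ⟨fun x => u x + C, k, hk, ?_⟩
  cases k with
  | sol => exact hs
  | sub => exact ⟨hs.hasGrad, fun ψ hψ _ => (hs.weak ψ hψ).le⟩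
  | conv => exact ⟨hs.hasGrad, _, _, univ, id, hs, ordConnected_univ, by simp, contDiffOn_id,
      convexOn_id convex_univ, Or.inl monotoneOn_id, by simp⟩
  | trunc => exact ⟨hs.hasGrad, _, _, 0, hs, h0.mono fun x hx => by simp [hx]⟩
  | pow => exact ⟨hs.hasGrad, _, _, Ici 0, id, 1, 0, hs, ordConnected_Ici, le_rfl, h0,
      fun t _ => by simpa using hasDerivWithinAt_id t _, convexOn_id (convex_Ici 0),
      Or.inl monotoneOn_id, by simp⟩
  | max => exact hs.hasGrad

end Cone

section CoarseGraining

variable {S : Set ConeName}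

theorem sq_le_mul_of_forall_pos {X Y c : ℝ} (hX : 0 ≤ X) (hY : 0 ≤ Y) (hc : 0 ≤ c)
    (h : ∀ t > 0, 2 * t * Y - t ^ 2 * X ≤ c) : Y ^ 2 ≤ X * c := by
  have h3 : ∀ t : ℝ, 0 ≤ X * (t * t) + (-2 * Y) * t + c := by
    intro t
    rcases lt_or_ge 0 t with ht | ht
    · have := h t ht; nlinarith
    · nlinarith [mul_nonneg hX (mul_self_nonneg t), mul_nonneg hY (neg_nonneg.2 ht)]
  have := discrim_le_zero h3
  rw [discrim] at this
  nlinarith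

theorem setAverage_le_of_ofReal_le {f : E d → ℝ} {N : ℝ≥0∞} (hN : N ≠ ∞) (hW0 : volume W ≠ 0)
    (hWf : volume W ≠ ∞) (h : ENNReal.ofReal (⨍ x in W, f x) ≤ N) :
    ∫ x in W, f x ≤ volume.real W * N.toReal := by
  have h1 : ⨍ x in W, f x ≤ N.toReal := by
    rwa [← ENNReal.ofReal_le_iff_le_toReal hN]
  rw [setAverage_eq, smul_eq_mul] at h1
  have h2 : 0 < volume.real W := ENNReal.toReal_pos hW0 hWf
  rwa [inv_mul_le_iff₀ h2] at h1

theorem le_norm_mul_inner {F : Type*} [NormedAddCommGroup F] [InnerProductSpace ℝ F] {X : F}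
    (hX : X ≠ 0) : ‖(‖X‖⁻¹ • X)‖ = 1 ∧ inner ℝ (‖X‖⁻¹ • X) X = ‖X‖ := by
  have h0 : ‖X‖ ≠ 0 := norm_ne_zero_iff.2 hX
  refine ⟨by rw [norm_smul, norm_inv, norm_norm, inv_mul_cancel₀ h0], ?_⟩
  rw [real_inner_smul_left, real_inner_self_eq_norm_sq]
  field_simp

theorem le_cgAStarInvNorm (hu : IsSol a W u G) {q : E d} (hq : ‖q‖ = 1) :
    ENNReal.ofReal (⨍ x in W, (-energyDensity a G x + 2 * inner ℝ q (G x))) ≤ cgAStarInvNorm a W :=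
  le_trans (by unfold cgAStarInv; exact le_iSup_of_le u (le_iSup_of_le G (le_iSup_of_le hu le_rfl)))
    (le_iSup₂ (f := fun (q : E d) (_ : ‖q‖ = 1) => cgAStarInv a W q) q hq)

theorem integral_neg_add_two_mul {f g : E d → ℝ} (hf : IntegrableOn f W) (hg : IntegrableOn g W) :
    ∫ x in W, (-f x + 2 * g x) = -(∫ x in W, f x) + 2 * ∫ x in W, g x := by
  rw [← integral_neg, ← integral_const_mul]
  exact integral_add hf.neg (hg.const_mul 2)

theorem le_cgANorm (hu : InCone S a W u G) {p : E d} (hp : ‖p‖ = 1) :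
    ENNReal.ofReal (⨍ x in W, (-energyDensity a G x + 2 * inner ℝ p (flux a G x))) ≤
      cgANorm S a W :=
  le_trans (by unfold cgA; exact le_iSup_of_le u (le_iSup_of_le G (le_iSup_of_le hu le_rfl)))
    (le_iSup₂ (f := fun (p : E d) (_ : ‖p‖ = 1) => cgA S a W p) p hp)

/-- Insert the multiples `t u`, `t > 0`, into the supremum with `q` the direction of `∫ G`, and
optimize over `t`. -/
theorem sq_norm_integral_gradient_le_of_sol (hW : IsOpen W) (hW0 : volume W ≠ 0)
    (hWf : volume W ≠ ∞) (ha : IsCoefficientField a W) (hN : cgAStarInvNorm a W ≠ ∞)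
    (hu : IsSol a W u G) :
    ‖∫ x in W, G x‖ ^ 2 ≤ volume.real W * (cgAStarInvNorm a W).toReal * bil a W G G := by
  rcases eq_or_ne (∫ x in W, G x) 0 with h0 | h0
  · rw [h0, norm_zero, zero_pow two_ne_zero]
    have := bil_self_nonneg ha G
    positivity
  obtain ⟨hq, hq'⟩ := le_norm_mul_inner h0
  set q := ‖∫ x in W, G x‖⁻¹ • ∫ x in W, G x with hqdef
  rw [mul_comm]
  refine sq_le_mul_of_forall_pos (bil_self_nonneg ha G) (norm_nonneg _) (by positivity)
    fun t ht => ?_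
  have hs := hu.const_mul hW hWf ha t
  have h1 : ENNReal.ofReal (⨍ x in W, (-energyDensity a (fun x => t • G x) x +
      2 * inner ℝ q (t • G x))) ≤ cgAStarInvNorm a W := le_cgAStarInvNorm hs hq
  have h2 := setAverage_le_of_ofReal_le hN hW0 hWf h1
  refine le_trans (le_of_eq ?_) h2
  have i1 := hu.hasGrad.finiteEnergy.integrable ha
  have i2 := hu.hasGrad.finiteEnergy.integrable_self ha
  simp only [energyDensity_smul a (fun _ => t), real_inner_smul_right]
  refine (Eq.trans (integral_neg_add_two_mul (i1.const_mul _) ((i2.const_inner q).const_mul t)) ?_).symm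
  rw [integral_const_mul, integral_const_mul, integral_inner i2, hq',
    bil_self]
  ring

/-- The supremum defining `a_*⁻¹` runs over solutions only. Replacing `m` by the solution with the
same boundary values preserves the mean gradient and does not increase the energy. -/
theorem sq_norm_integral_gradient_le (hd : 2 ≤ d) (hW : IsOpen W) (hWb : Bornology.IsBounded W)
    (hW0 : volume W ≠ 0) (ha : IsCoefficientField a W) (hN : cgAStarInvNorm a W ≠ ∞)
    {m : E d → ℝ} (hm : ContDiffOn ℝ (⊤ : ℕ∞) m W) {B : ℝ}
    (hB : ∀ x ∈ W, |m x| ≤ B) (hfe : FiniteEnergy a W (gradient m)) :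
    ‖∫ x in W, gradient m x‖ ^ 2 ≤
      volume.real W * (cgAStarInvNorm a W).toReal * bil a W (gradient m) (gradient m) := by
  obtain ⟨w, Gw, h1, h2, h3, -, -⟩ := exists_dirichlet_solution hd hW hWb ha hm hB hfe
  rw [← h2]
  refine (sq_norm_integral_gradient_le_of_sol hW hW0 hWb.measure_lt_top.ne ha hN h1).trans ?_
  gcongr

theorem integral_flux_le_of_inCone (hW : IsOpen W) (hW0 : volume W ≠ 0)
    (hWf : volume W ≠ ∞) (ha : IsCoefficientField a W) (hN : cgANorm S a W ≠ ∞)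
    (hu : InCone S a W u G) {p : E d} (hp : ‖p‖ = 1) {t : ℝ} (ht : 0 < t) :
    2 * t * inner ℝ p (∫ x in W, flux a G x) - t ^ 2 * bil a W G G ≤
      volume.real W * (cgANorm S a W).toReal := by
  have hs := hu.const_mul hW hWf ha ht
  have h1 : ENNReal.ofReal (⨍ x in W, (-energyDensity a (fun x => t • G x) x +
      2 * inner ℝ p (flux a (fun x => t • G x) x))) ≤ cgANorm S a W := le_cgANorm hs hp
  have h2 := setAverage_le_of_ofReal_le hN hW0 hWf h1
  refine le_trans (le_of_eq ?_) h2
  have i1 := hu.hasGrad.finiteEnergy.integrable ha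
  have i2 := hu.hasGrad.finiteEnergy.integrable_flux ha
  simp only [energyDensity_smul a (fun _ => t), flux_smul a (fun _ => t), real_inner_smul_right]
  refine (Eq.trans (integral_neg_add_two_mul (i1.const_mul _) ((i2.const_inner p).const_mul t)) ?_).symm
  rw [integral_const_mul, integral_const_mul, integral_inner i2,
    bil_self]
  ring

/-- As for slopes. Only positive multiples of `u` are used, and cones are closed under these. -/
theorem sq_norm_integral_flux_le (hW : IsOpen W) (hW0 : volume W ≠ 0)
    (hWf : volume W ≠ ∞) (ha : IsCoefficientField a W) (hN : cgANorm S a W ≠ ∞)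
    (hu : InCone S a W u G) :
    ‖∫ x in W, flux a G x‖ ^ 2 ≤ volume.real W * (cgANorm S a W).toReal * bil a W G G := by
  rcases eq_or_ne (∫ x in W, flux a G x) 0 with h0 | h0
  · rw [h0, norm_zero, zero_pow two_ne_zero]
    have := bil_self_nonneg ha G
    positivity
  obtain ⟨hq, hq'⟩ := le_norm_mul_inner h0
  rw [mul_comm]
  refine sq_le_mul_of_forall_pos (bil_self_nonneg ha G) (norm_nonneg _) (by positivity)
    fun t ht => ?_
  have := integral_flux_le_of_inCone hW hW0 hWf ha hN hu hq ht
  rwa [hq'] at this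

/-- The two coarse-grained quantities are bounded below by reciprocal positive numbers. -/
theorem exists_le_cgANorm (hd : 2 ≤ d) (hS : S.Nonempty) (hW : IsOpen W)
    (hWb : Bornology.IsBounded W) (hW0 : volume W ≠ 0) (ha : IsCoefficientField a W) :
    ∃ x : ℝ, 0 < x ∧ ENNReal.ofReal x ≤ cgANorm S a W ∧
      ENNReal.ofReal x⁻¹ ≤ cgAStarInvNorm a W := by
  have hWf : volume W ≠ ∞ := hWb.measure_lt_top.ne
  have hV : 0 < volume.real W := ENNReal.toReal_pos hW0 hWf
  set p : E d := EuclideanSpace.single ⟨0, by omega⟩ 1 with hp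
  have hp1 : ‖p‖ = 1 := by simp [hp]
  have hgr : gradient (fun x : E d => inner ℝ p x) = fun _ => p := by
    ext1 x
    refine ext_inner_right ℝ fun e => ?_
    rw [inner_gradient_left]
    have : HasFDerivAt (fun x : E d => inner ℝ p x) (innerSL ℝ p) x := (innerSL ℝ p).hasFDerivAt
    rw [this.fderiv]; rfl
  obtain ⟨R, hR⟩ := isBounded_iff_forall_norm_le.1 hWb
  have hfe : FiniteEnergy a W fun _ => p := .of_bounded ha aestronglyMeasurable_const
    (C := ‖p‖) (Eventually.of_forall fun _ => le_rfl)
  -- Let `E` be the energy of the solution with affine data `p · x`. Its mean gradient is `p` and `p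
  -- · ∫ aGw = E`, so with direction `p` the first functional equals `(-E + 2E)/|W| = E/|W|`. The
  -- multiple by `t = |W|/E` gives the second functional the value `(-t²E + 2t|W|)/|W| = |W|/E`.
  obtain ⟨w, Gw, h1, h2, h3, h4, C, hC⟩ := exists_dirichlet_solution hd hW hWb ha
    (m := fun x => inner ℝ p x) (B := R) (contDiff_const.inner ℝ contDiff_id).contDiffOn
    (fun x hx => (abs_real_inner_le_norm p x).trans (by rw [hp1, one_mul]; exact hR x hx))
    (by rw [hgr]; exact hfe)
  rw [hgr] at h2 h3 h4
  have hGw := h1.hasGrad.finiteEnergy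
  have h5 : ∫ x in W, Gw x = volume.real W • p := by rw [h2, setIntegral_const]
  have h6 : inner ℝ p (∫ x in W, flux a Gw x) = bil a W Gw Gw := by
    rw [← h4, bil_comm ha, ← integral_inner (hGw.integrable_flux ha)]; rfl
  have hE : 0 < bil a W Gw Gw := by
    refine lt_of_le_of_ne (bil_self_nonneg ha Gw) fun h0 => ?_
    have h7 := ae_eq_zero_of_bil_self_eq_zero ha hGw h0.symm
    have h8 : ∫ x in W, Gw x = 0 := by
      rw [integral_congr_ae h7]; simp
    rw [h8] at h5
    have := congrArg norm h5
    rw [norm_zero, norm_smul, hp1, mul_one, Real.norm_eq_abs, abs_of_pos hV] at this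
    linarith
  have i1 := hGw.integrable ha
  have i2 := hGw.integrable_self ha
  have i3 := hGw.integrable_flux ha
  refine ⟨bil a W Gw Gw / volume.real W, by positivity, ?_, ?_⟩
  · obtain ⟨v, hv⟩ := exists_inCone_of_isSol hS hW hWf ha h1 hC
    refine le_trans (le_of_eq ?_) (le_cgANorm hv hp1)
    congr 1
    rw [setAverage_eq, smul_eq_mul, integral_neg_add_two_mul i1 (i3.const_inner p),
      integral_inner i3, h6, ← bil_self]
    field_simp; ring
  · set t := volume.real W / bil a W Gw Gw with ht
    have hs := h1.const_mul hW hWf ha t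
    refine le_trans (le_of_eq ?_) (le_cgAStarInvNorm hs hp1)
    congr 1
    simp only [energyDensity_smul a (fun _ => t), real_inner_smul_right]
    rw [setAverage_eq, smul_eq_mul]
    refine Eq.trans ?_ (congrArg _ (integral_neg_add_two_mul (i1.const_mul _)
      ((i2.const_inner p).const_mul t))).symm
    rw [integral_const_mul, integral_const_mul, integral_inner i2, h5, ← bil_self,
      real_inner_smul_right, real_inner_self_eq_norm_sq, hp1, ht]
    field_simp; ring

end CoarseGraining

end CoarseGrained

end

/-! ### The Efron-Stein inequality and triadic cubes -/

noncomputable section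
namespace CoarseGrained

variable {d : ℕ}

section EfronStein

variable {α : Type*} [Fintype α]

/-- Averages over the coordinate `i`. -/
def avgCoord (i : Fin d) (f : (Fin d → α) → ℝ) (ω : Fin d → α) : ℝ :=
  (∑ b, f (Function.update ω i b)) / Fintype.card α

theorem avgCoord_update (i : Fin d) (f : (Fin d → α) → ℝ) (ω : Fin d → α) (b : α) :
    avgCoord i f (Function.update ω i b) = avgCoord i f ω := by
  simp [avgCoord]

/-- The map `(ω, b) ↦ (update ω i b, ω i)` is an involution, and it turns the summand into `f ω`,
which no longer depends on `b`. -/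
theorem sum_sum_update {F : Type*} [AddCommMonoid F] (i : Fin d) (f : (Fin d → α) → F) :
    ∑ ω, ∑ b, f (Function.update ω i b) = Fintype.card α • ∑ ω, f ω := by
  classical
  have h1 : ∑ ω : Fin d → α, ∑ b : α, f (Function.update ω i b) =
      ∑ p : (Fin d → α) × α, f (Function.update p.1 i p.2) := by
    rw [Fintype.sum_prod_type]
  have hinv : Function.Involutive fun p : (Fin d → α) × α => (Function.update p.1 i p.2, p.1 i) := by
    intro p
    ext1 <;> simp
  rw [h1, ← Equiv.sum_comp hinv.toPerm]
  simp only [Function.Involutive.coe_toPerm, Function.update_idem, Function.update_eq_self]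
  rw [Fintype.sum_prod_type]
  simp only [Finset.sum_const, Finset.card_univ, Finset.smul_sum]

theorem sum_avgCoord [Nonempty α] (i : Fin d) (f : (Fin d → α) → ℝ) :
    ∑ ω, avgCoord i f ω = ∑ ω, f ω := by
  simp only [avgCoord]
  rw [← Finset.sum_div, sum_sum_update, nsmul_eq_mul]
  have : (Fintype.card α : ℝ) ≠ 0 := by exact_mod_cast Fintype.card_ne_zero
  field_simp

theorem avgCoord_mul_of_invariant (i : Fin d) (f g : (Fin d → α) → ℝ)
    (hg : ∀ ω b, g (Function.update ω i b) = g ω) (ω : Fin d → α) :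
    avgCoord i (fun ω => f ω * g ω) ω = avgCoord i f ω * g ω := by
  simp only [avgCoord, hg]
  rw [← Finset.sum_mul]; ring

/-- Pythagoras: `f - avgCoord i f` is orthogonal to functions that do not depend on the coordinate
`i`. -/
theorem sum_sq_sub_avgCoord_add [Nonempty α] (i : Fin d) (f g : (Fin d → α) → ℝ)
    (hg : ∀ ω b, g (Function.update ω i b) = g ω) :
    ∑ ω, (f ω - g ω) ^ 2 = ∑ ω, (f ω - avgCoord i f ω) ^ 2 + ∑ ω, (avgCoord i f ω - g ω) ^ 2 := by
  have h1 : ∑ ω, f ω * (avgCoord i f ω - g ω) =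
      ∑ ω, avgCoord i f ω * (avgCoord i f ω - g ω) := by
    rw [← sum_avgCoord i fun ω => f ω * (avgCoord i f ω - g ω)]
    refine Finset.sum_congr rfl fun ω _ => ?_
    exact avgCoord_mul_of_invariant i f (fun ω => avgCoord i f ω - g ω)
      (fun ω b => by rw [avgCoord_update, hg]) ω
  have h2 : ∀ ω, (f ω - g ω) ^ 2 = (f ω - avgCoord i f ω) ^ 2 + (avgCoord i f ω - g ω) ^ 2 +
      2 * (f ω * (avgCoord i f ω - g ω) - avgCoord i f ω * (avgCoord i f ω - g ω)) := fun ω => by ring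
  simp only [h2]
  rw [Finset.sum_add_distrib, Finset.sum_add_distrib, ← Finset.mul_sum, Finset.sum_sub_distrib, h1]
  ring

theorem avgCoord_sub (i : Fin d) (f g : (Fin d → α) → ℝ) (ω : Fin d → α) :
    avgCoord i (fun ω => f ω - g ω) ω = avgCoord i f ω - avgCoord i g ω := by
  simp only [avgCoord]
  rw [Finset.sum_sub_distrib]; ring

theorem sum_sq_avgCoord_le [Nonempty α] (i : Fin d) (f : (Fin d → α) → ℝ) :
    ∑ ω, avgCoord i f ω ^ 2 ≤ ∑ ω, f ω ^ 2 := by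
  have h := sum_sq_sub_avgCoord_add i f (fun _ => 0) (fun _ _ => rfl)
  simp only [sub_zero] at h
  rw [h]
  have : 0 ≤ ∑ ω, (f ω - avgCoord i f ω) ^ 2 := Finset.sum_nonneg fun _ _ => sq_nonneg _
  linarith

/-- The Efron-Stein inequality on a finite product. -/
theorem efron_stein [Nonempty α] (f : (Fin d → α) → ℝ) :
    ∑ ω, (f ω - (∑ ω', f ω') / Fintype.card (Fin d → α)) ^ 2 ≤
      ∑ i, ∑ ω, (f ω - avgCoord i f ω) ^ 2 := by
  classical
  -- The function `g` arises by averaging over the coordinates in `s` one after another. By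
  -- orthogonality each new coordinate `i` adds `∑ (f - avgCoord i f)²` and the error for `avgCoord
  -- i g - avgCoord i f`, and averaging contracts the latter to the previous error.
  have key : ∀ s : Finset (Fin d), ∃ g : (Fin d → α) → ℝ,
      (∀ i ∈ s, ∀ ω b, g (Function.update ω i b) = g ω) ∧ ∑ ω, g ω = ∑ ω, f ω ∧
      ∑ ω, (f ω - g ω) ^ 2 ≤ ∑ i ∈ s, ∑ ω, (f ω - avgCoord i f ω) ^ 2 := by
    intro s
    induction s using Finset.induction_on with
    | empty => exact ⟨f, by simp, rfl, by simp⟩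
    | insert i s hi ih =>
      obtain ⟨g, h1, h2, h3⟩ := ih
      refine ⟨avgCoord i g, ?_, by rw [sum_avgCoord, h2], ?_⟩
      · intro j hj ω b
        rcases Finset.mem_insert.1 hj with rfl | hj
        · exact avgCoord_update _ _ _ _
        · by_cases hij : j = i
          · subst hij; exact avgCoord_update _ _ _ _
          simp only [avgCoord]
          congr 1
          refine Finset.sum_congr rfl fun c _ => ?_
          rw [Function.update_comm hij, h1 j hj]
      · rw [Finset.sum_insert hi, sum_sq_sub_avgCoord_add i f (avgCoord i g)
          (fun ω b => avgCoord_update i g ω b)]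
        have := sum_sq_avgCoord_le i fun ω => f ω - g ω
        simp only [avgCoord_sub] at this
        linarith
  obtain ⟨g, h1, h2, h3⟩ := key Finset.univ
  have hconst : ∀ ω ω', g ω = g ω' := by
    intro ω ω'
    have : ∀ s : Finset (Fin d), g (fun i => if i ∈ s then ω' i else ω i) = g ω := by
      intro s
      induction s using Finset.induction_on with
      | empty => simp
      | insert i s hi ih =>
        rw [← ih, ← h1 i (Finset.mem_univ i) (fun k => if k ∈ s then ω' k else ω k) (ω' i)]
        congr 1
        ext k
        by_cases hk : k = i
        · subst hk; simp
        · simp [Finset.mem_insert, hk]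
    rw [← this Finset.univ]
    simp
  have hmean : ∀ ω, g ω = (∑ ω', f ω') / Fintype.card (Fin d → α) := fun ω => by
    rw [← h2, Finset.sum_congr rfl fun ω' _ => hconst ω' ω]
    have : (Fintype.card (Fin d → α) : ℝ) ≠ 0 := by exact_mod_cast Fintype.card_ne_zero
    rw [Finset.sum_const, Finset.card_univ, nsmul_eq_mul]
    field_simp
  simp only [hmean] at h3
  exact h3

theorem sum_sq_sub_avgCoord_eq [Nonempty α] (i : Fin d) (f : (Fin d → α) → ℝ) :
    ∑ ω, (f ω - avgCoord i f ω) ^ 2 =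
      (∑ ω, ∑ b, (f (Function.update ω i b) - avgCoord i f ω) ^ 2) / Fintype.card α := by
  rw [← sum_avgCoord i, Finset.sum_div]
  refine Finset.sum_congr rfl fun ω _ => ?_
  simp only [avgCoord, Function.update_idem]

end EfronStein

section ThreePoints

/-- Three values whose increments are determined by slopes `D` and first moments `r`. -/
theorem three_point_variance {f D r : Fin 3 → ℝ} {h K : ℝ} (hK : 0 < K)
    (h1 : f 1 - f 0 = h * ((D 0 + D 1) / 2 + r 0 - r 1))
    (h2 : f 2 - f 1 = h * ((D 1 + D 2) / 2 + r 1 - r 2)) :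
    ∑ b, (f b - (∑ c, f c) / 3) ^ 2 ≤
      h ^ 2 * (7 / 8 + K) * (7 / 8 * ∑ b, D b ^ 2 + (∑ b, r b ^ 2) / K) := by
  simp only [Fin.sum_univ_three]
  have e1 : f 1 = f 0 + h * ((D 0 + D 1) / 2 + r 0 - r 1) := by linarith
  have e2 : f 2 = f 0 + h * ((D 0 + D 1) / 2 + r 0 - r 1) + h * ((D 1 + D 2) / 2 + r 1 - r 2) := by
    linarith
  set p := (D 0 + D 1) / 2 with hp
  set q := (D 1 + D 2) / 2 with hq
  set m := (r 0 + r 1 + r 2) / 3 with hm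
  -- Young's inequality weighted in the proportion `7/8 : K`, so that slopes and moments enter with
  -- the total factor `7/8 + K`.
  have gen : ∀ s ρ : ℝ, (s - ρ) ^ 2 ≤ (7 / 8 + K) * (8 / 7 * s ^ 2 + ρ ^ 2 / K) := by
    intro s ρ
    have : (7 / 8 + K) * (8 / 7 * s ^ 2 + ρ ^ 2 / K) - (s - ρ) ^ 2 =
        (8 * K * s + 7 * ρ) ^ 2 / (56 * K) := by
      field_simp; ring
    have h3 : 0 ≤ (8 * K * s + 7 * ρ) ^ 2 / (56 * K) := by positivity
    linarith
  have d0 : f 0 - (f 0 + f 1 + f 2) / 3 = h * (-(2 * p + q) / 3 - (r 0 - m)) := by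
    rw [e2, e1, hm]; ring
  have d1 : f 1 - (f 0 + f 1 + f 2) / 3 = h * ((p - q) / 3 - (r 1 - m)) := by
    rw [e2, e1, hm]; ring
  have d2 : f 2 - (f 0 + f 1 + f 2) / 3 = h * ((p + 2 * q) / 3 - (r 2 - m)) := by
    rw [e2, e1, hm]; ring
  rw [d0, d1, d2, mul_pow, mul_pow, mul_pow, ← mul_add, ← mul_add, mul_assoc (h ^ 2)]
  refine mul_le_mul_of_nonneg_left ?_ (sq_nonneg h)
  refine (add_le_add (add_le_add (gen _ _) (gen _ _)) (gen _ _)).trans ?_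
  rw [← mul_add, ← mul_add]
  refine mul_le_mul_of_nonneg_left ?_ (by positivity)
  -- The left side is `(8/7)(2/3)(p² + pq + q²)`. The sharp constant for `(2/3)(p² + pq + q²)`
  -- against `D₀² + D₁² + D₂²` is `3/4`, attained for `D` proportional to `(1, 2, 1)`; it is
  -- slightly below `(7/8)² = 49/64`.
  have b1 : 8 / 7 * (-(2 * p + q) / 3) ^ 2 + 8 / 7 * ((p - q) / 3) ^ 2 + 8 / 7 * ((p + 2 * q) / 3) ^ 2 ≤
      7 / 8 * (D 0 ^ 2 + D 1 ^ 2 + D 2 ^ 2) := by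
    rw [hp, hq]
    nlinarith [sq_nonneg (D 0 - D 2), sq_nonneg (D 0 + D 2 - D 1), sq_nonneg (D 0), sq_nonneg (D 1),
      sq_nonneg (D 2), sq_nonneg (D 0 + D 2 - 2 * D 1)]
  have b2 : (r 0 - m) ^ 2 + (r 1 - m) ^ 2 + (r 2 - m) ^ 2 ≤ r 0 ^ 2 + r 1 ^ 2 + r 2 ^ 2 := by
    rw [hm]; nlinarith [sq_nonneg (r 0 + r 1 + r 2)]
  have b3 : ((r 0 - m) ^ 2 + (r 1 - m) ^ 2 + (r 2 - m) ^ 2) / K ≤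
      (r 0 ^ 2 + r 1 ^ 2 + r 2 ^ 2) / K := by gcongr
  calc _ = (8 / 7 * (-(2 * p + q) / 3) ^ 2 + 8 / 7 * ((p - q) / 3) ^ 2 +
        8 / 7 * ((p + 2 * q) / 3) ^ 2) + ((r 0 - m) ^ 2 + (r 1 - m) ^ 2 + (r 2 - m) ^ 2) / K := by ring
    _ ≤ _ := add_le_add b1 b3

end ThreePoints

section Triadic

/-- The side length `3^{-j}`. -/
def side (j : ℕ) : ℝ := (3 : ℝ) ^ (0 - (j : ℤ))

/-- The triadic cube with side length `3^{-j}` and index `n`. -/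
def tri (j : ℕ) (n : Fin d → ℤ) : Set (E d) := cube (latticePoint (0 - (j : ℤ)) n) (side j)

theorem side_pos (j : ℕ) : 0 < side j := by unfold side; positivity

theorem side_succ (j : ℕ) : side (j + 1) = side j / 3 := by
  unfold side
  rw [show (0 - ((j + 1 : ℕ) : ℤ)) = (0 - (j : ℤ)) - 1 by push_cast; ring, zpow_sub_one₀ (by norm_num)]
  rfl

theorem side_zero : side 0 = 1 := by simp [side]

theorem side_eq_rpow (j : ℕ) : side j = (3 : ℝ) ^ (-(j : ℝ)) := by
  unfold side
  rw [Real.rpow_neg (by norm_num), Real.rpow_natCast, zero_sub, zpow_neg, zpow_natCast]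

theorem latticePoint_apply (k : ℤ) (n : Fin d → ℤ) (i : Fin d) :
    (latticePoint k n : E d) i = (3 : ℝ) ^ k * n i := rfl

theorem mem_tri {j : ℕ} {n : Fin d → ℤ} {x : E d} :
    x ∈ tri j n ↔ ∀ i, |x i - side j * n i| < side j / 2 := Iff.rfl

theorem isOpen_tri (j : ℕ) (n : Fin d → ℤ) : IsOpen (tri j n) := isOpen_cube _ _

theorem measurableSet_tri (j : ℕ) (n : Fin d → ℤ) : MeasurableSet (tri j n) :=
  measurableSet_cube _ _

theorem volume_tri (j : ℕ) (n : Fin d → ℤ) : volume (tri j n) = ENNReal.ofReal (side j ^ d) :=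
  volume_cube _ (side_pos j).le

theorem volume_real_tri (j : ℕ) (n : Fin d → ℤ) : volume.real (tri j n) = side j ^ d :=
  volume_real_cube _ (side_pos j).le

theorem volume_tri_ne_zero (j : ℕ) (n : Fin d → ℤ) : volume (tri j n) ≠ 0 := by
  rw [volume_tri]
  have := side_pos j
  simp only [ne_eq, ENNReal.ofReal_eq_zero, not_le]
  positivity

theorem volume_tri_ne_top (j : ℕ) (n : Fin d → ℤ) : volume (tri j n) ≠ ∞ := by
  rw [volume_tri]; exact ENNReal.ofReal_ne_top

theorem tri_zero : tri 0 (0 : Fin d → ℤ) = cube 0 1 := by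
  ext x
  rw [mem_tri]
  simp [cube, side_zero]

theorem convex_tri (j : ℕ) (n : Fin d → ℤ) : Convex ℝ (tri j n) := by
  rw [tri, cube_eq]
  exact (convex_pi fun i _ => convex_Ioo _ _).is_linear_preimage
    ⟨fun _ _ => rfl, fun _ _ => rfl⟩

/-- The index of the child `ω` of a triadic cube. -/
def childIdx (n : Fin d → ℤ) (ω : Fin d → Fin 3) : Fin d → ℤ := fun i => 3 * n i + ((ω i : ℕ) : ℤ) - 1

theorem side_mul_childIdx (j : ℕ) (n : Fin d → ℤ) (ω : Fin d → Fin 3) (i : Fin d) :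
    side (j + 1) * (childIdx n ω i : ℝ) = side j * n i + side (j + 1) * (((ω i : ℕ) : ℝ) - 1) := by
  rw [side_succ, childIdx]; push_cast; ring

theorem tri_child_subset (j : ℕ) (n : Fin d → ℤ) (ω : Fin d → Fin 3) :
    tri (j + 1) (childIdx n ω) ⊆ tri j n := by
  intro x hx i
  have h := hx i
  have h3 := side_mul_childIdx j n ω i
  change |x i - side (j + 1) * (childIdx n ω i : ℝ)| < side (j + 1) / 2 at h
  change |x i - side j * n i| < side j / 2
  rw [h3] at h
  have hp := side_pos j
  rw [side_succ] at h
  have h4 : ((ω i : ℕ) : ℝ) ≤ 2 := by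
    have := (ω i).isLt
    exact_mod_cast Nat.lt_succ_iff.1 this
  have h5 : (0 : ℝ) ≤ ((ω i : ℕ) : ℝ) := Nat.cast_nonneg _
  rw [abs_lt] at h ⊢
  constructor <;> nlinarith [h.1, h.2]

theorem childIdx_injective : Function.Injective
    fun p : (Fin d → ℤ) × (Fin d → Fin 3) => childIdx p.1 p.2 := by
  intro p q h
  have key : ∀ i, p.1 i = q.1 i ∧ p.2 i = q.2 i := fun i => by
    have h1 : 3 * p.1 i + ((p.2 i : ℕ) : ℤ) - 1 = 3 * q.1 i + ((q.2 i : ℕ) : ℤ) - 1 := congrFun h i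
    have h2 := (p.2 i).isLt
    have h3 := (q.2 i).isLt
    refine ⟨by omega, Fin.ext (by omega)⟩
  exact Prod.ext (funext fun i => (key i).1) (funext fun i => (key i).2)

theorem tri_disjoint {j : ℕ} {n n' : Fin d → ℤ} (h : n ≠ n') : Disjoint (tri j n) (tri j n') := by
  rw [Set.disjoint_left]
  intro x hx hx'
  refine h (funext fun i => ?_)
  have h1 := hx i
  have h2 := hx' i
  change |x i - side j * n i| < side j / 2 at h1
  change |x i - side j * n' i| < side j / 2 at h2
  have hp := side_pos j
  rw [abs_lt] at h1 h2
  have h3 : (n i : ℝ) - n' i < 1 := by nlinarith [h1.1, h1.2, h2.1, h2.2]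
  have h4 : (n' i : ℝ) - n i < 1 := by nlinarith [h1.1, h1.2, h2.1, h2.2]
  have h5 : n i - n' i < 1 := by exact_mod_cast h3
  have h6 : n' i - n i < 1 := by exact_mod_cast h4
  omega

theorem iUnion_child_ae_eq (j : ℕ) (n : Fin d → ℤ) :
    (⋃ ω, tri (j + 1) (childIdx n ω) : Set (E d)) =ᵐ[volume] tri j n := by
  refine ae_eq_of_subset_of_measure_ge (iUnion_subset fun ω => tri_child_subset j n ω) ?_
    (MeasurableSet.iUnion fun ω => measurableSet_tri _ _).nullMeasurableSet (volume_tri_ne_top j n)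
  rw [measure_iUnion (fun ω ω' h => tri_disjoint fun h' => h
    (Prod.ext_iff.1 (childIdx_injective (a₁ := (n, ω)) (a₂ := (n, ω')) h')).2)
    fun ω => measurableSet_tri _ _]
  simp only [volume_tri, tsum_fintype, Finset.sum_const, Finset.card_univ, Fintype.card_fun,
    Fintype.card_fin, nsmul_eq_mul]
  rw [side_succ, ← ENNReal.ofReal_natCast, ← ENNReal.ofReal_mul (by positivity)]
  refine ENNReal.ofReal_le_ofReal (le_of_eq ?_)
  push_cast
  rw [div_pow]
  field_simp

theorem setIntegral_tri_eq_sum {F : Type*} [NormedAddCommGroup F] [NormedSpace ℝ F] {f : E d → F}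
    {j : ℕ} {n : Fin d → ℤ} (hf : IntegrableOn f (tri j n)) :
    ∫ x in tri j n, f x = ∑ ω, ∫ x in tri (j + 1) (childIdx n ω), f x := by
  rw [← setIntegral_congr_set (iUnion_child_ae_eq j n), integral_iUnion_fintype
    (fun ω => measurableSet_tri _ _) (fun ω ω' h => tri_disjoint fun h' => h
    (Prod.ext_iff.1 (childIdx_injective (a₁ := (n, ω)) (a₂ := (n, ω')) h')).2)
    fun ω => hf.mono_set (tri_child_subset j n ω)]

variable (d) in
/-- The indices of the triadic cubes contained in the unit cube. -/
def idx : ℕ → Finset (Fin d → ℤ)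
  | 0 => {0}
  | j + 1 => (idx j ×ˢ Finset.univ).map ⟨_, childIdx_injective⟩

theorem childIdx_mem_idx {j : ℕ} {n : Fin d → ℤ} (hn : n ∈ idx d j) (ω : Fin d → Fin 3) :
    childIdx n ω ∈ idx d (j + 1) := by
  rw [idx, Finset.mem_map]
  exact ⟨(n, ω), by simp [hn], rfl⟩

theorem sum_idx_succ {F : Type*} [AddCommMonoid F] (j : ℕ) (f : (Fin d → ℤ) → F) :
    ∑ n ∈ idx d (j + 1), f n = ∑ n ∈ idx d j, ∑ ω, f (childIdx n ω) := by
  rw [idx, Finset.sum_map, Finset.sum_product]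
  rfl

theorem abs_childIdx_lt {j : ℕ} {n : Fin d → ℤ} (h : ∀ i, 2 * |n i| < 3 ^ j) (ω : Fin d → Fin 3)
    (i : Fin d) : 2 * |childIdx n ω i| < 3 ^ (j + 1) := by
  have h2 := h i
  have h3 := (ω i).isLt
  change 2 * |3 * n i + ((ω i : ℕ) : ℤ) - 1| < 3 ^ (j + 1)
  obtain ⟨k, hk⟩ : Odd ((3 : ℤ) ^ j) := Odd.pow (by decide)
  rw [pow_succ, hk]
  rw [hk] at h2
  have h5 := abs_le.1 (show |n i| ≤ k by omega)
  have h6 : |3 * n i + ((ω i : ℕ) : ℤ) - 1| ≤ 3 * k + 1 := abs_le.2 ⟨by omega, by omega⟩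
  omega

theorem abs_le_of_mem_idx {j : ℕ} {n : Fin d → ℤ} (hn : n ∈ idx d j) (i : Fin d) :
    2 * |n i| < 3 ^ j := by
  induction j generalizing n i with
  | zero =>
    rw [idx, Finset.mem_singleton] at hn
    simp [hn]
  | succ j ih =>
    rw [idx, Finset.mem_map] at hn
    obtain ⟨⟨n', ω⟩, h1, rfl⟩ := hn
    exact abs_childIdx_lt (ih (Finset.mem_product.1 h1).1) ω i

theorem latticePoint_mem_of_abs_lt {j : ℕ} {n : Fin d → ℤ} (h : ∀ i, 2 * |n i| < 3 ^ j) :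
    latticePoint (0 - (j : ℤ)) n ∈ cube (0 : E d) ((3 : ℝ) ^ (0 : ℤ)) := by
  intro i
  have h1 : (2 : ℝ) * |(n i : ℝ)| < 3 ^ j := by exact_mod_cast h i
  have h2 : side j * 3 ^ j = 1 := by
    rw [side, zero_sub, zpow_neg, zpow_natCast]; field_simp
  have h3 := side_pos j
  rw [latticePoint_apply]
  change |side j * n i - 0| < _
  rw [sub_zero, abs_mul, abs_of_pos h3, zpow_zero]
  nlinarith

theorem abs_lt_of_latticePoint_mem {j : ℕ} {n : Fin d → ℤ}
    (h : latticePoint (0 - (j : ℤ)) n ∈ cube (0 : E d) ((3 : ℝ) ^ (0 : ℤ))) (i : Fin d) :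
    2 * |n i| < 3 ^ j := by
  have h1 := h i
  change |side j * n i - 0| < _ at h1
  have h2 : side j * 3 ^ j = 1 := by
    rw [side, zero_sub, zpow_neg, zpow_natCast]; field_simp
  have h3 := side_pos j
  rw [sub_zero, abs_mul, abs_of_pos h3, zpow_zero] at h1
  have h4 : (2 : ℝ) * |(n i : ℝ)| < 3 ^ j := by
    by_contra h'
    have := mul_le_mul_of_nonneg_left (not_lt.1 h') h3.le
    linarith
  exact_mod_cast h4

theorem tri_subset_of_abs_lt {j : ℕ} {n : Fin d → ℤ} (h : ∀ i, 2 * |n i| < 3 ^ j) :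
    tri j n ⊆ cube (0 : E d) 1 := by
  intro x hx i
  have h1 := hx i
  change |x i - side j * n i| < side j / 2 at h1
  change |x i - 0| < 1 / 2
  have h2 : side j * 3 ^ j = 1 := by
    rw [side, zero_sub, zpow_neg, zpow_natCast]; field_simp
  have h3 := side_pos j
  have h5 : 2 * |n i| + 1 ≤ 3 ^ j := h i
  have h4 : (2 : ℝ) * |(n i : ℝ)| + 1 ≤ 3 ^ j := by exact_mod_cast h5
  have h6 : |x i| ≤ |x i - side j * n i| + side j * |(n i : ℝ)| := by
    have := abs_add_le (x i - side j * n i) (side j * n i)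
    rw [sub_add_cancel, abs_mul, abs_of_pos h3] at this
    exact this
  rw [sub_zero]
  nlinarith

theorem tri_subset {j : ℕ} {n : Fin d → ℤ} (hn : n ∈ idx d j) : tri j n ⊆ cube (0 : E d) 1 :=
  tri_subset_of_abs_lt (abs_le_of_mem_idx hn)

theorem sum_setIntegral_tri_le {j : ℕ} {s : Finset (Fin d → ℤ)} (hs : s ⊆ idx d j)
    {f : E d → ℝ} (hf : IntegrableOn f (cube 0 1)) (hf0 : 0 ≤ᵐ[volume.restrict (cube 0 1)] f)
    {Z : Set (E d)} (hZU : Z ⊆ cube 0 1) (hsZ : ∀ n ∈ s, tri j n ⊆ Z) :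
    ∑ n ∈ s, ∫ x in tri j n, f x ≤ ∫ x in Z, f x := by
  rw [← integral_biUnion_finset s (fun n _ => measurableSet_tri j n)
    (fun n _ n' _ h => tri_disjoint h) fun n hn => hf.mono_set (tri_subset (hs hn))]
  refine setIntegral_mono_set (hf.mono_set hZU) (ae_restrict_of_ae_restrict_of_subset hZU hf0) ?_
  exact (iUnion₂_subset hsZ).eventuallyLE

end Triadic

end CoarseGrained

end

/-! ### Increments of integrals between adjacent cubes -/

noncomputable section
namespace CoarseGrained

variable {d : ℕ}

section Translation

/-- The increment of an integral under translation, as a weighted integral of the derivative. -/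
theorem setIntegral_translate_sub {P Q : Set (E d)} {m : E d → ℝ} {v : E d} {h : ℝ} (hP : IsOpen P)
    (hPc : Convex ℝ P) (hQ : MeasurableSet Q) (hh : 0 ≤ h) (hQP : Q ⊆ P)
    (hQv : ∀ x ∈ Q, x + h • v ∈ P) (hm : ContDiffOn ℝ 1 m P) (hmi : IntegrableOn m P)
    (hgi : IntegrableOn (fun x => fderiv ℝ m x v) P) :
    (∫ x in Q, m (x + h • v)) - ∫ x in Q, m x =
      ∫ y in P, fderiv ℝ m y v * ∫ s in Ioc 0 h, Q.indicator (fun _ => (1 : ℝ)) (y - s • v) := by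
  set g : E d → ℝ := P.indicator fun x => fderiv ℝ m x v with hg
  have hgm : Measurable g := (measurable_fderiv_apply_const ℝ m v).indicator hP.measurableSet
  have hgI : Integrable g := (integrable_indicator_iff hP.measurableSet).2 hgi
  set q : E d → ℝ := Q.indicator fun _ => 1 with hq
  have hqm : Measurable q := measurable_const.indicator hQ
  have hqb : ∀ x, ‖q x‖ ≤ 1 := fun x => by
    by_cases hx : x ∈ Q <;> simp [hq, hx]
  set μ : Measure ℝ := volume.restrict (Ioc 0 h)
  have hF : Integrable (fun p : ℝ × E d => g p.2 * q (p.2 - p.1 • v)) (μ.prod volume) := by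
    have h1 : Integrable (fun p : ℝ × E d => g p.2) (μ.prod volume) := hgI.comp_snd μ
    refine h1.mul_bdd (c := 1) (hqm.comp (by fun_prop)).aestronglyMeasurable
      (Eventually.of_forall fun p => hqb _)
  have hG : Integrable (fun p : ℝ × E d => g (p.2 + p.1 • v) * q p.2) (μ.prod volume) := by
    have hms : AEStronglyMeasurable (fun p : ℝ × E d => g (p.2 + p.1 • v) * q p.2)
        (μ.prod volume) :=
      ((hgm.comp (by fun_prop)).mul (hqm.comp measurable_snd)).aestronglyMeasurable
    rw [integrable_prod_iff hms]
    have h2 := (integrable_prod_iff hF.aestronglyMeasurable).1 hF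
    refine ⟨?_, ?_⟩
    · filter_upwards [h2.1] with s hs
      have := hs.comp_add_right (s • v)
      simpa using this
    · refine h2.2.congr (Eventually.of_forall fun s => ?_)
      have := integral_add_right_eq_self (μ := volume) (fun y => ‖g y * q (y - s • v)‖) (s • v)
      simpa using this.symm
  have hseg : ∀ x ∈ Q, ∀ s ∈ Icc 0 h, x + s • v ∈ P := by
    intro x hx s hs
    rcases hh.eq_or_lt with rfl | h0
    · obtain rfl : s = 0 := le_antisymm hs.2 hs.1
      simpa using hQP hx
    have := hPc.add_smul_mem (hQP hx) (hQv x hx) (t := s / h)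
      ⟨div_nonneg hs.1 hh, (div_le_one h0).2 hs.2⟩
    rwa [smul_smul, div_mul_cancel₀ _ h0.ne'] at this
  -- The fundamental theorem of calculus along the segment from `x` to `x + h • v`, which stays in
  -- the convex set `P`. Exchanging the integrals and translating by `s • v` then moves the shift
  -- onto the indicator function.
  have hftc : ∀ x ∈ Q, m (x + h • v) - m x = ∫ s in Ioc 0 h, g (x + s • v) * q x := by
    intro x hx
    have hderiv : ∀ s ∈ uIcc 0 h, HasDerivAt (fun s : ℝ => m (x + s • v))
        (fderiv ℝ m (x + s • v) v) s := by
      intro s hs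
      rw [uIcc_of_le hh] at hs
      have h1 : HasFDerivAt m (fderiv ℝ m (x + s • v)) (x + s • v) :=
        ((hm.differentiableOn one_ne_zero).differentiableAt
          (hP.mem_nhds (hseg x hx s hs))).hasFDerivAt
      have h2 : HasDerivAt (fun s : ℝ => x + s • v) v s := by
        simpa using ((hasDerivAt_id s).smul_const v).const_add x
      exact h1.comp_hasDerivAt s h2
    have hcont : ContinuousOn (fun s : ℝ => fderiv ℝ m (x + s • v) v) (uIcc 0 h) := by
      rw [uIcc_of_le hh]
      have h1 : ContinuousOn (fun y => fderiv ℝ m y v) P :=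
        (hm.continuousOn_fderiv_of_isOpen hP le_rfl).clm_apply continuousOn_const
      exact h1.comp (by fun_prop) fun s hs => hseg x hx s hs
    have h3 := intervalIntegral.integral_eq_sub_of_hasDerivAt hderiv hcont.intervalIntegrable
    rw [intervalIntegral.integral_of_le hh] at h3
    simp only [zero_smul, add_zero] at h3
    rw [← h3]
    refine setIntegral_congr_fun measurableSet_Ioc fun s hs => ?_
    simp [hg, hq, hx, hseg x hx s ⟨hs.1.le, hs.2⟩]
  have hmQ : IntegrableOn m Q := hmi.mono_set hQP
  have hmQ' : IntegrableOn (fun x => m (x + h • v)) Q := by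
    have h1 : Integrable (P.indicator m) := (integrable_indicator_iff hP.measurableSet).2 hmi
    have h2 := (h1.comp_add_right (h • v)).integrableOn (s := Q)
    refine h2.congr_fun (fun x hx => ?_) hQ
    simp [hQv x hx]
  rw [← integral_sub hmQ' hmQ, setIntegral_congr_fun hQ hftc]
  have e1 : ∫ x in Q, ∫ s in Ioc 0 h, g (x + s • v) * q x =
      ∫ x : E d, ∫ s in Ioc 0 h, g (x + s • v) * q x := by
    refine setIntegral_eq_integral_of_forall_compl_eq_zero fun x hx => ?_
    simp [hq, hx]
  have e2 : ∫ x, ∫ s, g (x + s • v) * q x ∂μ = ∫ s, (∫ x, g (x + s • v) * q x) ∂μ :=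
    (integral_integral_swap (f := fun s x => g (x + s • v) * q x) hG).symm
  have e3 : ∫ s, (∫ x, g (x + s • v) * q x) ∂μ = ∫ s, (∫ y, g y * q (y - s • v)) ∂μ := by
    refine integral_congr_ae (Eventually.of_forall fun s => ?_)
    have := integral_add_right_eq_self (μ := volume) (fun y => g y * q (y - s • v)) (s • v)
    simpa using this
  have e4 : ∫ s, (∫ y, g y * q (y - s • v)) ∂μ = ∫ y, ∫ s, g y * q (y - s • v) ∂μ :=
    integral_integral_swap (f := fun s y => g y * q (y - s • v)) hF
  rw [e1, e2, e3, e4]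
  rw [← setIntegral_eq_integral_of_forall_compl_eq_zero (s := P)]
  · refine setIntegral_congr_fun hP.measurableSet fun y hy => ?_
    rw [integral_const_mul]
    simp [hg, hy]
  · intro y hy
    simp [hg, hy]

theorem volume_hyperplane (i : Fin d) (c : ℝ) : volume {x : E d | x i = c} = 0 := by
  have h := (PiLp.volume_preserving_ofLp (Fin d)).measure_preimage
    (s := {f : Fin d → ℝ | f i = c})
    (measurableSet_eq_fun (measurable_pi_apply i) measurable_const).nullMeasurableSet
  have h2 : {x : E d | x i = c} = (WithLp.ofLp) ⁻¹' {f : Fin d → ℝ | f i = c} := rfl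
  rw [h2, h]
  exact Measure.pi_hyperplane (α := fun _ => ℝ) (fun _ => volume) i c

theorem cube_single_iff {c x : E d} {h s : ℝ} {i : Fin d} :
    x - s • EuclideanSpace.single i (1 : ℝ) ∈ cube c h ↔
      |x i - s - c i| < h / 2 ∧ ∀ k ≠ i, |x k - c k| < h / 2 := by
  constructor
  · intro hx
    refine ⟨by simpa using hx i, fun k hk => by simpa [hk] using hx k⟩
  · rintro ⟨h1, h2⟩ k
    by_cases hk : k = i
    · subst hk; simpa using h1
    · simpa [hk] using h2 k hk

theorem integral_indicator_Ioo_Ioc {h x y : ℝ} (hx : 0 ≤ x) (hy : y ≤ h) (hxy : x ≤ y) :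
    ∫ s in Ioc 0 h, (Ioo x y).indicator (fun _ => (1 : ℝ)) s = y - x := by
  rw [setIntegral_indicator measurableSet_Ioo, inter_eq_right.2]
  · simp [hxy]
  · exact fun s hs => ⟨hx.trans_lt hs.1, hs.2.le.trans hy⟩

/-- The weight with which the derivative enters the increment between adjacent cubes. -/
theorem cube_weight_ae (c : E d) (h : ℝ) (i : Fin d) :
    ∀ᵐ y : E d, ∫ s in Ioc 0 h, (cube c h).indicator (fun _ => (1 : ℝ))
        (y - s • EuclideanSpace.single i (1 : ℝ)) =
      (cube c h).indicator (fun y => y i - c i + h / 2) y +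
      (cube (c + h • EuclideanSpace.single i (1 : ℝ)) h).indicator
        (fun y => h / 2 - (y i - c i - h)) y := by
  -- The common face of the two cubes belongs to neither of them and is a null set.
  have h0 : ∀ᵐ y : E d, y i ≠ c i + h / 2 := by
    rw [ae_iff]; simpa using volume_hyperplane i (c i + h / 2)
  filter_upwards [h0] with y hy
  have hmem' : y ∈ cube (c + h • EuclideanSpace.single i (1 : ℝ)) h ↔
      |y i - h - c i| < h / 2 ∧ ∀ k ≠ i, |y k - c k| < h / 2 := by
    rw [← cube_single_iff]
    refine forall_congr' fun k => ?_
    simp only [PiLp.add_apply, PiLp.sub_apply, PiLp.smul_apply]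
    rw [sub_add_eq_sub_sub, sub_right_comm]
  have hmem : y ∈ cube c h ↔ |y i - c i| < h / 2 ∧ ∀ k ≠ i, |y k - c k| < h / 2 := by
    have := cube_single_iff (c := c) (x := y) (h := h) (s := 0) (i := i)
    simpa using this
  by_cases hk : ∀ k ≠ i, |y k - c k| < h / 2
  · have hs : ∀ s : ℝ, y - s • EuclideanSpace.single i (1 : ℝ) ∈ cube c h ↔ |y i - s - c i| < h / 2 :=
      fun s => by rw [cube_single_iff, and_iff_left hk]
    rw [and_iff_left hk] at hmem hmem'
    simp only [Set.indicator, hs, hmem, hmem']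
    simp only [abs_lt]
    by_cases h1 : -(h / 2) < y i - c i ∧ y i - c i < h / 2
    · have h2 : ¬ (-(h / 2) < y i - h - c i ∧ y i - h - c i < h / 2) := by
        rintro ⟨h3, h4⟩; linarith [h1.2]
      rw [if_pos h1, if_neg h2, add_zero]
      rw [← sub_zero (y i - c i + h / 2),
        ← integral_indicator_Ioo_Ioc le_rfl (by linarith [h1.2] : y i - c i + h / 2 ≤ h)
        (by linarith [h1.1])]
      refine setIntegral_congr_fun measurableSet_Ioc fun s hs => ?_
      simp only [Set.indicator, Set.mem_Ioo]
      refine if_congr ⟨fun h5 => ⟨hs.1, by linarith [h5.1]⟩, fun h5 => ⟨by linarith [h5.2], by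
        linarith [h1.2, hs.1]⟩⟩ rfl rfl
    by_cases h2 : -(h / 2) < y i - h - c i ∧ y i - h - c i < h / 2
    · rw [if_neg h1, if_pos h2, zero_add]
      rw [show h / 2 - (y i - c i - h) = h - (y i - c i - h / 2) by ring,
        ← integral_indicator_Ioo_Ioc (by linarith [h2.1]) le_rfl (by linarith [h2.2])]
      refine setIntegral_congr_ae measurableSet_Ioc ?_
      have : ∀ᵐ s : ℝ, s ≠ h := by simp [ae_iff]
      filter_upwards [this] with s hsh hs
      simp only [Set.indicator, Set.mem_Ioo]
      refine if_congr ⟨fun h5 => ⟨by linarith [h5.2], lt_of_le_of_ne hs.2 hsh⟩, fun h5 => ⟨by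
        linarith [h2.1, hs.2], by linarith [h5.1]⟩⟩ rfl rfl
    · rw [if_neg h1, if_neg h2, zero_add]
      refine setIntegral_eq_zero_of_forall_eq_zero fun s hs => if_neg ?_
      rintro ⟨h3, h4⟩
      rcases lt_trichotomy (y i) (c i + h / 2) with h5 | h5 | h5
      · exact h1 ⟨by linarith [hs.1], by linarith⟩
      · exact hy h5
      · exact h2 ⟨by linarith, by linarith [hs.2]⟩
  · have hs : ∀ s : ℝ, ¬ y - s • EuclideanSpace.single i (1 : ℝ) ∈ cube c h :=
      fun s h' => hk (cube_single_iff.1 h').2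
    rw [indicator_of_notMem fun h' => hk (hmem.1 h').2,
      indicator_of_notMem fun h' => hk (hmem'.1 h').2]
    simp [hs]

/-- The difference of the integrals over two adjacent cubes. -/
theorem setIntegral_cube_sub {P : Set (E d)} {m : E d → ℝ} {c : E d} {h : ℝ} {i : Fin d}
    (hP : IsOpen P) (hPc : Convex ℝ P) (hh : 0 < h) (h1 : cube c h ⊆ P)
    (h2 : cube (c + h • EuclideanSpace.single i (1 : ℝ)) h ⊆ P) (hm : ContDiffOn ℝ 1 m P)
    (hmi : IntegrableOn m P) (hgi : IntegrableOn (gradient m) P) :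
    (∫ x in cube (c + h • EuclideanSpace.single i (1 : ℝ)) h, m x) - ∫ x in cube c h, m x =
      (∫ y in cube c h, gradient m y i * (y i - c i + h / 2)) +
      ∫ y in cube (c + h • EuclideanSpace.single i (1 : ℝ)) h,
        gradient m y i * (h / 2 - (y i - c i - h)) := by
  set v : E d := EuclideanSpace.single i (1 : ℝ)
  have hgv : ∀ y, fderiv ℝ m y v = gradient m y i := fun y => by
    rw [← inner_gradient_left, EuclideanSpace.inner_single_right]
    simp
  have hci : IntegrableOn (fun y => gradient m y i) P :=
    ((EuclideanSpace.proj (𝕜 := ℝ) i).integrable_comp hgi)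
  have hshift : ∀ x, x + h • v ∈ cube (c + h • v) h ↔ x ∈ cube c h := fun x => by
    refine forall_congr' fun k => ?_
    simp
  have hQv : ∀ x ∈ cube c h, x + h • v ∈ P := fun x hx => h2 ((hshift x).2 hx)
  have key := setIntegral_translate_sub hP hPc (measurableSet_cube c h) hh.le h1 hQv hm hmi
    (by simpa only [hgv] using hci)
  have e1 : ∫ x in cube c h, m (x + h • v) = ∫ x in cube (c + h • v) h, m x := by
    rw [← integral_indicator (measurableSet_cube _ _), ← integral_indicator (measurableSet_cube _ _),
      ← integral_add_right_eq_self (μ := volume) ((cube (c + h • v) h).indicator m) (h • v)]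
    refine integral_congr_ae (Eventually.of_forall fun x => ?_)
    by_cases hx : x ∈ cube c h
    · simp [hx, (hshift x).2 hx]
    · simp [hx, mt (hshift x).1 hx]
  have hb : ∀ (c' : E d) (b : ℝ), cube c' h ⊆ P → c' i = b → ∀ e : ℝ, ∀ ε : ℝ,
      IntegrableOn (fun y => gradient m y i * (e + ε * (y i - b))) (cube c' h) := by
    intro c' b hc' hb e ε
    refine (hci.mono_set hc').mul_bdd (c := |e| + |ε| * (h / 2))
      (Continuous.aestronglyMeasurable (by fun_prop)) ?_
    filter_upwards [ae_restrict_mem (measurableSet_cube c' h)] with y hy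
    have := hy i
    rw [hb] at this
    rw [Real.norm_eq_abs]
    refine (abs_add_le _ _).trans ?_
    rw [abs_mul]
    gcongr
  rw [e1] at key
  rw [key]
  simp only [hgv]
  have e2 : ∫ y in P, gradient m y i * ∫ s in Ioc 0 h,
      (cube c h).indicator (fun _ => (1 : ℝ)) (y - s • v) =
      ∫ y in P, ((cube c h).indicator (fun y => gradient m y i * (y i - c i + h / 2)) y +
        (cube (c + h • v) h).indicator (fun y => gradient m y i * (h / 2 - (y i - c i - h))) y) := by
    refine integral_congr_ae ?_
    filter_upwards [ae_restrict_of_ae (cube_weight_ae c h i)] with y hy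
    rw [hy, mul_add, indicator_mul_right, indicator_mul_right]
  rw [e2, integral_add, setIntegral_indicator (measurableSet_cube _ _),
    setIntegral_indicator (measurableSet_cube _ _), inter_eq_right.2 h1, inter_eq_right.2 h2]
  · rw [integrable_indicator_iff (measurableSet_cube _ _), IntegrableOn,
      Measure.restrict_restrict (measurableSet_cube _ _), inter_eq_left.2 h1]
    refine (hb c (c i) h1 rfl (h / 2) 1).congr (Eventually.of_forall fun y => ?_)
    simp only []; ring
  · rw [integrable_indicator_iff (measurableSet_cube _ _), IntegrableOn,
      Measure.restrict_restrict (measurableSet_cube _ _), inter_eq_left.2 h2]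
    refine (hb (c + h • v) (c i + h) h2 (by simp [v]) (h / 2) (-1)).congr
      (Eventually.of_forall fun y => ?_)
    simp only []; ring

end Translation

end CoarseGrained

end

/-! ### From slopes to oscillations between children -/

noncomputable section
namespace CoarseGrained

variable {d : ℕ}

section Moments

/-- The first moments, relative to the centre, of the components of a vector field. -/
def moment (j : ℕ) (n : Fin d → ℤ) (G : E d → E d) : E d :=
  WithLp.toLp 2 fun i => ∫ x in tri j n, G x i * ((x i - side j * n i) / side j)

theorem moment_apply (j : ℕ) (n : Fin d → ℤ) (G : E d → E d) (i : Fin d) :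
    moment j n G i = ∫ x in tri j n, G x i * ((x i - side j * n i) / side j) := rfl

theorem integrable_coord {W : Set (E d)} {G : E d → E d} (hG : IntegrableOn G W) (i : Fin d) :
    IntegrableOn (fun x => G x i) W :=
  (EuclideanSpace.proj (𝕜 := ℝ) i).integrable_comp hG

theorem integral_coord {W : Set (E d)} {G : E d → E d} (hG : IntegrableOn G W) (i : Fin d) :
    ∫ x in W, G x i = (∫ x in W, G x) i :=
  (EuclideanSpace.proj (𝕜 := ℝ) i).integral_comp_comm hG

theorem abs_coord_div_le {j : ℕ} {n : Fin d → ℤ} {x : E d} (hx : x ∈ tri j n) (i : Fin d) :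
    |(x i - side j * n i) / side j| ≤ 1 / 2 := by
  have hp := side_pos j
  rw [abs_div, abs_of_pos hp, div_le_iff₀ hp]
  have := mem_tri.1 hx i
  linarith

theorem integrableOn_coord_mul {j : ℕ} {n : Fin d → ℤ} {G : E d → E d}
    (hG : IntegrableOn G (tri j n)) (i : Fin d) :
    IntegrableOn (fun x => G x i * ((x i - side j * n i) / side j)) (tri j n) := by
  refine (integrable_coord hG i).mul_bdd (c := 1 / 2)
    (Continuous.aestronglyMeasurable (by fun_prop)) ?_
  filter_upwards [ae_restrict_mem (measurableSet_tri j n)] with x hx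
  exact abs_coord_div_le hx i

theorem norm_moment_le {j : ℕ} {n : Fin d → ℤ} {G : E d → E d} (hG : IntegrableOn G (tri j n)) :
    ‖moment j n G‖ ≤ 1 / 2 * ∫ x in tri j n, ‖G x‖ := by
  set K : E d → E d := fun x => WithLp.toLp 2 fun i => G x i * ((x i - side j * n i) / side j)
  have hKn : ∀ x ∈ tri j n, ‖K x‖ ≤ 1 / 2 * ‖G x‖ := by
    intro x hx
    rw [EuclideanSpace.norm_eq, EuclideanSpace.norm_eq, Real.sqrt_le_iff]
    refine ⟨by positivity, ?_⟩
    rw [mul_pow, Real.sq_sqrt (Finset.sum_nonneg fun i _ => by positivity), Finset.mul_sum]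
    refine Finset.sum_le_sum fun i _ => ?_
    change ‖G x i * ((x i - side j * n i) / side j)‖ ^ 2 ≤ _
    rw [norm_mul, mul_pow, mul_comm]
    refine mul_le_mul_of_nonneg_right ?_ (by positivity)
    exact pow_le_pow_left₀ (norm_nonneg _) (abs_coord_div_le hx i) 2
  have hKm : AEStronglyMeasurable K (volume.restrict (tri j n)) := by
    have h1 : AEMeasurable (fun x => fun i => G x i * ((x i - side j * n i) / side j))
        (volume.restrict (tri j n)) :=
      aemeasurable_pi_lambda _ fun i => (integrableOn_coord_mul hG i).aemeasurable
    exact ((WithLp.measurable_toLp 2 (Fin d → ℝ)).comp_aemeasurable h1).aestronglyMeasurable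
  have hKI : IntegrableOn K (tri j n) := by
    refine (hG.norm.const_mul (1 / 2)).mono' hKm ?_
    filter_upwards [ae_restrict_mem (measurableSet_tri j n)] with x hx using hKn x hx
  have he : moment j n G = ∫ x in tri j n, K x := by
    ext i
    rw [← integral_coord hKI i]
    rfl
  rw [he, ← integral_const_mul]
  refine norm_integral_le_of_norm_le (hG.norm.const_mul (1 / 2)) ?_
  filter_upwards [ae_restrict_mem (measurableSet_tri j n)] with x hx using hKn x hx

/-- On the child `ω` the relative coordinate in the parent is one third of the offset `ω i - 1` plus
the relative coordinate in the child. -/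
theorem moment_eq_sum {j : ℕ} {n : Fin d → ℤ} {G : E d → E d} (hG : IntegrableOn G (tri j n)) :
    moment j n G = (1 / 3 : ℝ) • ∑ ω : Fin d → Fin 3,
      ((WithLp.toLp 2 fun i => (((ω i : ℕ) : ℝ) - 1) * (∫ x in tri (j + 1) (childIdx n ω), G x) i) +
        moment (j + 1) (childIdx n ω) G) := by
  ext i
  have hp := side_pos j
  rw [moment_apply, setIntegral_tri_eq_sum (integrableOn_coord_mul hG i)]
  simp only [PiLp.smul_apply, WithLp.ofLp_sum, Finset.sum_apply, PiLp.add_apply, smul_eq_mul,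
    moment_apply]
  rw [Finset.mul_sum]
  refine Finset.sum_congr rfl fun ω _ => ?_
  have hc := hG.mono_set (tri_child_subset j n ω)
  rw [← integral_coord hc i, ← integral_const_mul, ← integral_add
    ((integrable_coord hc i).const_mul _) (integrableOn_coord_mul hc i), ← integral_const_mul]
  refine integral_congr_ae (Eventually.of_forall fun x => ?_)
  simp only []
  rw [side_mul_childIdx, side_succ]
  field_simp
  ring

theorem sum_fin_three_fun_sq (i : Fin d) :
    ∑ ω : Fin d → Fin 3, ((((ω i : ℕ) : ℝ) - 1) ^ 2) = 2 / 3 * 3 ^ d := by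
  have h := sum_avgCoord (α := Fin 3) i fun ω : Fin d → Fin 3 => (((ω i : ℕ) : ℝ) - 1) ^ 2
  rw [← h]
  have : ∀ ω : Fin d → Fin 3, avgCoord i (fun ω : Fin d → Fin 3 => (((ω i : ℕ) : ℝ) - 1) ^ 2) ω = 2 / 3 := fun ω => by
    simp [avgCoord, Fin.sum_univ_three]; norm_num
  simp only [this]
  simp
  ring

/-- Cauchy-Schwarz separately in each coordinate, with `∑ (ω i - 1)² = (2/3) 3^d`. The `i`-th offset
only meets the `i`-th component, so no factor of the dimension is lost beyond the number of
children. -/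
theorem norm_sum_offset_le (D : (Fin d → Fin 3) → E d) :
    ‖∑ ω : Fin d → Fin 3, (WithLp.toLp 2 fun i => (((ω i : ℕ) : ℝ) - 1) * D ω i : E d)‖ ^ 2 ≤
      2 / 3 * 3 ^ d * ∑ ω, ‖D ω‖ ^ 2 := by
  simp only [EuclideanSpace.real_norm_sq_eq, WithLp.ofLp_sum, Finset.sum_apply]
  rw [Finset.sum_comm, Finset.mul_sum]
  refine Finset.sum_le_sum fun i _ => ?_
  rw [← sum_fin_three_fun_sq i]
  exact Finset.sum_mul_sq_le_sq_mul_sq _ _ _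

theorem bil_tri_eq_sum {a : CoeffField d} {G : E d → E d} {j : ℕ} {n : Fin d → ℤ}
    (ha : IsCoefficientField a (tri j n)) (hG : FiniteEnergy a (tri j n) G) :
    bil a (tri j n) G G = ∑ ω, bil a (tri (j + 1) (childIdx n ω)) G G :=
  setIntegral_tri_eq_sum (hG.integrable ha)

theorem side_pow_succ (j : ℕ) : 3 ^ d * side (j + 1) ^ d = side j ^ d := by
  rw [side_succ, div_pow]; field_simp

theorem sum_sqrt_child_le {a : CoeffField d} {G : E d → E d} {j : ℕ} {n : Fin d → ℤ}
    (ha : IsCoefficientField a (tri j n)) (hG : FiniteEnergy a (tri j n) G) :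
    ∑ ω, √(side (j + 1) ^ d * bil a (tri (j + 1) (childIdx n ω)) G G) ≤
      √(side j ^ d * bil a (tri j n) G G) := by
  have hp := side_pos (j + 1)
  refine Real.le_sqrt_of_sq_le ?_
  have h := Finset.sum_mul_sq_le_sq_mul_sq Finset.univ (fun _ : Fin d → Fin 3 => (1 : ℝ))
    fun ω => √(side (j + 1) ^ d * bil a (tri (j + 1) (childIdx n ω)) G G)
  simp only [one_mul] at h
  refine h.trans (le_of_eq ?_)
  have h2 : ∀ ω : Fin d → Fin 3, √(side (j + 1) ^ d * bil a (tri (j + 1) (childIdx n ω)) G G) ^ 2 =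
      side (j + 1) ^ d * bil a (tri (j + 1) (childIdx n ω)) G G := fun ω =>
    Real.sq_sqrt (mul_nonneg (by positivity)
      (bil_self_nonneg (ha.mono (tri_child_subset j n ω)) G))
  simp only [h2]
  rw [← Finset.mul_sum, ← bil_tri_eq_sum ha hG, ← side_pow_succ j]
  simp
  ring

/-- The triadic slope bounds of a gradient control its first moments. -/
theorem norm_moment_le_of_slopes {a : CoeffField d} {G : E d → E d} {A t : ℝ}
    (ha : IsCoefficientField a (cube 0 1)) (hG : FiniteEnergy a (cube 0 1) G) (hA : 0 ≤ A)
    (ht : t < 1)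
    (hD : ∀ j, ∀ n ∈ idx d j, ‖∫ x in tri j n, G x‖ ^ 2 ≤
      (A * 3 ^ (t * (j : ℝ))) ^ 2 * (side j ^ d * bil a (tri j n) G G))
    {j : ℕ} {n : Fin d → ℤ} (hn : n ∈ idx d j) :
    ‖moment j n G‖ ≤ A * (7 / 8 * (3 : ℝ) ^ (t - 1) / (1 - 3 ^ (t - 1))) * 3 ^ (t * (j : ℝ)) *
      √(side j ^ d * bil a (tri j n) G G) := by
  set y : ℝ := (3 : ℝ) ^ (t - 1) with hy
  have hy0 : 0 < y := by positivity
  have hy1 : y < 1 := Real.rpow_lt_one_of_one_lt_of_neg (by norm_num) (by linarith)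
  -- `K` solves `K = y (7/8 + K)`: passing to the children, the factor `1/3` of the moments times
  -- the growth `3^t` of the slope bounds is `y = 3^{t-1}`. After `k` generations the trivial bound
  -- for the moments carries the factor `3^{-k}`.
  set K := 7 / 8 * y / (1 - y) with hK
  have hKy : y * (7 / 8 + K) = K := by rw [hK]; field_simp [(by linarith : (1 - y) ≠ 0)]; ring
  have hK0 : 0 ≤ K := by have : 0 < 1 - y := by linarith
                         positivity
  have hGI : IntegrableOn G (cube 0 1) := hG.integrable_self ha
  have main : ∀ k : ℕ, ∀ j : ℕ, ∀ n ∈ idx d j, ‖moment j n G‖ ≤ A * K * 3 ^ (t * (j : ℝ)) *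
      √(side j ^ d * bil a (tri j n) G G) + (1 / 3) ^ k * (1 / 2 * ∫ x in tri j n, ‖G x‖) := by
    intro k
    induction k with
    | zero =>
      intro j n hn
      have h1 := norm_moment_le (hGI.mono_set (tri_subset hn))
      have h2 : 0 ≤ A * K * 3 ^ (t * (j : ℝ)) * √(side j ^ d * bil a (tri j n) G G) := by positivity
      rw [pow_zero, one_mul]
      linarith
    | succ k ih =>
      intro j n hn
      have haj := ha.mono (tri_subset hn)
      have hGj := hG.mono (tri_subset hn)
      have hGIj := hGI.mono_set (tri_subset hn)
      have h3 : (3 : ℝ) ^ (t * ((j + 1 : ℕ) : ℝ)) = 3 * y * 3 ^ (t * (j : ℝ)) := by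
        rw [hy, Real.rpow_sub_one (by norm_num), mul_div_cancel₀ _ (by norm_num : (3 : ℝ) ≠ 0),
          ← Real.rpow_add (by norm_num)]
        congr 1; push_cast; ring
      set T : ℝ := (3 : ℝ) ^ (t * (j : ℝ)) with hT
      have hT0 : 0 < T := by positivity
      set V := side j ^ d * bil a (tri j n) G G with hV
      have hV0 : 0 ≤ V := mul_nonneg (by have := side_pos j; positivity) (bil_self_nonneg haj G)
      rw [moment_eq_sum hGIj, norm_smul, Finset.sum_add_distrib]
      -- The constant `7/8` replaces `√(2/3)`, the bound for the offsets.
      have b1 : ‖∑ ω : Fin d → Fin 3, (WithLp.toLp 2 fun i => (((ω i : ℕ) : ℝ) - 1) *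
          (∫ x in tri (j + 1) (childIdx n ω), G x) i : E d)‖ ≤ 7 / 8 * (A * (3 * y * T)) * √V := by
        refine abs_le_of_sq_le_sq' ?_ (by positivity) |>.2
        refine (norm_sum_offset_le fun ω => ∫ x in tri (j + 1) (childIdx n ω), G x).trans ?_
        rw [mul_pow, Real.sq_sqrt hV0]
        have h4 : ∑ ω, ‖∫ x in tri (j + 1) (childIdx n ω), G x‖ ^ 2 ≤
            ∑ ω, (A * (3 * y * T)) ^ 2 * (side (j + 1) ^ d *
              bil a (tri (j + 1) (childIdx n ω)) G G) :=
          Finset.sum_le_sum fun ω _ => by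
            have := hD (j + 1) _ (childIdx_mem_idx hn ω)
            rwa [h3] at this
        rw [← Finset.mul_sum, ← Finset.mul_sum, ← bil_tri_eq_sum haj hGj] at h4
        have h5 : 3 ^ d * (side (j + 1) ^ d * bil a (tri j n) G G) = V := by
          rw [← mul_assoc, side_pow_succ]
        have h6 : (0 : ℝ) ≤ (A * (3 * y * T)) ^ 2 * V := by positivity
        calc 2 / 3 * 3 ^ d * ∑ ω, ‖∫ x in tri (j + 1) (childIdx n ω), G x‖ ^ 2
            ≤ 2 / 3 * 3 ^ d * ((A * (3 * y * T)) ^ 2 *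
              (side (j + 1) ^ d * bil a (tri j n) G G)) := by gcongr
          _ = 2 / 3 * ((A * (3 * y * T)) ^ 2 * V) := by rw [← h5]; ring
          _ ≤ (7 / 8 * (A * (3 * y * T))) ^ 2 * V := by nlinarith
      have b2 : ‖∑ ω : Fin d → Fin 3, moment (j + 1) (childIdx n ω) G‖ ≤
          A * K * (3 * y * T) * √V + (1 / 3) ^ k * (1 / 2 * ∫ x in tri j n, ‖G x‖) := by
        refine (norm_sum_le _ _).trans ((Finset.sum_le_sum fun ω _ =>
          ih (j + 1) _ (childIdx_mem_idx hn ω)).trans ?_)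
        rw [Finset.sum_add_distrib, ← Finset.mul_sum, ← Finset.mul_sum, ← Finset.mul_sum, h3,
          ← setIntegral_tri_eq_sum hGIj.norm]
        have := sum_sqrt_child_le haj hGj
        gcongr
      have h7 := norm_add_le (∑ ω : Fin d → Fin 3, (WithLp.toLp 2 fun i => (((ω i : ℕ) : ℝ) - 1) *
          (∫ x in tri (j + 1) (childIdx n ω), G x) i : E d))
          (∑ ω : Fin d → Fin 3, moment (j + 1) (childIdx n ω) G)
      have h8 : ‖(1 / 3 : ℝ)‖ = 1 / 3 := by norm_num
      rw [h8]
      have h9 : A * K * T * √V = A * T * √V * (y * (7 / 8 + K)) := by rw [hKy]; ring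
      rw [h9, pow_succ]
      linarith
  have hlim : Tendsto (fun k : ℕ => A * K * 3 ^ (t * (j : ℝ)) *
      √(side j ^ d * bil a (tri j n) G G) + (1 / 3 : ℝ) ^ k * (1 / 2 * ∫ x in tri j n, ‖G x‖)) atTop
      (𝓝 (A * K * 3 ^ (t * (j : ℝ)) * √(side j ^ d * bil a (tri j n) G G) +
        0 * (1 / 2 * ∫ x in tri j n, ‖G x‖))) :=
    ((tendsto_pow_atTop_nhds_zero_of_lt_one (by norm_num) (by norm_num)).mul_const _).const_add _
  rw [zero_mul, add_zero] at hlim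
  exact ge_of_tendsto' hlim fun k => main k j n hn

theorem childIdx_update_center (j : ℕ) (n : Fin d → ℤ) (ω : Fin d → Fin 3) (i : Fin d)
    (b c : Fin 3) (hbc : (c : ℕ) = b + 1) :
    tri (j + 1) (childIdx n (Function.update ω i c)) =
      cube (latticePoint (0 - ((j + 1 : ℕ) : ℤ)) (childIdx n (Function.update ω i b)) +
        side (j + 1) • EuclideanSpace.single i (1 : ℝ)) (side (j + 1)) := by
  rw [tri]
  congr 1
  ext k
  change side (j + 1) * (childIdx n (Function.update ω i c) k : ℝ) =
    side (j + 1) * (childIdx n (Function.update ω i b) k : ℝ) + side (j + 1) *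
      (EuclideanSpace.single i (1 : ℝ) : E d) k
  by_cases hk : k = i
  · subst hk
    simp only [childIdx, Function.update_self, hbc, PiLp.single_apply, if_true]
    push_cast; ring
  · simp [childIdx, hk]

/-- The weights with which the derivative enters the increment are affine: rising from `0` to `h`
across the first cube and falling back across the second. Hence each cube contributes half of its
total slope, plus its first moment on the first cube and minus it on the second. -/
theorem setIntegral_child_sub {m : E d → ℝ} {j : ℕ} {n : Fin d → ℤ}
    (hm : ContDiffOn ℝ 1 m (tri j n)) (hmi : IntegrableOn m (tri j n))
    (hgi : IntegrableOn (gradient m) (tri j n)) (ω : Fin d → Fin 3) (i : Fin d)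
    (b c : Fin 3) (hbc : (c : ℕ) = b + 1) :
    (∫ x in tri (j + 1) (childIdx n (Function.update ω i c)), m x) -
      ∫ x in tri (j + 1) (childIdx n (Function.update ω i b)), m x =
    side (j + 1) * (((∫ x in tri (j + 1) (childIdx n (Function.update ω i b)), gradient m x) i +
      (∫ x in tri (j + 1) (childIdx n (Function.update ω i c)), gradient m x) i) / 2 +
      moment (j + 1) (childIdx n (Function.update ω i b)) (gradient m) i -
      moment (j + 1) (childIdx n (Function.update ω i c)) (gradient m) i) := by
  have hp := side_pos (j + 1)
  have hsub := fun ω => tri_child_subset j n ω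
  have e := childIdx_update_center j n ω i b c hbc
  set n₁ := childIdx n (Function.update ω i b) with hn₁
  set n₂ := childIdx n (Function.update ω i c) with hn₂
  have h : (∫ x in tri (j + 1) n₂, m x) - ∫ x in tri (j + 1) n₁, m x =
      (∫ y in tri (j + 1) n₁, gradient m y i *
        (y i - side (j + 1) * (n₁ i : ℝ) + side (j + 1) / 2)) +
      ∫ y in tri (j + 1) n₂, gradient m y i *
        (side (j + 1) / 2 - (y i - side (j + 1) * (n₁ i : ℝ) - side (j + 1))) := by
    have h := setIntegral_cube_sub (isOpen_tri j n) (convex_tri j n) hp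
      (hsub (Function.update ω i b)) (e ▸ hsub (Function.update ω i c)) hm hmi hgi
    rw [← e] at h
    exact h
  have hc : (n₂ i : ℝ) = n₁ i + 1 := by
    simp only [hn₁, hn₂, childIdx, Function.update_self, hbc]
    push_cast; ring
  have g₁ : IntegrableOn (gradient m) (tri (j + 1) n₁) := hgi.mono_set (hsub _)
  have g₂ : IntegrableOn (gradient m) (tri (j + 1) n₂) := hgi.mono_set (hsub _)
  have e₁ : ∫ y in tri (j + 1) n₁, gradient m y i *
        (y i - side (j + 1) * (n₁ i : ℝ) + side (j + 1) / 2) =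
      side (j + 1) * (moment (j + 1) n₁ (gradient m) i +
        (∫ x in tri (j + 1) n₁, gradient m x) i / 2) := by
    rw [moment_apply, ← integral_coord g₁, mul_add, ← mul_div_assoc, mul_div_right_comm,
      ← integral_const_mul, ← integral_const_mul, ← integral_add
      ((integrableOn_coord_mul g₁ i).const_mul _) ((integrable_coord g₁ i).const_mul _)]
    refine integral_congr_ae (Eventually.of_forall fun x => ?_)
    field_simp
  have e₂ : ∫ y in tri (j + 1) n₂, gradient m y i *
        (side (j + 1) / 2 - (y i - side (j + 1) * (n₁ i : ℝ) - side (j + 1))) =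
      side (j + 1) * ((∫ x in tri (j + 1) n₂, gradient m x) i / 2 -
        moment (j + 1) n₂ (gradient m) i) := by
    rw [moment_apply, ← integral_coord g₂, mul_sub, ← mul_div_assoc, mul_div_right_comm,
      ← integral_const_mul, ← integral_const_mul, ← integral_sub
      ((integrable_coord g₂ i).const_mul _) ((integrableOn_coord_mul g₂ i).const_mul _)]
    refine integral_congr_ae (Eventually.of_forall fun x => ?_)
    simp only []
    rw [hc]
    field_simp
    ring
  rw [h, e₁, e₂]
  ring

/-- The triadic slope bounds of a gradient control the oscillation of the function between the
children of a triadic cube, with a constant that does not depend on the dimension. -/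
theorem sum_sq_child_sub_mean_le {a : CoeffField d} {m : E d → ℝ} {A t : ℝ}
    (ha : IsCoefficientField a (cube 0 1)) (hm : ContDiffOn ℝ 1 m (cube 0 1))
    (hmi : IntegrableOn m (cube 0 1)) (hG : FiniteEnergy a (cube 0 1) (gradient m)) (hA : 0 ≤ A)
    (ht : t < 1)
    (hD : ∀ j, ∀ n ∈ idx d j, ‖∫ x in tri j n, gradient m x‖ ^ 2 ≤
      (A * 3 ^ (t * (j : ℝ))) ^ 2 * (side j ^ d * bil a (tri j n) (gradient m) (gradient m)))
    {j : ℕ} {n : Fin d → ℤ} (hn : n ∈ idx d j) :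
    ∑ ω, ((∫ x in tri (j + 1) (childIdx n ω), m x) -
        (∑ ω', ∫ x in tri (j + 1) (childIdx n ω'), m x) / Fintype.card (Fin d → Fin 3)) ^ 2 ≤
      (side (j + 1) * (7 / 8 / (1 - 3 ^ (t - 1))) * (A * 3 ^ (t * ((j + 1 : ℕ) : ℝ)))) ^ 2 *
        (side (j + 1) ^ d * bil a (tri j n) (gradient m) (gradient m)) := by
  have hy0 : (0 : ℝ) < (3 : ℝ) ^ (t - 1) := by positivity
  have hy1 : (3 : ℝ) ^ (t - 1) < 1 := Real.rpow_lt_one_of_one_lt_of_neg (by norm_num) (by linarith)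
  set y : ℝ := (3 : ℝ) ^ (t - 1) with hy
  set K := 7 / 8 * y / (1 - y) with hK
  have h1y : 0 < 1 - y := by linarith
  have hK0 : 0 < K := by positivity
  -- Slopes contribute `7/8` and moments `K` to each of the two factors in the three-point
  -- inequality, so the final constant is `(7/8 + K)²`.
  have hKy : 7 / 8 + K = 7 / 8 / (1 - y) := by rw [hK]; field_simp; ring
  have hgI : IntegrableOn (gradient m) (cube 0 1) := hG.integrable_self ha
  have haj := ha.mono (tri_subset hn)
  have hGj := hG.mono (tri_subset hn)
  set h := side (j + 1) with hh
  have hp : 0 < h := side_pos (j + 1)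
  set B := A * (3 : ℝ) ^ (t * ((j + 1 : ℕ) : ℝ)) with hB
  set f : (Fin d → Fin 3) → ℝ := fun ω => ∫ x in tri (j + 1) (childIdx n ω), m x with hf
  set D : (Fin d → Fin 3) → E d := fun ω => ∫ x in tri (j + 1) (childIdx n ω), gradient m x with hDd
  set r : (Fin d → Fin 3) → E d := fun ω => moment (j + 1) (childIdx n ω) (gradient m) with hr
  set V : (Fin d → Fin 3) → ℝ := fun ω =>
    h ^ d * bil a (tri (j + 1) (childIdx n ω)) (gradient m) (gradient m) with hV
  have hV0 : ∀ ω, 0 ≤ V ω := fun ω => mul_nonneg (by positivity)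
    (bil_self_nonneg (haj.mono (tri_child_subset j n ω)) _)
  have hD' : ∀ ω, ‖D ω‖ ^ 2 ≤ B ^ 2 * V ω := fun ω => hD (j + 1) _ (childIdx_mem_idx hn ω)
  have hr' : ∀ ω, ‖r ω‖ ^ 2 ≤ K ^ 2 * (B ^ 2 * V ω) := fun ω => by
    have h1 := norm_moment_le_of_slopes ha hG hA ht hD (childIdx_mem_idx hn ω)
    have h2 := pow_le_pow_left₀ (norm_nonneg _) h1 2
    rw [mul_pow, Real.sq_sqrt (hV0 ω)] at h2
    refine h2.trans (le_of_eq ?_)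
    rw [hB]; ring
  have line : ∀ i ω, ∑ b, (f (Function.update ω i b) - avgCoord i f ω) ^ 2 ≤
      h ^ 2 * (7 / 8 + K) * (7 / 8 * ∑ b, (D (Function.update ω i b) i) ^ 2 +
        (∑ b, (r (Function.update ω i b) i) ^ 2) / K) := by
    intro i ω
    have key := fun (b c : Fin 3) (hbc : (c : ℕ) = b + 1) =>
      setIntegral_child_sub (hm.mono (tri_subset hn)) (hmi.mono_set (tri_subset hn))
        (hgI.mono_set (tri_subset hn)) ω i b c hbc
    exact three_point_variance (f := fun b => f (Function.update ω i b))
      (D := fun b => D (Function.update ω i b) i) (r := fun b => r (Function.update ω i b) i) hK0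
      (key 0 1 rfl) (key 1 2 rfl)
  -- The children form the product `{0, 1, 2}^d`, so the oscillation is bounded by the sum over
  -- directions of the variances along rows of three adjacent cubes. Direction `i` involves only the
  -- `i`-th components, which add up to Euclidean norms.
  refine (efron_stein f).trans ?_
  have hi : ∀ i, ∑ ω, (f ω - avgCoord i f ω) ^ 2 ≤ h ^ 2 * (7 / 8 + K) *
      (7 / 8 * ∑ ω, (D ω i) ^ 2 + (∑ ω, (r ω i) ^ 2) / K) := by
    intro i
    rw [sum_sq_sub_avgCoord_eq]
    have hcard : (Fintype.card (Fin 3) : ℝ) = 3 := by simp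
    rw [hcard, div_le_iff₀ (by norm_num)]
    refine (Finset.sum_le_sum fun ω _ => line i ω).trans (le_of_eq ?_)
    rw [← Finset.mul_sum, Finset.sum_add_distrib, ← Finset.mul_sum, ← Finset.sum_div,
      sum_sum_update i fun ω => (D ω i) ^ 2, sum_sum_update i fun ω => (r ω i) ^ 2]
    simp only [Fintype.card_fin, nsmul_eq_mul]
    push_cast; ring
  refine (Finset.sum_le_sum fun i _ => hi i).trans ?_
  rw [← Finset.mul_sum, Finset.sum_add_distrib, ← Finset.mul_sum, ← Finset.sum_div,
    Finset.sum_comm, Finset.sum_comm (f := fun i ω => (r ω i) ^ 2)]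
  simp only [← EuclideanSpace.real_norm_sq_eq]
  have s1 : ∑ ω, ‖D ω‖ ^ 2 ≤ B ^ 2 * ∑ ω, V ω := by
    rw [Finset.mul_sum]; exact Finset.sum_le_sum fun ω _ => hD' ω
  have s2 : ∑ ω, ‖r ω‖ ^ 2 ≤ K ^ 2 * (B ^ 2 * ∑ ω, V ω) := by
    rw [Finset.mul_sum, Finset.mul_sum]; exact Finset.sum_le_sum fun ω _ => hr' ω
  have s3 : ∑ ω, V ω = h ^ d * bil a (tri j n) (gradient m) (gradient m) := by
    rw [bil_tri_eq_sum haj hGj, Finset.mul_sum]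
  rw [s3] at s1 s2
  have s4 : (∑ ω, ‖r ω‖ ^ 2) / K ≤
      K * (B ^ 2 * (h ^ d * bil a (tri j n) (gradient m) (gradient m))) := by
    rw [div_le_iff₀ hK0]
    refine s2.trans (le_of_eq (by ring))
  calc h ^ 2 * (7 / 8 + K) * (7 / 8 * ∑ ω, ‖D ω‖ ^ 2 + (∑ ω, ‖r ω‖ ^ 2) / K)
      ≤ h ^ 2 * (7 / 8 + K) * (7 / 8 * (B ^ 2 * (h ^ d * bil a (tri j n) (gradient m) (gradient m))) +
        K * (B ^ 2 * (h ^ d * bil a (tri j n) (gradient m) (gradient m)))) := by gcongr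
    _ = _ := by rw [← hKy]; ring

end Moments

end CoarseGrained

end

/-! ### Monotonicity of the coarse-grained quantities in the scale -/

noncomputable section
namespace CoarseGrained

variable {d : ℕ}

section Scales

theorem exists_setAverage_child_ge {f : E d → ℝ} {j : ℕ} {n : Fin d → ℤ}
    (hf : IntegrableOn f (tri j n)) :
    ∃ ω, ⨍ x in tri j n, f x ≤ ⨍ x in tri (j + 1) (childIdx n ω), f x := by
  by_contra! h
  have hp := side_pos (j + 1)
  simp only [setAverage_eq, volume_real_tri, smul_eq_mul] at h
  have h1 : ∀ ω, ∫ x in tri (j + 1) (childIdx n ω), f x <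
      side (j + 1) ^ d * ((side j ^ d)⁻¹ * ∫ x in tri j n, f x) := fun ω => by
    have h2 := mul_lt_mul_of_pos_left (h ω) (by positivity : 0 < side (j + 1) ^ d)
    rwa [mul_inv_cancel_left₀ (by positivity)] at h2
  have h3 := Finset.sum_lt_sum_of_nonempty (s := (Finset.univ : Finset (Fin d → Fin 3)))
    Finset.univ_nonempty fun ω _ => h1 ω
  rw [← setIntegral_tri_eq_sum hf] at h3
  simp only [Finset.sum_const, Finset.card_univ, Fintype.card_fun, Fintype.card_fin,
    nsmul_eq_mul] at h3
  push_cast at h3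
  rw [← mul_assoc, side_pow_succ, mul_inv_cancel_left₀ (by have := side_pos j; positivity)] at h3
  exact lt_irrefl _ h3

/-- The average over the parent is the mean of the averages over the children, so the restriction of
a competitor to some child does at least as well. -/
theorem cgANorm_tri_le {S : Set ConeName} {a : CoeffField d} {j : ℕ} {n : Fin d → ℤ}
    (ha : IsCoefficientField a (tri j n)) :
    cgANorm S a (tri j n) ≤ ⨆ ω, cgANorm S a (tri (j + 1) (childIdx n ω)) := by
  unfold cgANorm cgA
  refine iSup₂_le fun p hp => iSup_le fun v => iSup_le fun G => iSup_le fun hv => ?_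
  have hG := hv.hasGrad.finiteEnergy
  have hi : IntegrableOn (fun x => -energyDensity a G x + 2 * inner ℝ p (flux a G x)) (tri j n) :=
    (hG.integrable ha).neg.add (((hG.integrable_flux ha).const_inner p).const_mul 2)
  obtain ⟨ω, hω⟩ := exists_setAverage_child_ge hi
  refine (ENNReal.ofReal_le_ofReal hω).trans (le_iSup_of_le ω ?_)
  exact le_cgANorm (hv.mono ha (isOpen_tri j n) (tri_child_subset j n ω)) hp

theorem cgAStarInvNorm_tri_le {a : CoeffField d} {j : ℕ} {n : Fin d → ℤ}
    (ha : IsCoefficientField a (tri j n)) :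
    cgAStarInvNorm a (tri j n) ≤ ⨆ ω, cgAStarInvNorm a (tri (j + 1) (childIdx n ω)) := by
  unfold cgAStarInvNorm cgAStarInv
  refine iSup₂_le fun q hq => iSup_le fun v => iSup_le fun G => iSup_le fun hv => ?_
  have hG := hv.hasGrad.finiteEnergy
  have hi : IntegrableOn (fun x => -energyDensity a G x + 2 * inner ℝ q (G x)) (tri j n) :=
    (hG.integrable ha).neg.add (((hG.integrable_self ha).const_inner q).const_mul 2)
  obtain ⟨ω, hω⟩ := exists_setAverage_child_ge hi
  refine (ENNReal.ofReal_le_ofReal hω).trans (le_iSup_of_le ω ?_)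
  exact le_cgAStarInvNorm (hv.mono ha (isOpen_tri j n) (tri_child_subset j n ω)) hq

theorem hasSum_rpow_neg_mul {s : ℝ} (hs : 0 < s) :
    HasSum (fun j : ℕ => (3 : ℝ) ^ (-s * (j : ℝ))) (1 - (3 : ℝ) ^ (-s))⁻¹ := by
  have h := hasSum_geometric_of_lt_one (r := (3 : ℝ) ^ (-s)) (by positivity)
    (Real.rpow_lt_one_of_one_lt_of_neg (by norm_num) (by linarith))
  refine h.congr_fun fun j => ?_
  rw [← Real.rpow_natCast, ← Real.rpow_mul (by norm_num)]

/-- A finite multiscale sum of a subadditive quantity, as a summable real sequence. -/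
theorem exists_scales {s : ℝ} (hs : 0 < s) {F : Set (E d) → ℝ≥0∞}
    (hF : ∀ (j : ℕ) (n : Fin d → ℤ), (∀ i, 2 * |n i| < 3 ^ j) →
      F (tri j n) ≤ ⨆ ω, F (tri (j + 1) (childIdx n ω)))
    (hM : multiscaleSum s 0 F ≠ ∞) :
    ∃ b : ℕ → ℝ, (∀ j, 0 ≤ b j) ∧ Summable b ∧
      ∑' j, b j = (multiscaleSum s 0 F).toReal / (1 - (3 : ℝ) ^ (-s)) ∧
      (∀ j, b j ≤ (multiscaleSum s 0 F).toReal) ∧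
      ∀ j, ∀ n ∈ idx d j, F (tri j n) ≠ ∞ ∧
        (F (tri j n)).toReal ≤ (3 ^ (s * (j : ℝ)) * b j) ^ 2 := by
  have hq : (3 : ℝ) ^ (-s) < 1 := Real.rpow_lt_one_of_one_lt_of_neg (by norm_num) (by linarith)
  set W : ℕ → ℝ≥0∞ := fun j =>
    ⨆ (n : Fin d → ℤ) (_ : latticePoint (0 - (j : ℤ)) n ∈ cube (0 : E d) ((3 : ℝ) ^ (0 : ℤ))),
      F (tri j n) ^ (1 / 2 : ℝ) with hW
  set w : ℕ → ℝ≥0∞ := fun j => ENNReal.ofReal ((3 : ℝ) ^ (-s * (j : ℝ))) * W j with hw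
  have hMw : multiscaleSum s 0 F = ENNReal.ofReal (1 - (3 : ℝ) ^ (-s)) * ∑' j, w j := rfl
  have h1 : ENNReal.ofReal (1 - (3 : ℝ) ^ (-s)) ≠ 0 := by
    simp only [ne_eq, ENNReal.ofReal_eq_zero, not_le]; linarith
  have hsum : ∑' j, w j ≠ ∞ := by
    intro h
    rw [hMw, h, ENNReal.mul_top h1] at hM
    exact hM rfl
  have hwj : ∀ j, w j ≠ ∞ := fun j => ENNReal.ne_top_of_tsum_ne_top hsum j
  have hpos : ∀ j : ℕ, ENNReal.ofReal ((3 : ℝ) ^ (-s * (j : ℝ))) ≠ 0 := fun j => by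
    simp only [ne_eq, ENNReal.ofReal_eq_zero, not_le]; positivity
  have hWj : ∀ j, W j ≠ ∞ := by
    intro j h
    apply hwj j
    rw [hw]; simp only []
    rw [h, ENNReal.mul_top (hpos j)]
  have hFW : ∀ j n, (∀ i, 2 * |n i| < 3 ^ j) → F (tri j n) ^ (1 / 2 : ℝ) ≤ W j := fun j n hn =>
    le_iSup₂_of_le n (latticePoint_mem_of_abs_lt hn) le_rfl
  have hmono : ∀ j, W j ≤ W (j + 1) := by
    intro j
    refine iSup₂_le fun n hn => ?_
    have hn' := fun i => abs_lt_of_latticePoint_mem hn i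
    obtain ⟨ω, hω⟩ : ∃ ω, F (tri j n) ≤ F (tri (j + 1) (childIdx n ω)) := by
      obtain ⟨ω, hω⟩ := Finite.exists_max fun ω => F (tri (j + 1) (childIdx n ω))
      exact ⟨ω, (hF j n hn').trans (iSup_le hω)⟩
    refine le_trans ?_ (hFW (j + 1) (childIdx n ω) (abs_childIdx_lt hn' ω))
    gcongr
  set b : ℕ → ℝ := fun j => (w j).toReal with hb
  have hbs : Summable b := ENNReal.summable_toReal hsum
  have hbW : ∀ j, b j = (3 : ℝ) ^ (-s * (j : ℝ)) * (W j).toReal := fun j => by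
    rw [hb, hw]; simp only []
    rw [ENNReal.toReal_mul, ENNReal.toReal_ofReal (by positivity)]
  have hbt : ∑' j, b j = (multiscaleSum s 0 F).toReal / (1 - (3 : ℝ) ^ (-s)) := by
    rw [hMw, ENNReal.toReal_mul, ENNReal.toReal_ofReal (by linarith), ENNReal.tsum_toReal_eq hwj]
    rw [mul_div_cancel_left₀ _ (by linarith : (1 - (3 : ℝ) ^ (-s)) ≠ 0)]
  refine ⟨b, fun j => ENNReal.toReal_nonneg, hbs, hbt, fun j => ?_, fun j n hn => ?_⟩
  -- The maxima `W j` do not decrease at finer scales, so `b (i + j) ≥ 3^{-s i} b j`. Summing over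
  -- `i` gives `b j / (1 - 3^{-s}) ≤ ∑ b`, which is the multiscale sum divided by the same number.
  · have hm : ∀ i, W j ≤ W (i + j) := by
      intro i
      induction i with
      | zero => simp
      | succ i ih => rw [Nat.succ_add]; exact ih.trans (hmono _)
    have h2 : ∀ i : ℕ, (3 : ℝ) ^ (-s * (i : ℝ)) * b j ≤ b (i + j) := fun i => by
      rw [hbW, hbW, ← mul_assoc, ← Real.rpow_add (by norm_num)]
      have h3 : -s * (i : ℝ) + -s * j = -s * ((i + j : ℕ) : ℝ) := by push_cast; ring
      rw [h3]
      exact mul_le_mul_of_nonneg_left (ENNReal.toReal_mono (hWj _) (hm i)) (by positivity)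
    have h3 := ((hasSum_rpow_neg_mul hs).mul_right (b j)).summable.tsum_le_tsum h2
      ((summable_nat_add_iff j).2 hbs)
    rw [((hasSum_rpow_neg_mul hs).mul_right (b j)).tsum_eq] at h3
    have h4 : ∑' i, b (i + j) ≤ ∑' i, b i := by
      rw [← hbs.sum_add_tsum_nat_add j]
      have : 0 ≤ ∑ i ∈ Finset.range j, b i := Finset.sum_nonneg fun _ _ => ENNReal.toReal_nonneg
      linarith
    rw [hbt] at h4
    have h5 := h3.trans h4
    rw [inv_mul_eq_div] at h5
    exact (div_le_div_iff_of_pos_right (by linarith)).1 h5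
  · have h2 := hFW j n (abs_le_of_mem_idx hn)
    have h3 : F (tri j n) ≤ W j ^ 2 := by
      have h4 : (F (tri j n) ^ (1 / 2 : ℝ)) ^ 2 ≤ W j ^ 2 := by gcongr
      rwa [← ENNReal.rpow_natCast, ← ENNReal.rpow_mul, show (1 / 2 : ℝ) * ((2 : ℕ) : ℝ) = 1 by norm_num,
        ENNReal.rpow_one] at h4
    have h5 : W j ^ 2 ≠ ∞ := ENNReal.pow_ne_top (hWj j)
    refine ⟨ne_top_of_le_ne_top h5 h3, (ENNReal.toReal_mono h5 h3).trans (le_of_eq ?_)⟩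
    rw [ENNReal.toReal_pow, hbW, ← mul_assoc, ← Real.rpow_add (by norm_num)]
    simp

end Scales

end CoarseGrained

end

/-! ### Multiscale estimate of the pairing of a function with a flux -/

noncomputable section
namespace CoarseGrained

variable {d : ℕ}

section Pairing

/-- The centre of a triadic cube. -/
abbrev center (j : ℕ) (n : Fin d → ℤ) : E d := latticePoint (0 - (j : ℤ)) n

theorem center_mem (j : ℕ) (n : Fin d → ℤ) : center j n ∈ tri j n := fun i => by
  rw [sub_self, abs_zero]
  exact half_pos (side_pos j)

theorem norm_sub_center_le {j : ℕ} {n : Fin d → ℤ} {x : E d} (hx : x ∈ tri j n) :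
    ‖x - center j n‖ ≤ √d * side j := by
  have hp := side_pos j
  rw [EuclideanSpace.norm_eq]
  refine Real.sqrt_le_iff.2 ⟨by positivity, ?_⟩
  rw [mul_pow, Real.sq_sqrt (Nat.cast_nonneg d)]
  calc ∑ i, ‖(x - center j n) i‖ ^ 2 ≤ ∑ _i : Fin d, side j ^ 2 := by
        refine Finset.sum_le_sum fun i _ => pow_le_pow_left₀ (norm_nonneg _) ?_ 2
        have h : |x i - center j n i| < side j / 2 := hx i
        change |x i - center j n i| ≤ _
        linarith
    _ = _ := by simp

theorem norm_center_sub_le (j : ℕ) (n : Fin d → ℤ) (ω : Fin d → Fin 3) :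
    ‖center (j + 1) (childIdx n ω) - center j n‖ ≤ √d * side (j + 1) := by
  have hp := side_pos (j + 1)
  rw [EuclideanSpace.norm_eq]
  refine Real.sqrt_le_iff.2 ⟨by positivity, ?_⟩
  rw [mul_pow, Real.sq_sqrt (Nat.cast_nonneg d)]
  calc ∑ i, ‖(center (j + 1) (childIdx n ω) - center j n) i‖ ^ 2
      ≤ ∑ _i : Fin d, side (j + 1) ^ 2 := by
        refine Finset.sum_le_sum fun i _ => pow_le_pow_left₀ (norm_nonneg _) ?_ 2
        change |side (j + 1) * (childIdx n ω i : ℝ) - side j * n i| ≤ _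
        rw [side_mul_childIdx, add_sub_cancel_left, abs_mul, abs_of_pos hp]
        have h4 : ((ω i : ℕ) : ℝ) ≤ 2 := by
          exact_mod_cast Nat.lt_succ_iff.1 (ω i).isLt
        have h5 : (0 : ℝ) ≤ ((ω i : ℕ) : ℝ) := Nat.cast_nonneg _
        exact mul_le_of_le_one_right hp.le (abs_le.2 ⟨by linarith, by linarith⟩)
    _ = _ := by simp

theorem sum_mul_le_sqrt_mul_sqrt_of_le {ι : Type*} (s : Finset ι) {f g : ι → ℝ} {X Y : ℝ}
    (hf : ∑ i ∈ s, f i ^ 2 ≤ X) (hg : ∑ i ∈ s, g i ^ 2 ≤ Y) : ∑ i ∈ s, f i * g i ≤ √X * √Y :=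
  (Real.sum_mul_le_sqrt_mul_sqrt s f g).trans (by gcongr)

/-- The average over a triadic cube. -/
def cellAvg (m : E d → ℝ) (j : ℕ) (n : Fin d → ℤ) : ℝ := (∫ x in tri j n, m x) / side j ^ d

theorem sq_cellAvg_mul_le {m : E d → ℝ} {j : ℕ} {n : Fin d → ℤ}
    (hm : MemLp m 2 (volume.restrict (tri j n))) :
    side j ^ d * cellAvg m j n ^ 2 ≤ ∫ x in tri j n, m x ^ 2 := by
  have hp : 0 < side j ^ d := by have := side_pos j; positivity
  have : IsFiniteMeasure (volume.restrict (tri j n)) := ⟨by simpa using (volume_tri_ne_top j n).lt_top⟩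
  have hi : IntegrableOn m (tri j n) := hm.integrable (by simp)
  have h0 : 0 ≤ ∫ x in tri j n, (m x - cellAvg m j n) ^ 2 := integral_nonneg fun x => sq_nonneg _
  have h1 : ∫ x in tri j n, (m x - cellAvg m j n) ^ 2 = (∫ x in tri j n, m x ^ 2) -
      2 * cellAvg m j n * (∫ x in tri j n, m x) + side j ^ d * cellAvg m j n ^ 2 := by
    have e : ∀ x, (m x - cellAvg m j n) ^ 2 =
        (m x ^ 2 - 2 * cellAvg m j n * m x) + cellAvg m j n ^ 2 := fun x => by ring
    simp only [e]
    rw [integral_add (f := fun x => m x ^ 2 - 2 * cellAvg m j n * m x)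
      (g := fun _ => cellAvg m j n ^ 2) (hm.integrable_sq.sub (hi.const_mul _)) (integrable_const _),
      integral_sub hm.integrable_sq (hi.const_mul _), integral_const_mul, setIntegral_const,
      volume_real_tri, smul_eq_mul]
  have h2 : ∫ x in tri j n, m x = side j ^ d * cellAvg m j n := by
    rw [cellAvg]; field_simp
  rw [h1, h2] at h0
  linarith

theorem cellAvg_eq_mean {m : E d → ℝ} {j : ℕ} {n : Fin d → ℤ} (hm : IntegrableOn m (tri j n)) :
    cellAvg m j n = (∑ ω, ∫ x in tri (j + 1) (childIdx n ω), m x) /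
      Fintype.card (Fin d → Fin 3) / side (j + 1) ^ d := by
  rw [cellAvg, setIntegral_tri_eq_sum hm, ← side_pow_succ, div_div]
  simp

/-- The discretization of `∫ m p ⬝ g` at the scale `3^{-j}`. -/
def pairing (m : E d → ℝ) (p g : E d → E d) (j : ℕ) : ℝ :=
  ∑ n ∈ idx d j, cellAvg m j n * inner ℝ (p (center j n)) (∫ x in tri j n, g x)

/-- The first part, with `p` frozen at the parent, keeps the size of `p` as a weight and leads to
the term to be absorbed. The second part involves the variation of `p` and is of lower order. -/
theorem pairing_succ_sub {m : E d → ℝ} {p g : E d → E d} (hg : IntegrableOn g (cube 0 1)) (j : ℕ) :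
    pairing m p g (j + 1) - pairing m p g j = ∑ n ∈ idx d j,
      ((∑ ω, (cellAvg m (j + 1) (childIdx n ω) - cellAvg m j n) *
        inner ℝ (p (center j n)) (∫ x in tri (j + 1) (childIdx n ω), g x)) +
      ∑ ω, cellAvg m (j + 1) (childIdx n ω) * inner ℝ
        (p (center (j + 1) (childIdx n ω)) - p (center j n))
        (∫ x in tri (j + 1) (childIdx n ω), g x)) := by
  rw [pairing, pairing, sum_idx_succ, ← Finset.sum_sub_distrib]
  refine Finset.sum_congr rfl fun n hn => ?_
  rw [setIntegral_tri_eq_sum (hg.mono_set (tri_subset hn)), inner_sum, Finset.mul_sum,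
    ← Finset.sum_sub_distrib, ← Finset.sum_add_distrib]
  refine Finset.sum_congr rfl fun ω _ => ?_
  rw [inner_sub_left]; ring

/-- The data that enter the estimate of `∫ m p ⬝ g`. -/
structure PairingData (a : CoeffField d) (m : E d → ℝ) (g K : E d → E d) (b : ℕ → ℝ)
    (A s σ : ℝ) : Prop where
  coeff : IsCoefficientField a (cube 0 1)
  smooth : ContDiffOn ℝ 1 m (cube 0 1)
  memLp : MemLp m 2 (volume.restrict (cube (0 : E d) 1))
  finiteEnergy : FiniteEnergy a (cube 0 1) (gradient m)
  finiteEnergy' : FiniteEnergy a (cube 0 1) K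
  integrable : IntegrableOn g (cube 0 1)
  nonneg : ∀ j, 0 ≤ b j
  summable : Summable b
  A_nonneg : 0 ≤ A
  s_lt : s + σ < 1
  s_pos : 0 < s
  σ_pos : 0 < σ
  slope : ∀ j, ∀ n ∈ idx d j, ‖∫ x in tri j n, gradient m x‖ ^ 2 ≤
    (A * 3 ^ ((1 - s - σ) * (j : ℝ))) ^ 2 *
      (side j ^ d * bil a (tri j n) (gradient m) (gradient m))
  flux : ∀ j, ∀ n ∈ idx d j, ‖∫ x in tri j n, g x‖ ^ 2 ≤
    (3 ^ (s * (j : ℝ)) * b j) ^ 2 * (side j ^ d * bil a (tri j n) K K)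

variable {a : CoeffField d} {m : E d → ℝ} {g K : E d → E d} {b : ℕ → ℝ} {A s σ : ℝ}

theorem PairingData.integrableOn (h : PairingData a m g K b A s σ) : IntegrableOn m (cube 0 1) := by
  have : IsFiniteMeasure (volume.restrict (cube (0 : E d) 1)) :=
    ⟨by simpa using (volume_cube_ne_top 0 1).lt_top⟩
  exact h.memLp.integrable (by simp)

theorem PairingData.sum_child_flux_le (h : PairingData a m g K b A s σ) {j : ℕ} {n : Fin d → ℤ}
    (hn : n ∈ idx d j) : ∑ ω, ‖∫ x in tri (j + 1) (childIdx n ω), g x‖ ^ 2 ≤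
      (3 ^ (s * ((j + 1 : ℕ) : ℝ)) * b (j + 1)) ^ 2 * (side (j + 1) ^ d * bil a (tri j n) K K) := by
  rw [bil_tri_eq_sum (h.coeff.mono (tri_subset hn)) (h.finiteEnergy'.mono (tri_subset hn)),
    Finset.mul_sum, Finset.mul_sum]
  exact Finset.sum_le_sum fun ω _ => h.flux (j + 1) _ (childIdx_mem_idx hn ω)

/-- The side length against the growth of the slope bound, with exponent `t = 1 - s - σ`, and of the
flux bound, with exponent `s`. The surplus `3^{-σ j}` is what makes the sum over scales converge. -/
theorem rpow_scale_mul (s σ : ℝ) (j : ℕ) :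
    side j * (3 ^ ((1 - s - σ) * (j : ℝ)) * 3 ^ (s * (j : ℝ))) = (3 : ℝ) ^ (-σ * (j : ℝ)) := by
  rw [side_eq_rpow, ← Real.rpow_add (by norm_num), ← Real.rpow_add (by norm_num)]
  congr 1; ring

theorem PairingData.abs_sum_avg_sub_le (h : PairingData a m g K b A s σ) {j : ℕ} {n : Fin d → ℤ}
    (hn : n ∈ idx d j) (q : E d) :
    |∑ ω, (cellAvg m (j + 1) (childIdx n ω) - cellAvg m j n) *
        inner ℝ q (∫ x in tri (j + 1) (childIdx n ω), g x)| ≤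
      7 / 8 * A / (1 - 3 ^ (-(s + σ))) * (b (j + 1) * 3 ^ (-σ * ((j + 1 : ℕ) : ℝ))) *
        (‖q‖ * (√(bil a (tri j n) (gradient m) (gradient m)) * √(bil a (tri j n) K K))) := by
  have hv : 0 < side (j + 1) ^ d := by have := side_pos (j + 1); positivity
  have haj := h.coeff.mono (tri_subset hn)
  set Em := bil a (tri j n) (gradient m) (gradient m) with hEm
  set Ek := bil a (tri j n) K K with hEk
  have hEm0 : 0 ≤ Em := bil_self_nonneg haj _
  have hEk0 : 0 ≤ Ek := bil_self_nonneg haj _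
  have h1 := sum_sq_child_sub_mean_le h.coeff h.smooth h.integrableOn h.finiteEnergy h.A_nonneg
    (by linarith [h.s_pos, h.σ_pos] : 1 - s - σ < 1) h.slope hn
  set P := side (j + 1) * (7 / 8 / (1 - 3 ^ (1 - s - σ - 1))) *
    (A * 3 ^ ((1 - s - σ) * ((j + 1 : ℕ) : ℝ))) with hP
  have hy1 : (3 : ℝ) ^ (1 - s - σ - 1) < 1 :=
    Real.rpow_lt_one_of_one_lt_of_neg (by norm_num) (by linarith [h.s_pos, h.σ_pos])
  have hP0 : 0 ≤ P := by
    have := side_pos (j + 1)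
    have := h.A_nonneg
    have : 0 < 1 - (3 : ℝ) ^ (1 - s - σ - 1) := by linarith
    positivity
  have h2 : ∑ ω, (cellAvg m (j + 1) (childIdx n ω) - cellAvg m j n) ^ 2 ≤
      (P ^ 2 * Em) / side (j + 1) ^ d := by
    rw [le_div_iff₀ hv]
    have e : ∀ ω, (cellAvg m (j + 1) (childIdx n ω) - cellAvg m j n) ^ 2 =
        ((∫ x in tri (j + 1) (childIdx n ω), m x) -
        (∑ ω', ∫ x in tri (j + 1) (childIdx n ω'), m x) / Fintype.card (Fin d → Fin 3)) ^ 2 /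
        (side (j + 1) ^ d) ^ 2 := fun ω => by
      rw [cellAvg_eq_mean (h.integrableOn.mono_set (tri_subset hn)), cellAvg, ← sub_div, div_pow]
    simp only [e]
    rw [← Finset.sum_div, div_mul_eq_mul_div, div_le_iff₀ (by positivity)]
    calc _ ≤ (P ^ 2 * (side (j + 1) ^ d * Em)) * side (j + 1) ^ d := by gcongr
      _ = _ := by ring
  set Bj := (3 : ℝ) ^ (s * ((j + 1 : ℕ) : ℝ)) * b (j + 1) with hB
  have hB0 : 0 ≤ Bj := mul_nonneg (by positivity) (h.nonneg _)
  have h3 : ∑ ω, (‖q‖ * ‖∫ x in tri (j + 1) (childIdx n ω), g x‖) ^ 2 ≤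
      (‖q‖ * Bj) ^ 2 * Ek * side (j + 1) ^ d := by
    simp only [mul_pow]
    rw [← Finset.mul_sum]
    calc _ ≤ ‖q‖ ^ 2 * (Bj ^ 2 * (side (j + 1) ^ d * Ek)) := by
          gcongr; exact h.sum_child_flux_le hn
      _ = _ := by ring
  refine (Finset.abs_sum_le_sum_abs _ _).trans ?_
  have h4 : ∀ ω, |(cellAvg m (j + 1) (childIdx n ω) - cellAvg m j n) *
        inner ℝ q (∫ x in tri (j + 1) (childIdx n ω), g x)| ≤
      |cellAvg m (j + 1) (childIdx n ω) - cellAvg m j n| *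
        (‖q‖ * ‖∫ x in tri (j + 1) (childIdx n ω), g x‖) := fun ω => by
    rw [abs_mul]
    gcongr
    exact abs_real_inner_le_norm _ _
  refine (Finset.sum_le_sum fun ω _ => h4 ω).trans ?_
  refine (sum_mul_le_sqrt_mul_sqrt_of_le Finset.univ (by simpa only [sq_abs] using h2) h3).trans
    (le_of_eq ?_)
  rw [← Real.sqrt_mul (by positivity), show P ^ 2 * Em / side (j + 1) ^ d *
    ((‖q‖ * Bj) ^ 2 * Ek * side (j + 1) ^ d) = (P * (‖q‖ * Bj)) ^ 2 * (Em * Ek) by field_simp,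
    Real.sqrt_mul (by positivity), Real.sqrt_sq (by positivity), Real.sqrt_mul hEm0, hP, hB,
    ← rpow_scale_mul s σ (j + 1), show 1 - s - σ - 1 = -(s + σ) by ring]
  ring

/-- The difference of `p` between centres already supplies a factor of the side length, so the
averages of `m` are only measured in `L²` and no slope bound is used. -/
theorem PairingData.abs_sum_avg_mul_le (h : PairingData a m g K b A s σ) {j : ℕ} {n : Fin d → ℤ}
    (hn : n ∈ idx d j) {p : E d → E d} {Λ : ℝ} (hΛ : 0 ≤ Λ)
    (hp : ∀ x y, ‖p x - p y‖ ≤ Λ * ‖x - y‖) :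
    |∑ ω, cellAvg m (j + 1) (childIdx n ω) * inner ℝ
        (p (center (j + 1) (childIdx n ω)) - p (center j n))
        (∫ x in tri (j + 1) (childIdx n ω), g x)| ≤
      Λ * √d * (b (j + 1) * 3 ^ (-σ * ((j + 1 : ℕ) : ℝ))) *
        (√(∫ x in tri j n, m x ^ 2) * √(bil a (tri j n) K K)) := by
  have hs := side_pos (j + 1)
  have hv : 0 < side (j + 1) ^ d := by positivity
  have haj := h.coeff.mono (tri_subset hn)
  have hEk0 : 0 ≤ bil a (tri j n) K K := bil_self_nonneg haj _
  set Bj := (3 : ℝ) ^ (s * ((j + 1 : ℕ) : ℝ)) * b (j + 1) with hB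
  have hB0 : 0 ≤ Bj := mul_nonneg (by positivity) (h.nonneg _)
  have hmj : MemLp m 2 (volume.restrict (tri j n)) :=
    h.memLp.mono_measure (Measure.restrict_mono_set _ (tri_subset hn))
  have h2 : ∑ ω, cellAvg m (j + 1) (childIdx n ω) ^ 2 ≤
      (∫ x in tri j n, m x ^ 2) / side (j + 1) ^ d := by
    rw [le_div_iff₀ hv, setIntegral_tri_eq_sum (f := fun x => m x ^ 2) hmj.integrable_sq,
      Finset.sum_mul]
    refine Finset.sum_le_sum fun ω _ => ?_
    rw [mul_comm]
    exact sq_cellAvg_mul_le (hmj.mono_measure (Measure.restrict_mono_set _ (tri_child_subset j n ω)))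
  have h3 := h.sum_child_flux_le hn
  refine (Finset.abs_sum_le_sum_abs _ _).trans ?_
  have h4 : ∀ ω, |cellAvg m (j + 1) (childIdx n ω) * inner ℝ
        (p (center (j + 1) (childIdx n ω)) - p (center j n))
        (∫ x in tri (j + 1) (childIdx n ω), g x)| ≤ Λ * (√d * side (j + 1)) *
      (|cellAvg m (j + 1) (childIdx n ω)| * ‖∫ x in tri (j + 1) (childIdx n ω), g x‖) := fun ω => by
    rw [abs_mul, ← mul_assoc, mul_comm _ |cellAvg m (j + 1) (childIdx n ω)|, mul_assoc]
    refine mul_le_mul_of_nonneg_left ((abs_real_inner_le_norm _ _).trans ?_) (abs_nonneg _)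
    refine mul_le_mul_of_nonneg_right ((hp _ _).trans ?_) (norm_nonneg _)
    exact mul_le_mul_of_nonneg_left (norm_center_sub_le j n ω) hΛ
  refine (Finset.sum_le_sum fun ω _ => h4 ω).trans ?_
  rw [← Finset.mul_sum]
  have h5 := sum_mul_le_sqrt_mul_sqrt_of_le Finset.univ
    (f := fun ω => |cellAvg m (j + 1) (childIdx n ω)|) (by simpa only [sq_abs] using h2) h3
  have hI0 : 0 ≤ ∫ x in tri j n, m x ^ 2 := integral_nonneg fun x => sq_nonneg _
  rw [← Real.sqrt_mul (by positivity), show (∫ x in tri j n, m x ^ 2) / side (j + 1) ^ d *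
    (Bj ^ 2 * (side (j + 1) ^ d * bil a (tri j n) K K)) =
    Bj ^ 2 * ((∫ x in tri j n, m x ^ 2) * bil a (tri j n) K K) by field_simp,
    Real.sqrt_mul (by positivity), Real.sqrt_sq hB0, Real.sqrt_mul hI0] at h5
  set R := √(∫ x in tri j n, m x ^ 2) * √(bil a (tri j n) K K) with hR
  have hR0 : 0 ≤ R := by positivity
  have h6 : side (j + 1) * Bj ≤ b (j + 1) * 3 ^ (-σ * ((j + 1 : ℕ) : ℝ)) := by
    rw [hB, ← rpow_scale_mul s σ (j + 1)]
    have h7 : (1 : ℝ) ≤ 3 ^ ((1 - s - σ) * ((j + 1 : ℕ) : ℝ)) :=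
      Real.one_le_rpow (by norm_num) (mul_nonneg (by linarith [h.s_lt]) (Nat.cast_nonneg _))
    have h8 : 0 ≤ side (j + 1) * (3 ^ (s * ((j + 1 : ℕ) : ℝ)) * b (j + 1)) := by positivity
    nlinarith
  calc Λ * (√d * side (j + 1)) * ∑ ω, |cellAvg m (j + 1) (childIdx n ω)| *
        ‖∫ x in tri (j + 1) (childIdx n ω), g x‖ ≤ Λ * (√d * side (j + 1)) * (Bj * R) := by gcongr
    _ = Λ * √d * (side (j + 1) * Bj) * R := by ring
    _ ≤ _ := by gcongr

/-- The quantities through which `∫ m p ⬝ g` is estimated. -/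
def weightedEnergy (a : CoeffField d) (p : E d → E d) (κ : ℝ) (Z : Set (E d)) (G : E d → E d) : ℝ :=
  ∫ x in Z, (‖p x‖ + κ) * energyDensity a G x

theorem integrableOn_weight (ha : IsCoefficientField a (cube 0 1)) {G : E d → E d}
    (hG : FiniteEnergy a (cube 0 1) G) {p : E d → E d} (hpc : Continuous p) {M : ℝ}
    (hM : ∀ x, ‖p x‖ ≤ M) (κ : ℝ) :
    IntegrableOn (fun x => (‖p x‖ + κ) * energyDensity a G x) (cube 0 1) := by
  refine (hG.integrable ha).bdd_mul (c := M + |κ|)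
    (hpc.norm.add continuous_const).aestronglyMeasurable (Eventually.of_forall fun x => ?_)
  refine (norm_add_le _ _).trans ?_
  rw [norm_norm, Real.norm_eq_abs]
  linarith [hM x]

theorem mul_bil_le_setIntegral {G : E d → E d} (ha : IsCoefficientField a (cube 0 1))
    (hG : FiniteEnergy a (cube 0 1) G) {p : E d → E d} {Λ M κ : ℝ} (hΛ : 0 ≤ Λ)
    (hp : ∀ x y, ‖p x - p y‖ ≤ Λ * ‖x - y‖) (hpc : Continuous p) (hM : ∀ x, ‖p x‖ ≤ M) {j : ℕ}
    (hκ : Λ * (√d * side j) ≤ κ) {n : Fin d → ℤ} (hn : n ∈ idx d j) :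
    ‖p (center j n)‖ * bil a (tri j n) G G ≤
      ∫ x in tri j n, (‖p x‖ + κ) * energyDensity a G x := by
  rw [bil_self, ← integral_const_mul]
  refine integral_mono_ae (((hG.mono (tri_subset hn)).integrable
    (ha.mono (tri_subset hn))).const_mul _)
    ((integrableOn_weight ha hG hpc hM κ).mono_set (tri_subset hn)) ?_
  filter_upwards [ae_restrict_mem (measurableSet_tri j n),
    ae_energyDensity_nonneg (ha.mono (tri_subset hn)) G] with x hx h0
  refine mul_le_mul_of_nonneg_right ?_ h0
  have h1 := hp (center j n) x
  rw [norm_sub_rev (center j n) x] at h1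
  have h2 := mul_le_mul_of_nonneg_left (norm_sub_center_le hx) hΛ
  have h3 := norm_le_norm_add_norm_sub' (p (center j n)) (p x)
  linarith

/-- Cubes on which `p` vanishes do not contribute, and the others lie in `Z`. The factor
`‖p(center)‖` is divided evenly between the two square roots; on the cube it is at most `‖p x‖ + κ`
with `κ = Λ √d side N`. Cauchy-Schwarz over the cubes then gives weighted energies. -/
theorem PairingData.abs_pairing_succ_sub_le (h : PairingData a m g K b A s σ) {p : E d → E d}
    {Λ M : ℝ} (hΛ : 0 ≤ Λ) (hp : ∀ x y, ‖p x - p y‖ ≤ Λ * ‖x - y‖) (hpc : Continuous p)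
    (hM : ∀ x, ‖p x‖ ≤ M) {Z : Set (E d)} (hZU : Z ⊆ cube 0 1) {N j : ℕ} (hNj : N ≤ j)
    (hZ : ∀ n ∈ idx d j, (∃ x ∈ tri j n, p x ≠ 0) → tri j n ⊆ Z) :
    |pairing m p g (j + 1) - pairing m p g j| ≤
      b (j + 1) * 3 ^ (-σ * ((j + 1 : ℕ) : ℝ)) * (7 / 8 * A / (1 - 3 ^ (-(s + σ))) *
        (√(weightedEnergy a p (Λ * (√d * side N)) Z (gradient m)) *
          √(weightedEnergy a p (Λ * (√d * side N)) Z K)) +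
        Λ * √d * (√(∫ x in Z, m x ^ 2) * √(bil a Z K K))) := by
  classical
  set S := (idx d j).filter fun n => ∃ x ∈ tri j n, p x ≠ 0 with hS
  have hSi : S ⊆ idx d j := Finset.filter_subset _ _
  have hSZ : ∀ n ∈ S, tri j n ⊆ Z := fun n hn =>
    hZ n (Finset.mem_filter.1 hn).1 (Finset.mem_filter.1 hn).2
  have hκ : Λ * (√d * side j) ≤ Λ * (√d * side N) := by
    have : side j ≤ side N := by
      rw [side_eq_rpow, side_eq_rpow]
      exact Real.rpow_le_rpow_of_exponent_le (by norm_num) (by simpa using hNj)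
    gcongr
  have hκ0 : 0 ≤ Λ * (√d * side N) := by have := side_pos N; positivity
  have hβ : 0 ≤ b (j + 1) * (3 : ℝ) ^ (-σ * ((j + 1 : ℕ) : ℝ)) :=
    mul_nonneg (h.nonneg _) (by positivity)
  have hγ : 0 ≤ 7 / 8 * A / (1 - (3 : ℝ) ^ (-(s + σ))) := by
    have h1 : (3 : ℝ) ^ (-(s + σ)) < 1 :=
      Real.rpow_lt_one_of_one_lt_of_neg (by norm_num) (by linarith [h.s_pos, h.σ_pos])
    have h2 : 0 < 1 - (3 : ℝ) ^ (-(s + σ)) := by linarith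
    have := h.A_nonneg
    positivity
  rw [pairing_succ_sub h.integrable, ← Finset.sum_subset hSi]
  swap
  · intro n hn hnS
    have hz : ∀ x ∈ tri j n, p x = 0 := fun x hx => by
      by_contra hne
      exact hnS (Finset.mem_filter.2 ⟨hn, x, hx, hne⟩)
    have h1 := hz _ (center_mem j n)
    have h2 : ∀ ω, p (center (j + 1) (childIdx n ω)) = 0 := fun ω =>
      hz _ (tri_child_subset j n ω (center_mem _ _))
    simp [h1, h2]
  refine (Finset.abs_sum_le_sum_abs _ _).trans ?_
  refine (Finset.sum_le_sum fun n hn => (abs_add_le _ _).trans (add_le_add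
    (h.abs_sum_avg_sub_le (hSi hn) _) (h.abs_sum_avg_mul_le (hSi hn) hΛ hp))).trans ?_
  rw [Finset.sum_add_distrib, ← Finset.mul_sum, ← Finset.mul_sum]
  have hw : ∀ G, FiniteEnergy a (cube 0 1) G →
      ∑ n ∈ S, (√(‖p (center j n)‖ * bil a (tri j n) G G)) ^ 2 ≤
        weightedEnergy a p (Λ * (√d * side N)) Z G := by
    intro G hG
    refine le_trans (Finset.sum_le_sum fun n hn => ?_) (sum_setIntegral_tri_le hSi
      (integrableOn_weight h.coeff hG hpc hM (Λ * (√d * side N))) ?_ hZU hSZ)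
    · rw [Real.sq_sqrt (mul_nonneg (norm_nonneg _)
        (bil_self_nonneg (h.coeff.mono (tri_subset (hSi hn))) _))]
      exact mul_bil_le_setIntegral h.coeff hG hΛ hp hpc hM hκ (hSi hn)
    · filter_upwards [ae_energyDensity_nonneg h.coeff G] with x hx
      exact mul_nonneg (add_nonneg (norm_nonneg _) hκ0) hx
  have b1 : ∑ n ∈ S, ‖p (center j n)‖ * (√(bil a (tri j n) (gradient m) (gradient m)) *
      √(bil a (tri j n) K K)) ≤
      √(weightedEnergy a p (Λ * (√d * side N)) Z (gradient m)) *
        √(weightedEnergy a p (Λ * (√d * side N)) Z K) := by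
    refine le_trans (le_of_eq (Finset.sum_congr rfl fun n hn => ?_))
      (sum_mul_le_sqrt_mul_sqrt_of_le S (hw _ h.finiteEnergy) (hw _ h.finiteEnergy'))
    rw [Real.sqrt_mul (norm_nonneg _), Real.sqrt_mul (norm_nonneg _), mul_mul_mul_comm,
      Real.mul_self_sqrt (norm_nonneg _)]
  have b2 : ∑ n ∈ S, √(∫ x in tri j n, m x ^ 2) * √(bil a (tri j n) K K) ≤
      √(∫ x in Z, m x ^ 2) * √(bil a Z K K) := by
    refine sum_mul_le_sqrt_mul_sqrt_of_le S ?_ ?_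
    · refine le_trans (le_of_eq (Finset.sum_congr rfl fun n _ =>
        Real.sq_sqrt (integral_nonneg fun x => sq_nonneg _)))
        (sum_setIntegral_tri_le (f := fun x => m x ^ 2) hSi h.memLp.integrable_sq
        (Eventually.of_forall fun x => sq_nonneg _) hZU hSZ)
    · refine le_trans (le_of_eq (Finset.sum_congr rfl fun n hn =>
        Real.sq_sqrt (bil_self_nonneg (h.coeff.mono (tri_subset (hSi hn))) _)))
        (sum_setIntegral_tri_le hSi (h.finiteEnergy'.integrable h.coeff)
        (ae_energyDensity_nonneg h.coeff K) hZU hSZ)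
  have h8 : 0 ≤ Λ * √d := by positivity
  have c1 := mul_le_mul_of_nonneg_left b1 (mul_nonneg hγ hβ)
  have c2 := mul_le_mul_of_nonneg_left b2 (mul_nonneg h8 hβ)
  refine (add_le_add c1 c2).trans (le_of_eq (by ring))

/-- At the starting scale there is no oscillation to exploit: averages of `m` are bounded in `L²`
and fluxes by the coarse-grained bound, which accounts for the factor `3^{s j}`. -/
theorem PairingData.abs_pairing_le (h : PairingData a m g K b A s σ) {p : E d → E d} {M : ℝ}
    (hM0 : 0 ≤ M) (hM : ∀ x, ‖p x‖ ≤ M) {Z : Set (E d)} (hZU : Z ⊆ cube 0 1) {j : ℕ}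
    (hZ : ∀ n ∈ idx d j, (∃ x ∈ tri j n, p x ≠ 0) → tri j n ⊆ Z) :
    |pairing m p g j| ≤
      M * (3 ^ (s * (j : ℝ)) * b j) * (√(∫ x in Z, m x ^ 2) * √(bil a Z K K)) := by
  classical
  set S := (idx d j).filter fun n => ∃ x ∈ tri j n, p x ≠ 0 with hS
  have hSi : S ⊆ idx d j := Finset.filter_subset _ _
  have hSZ : ∀ n ∈ S, tri j n ⊆ Z := fun n hn =>
    hZ n (Finset.mem_filter.1 hn).1 (Finset.mem_filter.1 hn).2
  have hB0 : 0 ≤ (3 : ℝ) ^ (s * (j : ℝ)) * b j := mul_nonneg (by positivity) (h.nonneg j)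
  have hv : 0 < side j ^ d := by have := side_pos j; positivity
  rw [pairing, ← Finset.sum_subset hSi]
  swap
  · intro n hn hnS
    have hz : p (center j n) = 0 := by
      by_contra hne
      exact hnS (Finset.mem_filter.2 ⟨hn, _, center_mem j n, hne⟩)
    simp [hz]
  refine (Finset.abs_sum_le_sum_abs _ _).trans ?_
  have h1 : ∀ n ∈ S, |cellAvg m j n * inner ℝ (p (center j n)) (∫ x in tri j n, g x)| ≤
      M * (3 ^ (s * (j : ℝ)) * b j) * (√(∫ x in tri j n, m x ^ 2) * √(bil a (tri j n) K K)) := by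
    intro n hn
    have h2 : |cellAvg m j n| ≤ √(∫ x in tri j n, m x ^ 2) / √(side j ^ d) := by
      rw [← Real.sqrt_div' _ hv.le]
      refine Real.abs_le_sqrt ?_
      rw [le_div_iff₀ hv, mul_comm]
      exact sq_cellAvg_mul_le (h.memLp.mono_measure (Measure.restrict_mono_set _
        (tri_subset (hSi hn))))
    have h3 : ‖∫ x in tri j n, g x‖ ≤
        3 ^ (s * (j : ℝ)) * b j * (√(side j ^ d) * √(bil a (tri j n) K K)) := by
      rw [← Real.sqrt_mul hv.le]
      refine abs_le_of_sq_le_sq' ?_ (by positivity) |>.2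
      rw [mul_pow, Real.sq_sqrt (mul_nonneg hv.le
        (bil_self_nonneg (h.coeff.mono (tri_subset (hSi hn))) _))]
      exact h.flux j n (hSi hn)
    rw [abs_mul]
    have h4 : |inner ℝ (p (center j n)) (∫ x in tri j n, g x)| ≤
        M * (3 ^ (s * (j : ℝ)) * b j * (√(side j ^ d) * √(bil a (tri j n) K K))) :=
      (abs_real_inner_le_norm _ _).trans (mul_le_mul (hM _) h3 (norm_nonneg _) hM0)
    refine (mul_le_mul h2 h4 (abs_nonneg _) (by positivity)).trans (le_of_eq ?_)
    have := Real.sqrt_pos.2 hv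
    field_simp
  refine (Finset.sum_le_sum h1).trans ?_
  rw [← Finset.mul_sum]
  refine mul_le_mul_of_nonneg_left ?_ (by positivity)
  refine sum_mul_le_sqrt_mul_sqrt_of_le S ?_ ?_
  · refine le_trans (le_of_eq (Finset.sum_congr rfl fun n _ =>
      Real.sq_sqrt (integral_nonneg fun x => sq_nonneg _)))
      (sum_setIntegral_tri_le (f := fun x => m x ^ 2) hSi h.memLp.integrable_sq
      (Eventually.of_forall fun x => sq_nonneg _) hZU hSZ)
  · refine le_trans (le_of_eq (Finset.sum_congr rfl fun n hn =>
      Real.sq_sqrt (bil_self_nonneg (h.coeff.mono (tri_subset (hSi hn))) _)))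
      (sum_setIntegral_tri_le hSi (h.finiteEnergy'.integrable h.coeff)
      (ae_energyDensity_nonneg h.coeff K) hZU hSZ)

theorem ae_exists_mem_tri (j : ℕ) : ∀ᵐ x ∂(volume.restrict (cube (0 : E d) 1)),
    ∃ n ∈ idx d j, x ∈ tri j n := by
  rw [ae_restrict_iff' (measurableSet_cube _ _)]
  induction j with
  | zero =>
    refine Eventually.of_forall fun x hx => ⟨0, by simp [idx], ?_⟩
    rwa [tri_zero]
  | succ j ih =>
    have h1 : ∀ n : Fin d → ℤ, ∀ᵐ x : E d, x ∈ tri j n → ∃ ω, x ∈ tri (j + 1) (childIdx n ω) := by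
      intro n
      filter_upwards [(iUnion_child_ae_eq j n).mem_iff] with x hx hxn
      exact mem_iUnion.1 (hx.2 hxn)
    filter_upwards [ih, ae_all_iff.2 h1] with x h2 h3 hx
    obtain ⟨n, hn, hxn⟩ := h2 hx
    obtain ⟨ω, hω⟩ := h3 n hxn
    exact ⟨_, childIdx_mem_idx hn ω, hω⟩

theorem abs_cellAvg_sub_le {m : E d → ℝ} {j : ℕ} {n : Fin d → ℤ} {r ε : ℝ}
    (hm : IntegrableOn m (tri j n)) (h : ∀ y ∈ tri j n, |m y - r| ≤ ε) :
    |cellAvg m j n - r| ≤ ε := by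
  have hv : 0 < side j ^ d := by have := side_pos j; positivity
  have h1 := norm_setIntegral_le_of_norm_le_const (μ := volume) (volume_tri_ne_top j n).lt_top
    (f := fun y => m y - r) h
  rw [integral_sub hm (integrableOn_const (volume_tri_ne_top j n)), setIntegral_const,
    volume_real_tri, smul_eq_mul, Real.norm_eq_abs] at h1
  rw [cellAvg, show (∫ x in tri j n, m x) / side j ^ d - r =
    ((∫ x in tri j n, m x) - side j ^ d * r) / side j ^ d by field_simp, abs_div, abs_of_pos hv,
    div_le_iff₀ hv]
  exact h1

theorem tendsto_side : Tendsto side atTop (𝓝 0) := by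
  have h : side = fun j : ℕ => (1 / 3 : ℝ) ^ j := by
    ext j
    rw [side, zero_sub, zpow_neg, zpow_natCast, one_div, inv_pow]
  rw [h]
  exact tendsto_pow_atTop_nhds_zero_of_lt_one (by norm_num) (by norm_num)

/-- The pairing is the integral of the step function obtained by freezing the average of `m` and the
value of `p` on each cube. These step functions converge almost everywhere and are dominated by a
multiple of `‖g‖`. -/
theorem tendsto_pairing {p : E d → E d} {B M : ℝ} (hm : ContDiffOn ℝ 1 m (cube 0 1))
    (hmI : IntegrableOn m (cube 0 1)) (hB : ∀ x ∈ cube (0 : E d) 1, |m x| ≤ B)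
    (hg : IntegrableOn g (cube 0 1)) (hpc : Continuous p) (hM : ∀ x, ‖p x‖ ≤ M) :
    Tendsto (pairing m p g) atTop (𝓝 (∫ x in cube 0 1, m x * inner ℝ (p x) (g x))) := by
  classical
  set f : ℕ → E d → ℝ := fun j x => ∑ n ∈ idx d j,
    (tri j n).indicator (fun x => cellAvg m j n * inner ℝ (p (center j n)) (g x)) x with hf
  have hin : ∀ j (n : Fin d → ℤ), IntegrableOn
      (fun x => cellAvg m j n * inner ℝ (p (center j n)) (g x)) (cube 0 1) := fun j n =>
    (hg.const_inner _).const_mul _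
  have hfi : ∀ j n, IntegrableOn ((tri j n).indicator
      fun x => cellAvg m j n * inner ℝ (p (center j n)) (g x)) (cube 0 1) := fun j n =>
    (hin j n).indicator (measurableSet_tri j n)
  have hint : ∀ j, ∫ x in cube 0 1, f j x = pairing m p g j := by
    intro j
    rw [hf]
    simp only []
    rw [integral_finsetSum _ fun n _ => hfi j n, pairing]
    refine Finset.sum_congr rfl fun n hn => ?_
    rw [setIntegral_indicator (measurableSet_tri j n), inter_eq_right.2 (tri_subset hn),
      integral_const_mul]
    congr 1
    exact integral_inner (hg.mono_set (tri_subset hn)) _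
  have hval : ∀ j, ∀ n ∈ idx d j, ∀ x ∈ tri j n,
      f j x = cellAvg m j n * inner ℝ (p (center j n)) (g x) := by
    intro j n hn x hx
    rw [hf]; simp only []
    rw [Finset.sum_eq_single_of_mem n hn, indicator_of_mem hx]
    intro n' _ hne
    exact indicator_of_notMem (fun hx' => (Set.disjoint_left.1 (tri_disjoint hne) hx') hx) _
  rw [show pairing m p g = fun j => ∫ x in cube 0 1, f j x from funext fun j => (hint j).symm]
  have hall : ∀ᵐ x ∂(volume.restrict (cube (0 : E d) 1)), ∀ j, ∃ n ∈ idx d j, x ∈ tri j n :=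
    ae_all_iff.2 fun j => ae_exists_mem_tri j
  refine tendsto_integral_of_dominated_convergence (fun x => B * (M * ‖g x‖))
    (fun j => (integrable_finsetSum _ fun n _ => hfi j n).aestronglyMeasurable)
    ((hg.norm.const_mul M).const_mul B) (fun j => ?_) ?_
  · filter_upwards [hall, ae_restrict_mem (measurableSet_cube 0 1)] with x hx hxU
    obtain ⟨n, hn, hxn⟩ := hx j
    rw [hval j n hn x hxn, norm_mul]
    have h1 : |cellAvg m j n| ≤ B := by
      have := abs_cellAvg_sub_le (r := 0) (hmI.mono_set (tri_subset hn))
        (fun y hy => by simpa using hB y (tri_subset hn hy))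
      simpa using this
    refine mul_le_mul h1 ?_ (norm_nonneg _) ((abs_nonneg _).trans (hB x hxU))
    exact (norm_inner_le_norm _ _).trans (mul_le_mul_of_nonneg_right (hM _) (norm_nonneg _))
  · filter_upwards [hall, ae_restrict_mem (measurableSet_cube 0 1)] with x hx hxU
    choose n hn hxn using hx
    have hfx : (fun j => f j x) = fun j => cellAvg m j (n j) * inner ℝ (p (center j (n j))) (g x) :=
      funext fun j => hval j (n j) (hn j) x (hxn j)
    rw [hfx]
    have hc : Tendsto (fun j => center j (n j)) atTop (𝓝 x) := by
      rw [tendsto_iff_norm_sub_tendsto_zero]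
      refine squeeze_zero (fun j => norm_nonneg _) (fun j => ?_)
        (by simpa using tendsto_side.const_mul (√(d : ℝ)))
      rw [norm_sub_rev]
      exact norm_sub_center_le (hxn j)
    refine Tendsto.mul ?_ (((hpc.tendsto x).comp hc).inner tendsto_const_nhds)
    rw [Metric.tendsto_atTop]
    intro ε hε
    have hmc : ContinuousAt m x := hm.continuousOn.continuousAt ((isOpen_cube 0 1).mem_nhds hxU)
    obtain ⟨δ, hδ, hδ'⟩ := Metric.continuousAt_iff.1 hmc (ε / 2) (half_pos hε)
    have h2 : Tendsto (fun j => 2 * (√(d : ℝ) * side j)) atTop (𝓝 0) := by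
      simpa using (tendsto_side.const_mul (√(d : ℝ))).const_mul 2
    obtain ⟨J, hJ⟩ := (h2.eventually (gt_mem_nhds hδ)).exists_forall_of_atTop
    refine ⟨J, fun j hj => ?_⟩
    rw [Real.dist_eq]
    refine lt_of_le_of_lt (abs_cellAvg_sub_le (hmI.mono_set (tri_subset (hn j)))
      fun y hy => ?_) (half_lt_self hε)
    refine (hδ' ?_).le
    have h3 := dist_triangle y (center j (n j)) x
    have h4 := norm_sub_center_le hy
    have h5 := norm_sub_center_le (hxn j)
    rw [← dist_eq_norm] at h4 h5
    rw [dist_comm x] at h5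
    linarith [hJ j hj]

/-- The estimate of `∫ m p ⬝ g` by the multiscale slope bounds. -/
theorem PairingData.abs_integral_le (h : PairingData a m g K b A s σ) {p : E d → E d}
    {Λ M B : ℝ} (hΛ : 0 ≤ Λ) (hp : ∀ x y, ‖p x - p y‖ ≤ Λ * ‖x - y‖) (hpc : Continuous p)
    (hM : ∀ x, ‖p x‖ ≤ M) (hB : ∀ x ∈ cube (0 : E d) 1, |m x| ≤ B) {Z : Set (E d)}
    (hZU : Z ⊆ cube 0 1) {N : ℕ}
    (hZ : ∀ j, N ≤ j → ∀ n ∈ idx d j, (∃ x ∈ tri j n, p x ≠ 0) → tri j n ⊆ Z) :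
    |∫ x in cube 0 1, m x * inner ℝ (p x) (g x)| ≤
      tailSum b σ N * (7 / 8 * A / (1 - 3 ^ (-(s + σ)))) *
        (√(weightedEnergy a p (Λ * (√d * side N)) Z (gradient m)) *
          √(weightedEnergy a p (Λ * (√d * side N)) Z K)) +
        (tailSum b σ N * (Λ * √d) + M * (3 ^ (s * (N : ℝ)) * b N)) *
          (√(∫ x in Z, m x ^ 2) * √(bil a Z K K)) := by
  have hM0 : 0 ≤ M := (norm_nonneg _).trans (hM 0)
  set R := 7 / 8 * A / (1 - 3 ^ (-(s + σ))) *
        (√(weightedEnergy a p (Λ * (√d * side N)) Z (gradient m)) *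
          √(weightedEnergy a p (Λ * (√d * side N)) Z K)) +
        Λ * √d * (√(∫ x in Z, m x ^ 2) * √(bil a Z K K)) with hR
  have hR0 : 0 ≤ R := by
    have h1 : (3 : ℝ) ^ (-(s + σ)) < 1 :=
      Real.rpow_lt_one_of_one_lt_of_neg (by norm_num) (by linarith [h.s_pos, h.σ_pos])
    have h2 : 0 < 1 - (3 : ℝ) ^ (-(s + σ)) := by linarith
    have := h.A_nonneg
    positivity
  set Q := M * (3 ^ (s * (N : ℝ)) * b N) * (√(∫ x in Z, m x ^ 2) * √(bil a Z K K)) with hQ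
  set c : ℕ → ℝ := fun i => if N < i then b i * (3 : ℝ) ^ (-σ * (i : ℝ)) else 0 with hc
  have hc0 : ∀ i, 0 ≤ c i := fun i => by
    rw [hc]; simp only []
    split_ifs
    · exact mul_nonneg (h.nonneg i) (by positivity)
    · exact le_rfl
  have hcs : Summable c := summable_tail h.nonneg h.summable h.σ_pos N
  -- Telescoping from the scale `N`, which alone contributes `Q`; each later scale contributes its
  -- term of the tail times `R`.
  have main : ∀ k, |pairing m p g (N + k)| ≤ Q + (∑ i ∈ Finset.range (N + k + 1), c i) * R := by
    intro k
    induction k with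
    | zero =>
      have h1 := h.abs_pairing_le hM0 hM hZU (hZ N le_rfl)
      have h2 : 0 ≤ (∑ i ∈ Finset.range (N + 0 + 1), c i) * R :=
        mul_nonneg (Finset.sum_nonneg fun i _ => hc0 i) hR0
      simpa using h1.trans (le_add_of_nonneg_right h2)
    | succ k ih =>
      have h1 := h.abs_pairing_succ_sub_le hΛ hp hpc hM hZU (Nat.le_add_right N k)
        (hZ (N + k) (Nat.le_add_right N k))
      have h2 : c (N + k + 1) = b (N + k + 1) * 3 ^ (-σ * ((N + k + 1 : ℕ) : ℝ)) := by
        rw [hc]; exact if_pos (by omega)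
      rw [← h2] at h1
      have h3 : |pairing m p g (N + k + 1)| ≤ |pairing m p g (N + k)| +
          |pairing m p g (N + k + 1) - pairing m p g (N + k)| := by
        have := abs_add_le (pairing m p g (N + k))
          (pairing m p g (N + k + 1) - pairing m p g (N + k))
        rwa [add_sub_cancel] at this
      rw [← add_assoc, Finset.sum_range_succ, add_mul]
      linarith
  have hlim := (tendsto_pairing h.smooth h.integrableOn hB h.integrable hpc hM).abs
  have hle : ∀ᶠ j in atTop, |pairing m p g j| ≤ Q + tailSum b σ N * R := by
    filter_upwards [eventually_ge_atTop N] with j hj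
    obtain ⟨k, rfl⟩ := Nat.exists_eq_add_of_le hj
    refine (main k).trans ?_
    have := hcs.sum_le_tsum (Finset.range (N + k + 1)) fun i _ => hc0 i
    have h4 := mul_le_mul_of_nonneg_right this hR0
    rw [tailSum]
    linarith
  refine (le_of_tendsto hlim hle).trans (le_of_eq ?_)
  rw [hR, hQ]; ring

end Pairing

end CoarseGrained

end

/-! ### Removal of the smoothness and boundedness assumptions -/

noncomputable section
namespace CoarseGrained

variable {d : ℕ} {a : CoeffField d} {G K : E d → E d}

section Limit

theorem weightedEnergy_eq_bil {p : E d → E d} {κ : ℝ} (hκ : 0 ≤ κ) (Z : Set (E d)) :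
    weightedEnergy a p κ Z G = bil a Z (fun x => √(‖p x‖ + κ) • G x)
      (fun x => √(‖p x‖ + κ) • G x) := by
  rw [bil_self, weightedEnergy]
  refine integral_congr_ae (Eventually.of_forall fun x => ?_)
  simp only []
  rw [energyDensity_smul, Real.sq_sqrt (by positivity)]

theorem FiniteEnergy.sqrt_weight (ha : IsCoefficientField a (cube 0 1))
    (hG : FiniteEnergy a (cube 0 1) G) {p : E d → E d} (hpc : Continuous p) {M : ℝ}
    (hM : ∀ x, ‖p x‖ ≤ M) (κ : ℝ) :
    FiniteEnergy a (cube 0 1) fun x => √(‖p x‖ + κ) • G x := by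
  refine hG.bdd_smul ha (C := √(M + κ)) (Continuous.aestronglyMeasurable (by fun_prop))
    (Eventually.of_forall fun x => ?_)
  rw [abs_of_nonneg (Real.sqrt_nonneg _)]
  gcongr
  exact hM x

theorem weightedEnergy_le (ha : IsCoefficientField a (cube 0 1))
    (hG : FiniteEnergy a (cube 0 1) G) {p : E d → E d} (hpc : Continuous p) {M : ℝ}
    (hM : ∀ x, ‖p x‖ ≤ M) {κ : ℝ} (hκ : 0 ≤ κ) {Z : Set (E d)} (hZ : Z ⊆ cube 0 1) :
    weightedEnergy a p κ Z G ≤ (M + κ) * bil a (cube 0 1) G G := by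
  have h1 : 0 ≤ᵐ[volume.restrict (cube 0 1)] fun x => (‖p x‖ + κ) * energyDensity a G x := by
    filter_upwards [ae_energyDensity_nonneg ha G] with x hx
    exact mul_nonneg (by positivity) hx
  refine (setIntegral_mono_set (integrableOn_weight ha hG hpc hM κ) h1 hZ.eventuallyLE).trans ?_
  rw [bil_self, ← integral_const_mul]
  refine integral_mono_ae (integrableOn_weight ha hG hpc hM κ) ((hG.integrable ha).const_mul _) ?_
  filter_upwards [ae_energyDensity_nonneg ha G] with x hx
  exact mul_le_mul_of_nonneg_right (by linarith [hM x]) hx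

theorem sqrt_weightedEnergy_sub_le (ha : IsCoefficientField a (cube 0 1))
    (hG : FiniteEnergy a (cube 0 1) G) (hK : FiniteEnergy a (cube 0 1) K) {p : E d → E d}
    (hpc : Continuous p) {M : ℝ} (hM : ∀ x, ‖p x‖ ≤ M) {κ : ℝ} (hκ : 0 ≤ κ) {Z : Set (E d)}
    (hZ : Z ⊆ cube 0 1) :
    √(weightedEnergy a p κ Z G) ≤ √(weightedEnergy a p κ Z K) +
      √((M + κ) * bil a (cube 0 1) (fun x => G x - K x) (fun x => G x - K x)) := by
  have hD := hG.sub ha hK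
  have h1 := sqrt_bil_add_le (ha.mono hZ) ((hK.sqrt_weight ha hpc hM κ).mono hZ)
    ((hD.sqrt_weight ha hpc hM κ).mono hZ)
  simp only [← smul_add, add_sub_cancel] at h1
  rw [← weightedEnergy_eq_bil hκ, ← weightedEnergy_eq_bil hκ, ← weightedEnergy_eq_bil hκ] at h1
  exact h1.trans (by gcongr; exact weightedEnergy_le ha hD hpc hM hκ hZ)

theorem weightedEnergy_smul_le (ha : IsCoefficientField a (cube 0 1))
    (hG : FiniteEnergy a (cube 0 1) G) {p : E d → E d} (hpc : Continuous p) {M : ℝ}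
    (hM : ∀ x, ‖p x‖ ≤ M) {κ : ℝ} (hκ : 0 ≤ κ) {Z : Set (E d)} (hZ : Z ⊆ cube 0 1) {f : E d → ℝ}
    {C : ℝ} (hf : AEStronglyMeasurable f (volume.restrict (cube 0 1))) (hC : ∀ x, |f x| ≤ C) :
    weightedEnergy a p κ Z (fun x => f x • G x) ≤ C ^ 2 * weightedEnergy a p κ Z G := by
  rw [weightedEnergy, weightedEnergy, ← integral_const_mul]
  have h1 := hG.bdd_smul ha hf (Eventually.of_forall hC)
  refine integral_mono_ae ((integrableOn_weight ha h1 hpc hM κ).mono_set hZ)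
    (((integrableOn_weight ha hG hpc hM κ).mono_set hZ).const_mul _) ?_
  filter_upwards [ae_energyDensity_nonneg (ha.mono hZ) G] with x hx
  rw [energyDensity_smul]
  have h2 : f x ^ 2 ≤ C ^ 2 := sq_le_sq' (abs_le.1 (hC x)).1 (abs_le.1 (hC x)).2
  calc (‖p x‖ + κ) * (f x ^ 2 * energyDensity a G x)
      ≤ (‖p x‖ + κ) * (C ^ 2 * energyDensity a G x) := by gcongr
    _ = _ := by ring

theorem weightedEnergy_congr {G' : E d → E d} {p : E d → E d} {κ : ℝ} {Z : Set (E d)}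
    (hZm : MeasurableSet Z) (h : ∀ x ∈ Z, G x = G' x) :
    weightedEnergy a p κ Z G = weightedEnergy a p κ Z G' := by
  refine setIntegral_congr_fun hZm fun x hx => ?_
  simp only [energyDensity, flux, h x hx]

/-- The multiscale bounds on the coefficients that the estimate uses, for a field `K`. -/
structure ScaleBounds (a : CoeffField d) (K : E d → E d) (b : ℕ → ℝ) (A s σ : ℝ) : Prop where
  coeff : IsCoefficientField a (cube 0 1)
  finiteEnergy : FiniteEnergy a (cube 0 1) K
  nonneg : ∀ j, 0 ≤ b j
  summable : Summable b
  A_nonneg : 0 ≤ A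
  s_lt : s + σ < 1
  s_pos : 0 < s
  σ_pos : 0 < σ
  inv_ne_top : ∀ j, ∀ n ∈ idx d j, cgAStarInvNorm a (tri j n) ≠ ∞
  inv_le : ∀ j, ∀ n ∈ idx d j, (cgAStarInvNorm a (tri j n)).toReal ≤
    (A * 3 ^ ((1 - s - σ) * (j : ℝ))) ^ 2
  flux_le : ∀ j, ∀ n ∈ idx d j, ‖∫ x in tri j n, flux a K x‖ ^ 2 ≤
    (3 ^ (s * (j : ℝ)) * b j) ^ 2 * (side j ^ d * bil a (tri j n) K K)

variable {b : ℕ → ℝ} {A s σ : ℝ}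

theorem ScaleBounds.pairingData (hd : 2 ≤ d) (h : ScaleBounds a K b A s σ) {m : E d → ℝ} {B : ℝ}
    (hm : ContDiffOn ℝ (⊤ : ℕ∞) m (cube 0 1)) (hB : ∀ x ∈ cube (0 : E d) 1, |m x| ≤ B)
    (hfe : FiniteEnergy a (cube 0 1) (gradient m)) :
    PairingData a m (flux a K) K b A s σ where
  coeff := h.coeff
  smooth := hm.of_le (by simp)
  memLp := by
    have : IsFiniteMeasure (volume.restrict (cube (0 : E d) 1)) :=
      ⟨by simpa using (volume_cube_ne_top 0 1).lt_top⟩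
    refine MemLp.of_bound (hm.continuousOn.aestronglyMeasurable (measurableSet_cube 0 1)) B ?_
    filter_upwards [ae_restrict_mem (measurableSet_cube 0 1)] with x hx using hB x hx
  finiteEnergy := hfe
  finiteEnergy' := h.finiteEnergy
  integrable := h.finiteEnergy.integrable_flux h.coeff
  nonneg := h.nonneg
  summable := h.summable
  A_nonneg := h.A_nonneg
  s_lt := h.s_lt
  s_pos := h.s_pos
  σ_pos := h.σ_pos
  slope j n hn := by
    have hsub := tri_subset hn
    have h1 := sq_norm_integral_gradient_le hd (isOpen_tri j n) (isBounded_cube _ _)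
      (volume_tri_ne_zero j n) (h.coeff.mono hsub) (h.inv_ne_top j n hn) (hm.mono hsub)
      (fun x hx => hB x (hsub hx)) (hfe.mono hsub)
    refine h1.trans ?_
    rw [volume_real_tri, mul_comm (side j ^ d), mul_assoc]
    have := side_pos j
    exact mul_le_mul_of_nonneg_right (h.inv_le j n hn)
      (mul_nonneg (by positivity) (bil_self_nonneg (h.coeff.mono hsub) _))
  flux := h.flux_le

theorem measurable_kap {k : ℝ} {H : ℝ → ℝ} (hH : Continuous H) : Measurable (kap k H) := by
  unfold kap
  exact (measurable_deriv H).add (measurable_const.mul (hH.measurable.div measurable_id))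

/-- The weighted energy estimate that follows from the integral identity of the transform. -/
theorem ScaleBounds.mul_integral_le (hd : 2 ≤ d) (h : ScaleBounds a K b A s σ) {w : E d → ℝ}
    (hw : HasGrad a (cube 0 1) w K) {η : E d → ℝ} (hη : IsTest (cube 0 1) η) {k : ℝ}
    (hid : ∀ H r₀ r₁, IsAnnular H r₀ r₁ →
      ∫ x in cube 0 1, η x * kap k H (w x) * energyDensity a K x =
        -∫ x in cube 0 1, H (w x) * inner ℝ (gradient η x) (flux a K x))
    {Λ M : ℝ} (hΛ : 0 ≤ Λ) (hp : ∀ x y, ‖gradient η x - gradient η y‖ ≤ Λ * ‖x - y‖)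
    (hM : ∀ x, ‖gradient η x‖ ≤ M) {Z : Set (E d)} (hZm : MeasurableSet Z) (hZU : Z ⊆ cube 0 1)
    {N : ℕ} (hZ : ∀ j, N ≤ j → ∀ n ∈ idx d j, (∃ x ∈ tri j n, gradient η x ≠ 0) → tri j n ⊆ Z) :
    k * ∫ x in cube 0 1, η x * energyDensity a K x ≤
      tailSum b σ N * (7 / 8 * A / (1 - 3 ^ (-(s + σ)))) *
        weightedEnergy a (gradient η) (Λ * (√d * side N)) Z K +
      (tailSum b σ N * (Λ * √d) + M * (3 ^ (s * (N : ℝ)) * b N)) *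
        (√(∫ x in Z, w x ^ 2) * √(bil a Z K K)) := by
  have hU := isOpen_cube (0 : E d) 1
  have hUm := measurableSet_cube (0 : E d) 1
  have : IsFiniteMeasure (volume.restrict (cube (0 : E d) 1)) :=
    ⟨by simpa using (volume_cube_ne_top 0 1).lt_top⟩
  have ha := h.coeff
  obtain ⟨φ, hφ⟩ := hw.exists_approximates hU ha
  obtain ⟨C, hC0, hC⟩ := exists_deriv_logBump_le
  have hpc : Continuous (gradient η) := continuous_gradient hη.contDiff_one
  set p := gradient η with hpdef
  set κ := Λ * (√d * side N) with hκdef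
  have hκ : 0 ≤ κ := by have := side_pos N; positivity
  have hM0 : 0 ≤ M := (norm_nonneg _).trans (hM 0)
  set T₁ := tailSum b σ N * (7 / 8 * A / (1 - 3 ^ (-(s + σ)))) with hT₁
  set T₂ := tailSum b σ N * (Λ * √d) + M * (3 ^ (s * (N : ℝ)) * b N) with hT₂
  have hT₁0 : 0 ≤ T₁ := by
    have h1 : (3 : ℝ) ^ (-(s + σ)) < 1 :=
      Real.rpow_lt_one_of_one_lt_of_neg (by norm_num) (by linarith [h.s_pos, h.σ_pos])
    have h2 : 0 < 1 - (3 : ℝ) ^ (-(s + σ)) := by linarith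
    have := h.A_nonneg
    have := tailSum_nonneg h.nonneg σ N
    positivity
  have hT₂0 : 0 ≤ T₂ := by
    have := tailSum_nonneg h.nonneg σ N
    have := h.nonneg N
    positivity
  set X := weightedEnergy a p κ Z K with hX
  have hX0 : 0 ≤ X := by
    rw [hX, weightedEnergy_eq_bil hκ]
    exact bil_self_nonneg (ha.mono hZU) _
  set Y := √(∫ x in Z, w x ^ 2) * √(bil a Z K K) with hY
  have hgI : IntegrableOn (fun x => inner ℝ (p x) (flux a K x)) (cube 0 1) := by
    have hfI := h.finiteEnergy.integrable_flux ha
    refine (hfI.norm.const_mul M).mono' (hpc.aestronglyMeasurable.inner hfI.1)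
      (Eventually.of_forall fun x => ?_)
    exact (norm_inner_le_norm _ _).trans (mul_le_mul_of_nonneg_right (hM x) (norm_nonneg _))
  -- For fixed `n` the multiscale estimate applies to `m = annularId n (φ_i)`, which is smooth and
  -- bounded although `w` is neither. As `i → ∞` its weighted energy is at most `(1 + C/n)²` times
  -- that of `w`, and one square root of it occurs.
  have step : ∀ n : ℕ, 0 < n →
      |∫ x in cube 0 1, annularId n (w x) * inner ℝ (p x) (flux a K x)| ≤
        T₁ * ((1 + C / n) * X) + T₂ * Y := by
    intro n hn
    have hn' : (0 : ℝ) < n := by exact_mod_cast hn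
    have hHa := isAnnular_annularId hn'
    set H := annularId (n : ℝ) with hH
    have hHc : Continuous H := hHa.contDiff.continuous
    have hHb : ∀ r, |H r| ≤ Real.exp (2 * n) := fun r => by
      by_cases hr : Real.exp (2 * n) < |r|
      · rw [hHa.eq_zero_of_gt r hr, abs_zero]; positivity
      · exact (abs_annularId_le _ r).trans (not_lt.1 hr)
    have hH'c : Continuous (deriv H) := hHa.contDiff.continuous_deriv (by simp)
    have hgrad : ∀ i, ∀ x ∈ cube (0 : E d) 1,
        gradient (fun y => H (φ i y)) x = deriv H (φ i x) • gradient (φ i) x := fun i x hx =>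
      gradient_comp ((hHa.contDiff.differentiable (by simp)) _)
        (((hφ.contDiffOn i).differentiableOn (by simp)).differentiableAt (hU.mem_nhds hx))
    have hd' : ∀ i x, |deriv H (φ i x)| ≤ 1 + C / n := fun i x => abs_deriv_annularId_le hn' hC _
    have hdm : ∀ i, AEStronglyMeasurable (fun x => deriv H (φ i x))
        (volume.restrict (cube 0 1)) := fun i => hH'c.comp_aestronglyMeasurable (hφ.memLp i).1
    have hfe : ∀ i, FiniteEnergy a (cube 0 1) (gradient fun y => H (φ i y)) := fun i => by
      refine ((hφ.finiteEnergy i).bdd_smul ha (hdm i) (Eventually.of_forall (hd' i))).congr ?_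
      filter_upwards [ae_restrict_mem hUm] with x hx
      rw [hgrad i x hx]
    have hpd : ∀ i, PairingData a (fun y => H (φ i y)) (flux a K) K b A s σ := fun i =>
      h.pairingData hd (hHa.contDiff.comp_contDiffOn (hφ.contDiffOn i)) (fun x _ => hHb _) (hfe i)
    have hmain := fun i => (hpd i).abs_integral_le hΛ hp hpc hM (B := Real.exp (2 * n))
      (fun x _ => hHb _) hZU hZ
    have hwE : ∀ i, √(weightedEnergy a p κ Z (gradient fun y => H (φ i y))) ≤ (1 + C / n) *
        (√X + √((M + κ) * bil a (cube 0 1) (fun x => gradient (φ i) x - K x)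
          (fun x => gradient (φ i) x - K x))) := by
      intro i
      rw [weightedEnergy_congr hZm fun x hx => hgrad i x (hZU hx)]
      have h1 := weightedEnergy_smul_le ha (hφ.finiteEnergy i) hpc hM hκ hZU (hdm i) (hd' i)
      have h2 : 0 ≤ 1 + C / n := by positivity
      refine (Real.sqrt_le_sqrt h1).trans ?_
      rw [Real.sqrt_mul (by positivity), Real.sqrt_sq h2]
      exact mul_le_mul_of_nonneg_left
        (sqrt_weightedEnergy_sub_le ha (hφ.finiteEnergy i) h.finiteEnergy hpc hM hκ hZU) h2
    have hL : Tendsto (fun i => ∫ x in cube 0 1, H (φ i x) * inner ℝ (p x) (flux a K x)) atTop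
        (𝓝 (∫ x in cube 0 1, H (w x) * inner ℝ (p x) (flux a K x))) := by
      refine tendsto_integral_of_dominated_convergence
        (fun x => Real.exp (2 * n) * ‖inner ℝ (p x) (flux a K x)‖)
        (fun i => (hHc.comp_aestronglyMeasurable (hφ.memLp i).1).mul hgI.1)
        (hgI.norm.const_mul _) (fun i => Eventually.of_forall fun x => ?_) ?_
      · rw [norm_mul]
        exact mul_le_mul_of_nonneg_right (hHb _) (norm_nonneg _)
      · filter_upwards [hφ.ae_tendsto] with x hx
        exact ((hHc.tendsto _).comp hx).mul_const _
    have hR2 : Tendsto (fun i => ∫ x in Z, H (φ i x) ^ 2) atTop (𝓝 (∫ x in Z, H (w x) ^ 2)) := by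
      have : IsFiniteMeasure (volume.restrict Z) :=
        ⟨by simpa using (measure_mono hZU).trans_lt (volume_cube_ne_top 0 1).lt_top⟩
      refine tendsto_integral_of_dominated_convergence (fun _ => Real.exp (2 * n) ^ 2)
        (fun i => ((hHc.comp_aestronglyMeasurable (hφ.memLp i).1).mono_set hZU).pow 2)
        (integrable_const _) (fun i => Eventually.of_forall fun x => ?_) ?_
      · rw [norm_pow]
        exact pow_le_pow_left₀ (norm_nonneg _) (hHb _) 2
      · filter_upwards [ae_restrict_of_ae_restrict_of_subset hZU hφ.ae_tendsto] with x hx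
        exact ((hHc.tendsto _).comp hx).pow 2
    have hR3 : ∫ x in Z, H (w x) ^ 2 ≤ ∫ x in Z, w x ^ 2 := by
      refine integral_mono_of_nonneg (Eventually.of_forall fun x => sq_nonneg _)
        (hw.memLp.mono_measure (Measure.restrict_mono_set _ hZU)).integrable_sq
        (Eventually.of_forall fun x => ?_)
      exact sq_le_sq.2 (abs_annularId_le _ _)
    have hR1 : Tendsto (fun i => T₁ * (((1 + C / n) *
        (√X + √((M + κ) * bil a (cube 0 1) (fun x => gradient (φ i) x - K x)
          (fun x => gradient (φ i) x - K x)))) * √X) +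
        T₂ * (√(∫ x in Z, H (φ i x) ^ 2) * √(bil a Z K K))) atTop
        (𝓝 (T₁ * (((1 + C / n) * (√X + √((M + κ) * 0))) * √X) +
          T₂ * (√(∫ x in Z, H (w x) ^ 2) * √(bil a Z K K)))) := by
      refine Tendsto.add ?_ ((hR2.sqrt.mul_const _).const_mul _)
      exact (((((hφ.tendsto_bil.const_mul _).sqrt.const_add _).const_mul _).mul_const _).const_mul _)
    have hfin := le_of_tendsto_of_tendsto' hL.abs hR1 fun i => (hmain i).trans (by
      gcongr
      exact hwE i)
    rw [mul_zero, Real.sqrt_zero, add_zero, mul_assoc (1 + C / (n : ℝ)), Real.mul_self_sqrt hX0] at hfin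
    refine hfin.trans ?_
    rw [hY]
    gcongr
  have hE := h.finiteEnergy.integrable ha
  -- As `n → ∞` the coefficient `kap` tends boundedly to `k` where `w ≠ 0`; on `{w = 0}` the energy
  -- density of `w` vanishes almost everywhere.
  have hlim : Tendsto (fun n : ℕ => ∫ x in cube 0 1, η x * kap k (annularId (n + 1 : ℕ)) (w x) *
      energyDensity a K x) atTop (𝓝 (∫ x in cube 0 1, η x * k * energyDensity a K x)) := by
    obtain ⟨Cη, hCη0, hCη, -⟩ := hη.exists_bound
    have hn' : ∀ n : ℕ, (0 : ℝ) < ((n + 1 : ℕ) : ℝ) := fun n => by positivity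
    refine tendsto_integral_of_dominated_convergence
      (fun x => (Cη * (1 + C + |k - 1|)) * energyDensity a K x)
      (fun n => ((hη.contDiff.continuous.aestronglyMeasurable.mul
        ((measurable_kap (isAnnular_annularId (hn' n)).contDiff.continuous).comp_aemeasurable
          hw.memLp.1.aemeasurable).aestronglyMeasurable).mul hE.1))
      (hE.const_mul _) (fun n => ?_) ?_
    · filter_upwards [ae_energyDensity_nonneg ha K] with x hx
      rw [norm_mul, norm_mul, Real.norm_of_nonneg hx]
      refine mul_le_mul_of_nonneg_right (mul_le_mul (hCη x) ?_ (norm_nonneg _) hCη0) hx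
      refine (abs_kap_annularId_le (hn' n) hC _).trans ?_
      have : C / ((n + 1 : ℕ) : ℝ) ≤ C := div_le_self hC0 (by push_cast; linarith [n.cast_nonneg (α := ℝ)])
      linarith
    · filter_upwards [hw.ae_eq_zero_of_eq hU (volume_cube_ne_top 0 1) ha 0] with x hx
      by_cases h0 : w x = 0
      · have : energyDensity a K x = 0 := by simp [energyDensity, hx h0]
        simp [this]
      · refine tendsto_const_nhds.congr' ?_
        obtain ⟨n₀, hn₀⟩ := exists_nat_gt |Real.log (w x)|
        filter_upwards [eventually_ge_atTop n₀] with n hn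
        rw [kap_annularId_of_lt (hn' n) h0]
        refine hn₀.trans_le ?_
        exact_mod_cast hn.trans (Nat.le_succ n)
  have hRlim : Tendsto (fun n : ℕ => T₁ * ((1 + C / ((n + 1 : ℕ) : ℝ)) * X) + T₂ * Y) atTop
      (𝓝 (T₁ * ((1 + 0) * X) + T₂ * Y)) := by
    have h1 : Tendsto (fun n : ℕ => C / ((n + 1 : ℕ) : ℝ)) atTop (𝓝 0) :=
      (tendsto_const_div_atTop_nhds_zero_nat C).comp (tendsto_add_atTop_nat 1)
    exact (((h1.const_add 1).mul_const X).const_mul T₁).add_const _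
  have hfin := le_of_tendsto_of_tendsto' hlim hRlim fun n => by
    rw [hid _ _ _ (isAnnular_annularId (n := ((n + 1 : ℕ) : ℝ)) (by positivity))]
    exact (neg_le_abs _).trans (step (n + 1) (Nat.succ_pos n))
  have e : ∫ x in cube 0 1, η x * k * energyDensity a K x =
      k * ∫ x in cube 0 1, η x * energyDensity a K x := by
    rw [← integral_const_mul]
    refine integral_congr_ae (Eventually.of_forall fun x => ?_)
    simp only []; ring
  rw [e] at hfin
  simpa using hfin

end Limit

end CoarseGrained

end

/-! ### The cut-off profile and smoothing at unit scale -/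

noncomputable section
namespace CoarseGrained

section Profile

/-- A smooth approximation of the indicator function of `[0, 1]`, vanishing near `0`. -/
def plateau (ε z : ℝ) : ℝ := Real.smoothTransition (z / ε - 1) * Real.smoothTransition (2 - z)

/-- The primitive of `plateau ε`. -/
def ramp (ε z : ℝ) : ℝ := ∫ r in (0 : ℝ)..z, plateau ε r

variable {ε : ℝ}

theorem contDiff_plateau (ε : ℝ) : ContDiff ℝ (⊤ : ℕ∞) (plateau ε) :=
  (Real.smoothTransition.contDiff.comp ((contDiff_id.div_const ε).sub contDiff_const)).mul
    (Real.smoothTransition.contDiff.comp (contDiff_const.sub contDiff_id))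

theorem plateau_nonneg (ε z : ℝ) : 0 ≤ plateau ε z :=
  mul_nonneg (Real.smoothTransition.nonneg _) (Real.smoothTransition.nonneg _)

theorem plateau_le_one (ε z : ℝ) : plateau ε z ≤ 1 :=
  mul_le_one₀ (Real.smoothTransition.le_one _) (Real.smoothTransition.nonneg _)
    (Real.smoothTransition.le_one _)

theorem plateau_eq_zero_of_le (hε : 0 < ε) {z : ℝ} (hz : z ≤ ε) : plateau ε z = 0 := by
  rw [plateau, Real.smoothTransition.zero_of_nonpos, zero_mul]
  rw [sub_nonpos, div_le_one hε]; exact hz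

theorem plateau_eq_zero_of_ge {z : ℝ} (hz : 2 ≤ z) : plateau ε z = 0 := by
  rw [plateau, Real.smoothTransition.zero_of_nonpos (x := 2 - z) (by linarith), mul_zero]

theorem plateau_eq_one (hε : 0 < ε) {z : ℝ} (h1 : 2 * ε ≤ z) (h2 : z ≤ 1) : plateau ε z = 1 := by
  rw [plateau, Real.smoothTransition.one_of_one_le, Real.smoothTransition.one_of_one_le, one_mul]
  · linarith
  · rw [le_sub_iff_add_le, le_div_iff₀ hε]; linarith

theorem plateau_antitoneOn (hε : 0 < ε) : AntitoneOn (plateau ε) (Ici (2 * ε)) := by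
  have h1 : ∀ z ∈ Ici (2 * ε), plateau ε z = Real.smoothTransition (2 - z) := fun z hz => by
    rw [plateau, Real.smoothTransition.one_of_one_le, one_mul]
    rw [le_sub_iff_add_le, le_div_iff₀ hε]
    linarith [mem_Ici.1 hz]
  intro x hx y hy hxy
  rw [h1 x hx, h1 y hy]
  exact Real.smoothTransition.monotone (by linarith)

theorem intervalIntegrable_plateau (ε x y : ℝ) : IntervalIntegrable (plateau ε) volume x y :=
  (contDiff_plateau ε).continuous.intervalIntegrable x y

theorem hasDerivAt_ramp (ε z : ℝ) : HasDerivAt (ramp ε) (plateau ε z) z :=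
  intervalIntegral.integral_hasDerivAt_right (intervalIntegrable_plateau ε 0 z)
    (contDiff_plateau ε).continuous.aestronglyMeasurable.stronglyMeasurableAtFilter
    (contDiff_plateau ε).continuous.continuousAt

theorem contDiff_ramp (ε : ℝ) : ContDiff ℝ (⊤ : ℕ∞) (ramp ε) := by
  rw [contDiff_infty_iff_deriv]
  refine ⟨fun z => (hasDerivAt_ramp ε z).differentiableAt, ?_⟩
  rw [funext fun z => (hasDerivAt_ramp ε z).deriv]
  exact contDiff_plateau ε

theorem ramp_mono (ε : ℝ) : Monotone (ramp ε) :=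
  monotone_of_deriv_nonneg (fun z => (hasDerivAt_ramp ε z).differentiableAt) fun z => by
    rw [(hasDerivAt_ramp ε z).deriv]; exact plateau_nonneg ε z

theorem ramp_eq_zero (hε : 0 < ε) {z : ℝ} (hz : z ≤ ε) : ramp ε z = 0 := by
  have h0 : ramp ε z = ∫ _r in (0 : ℝ)..z, (0 : ℝ) :=
    intervalIntegral.integral_congr fun r hr => plateau_eq_zero_of_le hε ?_
  · rw [h0, intervalIntegral.integral_zero]
  rcases mem_uIcc.1 hr with h | h
  · exact h.2.trans hz
  · exact h.2.trans hε.le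

theorem ramp_nonneg (hε : 0 < ε) (z : ℝ) : 0 ≤ ramp ε z := by
  rcases le_total z ε with h | h
  · rw [ramp_eq_zero hε h]
  · rw [← ramp_eq_zero hε le_rfl]; exact ramp_mono ε h

theorem sub_mul_plateau_le_ramp (hε : 0 < ε) {x z : ℝ} (hx : 2 * ε ≤ x) (hxz : x ≤ z) :
    (x - 2 * ε) * plateau ε x ≤ ramp ε z := by
  have h1 : ramp ε x = ramp ε (2 * ε) + ∫ r in (2 * ε)..x, plateau ε r := by
    rw [ramp, ramp, intervalIntegral.integral_add_adjacent_intervals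
      (intervalIntegrable_plateau _ _ _) (intervalIntegrable_plateau _ _ _)]
  have h2 : ∫ _r in (2 * ε)..x, plateau ε x ≤ ∫ r in (2 * ε)..x, plateau ε r :=
    intervalIntegral.integral_mono_on hx (by simp) (intervalIntegrable_plateau _ _ _)
      fun r hr => plateau_antitoneOn hε hr.1 (mem_Ici.2 hx) hr.2
  rw [intervalIntegral.integral_const, smul_eq_mul] at h2
  have h3 := ramp_nonneg hε (2 * ε)
  have h4 := ramp_mono ε hxz
  linarith

/-- Beyond `2ε` the plateau is nonincreasing, so its primitive at `z` is at least `(z - 2ε)` times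
its value. Composed with a decaying exponential, the ramp thus has a gradient controlled by the
function itself, up to an error of order `ε`. -/
theorem mul_plateau_le (hε : 0 < ε) {z : ℝ} (hz : 0 ≤ z) : z * plateau ε z ≤ ramp ε z + 2 * ε := by
  have h0 := plateau_nonneg ε z
  have h1 := plateau_le_one ε z
  have h2 := ramp_nonneg hε z
  rcases le_total z (2 * ε) with h | h
  · nlinarith
  · have := sub_mul_plateau_le_ramp hε h le_rfl
    nlinarith

theorem one_sub_le_ramp (hε : 0 < ε) (hε1 : 2 * ε ≤ 1) {z : ℝ} (hz : 1 ≤ z) :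
    1 - 2 * ε ≤ ramp ε z := by
  have := sub_mul_plateau_le_ramp hε hε1 hz
  rwa [plateau_eq_one hε hε1 le_rfl, mul_one] at this

theorem mul_plateau_le_two {z : ℝ} (hz : 0 ≤ z) : z * plateau ε z ≤ 2 := by
  rcases le_total 2 z with h | h
  · rw [plateau_eq_zero_of_ge h]; norm_num
  · have := plateau_le_one ε z
    have := plateau_nonneg ε z
    nlinarith

theorem exists_lipschitz_profile (hε : 0 < ε) : ∃ C, 0 ≤ C ∧ ∀ t t' : ℝ,
    |Real.exp t * plateau ε (Real.exp t) - Real.exp t' * plateau ε (Real.exp t')| ≤ C * |t - t'| := by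
  set f : ℝ → ℝ := fun t => Real.exp t * plateau ε (Real.exp t) with hf
  have hfd : ContDiff ℝ 1 f :=
    Real.contDiff_exp.mul (((contDiff_plateau ε).of_le (by simp)).comp Real.contDiff_exp)
  have hcs : HasCompactSupport f := by
    refine HasCompactSupport.intro (isCompact_Icc (a := Real.log ε) (b := Real.log 2)) fun t ht => ?_
    rw [Set.mem_Icc, not_and_or, not_le, not_le] at ht
    rcases ht with h | h
    · rw [hf]; simp only []
      rw [plateau_eq_zero_of_le hε, mul_zero]
      rw [← Real.exp_log hε]; exact Real.exp_le_exp.2 h.le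
    · rw [hf]; simp only []
      rw [plateau_eq_zero_of_ge, mul_zero]
      rw [← Real.exp_log (by norm_num : (0 : ℝ) < 2)]; exact Real.exp_le_exp.2 h.le
  obtain ⟨C, hC⟩ := hcs.deriv.exists_bound_of_continuous (hfd.continuous_deriv le_rfl)
  refine ⟨C, (norm_nonneg _).trans (hC 0), fun t t' => ?_⟩
  exact convex_univ.norm_image_sub_le_of_norm_deriv_le
    (fun x _ => (hfd.differentiable one_ne_zero) x) (fun x _ => hC x) (mem_univ t') (mem_univ t)

end Profile

section Mollify

variable {F : Type*} [NormedAddCommGroup F] [InnerProductSpace ℝ F] [FiniteDimensional ℝ F]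
  [MeasurableSpace F] [BorelSpace F]

variable (F) in
/-- Smoothing of Lipschitz functions at unit scale. -/
theorem exists_smoothing : ∃ C, 0 ≤ C ∧ ∀ f : F → ℝ, LipschitzWith 1 f → ∃ g : F → ℝ,
    ContDiff ℝ (⊤ : ℕ∞) g ∧ LipschitzWith 1 g ∧ (∀ x, |g x - f x| ≤ 1) ∧
      ∀ x y, ‖fderiv ℝ g x - fderiv ℝ g y‖ ≤ C * ‖x - y‖ := by
  set φ : ContDiffBump (0 : F) := ⟨1 / 2, 1, by norm_num, by norm_num⟩
  set ρ : F → ℝ := φ.normed volume with hρ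
  have hρs : ContDiff ℝ (⊤ : ℕ∞) ρ := φ.contDiff_normed
  have hρc : HasCompactSupport ρ := φ.hasCompactSupport_normed
  have hρ1 : ContDiff ℝ 1 ρ := hρs.of_le (by simp)
  have hdc : Continuous (fderiv ℝ ρ) := hρ1.continuous_fderiv one_ne_zero
  have hdI : Integrable (fderiv ℝ ρ) := hdc.integrable_of_hasCompactSupport (hρc.fderiv ℝ)
  refine ⟨∫ y, ‖fderiv ℝ ρ y‖, integral_nonneg fun _ => norm_nonneg _, fun f hf => ?_⟩
  set g : F → ℝ := convolution ρ f (ContinuousLinearMap.lsmul ℝ ℝ) volume with hg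
  have hfc : Continuous f := hf.continuous
  have hfl : LocallyIntegrable f := hfc.locallyIntegrable
  have hval : ∀ x, g x = ∫ y, ρ y * f (x - y) := fun x => rfl
  have hI : ∀ x, Integrable fun y => ρ y * f (x - y) := fun x =>
    Continuous.integrable_of_hasCompactSupport (hρ1.continuous.mul (by fun_prop)) hρc.mul_right
  refine ⟨g, hρc.contDiff_convolution_left _ hρs hfl, ?_, fun x => ?_, fun x y => ?_⟩
  · refine LipschitzWith.of_dist_le_mul fun x y => ?_
    rw [NNReal.coe_one, one_mul, Real.dist_eq, hval, hval, ← integral_sub (hI x) (hI y)]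
    have h1 : ∀ z, ‖ρ z * f (x - z) - ρ z * f (y - z)‖ ≤ ρ z * dist x y := fun z => by
      rw [← mul_sub, norm_mul, Real.norm_of_nonneg (φ.nonneg_normed z)]
      refine mul_le_mul_of_nonneg_left ?_ (φ.nonneg_normed z)
      have := hf.dist_le_mul (x - z) (y - z)
      rwa [NNReal.coe_one, one_mul, dist_sub_right, Real.dist_eq] at this
    have h2 := norm_integral_le_of_norm_le (φ.integrable_normed.mul_const (dist x y))
      (Eventually.of_forall h1)
    rwa [integral_mul_const, φ.integral_normed, one_mul] at h2
  · have := φ.dist_normed_convolution_le (μ := volume) (x₀ := x) (g := f) (ε := 1)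
      hfc.aestronglyMeasurable fun y hy => ?_
    · rwa [Real.dist_eq] at this
    · have := hf.dist_le_mul y x
      rw [NNReal.coe_one, one_mul] at this
      exact this.trans (Metric.mem_ball.1 hy).le
  -- The derivative is put on the mollifier, so the Lipschitz constant of the derivative of `g` is
  -- `∫ ‖ρ'‖`, the same for every `f`.
  · have hder : ∀ x, fderiv ℝ g x = ∫ z, f (x - z) • fderiv ℝ ρ z := fun x => by
      rw [(hρc.hasFDerivAt_convolution_left (ContinuousLinearMap.lsmul ℝ ℝ) hρ1 hfl x).fderiv]
      refine integral_congr_ae (Eventually.of_forall fun z => ?_)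
      ext v
      simp [ContinuousLinearMap.precompL, mul_comm]
    have hJ : ∀ x, Integrable fun z => f (x - z) • fderiv ℝ ρ z := fun x => by
      have h1 : Continuous fun z => f (x - z) := hfc.comp (continuous_const.sub continuous_id)
      have h2 : HasCompactSupport fun z => f (x - z) • fderiv ℝ ρ z :=
        HasCompactSupport.smul_left (f := fun z => f (x - z)) (hρc.fderiv ℝ)
      exact (h1.smul hdc).integrable_of_hasCompactSupport h2
    rw [hder, hder, ← integral_sub (hJ x) (hJ y), ← integral_mul_const]
    refine norm_integral_le_of_norm_le (hdI.norm.mul_const _) (Eventually.of_forall fun z => ?_)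
    rw [← sub_smul, norm_smul, mul_comm]
    refine mul_le_mul_of_nonneg_left ?_ (norm_nonneg _)
    have := hf.dist_le_mul (x - z) (y - z)
    rwa [NNReal.coe_one, one_mul, dist_sub_right, dist_eq_norm, dist_eq_norm] at this

end Mollify

end CoarseGrained

end

/-! ### Level functions and exponential cut-offs -/

noncomputable section
namespace CoarseGrained

variable {d : ℕ}

/-- A smooth substitute for the distance to the cube of side length `ρ₁`, which exceeds
`47/100 (ρ₂ - ρ₁)` near the complement of the cube of side length `ρ₂`. -/
structure IsLevel (C ρ₁ ρ₂ : ℝ) (θ : E d → ℝ) : Prop where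
  contDiff : ContDiff ℝ (⊤ : ℕ∞) θ
  lipschitz : ∀ x y, |θ x - θ y| ≤ ‖x - y‖
  norm_gradient_le : ∀ x, ‖gradient θ x‖ ≤ 1
  norm_gradient_sub_le : ∀ x y, ‖gradient θ x - gradient θ y‖ ≤ C / (ρ₂ - ρ₁) * ‖x - y‖
  nonpos : ∀ x ∈ cube (0 : E d) ρ₁, θ x ≤ 0
  abs_coord_le : ∀ x, θ x ≤ 47 / 100 * (ρ₂ - ρ₁) → ∀ i, |x i| ≤ ρ₂ / 2 - (ρ₂ - ρ₁) / 200

theorem norm_gradient_sub_eq (f : E d → ℝ) (x y : E d) :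
    ‖gradient f x - gradient f y‖ = ‖fderiv ℝ f x - fderiv ℝ f y‖ := by
  rw [gradient, gradient, ← map_sub, LinearIsometryEquiv.norm_map]

-- The distance to the inner cube is smoothed at the scale `r = (ρ₂ - ρ₁)/100` and lowered by `r`,
-- which makes it nonpositive on the inner cube. It differs from the distance by at most `2r`, so `θ
-- ≤ 47/100 (ρ₂ - ρ₁)` forces a distance of at most `49/100 (ρ₂ - ρ₁)`, less than the gap `(ρ₂ -
-- ρ₁)/2` between the cubes.
variable (d) in
theorem exists_isLevel : ∃ C, 0 ≤ C ∧ ∀ ρ₁ ρ₂ : ℝ, 0 < ρ₁ → ρ₁ < ρ₂ →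
    ∃ θ : E d → ℝ, IsLevel C ρ₁ ρ₂ θ := by
  obtain ⟨C, hC0, hC⟩ := exists_smoothing (E d)
  refine ⟨100 * C, by positivity, fun ρ₁ ρ₂ h1 h2 => ?_⟩
  have hΔ : 0 < ρ₂ - ρ₁ := by linarith
  set r := (ρ₂ - ρ₁) / 100 with hr
  have hr0 : 0 < r := by positivity
  set D : E d → ℝ := fun x => Metric.infDist x (cube 0 ρ₁)
  have hDl : ∀ x y, |D x - D y| ≤ ‖x - y‖ := fun x y => by
    have := (Metric.lipschitz_infDist_pt (cube (0 : E d) ρ₁)).dist_le_mul x y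
    rwa [NNReal.coe_one, one_mul, Real.dist_eq, dist_eq_norm] at this
  have hf : LipschitzWith 1 fun y : E d => D (r • y) / r := by
    refine LipschitzWith.of_dist_le_mul fun x y => ?_
    rw [NNReal.coe_one, one_mul, Real.dist_eq, ← sub_div, abs_div, abs_of_pos hr0,
      div_le_iff₀ hr0]
    refine (hDl _ _).trans (le_of_eq ?_)
    rw [← smul_sub, norm_smul, Real.norm_of_nonneg hr0.le, dist_eq_norm, mul_comm]
  obtain ⟨g, hg, hgl, hgf, hgd⟩ := hC _ hf
  have hgfd : ∀ x, ‖fderiv ℝ g x‖ ≤ 1 := fun x => by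
    simpa using norm_fderiv_le_of_lipschitz ℝ hgl (x₀ := x)
  set θ : E d → ℝ := fun x => r * g (r⁻¹ • x) - r with hθ
  have hθd : ContDiff ℝ (⊤ : ℕ∞) θ :=
    (contDiff_const.mul (hg.comp (contDiff_const_smul r⁻¹))).sub contDiff_const
  have hfd : ∀ x, fderiv ℝ θ x = fderiv ℝ g (r⁻¹ • x) := fun x => by
    have e1 : HasFDerivAt g (fderiv ℝ g (r⁻¹ • x)) (r⁻¹ • x) :=
      ((hg.differentiable (by simp)) _).hasFDerivAt
    have e2 : HasFDerivAt (fun y : E d => r⁻¹ • y) (r⁻¹ • ContinuousLinearMap.id ℝ (E d)) x :=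
      (hasFDerivAt_id x).const_smul r⁻¹
    have e3 := ((e1.comp x e2).const_mul r).sub_const r
    rw [hθ]
    refine HasFDerivAt.fderiv (e3.congr_fderiv ?_)
    ext v
    simp [mul_inv_cancel_left₀ hr0.ne']
  have hθD : ∀ x, |θ x + r - D x| ≤ r := fun x => by
    have := hgf (r⁻¹ • x)
    simp only [smul_inv_smul₀ hr0.ne'] at this
    have e : θ x + r - D x = r * (g (r⁻¹ • x) - D x / r) := by
      rw [hθ]; field_simp; ring
    rw [e, abs_mul, abs_of_pos hr0]
    nlinarith
  refine ⟨θ, hθd, fun x y => ?_, fun x => ?_, fun x y => ?_, fun x hx => ?_, fun x hx i => ?_⟩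
  · have := hgl.dist_le_mul (r⁻¹ • x) (r⁻¹ • y)
    rw [NNReal.coe_one, one_mul, Real.dist_eq, dist_eq_norm, ← smul_sub, norm_smul, norm_inv,
      Real.norm_of_nonneg hr0.le] at this
    have e : θ x - θ y = r * (g (r⁻¹ • x) - g (r⁻¹ • y)) := by rw [hθ]; ring
    rw [e, abs_mul, abs_of_pos hr0]
    calc _ ≤ r * (r⁻¹ * ‖x - y‖) := by gcongr
      _ = _ := by rw [mul_inv_cancel_left₀ hr0.ne']
  · rw [norm_gradient, hfd]; exact hgfd _
  · rw [norm_gradient_sub_eq, hfd, hfd]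
    refine (hgd _ _).trans (le_of_eq ?_)
    rw [← smul_sub, norm_smul, norm_inv, Real.norm_of_nonneg hr0.le, hr]
    field_simp
  · have h3 : D x = 0 := Metric.infDist_zero_of_mem hx
    have := hθD x
    rw [h3, sub_zero] at this
    linarith [le_abs_self (θ x + r)]
  · by_contra! hlt
    have hne : (cube (0 : E d) ρ₁).Nonempty := ⟨0, fun i => by simpa using half_pos h1⟩
    have h3 : |x i| - ρ₁ / 2 ≤ D x := by
      refine (Metric.le_infDist hne).2 fun y hy => ?_
      have h4 : |y i| < ρ₁ / 2 := by simpa using hy i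
      have h5 : |x i - y i| ≤ dist x y := by
        rw [dist_eq_norm]
        exact PiLp.norm_apply_le (x - y) i
      have h6 := abs_sub_abs_le_abs_sub (x i) (y i)
      linarith
    have h7 := (abs_le.1 (hθD x)).1
    rw [hr] at h7
    linarith

/-- The cut-off is the ramp with `ε = e^{-L}`, evaluated at `exp(-(L/h)(θ - τ))`. The exponential is
at least `1` on `{θ ≤ τ}` and falls to `ε`, where the ramp vanishes, at `θ = τ + h`. The bound of
`|∇η|` by `η` itself is `mul_plateau_le`. -/
theorem IsLevel.exists_cutoff {C : ℝ} (hC : 0 ≤ C) {L : ℝ} (hL : 1 ≤ L) : ∃ D, 0 ≤ D ∧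
    ∀ (ρ₁ ρ₂ : ℝ) (θ : E d → ℝ), ρ₁ < ρ₂ → ρ₂ ≤ 1 → IsLevel C ρ₁ ρ₂ θ →
    ∀ τ h : ℝ, 0 ≤ τ → 0 < h → τ + h ≤ 47 / 100 * (ρ₂ - ρ₁) → ∃ η : E d → ℝ,
      IsTest (cube 0 1) η ∧ (∀ x, 0 ≤ η x) ∧
      (∀ x, θ x ≤ τ → 1 - 2 * Real.exp (-L) ≤ η x) ∧
      (∀ x, ‖gradient η x‖ ≤ L / h * (η x + 2 * Real.exp (-L))) ∧
      (∀ x, ‖gradient η x‖ ≤ 2 * L / h) ∧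
      (∀ x y, ‖gradient η x - gradient η y‖ ≤ D / h ^ 2 * ‖x - y‖) ∧
      (∀ x, τ + h ≤ θ x → gradient η x = 0) := by
  set ε := Real.exp (-L) with hε
  have hε0 : 0 < ε := Real.exp_pos _
  have hε1 : 2 * ε ≤ 1 := by
    have h1 : ε ≤ Real.exp (-1) := Real.exp_le_exp.2 (by linarith)
    have h2 : Real.exp (-1) ≤ 1 / 2 := by
      rw [Real.exp_neg, inv_le_comm₀ (Real.exp_pos 1) (by norm_num)]
      have := Real.add_one_le_exp 1
      norm_num at this ⊢
      exact this
    linarith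
  obtain ⟨B, hB0, hB⟩ := exists_lipschitz_profile hε0
  refine ⟨L ^ 2 * B + 2 * L * C, by positivity, fun ρ₁ ρ₂ θ h12 h21 hθ τ h hτ hh hτh => ?_⟩
  set l := L / h with hl
  have hl0 : 0 < l := by positivity
  set t : E d → ℝ := fun x => -l * (θ x - τ) with ht
  set η : E d → ℝ := fun x => ramp ε (Real.exp (t x)) with hη
  have hηd : ContDiff ℝ (⊤ : ℕ∞) η :=
    (contDiff_ramp ε).comp (Real.contDiff_exp.comp (contDiff_const.mul (hθ.contDiff.sub contDiff_const)))
  have hexp : ∀ x, τ + h ≤ θ x → Real.exp (t x) ≤ ε := fun x hx => by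
    refine Real.exp_le_exp.2 ?_
    have h1 : l * h = L := by rw [hl]; field_simp
    simp only [ht]
    nlinarith
  have hgrad : ∀ x, gradient η x =
      (-l * (Real.exp (t x) * plateau ε (Real.exp (t x)))) • gradient θ x := fun x => by
    have hS : HasDerivAt (fun r => ramp ε (Real.exp (-l * (r - τ))))
        (plateau ε (Real.exp (t x)) * (Real.exp (t x) * (-l * 1))) (θ x) := by
      have h1 : HasDerivAt (fun r : ℝ => -l * (r - τ)) (-l * 1) (θ x) :=
        ((hasDerivAt_id (θ x)).sub_const τ).const_mul (-l)
      exact (hasDerivAt_ramp ε _).comp (θ x) h1.exp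
    have h2 := gradient_comp hS.differentiableAt ((hθ.contDiff.differentiable (by simp)) x)
    rw [hS.deriv] at h2
    rw [show η = fun y => (fun r => ramp ε (Real.exp (-l * (r - τ)))) (θ y) from rfl, h2]
    congr 1; ring
  have hzp : ∀ x, 0 ≤ Real.exp (t x) * plateau ε (Real.exp (t x)) := fun x =>
    mul_nonneg (Real.exp_pos _).le (plateau_nonneg _ _)
  have hng : ∀ x, ‖gradient η x‖ ≤ l * (Real.exp (t x) * plateau ε (Real.exp (t x))) := fun x => by
    rw [hgrad, norm_smul, norm_mul, norm_neg, Real.norm_of_nonneg hl0.le,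
      Real.norm_of_nonneg (hzp x)]
    exact mul_le_of_le_one_right (mul_nonneg hl0.le (hzp x)) (hθ.norm_gradient_le x)
  refine ⟨η, ⟨hηd, ?_, ?_⟩, fun x => ramp_nonneg hε0 _, fun x hx => ?_, fun x => ?_, fun x => ?_,
    fun x y => ?_, fun x hx => ?_⟩
  rotate_left 2
  · refine one_sub_le_ramp hε0 hε1 (Real.one_le_exp ?_)
    simp only [ht]
    nlinarith
  · exact (hng x).trans (mul_le_mul_of_nonneg_left (mul_plateau_le hε0 (Real.exp_pos _).le) hl0.le)
  · refine (hng x).trans ((mul_le_mul_of_nonneg_left (mul_plateau_le_two (Real.exp_pos _).le)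
      hl0.le).trans (le_of_eq ?_))
    rw [hl]; ring
  · set z : E d → ℝ := fun x => Real.exp (t x) * plateau ε (Real.exp (t x)) with hz
    have e : gradient η x - gradient η y =
        (-l * (z x - z y)) • gradient θ x + (-l * z y) • (gradient θ x - gradient θ y) := by
      rw [hgrad, hgrad, smul_sub, ← add_sub_assoc, ← add_smul]
      congr 2
      ring
    have h1 : |z x - z y| ≤ B * (l * ‖x - y‖) := by
      refine (hB (t x) (t y)).trans (mul_le_mul_of_nonneg_left ?_ hB0)
      rw [ht]; simp only []
      rw [← mul_sub, sub_sub_sub_cancel_right, abs_mul, abs_neg, abs_of_pos hl0]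
      exact mul_le_mul_of_nonneg_left (hθ.lipschitz x y) hl0.le
    have h2 : z y ≤ 2 := mul_plateau_le_two (Real.exp_pos _).le
    rw [e]
    refine (norm_add_le _ _).trans ?_
    rw [norm_smul, norm_smul, norm_mul, norm_mul, norm_neg, Real.norm_of_nonneg hl0.le,
      Real.norm_of_nonneg (hzp y), Real.norm_eq_abs]
    have h3 : l * |z x - z y| * ‖gradient θ x‖ ≤ l * (B * (l * ‖x - y‖)) * 1 :=
      mul_le_mul (mul_le_mul_of_nonneg_left h1 hl0.le) (hθ.norm_gradient_le x) (norm_nonneg _)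
        (by positivity)
    have hhΔ : h ≤ ρ₂ - ρ₁ := by linarith
    have h4 : C / (ρ₂ - ρ₁) ≤ C / h := by gcongr
    have h5 : l * z y * ‖gradient θ x - gradient θ y‖ ≤ l * 2 * (C / h * ‖x - y‖) :=
      mul_le_mul (mul_le_mul_of_nonneg_left h2 hl0.le)
        ((hθ.norm_gradient_sub_le x y).trans (mul_le_mul_of_nonneg_right h4 (norm_nonneg _)))
        (norm_nonneg _) (by positivity)
    refine (add_le_add h3 h5).trans (le_of_eq ?_)
    rw [hl]; field_simp
  · rw [hgrad, plateau_eq_zero_of_le hε0 (hexp x hx)]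
    simp
  all_goals
    have hsub : Function.support η ⊆
        (WithLp.ofLp : E d → Fin d → ℝ) ⁻¹' (Set.pi univ fun _ =>
          Icc (-(ρ₂ / 2 - (ρ₂ - ρ₁) / 200)) (ρ₂ / 2 - (ρ₂ - ρ₁) / 200)) := by
      intro x hx
      have h1 : θ x < τ + h := by
        by_contra! hge
        exact hx (ramp_eq_zero hε0 (hexp x hge))
      exact Set.mem_pi.2 fun i _ => abs_le.1 (hθ.abs_coord_le x (h1.le.trans hτh) i)
    have hcl : IsClosed ((WithLp.ofLp : E d → Fin d → ℝ) ⁻¹' (Set.pi univ fun _ : Fin d =>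
          Icc (-(ρ₂ / 2 - (ρ₂ - ρ₁) / 200)) (ρ₂ / 2 - (ρ₂ - ρ₁) / 200))) :=
      (isClosed_set_pi fun _ _ => isClosed_Icc).preimage (PiLp.continuous_ofLp 2 _)
    have hts := closure_minimal hsub hcl
    have hU : tsupport η ⊆ cube 0 1 := fun x hx i => by
      have h1 : |x i| ≤ ρ₂ / 2 - (ρ₂ - ρ₁) / 200 := abs_le.2 (Set.mem_pi.1 (hts hx) i (mem_univ i))
      have h2 : |x i - (0 : E d) i| = |x i| := by simp
      rw [h2]
      linarith
  · exact Metric.isCompact_of_isClosed_isBounded (isClosed_tsupport η)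
      ((isBounded_cube 0 1).subset hU)
  · exact hU

end CoarseGrained

end

/-! ### One step of absorption -/

noncomputable section
namespace CoarseGrained

variable {d : ℕ}

/-- The elementary absorption argument behind the one-step estimate. -/
theorem absorb {I F F' c ε T lam κ h L T₂ E V Y H : ℝ} (hI : F * (1 - 2 * ε) ≤ I)
    (hF' : 0 ≤ F') (hc : 0 < c) (hε : 0 < ε) (hε1 : ε ≤ 37 / 100) (hT : 0 ≤ T)
    (hL : 1 ≤ L) (hh : 0 < h) (hI0 : 0 ≤ I) (hTL : 11 / 10 * L * T ≤ c * h)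
    (hlam : lam * h = 21 / 20 * L) (hκ0 : 0 ≤ κ) (hκ : h * κ ≤ ε) (hH : 0 ≤ H)
    (hT₂ : T₂ ≤ c * (E * V)) (hE : 0 ≤ E) (hV : 0 ≤ V) (hY : Y ≤ √H * √F') (hY0 : 0 ≤ Y)
    (hmain : c * I ≤ T * (lam * I + (2 * lam * ε + κ) * F') + T₂ * Y) :
    F ≤ 268 * ε * F' + 484 * E ^ 2 / ε * V ^ 2 * H := by
  -- The quotient `(21/20) / (11/10) = 21/22` leaves the fraction `1/22` of `c I` on the left-hand
  -- side after absorption.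
  have h1 : T * lam ≤ 21 / 22 * c := by
    have h2 : 11 / 10 * T * (lam * h) ≤ 21 / 20 * (c * h) := by rw [hlam]; nlinarith
    have h3 : (11 / 10 * T * lam) * h ≤ (21 / 20 * c) * h := by linarith
    have h4 := le_of_mul_le_mul_right h3 hh
    linarith
  have h2 : T * κ ≤ c * ε := by
    have h3 : T ≤ c * h := by nlinarith
    calc T * κ ≤ c * h * κ := by gcongr
      _ = c * (h * κ) := by ring
      _ ≤ c * ε := by gcongr
  have h3 : T₂ * Y ≤ c * (E * V * (√H * √F')) := by
    have hEV : 0 ≤ c * (E * V) := by positivity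
    calc T₂ * Y ≤ c * (E * V) * Y := mul_le_mul_of_nonneg_right hT₂ hY0
      _ ≤ c * (E * V) * (√H * √F') := mul_le_mul_of_nonneg_left hY hEV
      _ = _ := by ring
  have h4 : 22 * (E * V * (√H * √F')) ≤ ε * F' + 121 * E ^ 2 / ε * V ^ 2 * H := by
    have e1 : ε * F' + 121 * E ^ 2 / ε * V ^ 2 * H - 22 * (E * V * (√H * √F')) =
        (ε * √F' - 11 * E * V * √H) ^ 2 / ε := by
      have s1 : F' = √F' ^ 2 := (Real.sq_sqrt hF').symm
      have s2 : H = √H ^ 2 := (Real.sq_sqrt hH).symm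
      field_simp
      nth_rewrite 1 [s1]
      nth_rewrite 1 [s2]
      ring
    have e2 : 0 ≤ (ε * √F' - 11 * E * V * √H) ^ 2 / ε := by positivity
    linarith
  have h5 : c * I ≤ c * (21 / 22 * I + 3 * (ε * F') + E * V * (√H * √F')) := by
    have e1 : T * (lam * I) ≤ 21 / 22 * c * I := by
      rw [← mul_assoc]; exact mul_le_mul_of_nonneg_right h1 hI0
    have e2 : T * lam * (2 * ε * F') ≤ 21 / 22 * c * (2 * ε * F') :=
      mul_le_mul_of_nonneg_right h1 (by positivity)
    have e3 : T * κ * F' ≤ c * ε * F' := mul_le_mul_of_nonneg_right h2 hF'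
    have e4 : 0 ≤ c * ε * F' := by positivity
    linarith
  have h6 := le_of_mul_le_mul_left h5 hc
  -- Multiplying by `22` turns `3 ε F'` into `66 ε F'`, and the Young inequality above adds one
  -- more. The next step uses `1 - 2ε ≥ 26/100 > 1/4`; hence `268 = 4 · 67` and `484 = 4 · 121`.
  have h7 : I ≤ 67 * (ε * F') + 121 * E ^ 2 / ε * V ^ 2 * H := by linarith
  have h8 : F ≤ 4 * I := by
    rcases le_total F 0 with h | h
    · linarith
    · nlinarith
  calc F ≤ 4 * (67 * (ε * F') + 121 * E ^ 2 / ε * V ^ 2 * H) := by linarith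
    _ = _ := by ring

theorem measurableSet_sublevel {C ρ₁ ρ₂ : ℝ} {θ : E d → ℝ} (hθ : IsLevel C ρ₁ ρ₂ θ) (τ : ℝ) :
    MeasurableSet ({x | θ x ≤ τ} ∩ cube 0 1) :=
  (measurableSet_le hθ.contDiff.continuous.measurable measurable_const).inter
    (measurableSet_cube 0 1)

theorem one_le_inv_one_sub_rpow {x : ℝ} (hx : 0 < x) : 1 ≤ (1 - (3 : ℝ) ^ (-x))⁻¹ := by
  have h1 : (3 : ℝ) ^ (-x) < 1 := Real.rpow_lt_one_of_one_lt_of_neg (by norm_num) (by linarith)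
  have h2 : 0 < (3 : ℝ) ^ (-x) := by positivity
  rw [one_le_inv₀ (by linarith)]
  linarith

/-- Both lower-order coefficients are comparable to `ℓ R / h`. For the one with the Lipschitz
constant of the gradient, `ℓ A ≥ 1` and the condition on `T` give `Ts ≤ ℓ A Ts ≤ 2 c h ℓ`, which
gains one power of `h`. -/
theorem lowOrder_le {A Ts T ℓ c h L D q R β : ℝ} (hL : 1 ≤ L) (hh : 0 < h) (hc : 0 < c)
    (hc2 : c ≤ 2) (hTs : 0 ≤ Ts) (hℓ : 0 < ℓ) (hℓA : 1 ≤ ℓ * A) (hTA : 7 / 8 * A * Ts ≤ T)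
    (hTc : T ≤ c * h) (hD : 0 ≤ D) (hq : 0 ≤ q) (hR : 1 ≤ R) (hβ : β ≤ ℓ) :
    Ts * (D / (20 / 21 * h) ^ 2 * q) + 2 * L / (20 / 21 * h) * (R * β) ≤
      c * ((6 * D * q + 3 * L) * (ℓ * R / (c * h))) := by
  have t1 : Ts ≤ 2 * (c * h * ℓ) := by
    have e1 : Ts ≤ ℓ * A * Ts := le_mul_of_one_le_left hTs hℓA
    have e2 : A * Ts ≤ 2 * (c * h) := by
      have : 0 < c * h := by positivity
      linarith
    calc _ ≤ ℓ * A * Ts := e1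
      _ = ℓ * (A * Ts) := by ring
      _ ≤ ℓ * (2 * (c * h)) := by gcongr
      _ = _ := by ring
  have hDq : 0 ≤ ℓ * (D * q) := by positivity
  have t2 : Ts * (D / (20 / 21 * h) ^ 2 * q) ≤ 6 * D * q * (ℓ * R / h) := by
    calc Ts * (D / (20 / 21 * h) ^ 2 * q)
        ≤ 2 * (c * h * ℓ) * (D / (20 / 21 * h) ^ 2 * q) := by gcongr
      _ = 441 / 200 * c * (ℓ * (D * q)) / h := by field_simp; ring
      _ ≤ 441 / 200 * 2 * (ℓ * (D * q)) / h := by gcongr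
      _ ≤ 6 * (ℓ * (D * q)) / h := by gcongr; linarith
      _ ≤ 6 * (ℓ * (D * q) * R) / h := by
          have := le_mul_of_one_le_right hDq hR
          exact div_le_div_of_nonneg_right (by linarith) hh.le
      _ = _ := by ring
  have t3 : 2 * L / (20 / 21 * h) * (R * β) ≤ 3 * L * (ℓ * R / h) := by
    have e3 : 0 ≤ L * (R * ℓ) / h := by positivity
    calc 2 * L / (20 / 21 * h) * (R * β) ≤ 2 * L / (20 / 21 * h) * (R * ℓ) := by gcongr
      _ = 21 / 10 * (L * (R * ℓ) / h) := by field_simp; ring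
      _ ≤ 3 * (L * (R * ℓ) / h) := by linarith
      _ = _ := by ring
  calc _ ≤ 6 * D * q * (ℓ * R / h) + 3 * L * (ℓ * R / h) := add_le_add t2 t3
    _ = _ := by field_simp

set_option maxHeartbeats 1600000 in
/-- The one-step estimate for the energy in the sublevel sets of a level function. -/
theorem exists_oneStep (hd : 2 ≤ d) {C : ℝ} (hC : 0 ≤ C) : ∃ C₀ : ℝ, 1 ≤ C₀ ∧ ∃ CL : ℝ → ℝ,
    (∀ L, 1 ≤ CL L) ∧ ∀ (a : CoeffField d) (K : E d → E d) (b : ℕ → ℝ) (A s σ : ℝ),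
    ScaleBounds a K b A s σ → ∀ (w : E d → ℝ), HasGrad a (cube 0 1) w K →
    ∀ (c ℓ : ℝ), 1 ≤ c → c ≤ 2 → (∀ H r₀ r₁, IsAnnular H r₀ r₁ → ∀ η, IsTest (cube 0 1) η →
      ∫ x in cube 0 1, η x * kap c H (w x) * energyDensity a K x =
        -∫ x in cube 0 1, H (w x) * inner ℝ (gradient η x) (flux a K x)) →
    0 < ℓ → 1 ≤ ℓ * A → (∀ j, b j ≤ ℓ) →
    ∀ (ρ₁ ρ₂ : ℝ) (θ : E d → ℝ), ρ₁ < ρ₂ → ρ₂ ≤ 1 → IsLevel C ρ₁ ρ₂ θ →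
    ∀ L τ h : ℝ, ∀ N : ℕ, 1 ≤ L → 0 ≤ τ → 0 < h → τ + h ≤ 47 / 100 * (ρ₂ - ρ₁) →
      11 / 10 * L * (7 / 8 * A / (1 - (3 : ℝ) ^ (-(s + σ))) * tailSum b σ N) ≤ c * h →
      CL L * (3 : ℝ) ^ (-(N : ℝ)) ≤ h →
      bil a ({x | θ x ≤ τ} ∩ cube 0 1) K K ≤
        C₀ * Real.exp (-L) * bil a ({x | θ x ≤ τ + h} ∩ cube 0 1) K K +
        CL L * (ℓ * (3 : ℝ) ^ (s * (N : ℝ)) / (c * h)) ^ 2 * ∫ x in cube 0 ρ₂, w x ^ 2 := by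
  -- The maximum with `1` makes the choice meaningful for every real `L`; it is removed once `1 ≤ L`
  -- is known.
  choose D hD0 hD using fun L : ℝ => IsLevel.exists_cutoff (d := d) hC (le_max_left 1 L)
  set Em : ℝ → ℝ := fun L => 6 * D L * √d + 3 * |L| with hEm
  have hEm0 : ∀ L, 0 ≤ Em L := fun L => by have := hD0 L; positivity
  -- The summand `42 √d` keeps the cubes of scale `N` inside the layer, `2 D √d e^{L}` makes `h κ ≤
  -- e^{-L}`, and the last one is the constant produced by the absorption.
  refine ⟨268, by norm_num, fun L => 1 + 42 * √d + 2 * D L * √d / Real.exp (-L) +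
    484 * Em L ^ 2 / Real.exp (-L), fun L => ?_, ?_⟩
  · have := hD0 L
    have h1 : 0 ≤ 42 * √(d : ℝ) := by positivity
    have h2 : 0 ≤ 2 * D L * √d / Real.exp (-L) := by positivity
    have h3 : 0 ≤ 484 * Em L ^ 2 / Real.exp (-L) := by positivity
    simp only []
    linarith
  intro a K b A s σ hS w hw c ℓ hc1 hc2 hid hℓ hℓA hbℓ ρ₁ ρ₂ θ h12 h21 hθ L τ h N hL hτ hh hτh hT hN
  have hD := hD L
  rw [max_eq_right hL] at hD
  have hD0 := hD0 L
  have hEm0 := hEm0 L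
  have hEmv : Em L = 6 * D L * √d + 3 * L := by simp only [hEm]; rw [abs_of_nonneg (by linarith)]
  set ε := Real.exp (-L) with hε
  have hε0 : 0 < ε := Real.exp_pos _
  have hε1 : ε ≤ 37 / 100 := by
    have h1 : ε ≤ Real.exp (-1) := Real.exp_le_exp.2 (by linarith)
    linarith [Real.exp_neg_one_lt_d9]
  have ha := hS.coeff
  have hside : side N = (3 : ℝ) ^ (-(N : ℝ)) := side_eq_rpow N
  have hsN := side_pos N
  rw [← hside] at hN
  have hd0 : 0 ≤ √(d : ℝ) := Real.sqrt_nonneg _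
  have n1 : 42 * √d * side N ≤ h := by
    refine le_trans (mul_le_mul_of_nonneg_right ?_ hsN.le) hN
    have h2 : 0 ≤ 2 * D L * √d / ε := by positivity
    have h3 : 0 ≤ 484 * Em L ^ 2 / ε := by positivity
    linarith
  have n2 : 2 * D L * √d * side N ≤ ε * h := by
    have h1 : 2 * D L * √d / ε * side N ≤ h := by
      refine le_trans (mul_le_mul_of_nonneg_right ?_ hsN.le) hN
      have h3 : 0 ≤ 484 * Em L ^ 2 / ε := by positivity
      linarith
    rw [div_mul_eq_mul_div, div_le_iff₀ hε0] at h1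
    linarith
  -- The cut-off uses only `20/21` of the width. The remaining `h/21` is at least `2 √d side N`, so
  -- a cube of scale `N` or finer that meets the support of `∇η` stays in `{θ ≤ τ + h}`.
  set h' := 20 / 21 * h with hh'
  have hh'0 : 0 < h' := by positivity
  obtain ⟨η, hη, hη0, hη1, hη2, hη3, hη4, hη5⟩ := hD ρ₁ ρ₂ θ h12 h21 hθ τ h' hτ hh'0 (by linarith)
  set Z := {x | θ x ≤ τ + h} ∩ cube (0 : E d) 1 with hZ
  have hZm : MeasurableSet Z := measurableSet_sublevel hθ _
  have hZU : Z ⊆ cube 0 1 := inter_subset_right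
  set Λ := D L / h' ^ 2 with hΛ
  have hΛ0 : 0 ≤ Λ := by positivity
  set κ := Λ * (√d * side N) with hκ
  have hκ0 : 0 ≤ κ := by positivity
  have hZs : ∀ j, N ≤ j → ∀ n ∈ idx d j, (∃ x ∈ tri j n, gradient η x ≠ 0) → tri j n ⊆ Z := by
    rintro j hj n hn ⟨x, hx, hgx⟩ y hy
    refine ⟨?_, tri_subset hn hy⟩
    have h1 : θ x < τ + h' := by
      by_contra! hge
      exact hgx (hη5 x hge)
    have h2 := norm_sub_center_le hx
    have h3 := norm_sub_center_le hy
    have h4 : ‖y - x‖ ≤ ‖y - center j n‖ + ‖x - center j n‖ := by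
      have := norm_sub_le (y - center j n) (x - center j n)
      rwa [sub_sub_sub_cancel_right] at this
    have h5 : side j ≤ side N := by
      rw [side_eq_rpow, side_eq_rpow]
      exact Real.rpow_le_rpow_of_exponent_le (by norm_num) (by simpa using hj)
    have h6 := mul_le_mul_of_nonneg_left h5 hd0
    have h7 := (le_abs_self _).trans (hθ.lipschitz y x)
    change θ y ≤ τ + h
    linarith
  have hmain := hS.mul_integral_le hd hw hη (fun H r₀ r₁ hH => hid H r₀ r₁ hH η hη) hΛ0 hη4 hη3
    hZm hZU hZs
  have hE := hS.finiteEnergy.integrable ha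
  obtain ⟨Bη, hBη0, hBη, -⟩ := hη.exists_bound
  have hηI : IntegrableOn (fun x => η x * energyDensity a K x) (cube 0 1) :=
    hE.bdd_mul (c := Bη) hη.contDiff.continuous.aestronglyMeasurable (Eventually.of_forall hBη)
  have hηe0 : 0 ≤ᵐ[volume.restrict (cube 0 1)] fun x => η x * energyDensity a K x := by
    filter_upwards [ae_energyDensity_nonneg ha K] with x hx
    exact mul_nonneg (hη0 x) hx
  set I := ∫ x in cube 0 1, η x * energyDensity a K x with hI
  have hI0 : 0 ≤ I := integral_nonneg_of_ae hηe0
  have hpc : Continuous (gradient η) := continuous_gradient hη.contDiff_one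
  have hwE : weightedEnergy a (gradient η) κ Z K ≤
      L / h' * I + (2 * (L / h') * ε + κ) * bil a Z K K := by
    have h1 : weightedEnergy a (gradient η) κ Z K ≤ ∫ x in Z, (L / h' * (η x * energyDensity a K x) +
        (2 * (L / h') * ε + κ) * energyDensity a K x) := by
      refine integral_mono_ae ((integrableOn_weight ha hS.finiteEnergy hpc hη3 κ).mono_set hZU)
        (((hηI.mono_set hZU).const_mul _).add ((hE.mono_set hZU).const_mul _)) ?_
      filter_upwards [ae_energyDensity_nonneg (ha.mono hZU) K] with x hx
      have := mul_le_mul_of_nonneg_right (hη2 x) hx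
      calc _ = ‖gradient η x‖ * energyDensity a K x + κ * energyDensity a K x := by ring
        _ ≤ L / h' * (η x + 2 * ε) * energyDensity a K x + κ * energyDensity a K x := by linarith
        _ = _ := by ring
    rw [integral_add ((hηI.mono_set hZU).const_mul _) ((hE.mono_set hZU).const_mul _),
      integral_const_mul, integral_const_mul] at h1
    have h2 : ∫ x in Z, η x * energyDensity a K x ≤ I :=
      setIntegral_mono_set hηI hηe0 hZU.eventuallyLE
    refine h1.trans (add_le_add (mul_le_mul_of_nonneg_left h2 (by positivity)) le_rfl)
  have hFI : bil a ({x | θ x ≤ τ} ∩ cube 0 1) K K * (1 - 2 * ε) ≤ I := by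
    have hsub : {x | θ x ≤ τ} ∩ cube (0 : E d) 1 ⊆ cube 0 1 := inter_subset_right
    have h1 : bil a ({x | θ x ≤ τ} ∩ cube 0 1) K K * (1 - 2 * ε) ≤
        ∫ x in {x | θ x ≤ τ} ∩ cube 0 1, η x * energyDensity a K x := by
      rw [bil_self, ← integral_mul_const]
      refine integral_mono_ae ((hE.mono_set hsub).mul_const _) (hηI.mono_set hsub) ?_
      filter_upwards [ae_energyDensity_nonneg (ha.mono hsub) K,
        ae_restrict_mem (measurableSet_sublevel hθ τ)] with x hx hxm
      rw [mul_comm]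
      exact mul_le_mul_of_nonneg_right (hη1 x hxm.1) hx
    exact h1.trans (setIntegral_mono_set hηI hηe0 hsub.eventuallyLE)
  set T := 7 / 8 * A / (1 - (3 : ℝ) ^ (-(s + σ))) * tailSum b σ N with hTd
  have hts := tailSum_nonneg hS.nonneg σ N
  have hinv := one_le_inv_one_sub_rpow (add_pos hS.s_pos hS.σ_pos)
  have hA0 := hS.A_nonneg
  have hTA : 7 / 8 * A * tailSum b σ N ≤ T := by
    rw [hTd, div_eq_mul_inv]
    exact mul_le_mul_of_nonneg_right (le_mul_of_one_le_right (by positivity) hinv) hts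
  have hT0 : 0 ≤ T := le_trans (by positivity) hTA
  have hTch : T ≤ c * h :=
    (le_mul_of_one_le_left hT0 (by linarith : 1 ≤ 11 / 10 * L)).trans hT
  have hc0 : 0 < c := by linarith
  have h3N : (1 : ℝ) ≤ 3 ^ (s * (N : ℝ)) :=
    Real.one_le_rpow (by norm_num) (mul_nonneg hS.s_pos.le (Nat.cast_nonneg N))
  set V := ℓ * (3 : ℝ) ^ (s * (N : ℝ)) / (c * h) with hV
  have hV0 : 0 ≤ V := by positivity
  set H := ∫ x in cube 0 ρ₂, w x ^ 2 with hH
  have hH0 : 0 ≤ H := integral_nonneg fun _ => sq_nonneg _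
  set F' := bil a Z K K with hF'
  have hF'0 : 0 ≤ F' := bil_self_nonneg (ha.mono hZU) K
  have hZρ : Z ⊆ cube 0 ρ₂ := by
    intro x hx i
    have h1 := hθ.abs_coord_le x (hx.1.trans hτh) i
    rw [show x i - (0 : E d) i = x i by simp]
    linarith
  have hρU : cube (0 : E d) ρ₂ ⊆ cube 0 1 := fun x hx i => (hx i).trans_le (by linarith)
  have hwZ : ∫ x in Z, w x ^ 2 ≤ H :=
    setIntegral_mono_set (hw.memLp.mono_measure (Measure.restrict_mono_set _ hρU)).integrable_sq
      (Eventually.of_forall fun _ => sq_nonneg _) hZρ.eventuallyLE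
  have hκε : h * κ ≤ ε := by
    have e : h * κ * h = 441 / 400 * (D L * √d * side N) := by
      rw [hκ, hΛ, hh']; field_simp; ring
    have h0 : 0 ≤ D L * √d * side N := by positivity
    refine le_of_mul_le_mul_right ?_ hh
    rw [e]
    linarith
  have hT₂ : tailSum b σ N * (Λ * √d) + 2 * L / h' * (3 ^ (s * (N : ℝ)) * b N) ≤
      c * (Em L * V) := by
    rw [hEmv]
    exact lowOrder_le hL hh hc0 hc2 hts hℓ hℓA hTA hTch hD0 hd0 h3N (hbℓ N)
  have hTc : tailSum b σ N * (7 / 8 * A / (1 - (3 : ℝ) ^ (-(s + σ)))) = T := by rw [hTd]; ring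
  rw [hTc] at hmain
  have hfin := absorb (F := bil a ({x | θ x ≤ τ} ∩ cube 0 1) K K) (lam := L / h')
    (Y := √(∫ x in Z, w x ^ 2) * √F') hFI hF'0 hc0 hε0 hε1 hT0 hL hh hI0 hT
    (by rw [hh']; field_simp) hκ0 hκε hH0 hT₂ hEm0 hV0
    (mul_le_mul_of_nonneg_right (Real.sqrt_le_sqrt hwZ) (Real.sqrt_nonneg _)) (by positivity)
    (hmain.trans (add_le_add (mul_le_mul_of_nonneg_left hwE hT0) le_rfl))
  refine hfin.trans (add_le_add le_rfl ?_)
  have hVH : 0 ≤ V ^ 2 * H := by positivity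
  have h1 : 484 * Em L ^ 2 / ε ≤ 1 + 42 * √d + 2 * D L * √d / ε + 484 * Em L ^ 2 / ε := by
    have h2 : 0 ≤ 2 * D L * √d / ε := by positivity
    linarith
  calc 484 * Em L ^ 2 / ε * V ^ 2 * H = 484 * Em L ^ 2 / ε * (V ^ 2 * H) := by ring
    _ ≤ (1 + 42 * √d + 2 * D L * √d / ε + 484 * Em L ^ 2 / ε) * (V ^ 2 * H) := by gcongr
    _ = _ := by ring

end CoarseGrained

end

/-! ### Conclusion -/

noncomputable section
namespace CoarseGrained

variable {d : ℕ} {S : Set ConeName} {a : CoeffField d}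

theorem scale_bounds_zero {s : ℝ} {F : Set (E d) → ℝ≥0∞} {M : ℝ} {b : ℕ → ℝ} {x : ℝ}
    (hb0 : ∀ j, 0 ≤ b j) (hbM : ∀ j, b j ≤ M) (hF : ∀ j, ∀ n ∈ idx d j, F (tri j n) ≠ ∞ ∧
      (F (tri j n)).toReal ≤ (3 ^ (s * (j : ℝ)) * b j) ^ 2)
    (hx : 0 ≤ x) (hxF : ENNReal.ofReal x ≤ F (cube 0 1)) : √x ≤ M := by
  have h0 : (0 : Fin d → ℤ) ∈ idx d 0 := by simp [idx]
  obtain ⟨h1, h2⟩ := hF 0 0 h0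
  rw [tri_zero] at h1 h2
  have h3 : x ≤ (F (cube 0 1)).toReal := by
    rw [← ENNReal.toReal_ofReal hx]
    exact ENNReal.toReal_mono h1 hxF
  refine (Real.sqrt_le_left (hb0 0)|>.2 ?_).trans (hbM 0)
  simpa using h3.trans h2

theorem cgANorm_le_iSup_child (ha : IsCoefficientField a (cube 0 1)) (j : ℕ) (n : Fin d → ℤ)
    (hn : ∀ i, 2 * |n i| < 3 ^ j) :
    cgANorm S a (tri j n) ≤ ⨆ ω, cgANorm S a (tri (j + 1) (childIdx n ω)) :=
  cgANorm_tri_le (ha.mono (tri_subset_of_abs_lt hn))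

theorem cgAStarInvNorm_le_iSup_child (ha : IsCoefficientField a (cube 0 1)) (j : ℕ)
    (n : Fin d → ℤ) (hn : ∀ i, 2 * |n i| < 3 ^ j) :
    cgAStarInvNorm a (tri j n) ≤ ⨆ ω, cgAStarInvNorm a (tri (j + 1) (childIdx n ω)) :=
  cgAStarInvNorm_tri_le (ha.mono (tri_subset_of_abs_lt hn))

theorem multiscaleSum_ne_zero {s : ℝ} (hs : 0 < s) {F : Set (E d) → ℝ≥0∞}
    (hF : ∀ (j : ℕ) (n : Fin d → ℤ), (∀ i, 2 * |n i| < 3 ^ j) →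
      F (tri j n) ≤ ⨆ ω, F (tri (j + 1) (childIdx n ω)))
    {x : ℝ} (hx : 0 < x) (hxF : ENNReal.ofReal x ≤ F (cube 0 1)) : multiscaleSum s 0 F ≠ 0 := by
  intro h0
  obtain ⟨b, hb0, -, -, hbM, hb⟩ := exists_scales hs hF (h0 ▸ ENNReal.zero_ne_top)
  have := scale_bounds_zero hb0 hbM hb hx.le hxF
  rw [h0, ENNReal.toReal_zero] at this
  exact absurd (Real.sqrt_pos.2 hx) this.not_gt

/-- The Caccioppoli inequality between two concentric cubes, in terms of real numbers. -/
theorem exists_bil_le (hd : 2 ≤ d) : ∃ C : ℝ, 0 < C ∧ ∀ (a : CoeffField d),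
    IsCoefficientField a (cube 0 1) → ∀ (s t σ : ℝ), 0 < s → 0 < t → σ = 1 - s - t → 0 < σ →
    ∀ (S : Set ConeName) (w : E d → ℝ) (K : E d → E d), InCone S a (cube 0 1) w K →
    ∀ c : ℝ, 1 ≤ c → c ≤ 2 → (∀ H r₀ r₁, IsAnnular H r₀ r₁ → ∀ η, IsTest (cube 0 1) η →
      ∫ x in cube 0 1, η x * kap c H (w x) * energyDensity a K x =
        -∫ x in cube 0 1, H (w x) * inner ℝ (gradient η x) (flux a K x)) →
    ∀ ℓ A : ℝ, multiscaleSum s 0 (cgANorm S a) = ENNReal.ofReal ℓ →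
      multiscaleSum t 0 (cgAStarInvNorm a) = ENNReal.ofReal A → 0 ≤ ℓ → 0 ≤ A →
    ∀ ρ₁ ρ₂ : ℝ, 0 < ρ₁ → ρ₁ < ρ₂ → ρ₂ ≤ 1 →
      bil a (cube 0 ρ₁) K K ≤ C * ((2 / σ) ^ ((s + σ) / σ) * (ℓ * A) ^ (s / σ) * ℓ /
        (c ^ ((s + σ) / σ) * s ^ (s / σ) * (1 - s) ^ (s / σ) * (ρ₂ - ρ₁) ^ ((s + σ) / σ))) ^ 2 *
        ∫ x in cube 0 ρ₂, w x ^ 2 := by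
  obtain ⟨Cθ, hCθ, hθ⟩ := exists_isLevel d
  obtain ⟨C₀, hC₀, CL, hCL, hstep⟩ := exists_oneStep hd hCθ
  obtain ⟨C, hC, hit⟩ := iteration C₀ hC₀ CL hCL
  refine ⟨C, hC, ?_⟩
  intro a ha s t σ hs ht hσt hσ S w K hcone c hc1 hc2 hid ℓ A hℓM hAM hℓ0 hA0 ρ₁ ρ₂ h1 h12 h2
  have hU0 : volume (cube (0 : E d) 1) ≠ 0 := tri_zero (d := d) ▸ volume_tri_ne_zero 0 0
  have hUo : IsOpen (cube (0 : E d) 1) := isOpen_cube 0 1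
  obtain ⟨b, hb0, hbs, hbt, hbM, hb⟩ := exists_scales hs (cgANorm_le_iSup_child (S := S) ha)
    (hℓM ▸ ENNReal.ofReal_ne_top)
  obtain ⟨b', hb'0, -, -, hb'M, hb'⟩ := exists_scales ht (cgAStarInvNorm_le_iSup_child ha)
    (hAM ▸ ENNReal.ofReal_ne_top)
  rw [hℓM, ENNReal.toReal_ofReal hℓ0] at hbM hbt
  rw [hAM, ENNReal.toReal_ofReal hA0] at hb'M
  obtain ⟨x, hx, hxa, hxi⟩ := exists_le_cgANorm hd ⟨hcone.choose, hcone.choose_spec.1⟩ hUo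
    (isBounded_cube 0 1) hU0 ha
  have hxℓ := scale_bounds_zero hb0 hbM hb hx.le hxa
  have hxA := scale_bounds_zero hb'0 hb'M hb' (inv_nonneg.2 hx.le) hxi
  have hℓ : 0 < ℓ := (Real.sqrt_pos.2 hx).trans_le hxℓ
  have hA : 0 < A := (Real.sqrt_pos.2 (inv_pos.2 hx)).trans_le hxA
  -- The two quantities of the unit cube are at least `x` and `x⁻¹`, and each multiscale sum
  -- dominates the square root of its value on the unit cube.
  have hℓA : 1 ≤ ℓ * A := by
    calc 1 = √x * √x⁻¹ := by rw [← Real.sqrt_mul hx.le, mul_inv_cancel₀ hx.ne', Real.sqrt_one]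
      _ ≤ ℓ * A := mul_le_mul hxℓ hxA (Real.sqrt_nonneg _) hℓ0
  have hw := hcone.hasGrad
  have hfe := hw.finiteEnergy
  have hSB : ScaleBounds a K b A s σ :=
    { coeff := ha
      finiteEnergy := hfe
      nonneg := hb0
      summable := hbs
      A_nonneg := hA0
      s_lt := by linarith
      s_pos := hs
      σ_pos := hσ
      inv_ne_top := fun j n hn => (hb' j n hn).1
      inv_le := fun j n hn => by
        refine (hb' j n hn).2.trans ?_
        have e : 1 - s - σ = t := by linarith
        rw [e, mul_comm]
        have := hb'0 j
        have := hb'M j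
        gcongr
      flux_le := fun j n hn => by
        have hsub := tri_subset hn
        refine (sq_norm_integral_flux_le (isOpen_tri j n) (volume_tri_ne_zero j n)
          (volume_tri_ne_top j n) (ha.mono hsub) (hb j n hn).1
          (hcone.mono ha hUo hsub)).trans ?_
        rw [volume_real_tri]
        have e1 := bil_self_nonneg (ha.mono hsub) K
        have e2 := (hb j n hn).2
        have e3 := (side_pos j).le
        calc _ = (cgANorm S a (tri j n)).toReal * (side j ^ d * bil a (tri j n) K K) := by ring
          _ ≤ _ := by gcongr }
  obtain ⟨θ, hθ⟩ := hθ ρ₁ ρ₂ h1 h12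
  have hF := hit s σ c (ρ₂ - ρ₁) ℓ A (∫ x in cube 0 ρ₂, w x ^ 2) (bil a (cube 0 1) K K) b
    (fun τ => bil a ({x | θ x ≤ τ} ∩ cube 0 1) K K) hs (by linarith) hσ (by linarith) hc1 hc2
    (by linarith) (by linarith) hℓ hA hℓA (integral_nonneg fun _ => sq_nonneg _) hb0 hbs
    hbt.le (fun τ => bil_self_mono ha hfe inter_subset_right)
    (hstep a K b A s σ hSB w hw c ℓ hc1 hc2 hid hℓ hℓA hbM ρ₁ ρ₂ θ h12 h2 hθ)
  refine le_trans (bil_self_mono (ha.mono inter_subset_right) (hfe.mono inter_subset_right) ?_) hF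
  exact fun y hy => ⟨hθ.nonpos y hy, fun i => (hy i).trans_le (by linarith)⟩

theorem avgEnergyNorm_eq_zero {W : Set (E d)} {K : E d → E d} (hK : K =ᵐ[volume.restrict W] 0) :
    avgEnergyNorm a W K = 0 := by
  have h : energy a W K = 0 := by
    rw [energy, lintegral_congr_ae (g := fun _ => 0), lintegral_zero]
    filter_upwards [hK] with x hx
    simp [energyDensity, hx]
  simp [avgEnergyNorm, h]

theorem ae_eq_zero_of_avgL2_eq_zero {W : Set (E d)} {w : E d → ℝ} (hWf : volume W ≠ ∞)
    (hw : AEStronglyMeasurable w (volume.restrict W)) (h : avgL2 W w = 0) :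
    ∀ᵐ x ∂(volume.restrict W), w x = 0 := by
  rw [avgL2, ENNReal.rpow_eq_zero_iff_of_pos (by norm_num), mul_eq_zero, ENNReal.inv_eq_zero,
    or_iff_right hWf, lintegral_eq_zero_iff' (by fun_prop)] at h
  filter_upwards [h] with x hx
  simpa using le_antisymm (ENNReal.ofReal_eq_zero.1 hx) (sq_nonneg _)

theorem avgL2_eq_ofReal {ρ : ℝ} (hρ : 0 < ρ) {w : E d → ℝ}
    (hw : MemLp w 2 (volume.restrict (cube 0 ρ))) :
    avgL2 (cube 0 ρ) w = ENNReal.ofReal √((∫ x in cube 0 ρ, w x ^ 2) / ρ ^ d) := by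
  rw [avgL2, ← ofReal_integral_eq_lintegral_ofReal hw.integrable_sq
    (Eventually.of_forall fun _ => sq_nonneg _), volume_cube 0 hρ.le,
    ← ENNReal.ofReal_inv_of_pos (by positivity), ← ENNReal.ofReal_mul (by positivity),
    ENNReal.ofReal_rpow_of_nonneg (mul_nonneg (by positivity)
      (integral_nonneg fun _ => sq_nonneg _)) (by norm_num), ← Real.sqrt_eq_rpow, div_eq_inv_mul]

theorem avgEnergyNorm_eq_ofReal {ρ : ℝ} (hρ : 0 < ρ) {K : E d → E d}
    (ha : IsCoefficientField a (cube 0 ρ)) (hK : FiniteEnergy a (cube 0 ρ) K) :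
    avgEnergyNorm a (cube 0 ρ) K = ENNReal.ofReal √(bil a (cube 0 ρ) K K / ρ ^ d) := by
  rw [avgEnergyNorm, energy_eq_ofReal ha hK, volume_cube 0 hρ.le,
    ← ENNReal.ofReal_inv_of_pos (by positivity), ← ENNReal.ofReal_mul (by positivity),
    ENNReal.ofReal_rpow_of_nonneg (mul_nonneg (by positivity) (bil_self_nonneg ha K))
      (by norm_num), ← Real.sqrt_eq_rpow, div_eq_inv_mul]

end CoarseGrained

end

theorem propositionp (d : ℕ) (hd : 2 ≤ d) :
    ∃ C : ℝ, 0 < C ∧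
      ∀ (a : CoarseGrained.CoeffField d),
        CoarseGrained.IsCoefficientField a (CoarseGrained.cube 0 1) →
      ∀ (s t σ : ℝ), s ∈ Set.Ioo (0 : ℝ) 1 → t ∈ Set.Ioo (0 : ℝ) 1 → σ = 1 - s - t → 0 < σ →
      ∀ (u : CoarseGrained.E d → ℝ) (Gu : CoarseGrained.E d → CoarseGrained.E d),
        CoarseGrained.IsSol a (CoarseGrained.cube 0 1) u Gu →
      ∀ (Φ Ψ : ℝ → ℝ) (ε cΦ : ℝ),
        ConvexOn ℝ Set.univ Φ →
        CoarseGrained.IsMonotoneSign Φ (u '' CoarseGrained.cube 0 1) ε →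
        0 < cΦ →
        CoarseGrained.IsTransform Φ Ψ ε cΦ →
      ∀ (S : Set CoarseGrained.ConeName)
        (GΦ GΨ : CoarseGrained.E d → CoarseGrained.E d),
        CoarseGrained.InCone S a (CoarseGrained.cube 0 1) (fun x => Φ (u x)) GΦ →
        CoarseGrained.InCone S a (CoarseGrained.cube 0 1) (fun x => Ψ (u x)) GΨ →
      ∀ (ρ₁ ρ₂ : ℝ), 1 / 2 ≤ ρ₁ → ρ₁ < ρ₂ → ρ₂ ≤ 1 →
        CoarseGrained.avgEnergyNorm a (CoarseGrained.cube 0 ρ₁) GΨ ≤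
          ENNReal.ofReal
              (C * (2 / σ) ^ ((s + σ) / σ) /
                (cΦ ^ ((s + σ) / σ) * s ^ (s / σ) * (1 - s) ^ (s / σ) *
                  (ρ₂ - ρ₁) ^ ((s + σ) / σ))) *
            CoarseGrained.Theta S a s t 0 ^ (s / (2 * σ)) *
            CoarseGrained.Lam S a s 0 ^ (1 / 2 : ℝ) *
            CoarseGrained.avgL2 (CoarseGrained.cube 0 ρ₂) (fun x => Ψ (u x)) := by
  open CoarseGrained in
  obtain ⟨C, hC, hmain⟩ := exists_bil_le hd
  -- The factor `2 ^ d` bounds the volume ratio of the two cubes, since `ρ₂ ≤ 1 ≤ 2 ρ₁`.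
  refine ⟨√(C * 2 ^ d), by positivity, ?_⟩
  intro a ha s t σ ⟨hs, hs1⟩ ⟨ht, ht1⟩ hσt hσ u Gu hu Φ Ψ ε cΦ hΦ hε hcΦ hT S GΦ GΨ hcΦ' hcone
    ρ₁ ρ₂ h1 h12 h2
  have hρ₁ : 0 < ρ₁ := by linarith
  have hρ₂ : 0 < ρ₂ := by linarith
  have hUo : IsOpen (cube (0 : E d) 1) := isOpen_cube 0 1
  have hU0 : volume (cube (0 : E d) 1) ≠ 0 := tri_zero (d := d) ▸ volume_tri_ne_zero 0 0
  have hUf : volume (cube (0 : E d) 1) ≠ ∞ := tri_zero (d := d) ▸ volume_tri_ne_top 0 0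
  have hsub : ∀ {ρ : ℝ}, ρ ≤ 1 → cube (0 : E d) ρ ⊆ cube 0 1 :=
    fun hρ x hx i => (hx i).trans_le (by linarith)
  have hsub12 : cube (0 : E d) ρ₁ ⊆ cube 0 ρ₂ := fun x hx i => (hx i).trans_le (by linarith)
  have hw := hcone.hasGrad
  have hw2 : MemLp (fun x => Ψ (u x)) 2 (volume.restrict (cube 0 ρ₂)) :=
    hw.memLp.mono_measure (Measure.restrict_mono_set _ (hsub h2))
  -- the identity for the reflected pair
  have hεs : ε = 1 ∨ ε = -1 := hε.imp And.left And.left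
  have hεε : ∀ r, ε * (ε * r) = r := by rcases hεs with rfl | rfl <;> intro r <;> ring
  obtain ⟨k, hk, hpair⟩ := hT.exists_isTransformPair hΦ hcΦ hεs
  have hmono : MonotoneOn (fun r => Φ (ε * r)) ((fun x => ε * u x) '' cube 0 1) := by
    rintro _ ⟨x, hx, rfl⟩ _ ⟨y, hy, rfl⟩ hxy
    simp only [hεε]
    rcases hε with ⟨rfl, h⟩ | ⟨rfl, h⟩
    · exact h (mem_image_of_mem u hx) (mem_image_of_mem u hy) (by simpa using hxy)
    · exact h (mem_image_of_mem u hy) (mem_image_of_mem u hx) (by simpa using hxy)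
  have hid := hpair.integral_identity hUo hUf ha (hu.const_mul hUo hUf ha ε) hmono
    (K := GΨ) (by simpa only [hεε] using hw)
  simp only [hεε] at hid
  rcases hid with hK0 | ⟨hk1, hk2, hid⟩
  · rw [avgEnergyNorm_eq_zero (ae_restrict_of_ae_restrict_of_subset (hsub (by linarith)) hK0)]
    exact zero_le
  obtain rfl : k = cΦ := by rw [← hk, abs_of_pos (by linarith)]
  -- In `[0, ∞]` one has `∞ · 0 = 0`, so when `Ψ(u)` vanishes on the larger cube the right-hand side
  -- is zero even for infinite `Λ` or `Θ`. The left-hand side is then zero too, because gradients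
  -- vanish on level sets.
  by_cases hL0 : avgL2 (cube 0 ρ₂) (fun x => Ψ (u x)) = 0
  · have h3 := ae_eq_zero_of_avgL2_eq_zero (measure_ne_top_of_subset (hsub h2) hUf) hw2.1 hL0
    have h4 : GΨ =ᵐ[volume.restrict (cube 0 ρ₁)] 0 := by
      have h5 := ae_restrict_of_ae_restrict_of_subset (hsub (h12.le.trans h2))
        (hw.ae_eq_zero_of_eq hUo hUf ha 0)
      filter_upwards [h5, ae_restrict_of_ae_restrict_of_subset hsub12 h3] with x hx hx0
      exact hx hx0
    rw [avgEnergyNorm_eq_zero h4]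
    exact zero_le
  set M := multiscaleSum s 0 (cgANorm S a) with hM
  set M' := multiscaleSum t 0 (cgAStarInvNorm a) with hM'
  obtain ⟨x, hx, hxa, hxi⟩ := exists_le_cgANorm hd ⟨hcone.choose, hcone.choose_spec.1⟩ hUo
    (isBounded_cube 0 1) hU0 ha
  have hM0 : M ≠ 0 := multiscaleSum_ne_zero hs (cgANorm_le_iSup_child ha) hx hxa
  have hM'0 : M' ≠ 0 := multiscaleSum_ne_zero ht (cgAStarInvNorm_le_iSup_child ha)
    (inv_pos.2 hx) hxi
  have hΘ : Theta S a s t 0 = (M * M') ^ 2 := by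
    rw [Theta, lam, Lam, div_eq_mul_inv, inv_inv, mul_pow]
  have hΛ : Lam S a s 0 ^ (1 / 2 : ℝ) = M := by
    rw [Lam, ← hM, ← ENNReal.rpow_natCast, ← ENNReal.rpow_mul]
    norm_num
  have hΘ' : Theta S a s t 0 ^ (s / (2 * σ)) = (M * M') ^ (s / σ) := by
    rw [hΘ, ← ENNReal.rpow_natCast, ← ENNReal.rpow_mul]
    congr 1
    push_cast
    field_simp
  rw [hΘ', hΛ]
  have h1s : 0 < 1 - s := by linarith
  have hΔ : 0 < ρ₂ - ρ₁ := by linarith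
  have hden : 0 < k ^ ((s + σ) / σ) * s ^ (s / σ) * (1 - s) ^ (s / σ) *
      (ρ₂ - ρ₁) ^ ((s + σ) / σ) := by positivity
  -- Neither multiscale sum is zero, so if one of them is infinite then so is the right-hand side.
  by_cases hfin : M = ∞ ∨ M' = ∞
  · have h3 : M * M' = ∞ := by
      rcases hfin with h | h
      · rw [h, ENNReal.top_mul hM'0]
      · rw [h, ENNReal.mul_top hM0]
    rw [h3, ENNReal.top_rpow_of_pos (by positivity), ENNReal.mul_top, ENNReal.top_mul hM0,
      ENNReal.top_mul hL0]
    · exact le_top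
    · exact (ENNReal.ofReal_pos.2 (by positivity)).ne'
  push Not at hfin
  have hMr := (ENNReal.ofReal_toReal hfin.1).symm
  have hM'r := (ENNReal.ofReal_toReal hfin.2).symm
  have hB := hmain a ha s t σ hs ht hσt hσ S _ GΨ hcone k hk1 hk2 hid _ _ hMr hM'r
    ENNReal.toReal_nonneg ENNReal.toReal_nonneg ρ₁ ρ₂ hρ₁ h12 h2
  have hℓ0 : 0 ≤ M.toReal := ENNReal.toReal_nonneg
  have hA0 : 0 ≤ M'.toReal := ENNReal.toReal_nonneg
  rw [hMr, hM'r, ← ENNReal.ofReal_mul hℓ0, ENNReal.ofReal_rpow_of_nonneg (by positivity)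
    (by positivity), avgL2_eq_ofReal hρ₂ hw2, avgEnergyNorm_eq_ofReal hρ₁
    (ha.mono (hsub (h12.le.trans h2))) (hw.finiteEnergy.mono (hsub (h12.le.trans h2))),
    ← ENNReal.ofReal_mul (by positivity), ← ENNReal.ofReal_mul (by positivity),
    ← ENNReal.ofReal_mul (by positivity)]
  refine ENNReal.ofReal_le_ofReal ?_
  generalize M.toReal = ℓ at hB hℓ0 ⊢
  generalize M'.toReal = A at hB hA0 ⊢
  have hH : 0 ≤ ∫ x in cube (0 : E d) ρ₂, Ψ (u x) ^ 2 := integral_nonneg fun _ => sq_nonneg _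
  generalize ∫ x in cube (0 : E d) ρ₂, Ψ (u x) ^ 2 = H at hB hH ⊢
  generalize bil a (cube 0 ρ₁) GΨ GΨ = B at hB ⊢
  set D := k ^ ((s + σ) / σ) * s ^ (s / σ) * (1 - s) ^ (s / σ) * (ρ₂ - ρ₁) ^ ((s + σ) / σ)
  set X := (2 / σ) ^ ((s + σ) / σ) * (ℓ * A) ^ (s / σ) * ℓ / D with hX
  have hX0 : 0 ≤ X := by positivity
  have e : √(C * 2 ^ d) * (2 / σ) ^ ((s + σ) / σ) / D * (ℓ * A) ^ (s / σ) * ℓ *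
      √(H / ρ₂ ^ d) = √(C * 2 ^ d * X ^ 2 * (H / ρ₂ ^ d)) := by
    rw [Real.sqrt_mul (by positivity : 0 ≤ C * 2 ^ d * X ^ 2),
      Real.sqrt_mul (by positivity : 0 ≤ C * 2 ^ d) (X ^ 2), Real.sqrt_sq hX0, hX]
    ring
  rw [e]
  refine Real.sqrt_le_sqrt ?_
  rw [div_le_iff₀ (by positivity)]
  have h5 : ρ₂ ^ d ≤ 2 ^ d * ρ₁ ^ d := by
    rw [← mul_pow]
    exact pow_le_pow_left₀ hρ₂.le (by linarith) d
  calc B ≤ C * X ^ 2 * H := hB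
    _ = C * X ^ 2 * (H / ρ₂ ^ d) * ρ₂ ^ d := by field_simp
    _ ≤ C * X ^ 2 * (H / ρ₂ ^ d) * (2 ^ d * ρ₁ ^ d) := by gcongr
    _ = _ := by ring
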